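/- Let $V$ be a complex symplectic vector space of dimension $2n$ with form $\langle\ ,\ \rangle$. For $W\subseteq V$ let $W^\perp$ be its orthogonal with respect to the form. For a bipartition $(\mu,\nu)$ of $n$ (a pair of partitions with $|\mu|+|\nu|=n$), let $\mathbb O_{(\mu,\nu)}$ be the set of pairs $(v,x)$ with $v\in V$ and $x\in\operatorname{End}(V)$ nilpotent with $\langle xu,w\rangle=\langle u,xw\rangle$ for all $u,w\in V$, for which there is a basis $\{v_{ij},v^*_{ij} : i\ge 1,\ 1\le j\le\mu_i+\nu_i\}$ of $V$ with $\langle v_{ij},v^*_{i'j'}\rangle=\delta_{ii'}\delta_{jj'}$, $\langle v_{ij},v_{i'j'}\rangle=\langle v^*_{ij},v^*_{i'j'}\rangle=0$, $xv_{ij}=v_{i,j-1}$ (and $xv_{i1}=0$), $xv^*_{ij}=v^*_{i,j+1}$ (and $xv^*_{ij}=0$ for $j=\mu_i+\nu_i$), and $v=\sum_{i:\,\mu_i>0}v_{i,\mu_i}$. In this case we write $eJ(v,x)=(\mu,\nu)$; the same notation is used for pairs on any symplectic space. For a finite sequence $\alpha$ of positive integers with sum $|\mu|+|\nu|$ put $$d^\alpha_{(\mu,\nu)}=2\sum_{i\ge1}(i-1)(\mu_i+\nu_i)+|\nu|-\tfrac12\sum_i(\alpha_i^2-\alpha_i).$$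 Let $\alpha=(\alpha_1,\alpha_2,\dots,\alpha_m)$ with $m\ge 1$ be a composition of $n$ into positive integers, $\alpha'=(\alpha_2,\dots,\alpha_m)$, let $(\mu,\nu)$ be a bipartition of $n$ and $(\mu',\nu')$ a bipartition of $n-\alpha_1$. Let $(v,x)\in\mathbb O_{(\mu,\nu)}$ with $x^2=0$, let $\mathbb C[x]v$ be the span of $v,xv,x^2v,\dots$, and let $$\mathcal B=\{F\subseteq\ker(x)\cap(\mathbb C[x]v)^\perp : \dim F=\alpha_1,\ F\subseteq F^\perp,\ eJ(v+F,\,x|_{F^\perp/F})=(\mu',\nu')\},$$ a subset of the Grassmannian of $\alpha_1$-dimensional subspaces of $V$, with the Zariski topology. Then: 1. if $\mathcal B$ is nonempty, then it is irreducible and $$\dim\mathcal B\le d^\alpha_{(\mu,\nu)}-d^{\alpha'}_{(\mu',\nu')};$$ 2. $\mathcal B$ is nonempty with $\dim\mathcal B=d^\alpha_{(\mu,\nu)}-d^{\alpha'}_{(\mu',\nu')}$ if and only if $(\mu',\nu')$ is obtained from $(\mu,\nu)$ by removing $\alpha_1$ boxes that form a vertical strip in each diagram (that is, $\mu'_i\le\mu_i\le\mu'_i+1$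 and $\nu'_i\le\nu_i\le\nu'_i+1$ for all $i$). -/

import Mathlib

namespace Exotic

/-! ### Zariski topology on the Grassmannian -/

section Zariski

variable (W : Type*) [AddCommGroup W] [Module ℂ W]

/-- The common zero locus in `W` of a set of polynomials in the linear functionals on `W`. -/
def zeroLocus (S : Set (MvPolynomial (Module.Dual ℂ W) ℂ)) : Set W :=
  {w | ∀ p ∈ S, MvPolynomial.eval (fun φ : Module.Dual ℂ W => φ w) p = 0}

/-- The Zariski topology on a complex vector space: the closed sets are the common zero loci of
sets of polynomial functions. -/
@[reducible] def zariskiTopology : TopologicalSpace W :=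
  TopologicalSpace.ofClosed {Z | ∃ S, Z = zeroLocus W S}
    ⟨{1}, by ext w; simp [zeroLocus]⟩
    (by
      intro A hA
      refine ⟨{p | ∃ S, zeroLocus W S ∈ A ∧ p ∈ S}, ?_⟩
      ext w
      constructor
      · rintro hw p ⟨S, hS, hp⟩
        exact hw _ hS p hp
      · intro hw Z hZ
        obtain ⟨S, rfl⟩ := hA hZ
        exact fun p hp => hw p ⟨S, hZ, hp⟩)
    (by
      rintro _ ⟨S, rfl⟩ _ ⟨T, rfl⟩
      refine ⟨{r | ∃ p ∈ S, ∃ q ∈ T, r = p * q}, ?_⟩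
      ext w
      constructor
      · rintro (hw | hw) _ ⟨p, hp, q, hq, rfl⟩
        · simp [hw p hp]
        · simp [hw q hq]
      · intro hw
        by_contra hcon
        simp only [Set.mem_union, not_or, zeroLocus, Set.mem_ofPred_eq, not_forall] at hcon
        obtain ⟨⟨p, hp, hp0⟩, q, hq, hq0⟩ := hcon
        have h := hw _ ⟨p, hp, q, hq, rfl⟩
        rw [map_mul] at h
        exact (mul_ne_zero hp0 hq0) h)

end Zariski

section Grassmannian

variable (k : ℕ) (V : Type*) [AddCommGroup V] [Module ℂ V]

/-- Linearly independent `k`-tuples of vectors of `V`, a Zariski open subset of `Fin k → V`. -/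
def Frame : Type _ := {b : Fin k → V // LinearIndependent ℂ b}

/-- The Grassmannian of `k`-dimensional subspaces of `V`. -/
def Gr : Type _ := {F : Submodule ℂ V // Module.finrank ℂ F = k}

variable {k V}

/-- The subspace spanned by a linearly independent `k`-tuple. -/
def Frame.span (b : Frame k V) : Gr k V :=
  ⟨Submodule.span ℂ (Set.range b.1), by simpa using finrank_span_eq_card b.2⟩

variable (k V)

instance Frame.instTopologicalSpace : TopologicalSpace (Frame k V) :=
  (zariskiTopology (Fin k → V)).induced Subtype.val

/-- The Zariski topology on the Grassmannian, as the quotient of the space of linearly independent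
`k`-tuples by change of basis: a set of subspaces is closed if and only if the set of linearly
independent `k`-tuples that span one of its members is cut out, among all linearly independent
`k`-tuples, by polynomial equations. -/
instance Gr.instTopologicalSpace : TopologicalSpace (Gr k V) :=
  (Frame.instTopologicalSpace k V).coinduced Frame.span

end Grassmannian

/-! ### Bipartitions and compositions -/

/-- `(μ, ν)` is a bipartition of `n`. A partition is given by its Young diagram; its parts are the
row lengths `μ.rowLen 0 ≥ μ.rowLen 1 ≥ …`, and its number of nonzero parts is `μ.colLen 0`. -/
def IsBipartition (μ ν : YoungDiagram) (n : ℕ) : Prop := μ.card + ν.card = n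

/-- `α` is a composition of `n`: a finite sequence of positive integers with sum `n`. -/
def IsComposition (α : List ℕ) (n : ℕ) : Prop := (∀ a ∈ α, 0 < a) ∧ α.sum = n

/-- The `i`-th part of the partition `μ + ν` (with `i` starting from `0`). -/
def sumPart (μ ν : YoungDiagram) (i : ℕ) : ℕ := μ.rowLen i + ν.rowLen i

/-- `N(μ + ν) = ∑ᵢ (i - 1) (μ + ν)ᵢ` with `i` starting from `1`. -/
def sumN (μ ν : YoungDiagram) : ℕ :=
  ∑ i ∈ Finset.range (max (μ.colLen 0) (ν.colLen 0)), i * sumPart μ ν i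

/-- `d^α_(μ,ν) = 2 N(μ + ν) + |ν| - ½ ∑ᵢ (αᵢ² - αᵢ)`. -/
noncomputable def dimNumber (α : List ℕ) (μ ν : YoungDiagram) : ℚ :=
  2 * (sumN μ ν : ℚ) + (ν.card : ℚ) - 1 / 2 * (α.map fun a : ℕ => (a : ℚ) ^ 2 - (a : ℚ)).sum

/-- `μ'` is obtained from `μ` by removing a vertical strip: boxes no two of which are in the
same row. -/
def IsVerticalStrip (μ' μ : YoungDiagram) : Prop :=
  μ' ≤ μ ∧ ∀ i, μ.rowLen i ≤ μ'.rowLen i + 1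

/-! ### Exotic Jordan types -/

section ExoticType

variable {V : Type*} [AddCommGroup V] [Module ℂ V]

/-- The exotic nilpotent cone: pairs of a vector and a nilpotent endomorphism that is
self-adjoint with respect to the form. -/
def exoticNilpotentCone (ω : LinearMap.BilinForm ℂ V) : Set (V × Module.End ℂ V) :=
  {p | (∀ u w, ω (p.2 u) w = ω u (p.2 w)) ∧ IsNilpotent p.2}

/-- The positions `(i, j)` in the diagram of `μ + ν`, both coordinates starting from `0`. -/
def Box (μ ν : YoungDiagram) : Type := {c : ℕ × ℕ // c.2 < sumPart μ ν c.1}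

/-- The last position of the `i`-th row of `μ`, for `i` less than the number of rows of `μ`. -/
def Box.last (μ ν : YoungDiagram) (i : Fin (μ.colLen 0)) : Box μ ν :=
  ⟨(i, μ.rowLen i - 1), by
    have h : 0 < μ.rowLen i :=
      YoungDiagram.mem_iff_lt_rowLen.1 (YoungDiagram.mem_iff_lt_colLen.2 i.2)
    show μ.rowLen i - 1 < μ.rowLen i + ν.rowLen i
    omega⟩

/-- A normal basis of type `(μ, ν)` for `(v, x)`: a symplectic basis consisting of vectors
`v_{ij}` (the left half of the index type) and `v*_{ij}` (the right half) such that `x` moves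
`v_{i,j+1}` to `v_{i,j}` and `v*_{i,j}` to `v*_{i,j+1}` and kills the vectors at the end of these
strings, and such that `v` is the sum over the rows `i` of `μ` of the `v_{ij}` with `(i, j)` at the
end of the `i`-th row of `μ`. -/
structure IsNormalBasis (ω : LinearMap.BilinForm ℂ V) (v : V) (x : Module.End ℂ V)
    (μ ν : YoungDiagram) (b : Module.Basis (Box μ ν ⊕ Box μ ν) ℂ V) : Prop where
  pairing_self : ∀ c, ω (b (Sum.inl c)) (b (Sum.inr c)) = 1
  pairing_ne : ∀ c c', c ≠ c' → ω (b (Sum.inl c)) (b (Sum.inr c')) = 0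
  pairing_left : ∀ c c', ω (b (Sum.inl c)) (b (Sum.inl c')) = 0
  pairing_right : ∀ c c', ω (b (Sum.inr c)) (b (Sum.inr c')) = 0
  vec : v = ∑ i, b (Sum.inl (Box.last μ ν i))
  left_zero : ∀ i (h : 0 < sumPart μ ν i), x (b (Sum.inl ⟨(i, 0), h⟩)) = 0
  left_succ : ∀ i j (h : j + 1 < sumPart μ ν i),
    x (b (Sum.inl ⟨(i, j + 1), h⟩)) = b (Sum.inl ⟨(i, j), lt_of_le_of_lt j.le_succ h⟩)
  right_succ : ∀ i j (h : j + 1 < sumPart μ ν i),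
    x (b (Sum.inr ⟨(i, j), lt_of_le_of_lt j.le_succ h⟩)) = b (Sum.inr ⟨(i, j + 1), h⟩)
  right_last : ∀ i j (h : j < sumPart μ ν i), j + 1 = sumPart μ ν i →
    x (b (Sum.inr ⟨(i, j), h⟩)) = 0

/-- The orbit `𝕆_(μ,ν)`: the points `(v, x)` of the exotic nilpotent cone of exotic Jordan type
`eJ(v, x) = (μ, ν)`, that is, those that have a normal basis of type `(μ, ν)`. -/
def exoticOrbit (ω : LinearMap.BilinForm ℂ V) (μ ν : YoungDiagram) : Set (V × Module.End ℂ V) :=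
  {p | p ∈ exoticNilpotentCone ω ∧ ∃ b, IsNormalBasis ω p.1 p.2 μ ν b}

/-- `ℂ[x]v`, the span of `v, x v, x² v, …`. -/
def cyclicSpan (x : Module.End ℂ V) (v : V) : Submodule ℂ V :=
  Submodule.span ℂ (Set.range fun j : ℕ => (x ^ j) v)

end ExoticType

/-! ### Reduction to `F^⊥ / F` -/

section Reduction

variable {V : Type*} [AddCommGroup V] [Module ℂ V]

/-- The quotient `F^⊥ / F` (for isotropic `F`; in general `F^⊥ / (F ∩ F^⊥)`). -/
abbrev Reduction (ω : LinearMap.BilinForm ℂ V) (F : Submodule ℂ V) : Type _ :=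
  ω.orthogonal F ⧸ F.submoduleOf (ω.orthogonal F)

variable {ω : LinearMap.BilinForm ℂ V} {x : Module.End ℂ V}

/-- The form induced on `F^⊥ / F`. -/
def reducedForm (hω : ω.IsAlt) (F : Submodule ℂ V) : LinearMap.BilinForm ℂ (Reduction ω F) :=
  Submodule.liftQ _
    { toFun := fun u => Submodule.liftQ _ (ω.restrict (ω.orthogonal F) u) (by
        intro f hf
        have h : ω f u = 0 := u.2 f hf
        show ω u f = 0
        rw [← hω.neg_eq, h, neg_zero])
      map_add' := by
        intro u w
        ext t
        simp
      map_smul' := by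
        intro c u
        ext t
        simp }
    (by
      intro f hf
      ext t
      exact t.2 f hf)

/-- The endomorphism of `F^⊥` to which a self-adjoint `x` that vanishes on `F` restricts. -/
def perpEnd (hx : ∀ u w, ω (x u) w = ω u (x w)) (F : Submodule ℂ V)
    (hF : F ≤ LinearMap.ker x) : Module.End ℂ (ω.orthogonal F) :=
  x.restrict (p := ω.orthogonal F) (q := ω.orthogonal F) (by
    intro u hu f hf
    show ω f (x u) = 0
    rw [← hx, LinearMap.mem_ker.1 (hF hf), map_zero, LinearMap.zero_apply])

/-- The endomorphism `x|_{F^⊥/F}` induced by a self-adjoint `x` that vanishes on `F`. -/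
def reducedEnd (hx : ∀ u w, ω (x u) w = ω u (x w)) (F : Submodule ℂ V)
    (hF : F ≤ LinearMap.ker x) : Module.End ℂ (Reduction ω F) :=
  Submodule.mapQ _ _ (perpEnd hx F hF) (by
    intro f hf
    have h : x f.1 = 0 := LinearMap.mem_ker.1 (hF hf)
    show x f.1 ∈ F
    rw [h]
    exact F.zero_mem)

/-- The class `v + F` in `F^⊥ / F` of a vector `v ∈ F^⊥`. -/
def reducedVec {v : V} (F : Submodule ℂ V) (hv : v ∈ ω.orthogonal F) : Reduction ω F :=
  Submodule.Quotient.mk ⟨v, hv⟩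

/-- If `F ⊆ (ℂ[x]v)^⊥` then `v ∈ F^⊥`. -/
theorem mem_orthogonal_of_le (hω : ω.IsAlt) {v : V} {F : Submodule ℂ V}
    (hF : F ≤ ω.orthogonal (cyclicSpan x v)) : v ∈ ω.orthogonal F := by
  intro f hf
  have h : ω v f = 0 := hF hf v (Submodule.subset_span ⟨0, by simp⟩)
  show ω f v = 0
  rw [← hω.neg_eq, h, neg_zero]

/-- The set of `k`-dimensional isotropic subspaces `F` of `ker x ∩ (ℂ[x]v)^⊥` such that
`eJ(v + F, x|_{F^⊥/F}) = (μ', ν')`. -/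
def varietyB (hω : ω.IsAlt) (hx : ∀ u w, ω (x u) w = ω u (x w)) (v : V) (k : ℕ)
    (μ' ν' : YoungDiagram) : Set (Gr k V) :=
  {F | F.1 ≤ ω.orthogonal F.1 ∧
    ∃ hF : F.1 ≤ LinearMap.ker x ⊓ ω.orthogonal (cyclicSpan x v),
      (reducedVec F.1 (mem_orthogonal_of_le hω (le_trans hF inf_le_right)),
        reducedEnd hx F.1 (le_trans hF inf_le_left)) ∈ exoticOrbit (reducedForm hω F.1) μ' ν'}

end Reduction

end Exotic

/-! Self-adjointness and x² = 0 split the problem into two symplectic spaces: I = im x with the form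
β(xu, xw) = ⟨u, xw⟩, and Q = ker x / im x with the form γ induced by ⟨ , ⟩. `exists_isStandard`
identifies V with I × Q × I, where x carries the last factor to the first. The transvections and
isometries that respect this structure show that (v, x) is determined up to isometry by dim V = 4p +
2q, rank x = 2p and the position of v relative to 0 ⊆ im x ⊆ ker x ⊆ V (`mem_exoticOrbit_iff`). The
bipartitions that occur are those with μ₁ + ν₁ ≤ 2; they form four families, one for each position
(`Shape`).

For F in ker x = I × Q put E = F ∩ I. Then F is isotropic iff its image in Q is; since F lies in ker
x, orthogonality to ℂ[x]v is orthogonality to v; the image of x on F^⊥/F is E^⊥/rad E, so the rank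
2p' of the reduced endomorphism prescribes dim E + dim rad E
(`IsStandard.finrank_range_reducedEnd`); and the position of v + F depends on whether xv ∈ F, v ∈ F
+ E^⊥, v ∈ F. Hence 𝓑 becomes an explicit set of subspaces of I × Q (`varietyB_eq_image`). A generic
member has dim rad E = ρ, dim E = ρ + 2s and an image of dimension m = q - z in Q, where p = p' + ρ
+ s, q' = ρ + z, and s = 0 or z = 0, because dim E is as small as the conditions allow.

Irreducibility: every member, generic or not, has a frame built from an isotropic tuple R whose span
contains rad E, further vectors h of E orthogonal to R, and remaining rows with isotropic image in Q
(`exists_adapted`, `exists_adapted_of_mem`). Such data at t = 0 and t = 1 are joined by polynomial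
curves (`exists_isotropic_curve`, `exists_orthogonal_curve`), and the prescribed rank, once it holds
at t = 0, holds for almost all t (`pair_curve`). As ℂ[t] is a domain, this gives irreducibility
(`isIrreducible_of_curves`).

Dimension: generic members are parametrized by a vector space `Params` of explicit rows, whose
parameters can be recovered rationally from any frame (`recoverRows_eq`). For a conveniently placed
v its conditions become independent linear equations on the parameters together with an open
condition, so the dimension is a difference of two counts (`topologicalKrullDim_eq_of_chart`). The
upper bound for the Krull dimension turns a chain of closed irreducible sets into algebraically
independent functions on frames (`topologicalKrullDim_le_of_dominant`); the lower bound uses a flag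
of affine subspaces of the parameter space (`le_topologicalKrullDim`).

Nine pairs (position of v, position of v + F) can occur. In each, d^α - d^α' exceeds the dimension
by `defect`, one of 0, s, z, p', p' + s, p' + z (`chartDim_sub`), and this vanishes exactly for
vertical strips (`isVerticalStrip_iff`). The existence of a single member already forces the numbers
to be in the range where the chart applies (`exists_parameters_of_mem`). -/

namespace Exotic
open scoped Topology
open Topology

/-! ### Polynomial functions -/

/-- The algebra of polynomial functions on a complex vector space. -/
def PolyFun (S : Type*) [AddCommGroup S] [Module ℂ S] : Subalgebra ℂ (S → ℂ) :=
  Algebra.adjoin ℂ (Set.range fun φ : Module.Dual ℂ S => (φ : S → ℂ))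

section PolyFun

variable {S W U : Type*} [AddCommGroup S] [Module ℂ S] [AddCommGroup W] [Module ℂ W]
  [AddCommGroup U] [Module ℂ U]

theorem dual_mem_polyFun (φ : Module.Dual ℂ S) : (fun s => φ s) ∈ PolyFun S :=
  Algebra.subset_adjoin ⟨φ, rfl⟩

theorem const_mem_polyFun (c : ℂ) : (fun _ : S => c) ∈ PolyFun S :=
  (PolyFun S).algebraMap_mem c

/-- A map is polynomial if it pulls back linear functionals to polynomial functions. -/
def IsPolyMap (f : S → W) : Prop := ∀ φ : Module.Dual ℂ W, (fun s => φ (f s)) ∈ PolyFun S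

theorem IsPolyMap.comp_mem {f : S → W} (hf : IsPolyMap f) {g : W → ℂ} (hg : g ∈ PolyFun W) :
    (fun s => g (f s)) ∈ PolyFun S := by
  induction hg using Algebra.adjoin_induction with
  | mem x hx => obtain ⟨φ, rfl⟩ := hx; exact hf φ
  | algebraMap r => exact const_mem_polyFun r
  | add x y _ _ hx hy => exact (PolyFun S).add_mem hx hy
  | mul x y _ _ hx hy => exact (PolyFun S).mul_mem hx hy

theorem IsPolyMap.comp {g : W → U} {f : S → W} (hg : IsPolyMap g) (hf : IsPolyMap f) :
    IsPolyMap (fun s => g (f s)) := fun φ => hf.comp_mem (hg φ)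

theorem isPolyMap_linear (f : S →ₗ[ℂ] W) : IsPolyMap f := fun φ => dual_mem_polyFun (φ ∘ₗ f)

theorem IsPolyMap.linear_comp {f : S → W} (hf : IsPolyMap f) (g : W →ₗ[ℂ] U) :
    IsPolyMap (fun s => g (f s)) := (isPolyMap_linear g).comp hf

theorem isPolyMap_const (w : W) : IsPolyMap (fun _ : S => w) := fun φ => const_mem_polyFun (φ w)

theorem IsPolyMap.add {f g : S → W} (hf : IsPolyMap f) (hg : IsPolyMap g) :
    IsPolyMap (fun s => f s + g s) := fun φ => by
  simp only [map_add]; exact (PolyFun S).add_mem (hf φ) (hg φ)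

theorem IsPolyMap.neg {f : S → W} (hf : IsPolyMap f) : IsPolyMap (fun s => - f s) := fun φ => by
  simp only [map_neg]; exact (PolyFun S).neg_mem (hf φ)

theorem IsPolyMap.sub {f g : S → W} (hf : IsPolyMap f) (hg : IsPolyMap g) :
    IsPolyMap (fun s => f s - g s) := fun φ => by
  simp only [map_sub]; exact (PolyFun S).sub_mem (hf φ) (hg φ)

theorem IsPolyMap.smul {c : S → ℂ} {f : S → W} (hc : c ∈ PolyFun S) (hf : IsPolyMap f) :
    IsPolyMap (fun s => c s • f s) := fun φ => by
  simp only [map_smul, smul_eq_mul]; exact (PolyFun S).mul_mem hc (hf φ)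

theorem IsPolyMap.sum {ι : Type*} (t : Finset ι) {f : ι → S → W} (hf : ∀ i ∈ t, IsPolyMap (f i)) :
    IsPolyMap (fun s => ∑ i ∈ t, f i s) := fun φ => by
  simp only [map_sum]
  have := (PolyFun S).sum_mem (t := t) (f := fun i s => φ (f i s)) fun i hi => hf i hi φ
  convert this using 1
  ext s; simp

theorem IsPolyMap.mem {f : S → ℂ} (hf : IsPolyMap f) : f ∈ PolyFun S :=
  hf LinearMap.id

theorem isPolyMap_of_mem {f : S → ℂ} (hf : f ∈ PolyFun S) : IsPolyMap f := fun φ => by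
  have : (fun s => φ (f s)) = fun s => f s * φ 1 := by
    ext s
    have := φ.map_smul (f s) 1
    simpa using this
  rw [this]
  exact (PolyFun S).mul_mem hf (const_mem_polyFun _)

theorem IsPolyMap.bilin {f : S → W} {g : S → U} (hf : IsPolyMap f) (hg : IsPolyMap g)
    [FiniteDimensional ℂ W] (B : W →ₗ[ℂ] U →ₗ[ℂ] ℂ) : (fun s => B (f s) (g s)) ∈ PolyFun S := by
  let b := Module.finBasis ℂ W
  have : (fun s => B (f s) (g s)) = fun s => ∑ i, b.coord i (f s) * B (b i) (g s) := by
    ext s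
    conv_lhs => rw [← b.sum_repr (f s), map_sum, LinearMap.sum_apply]
    simp
  rw [this]
  refine IsPolyMap.mem (IsPolyMap.sum _ fun i _ => isPolyMap_of_mem ?_)
  exact (PolyFun S).mul_mem (hf (b.coord i)) (hg (B (b i)))

theorem isPolyMap_pi {ι : Type*} [Finite ι] {f : S → ι → W} :
    IsPolyMap f ↔ ∀ i, IsPolyMap (fun s => f s i) := by
  classical
  have := Fintype.ofFinite ι
  refine ⟨fun h i => h.linear_comp (LinearMap.proj i), fun h φ => ?_⟩
  have : (fun s => φ (f s)) = fun s => ∑ i, (φ ∘ₗ LinearMap.single ℂ (fun _ : ι => W) i) (f s i) := by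
    ext s
    conv_lhs => rw [← LinearMap.sum_single_apply (fun _ : ι => W) (f s)]
    simp
  rw [this]
  exact IsPolyMap.mem (IsPolyMap.sum _ fun i _ => isPolyMap_of_mem (h i _))

theorem isPolyMap_prod {f : S → W × U} :
    IsPolyMap f ↔ IsPolyMap (fun s => (f s).1) ∧ IsPolyMap (fun s => (f s).2) := by
  refine ⟨fun h => ⟨h.linear_comp (LinearMap.fst ℂ W U), h.linear_comp (LinearMap.snd ℂ W U)⟩,
    fun h => ?_⟩
  have := (h.1.linear_comp (LinearMap.inl ℂ W U)).add (h.2.linear_comp (LinearMap.inr ℂ W U))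
  simpa using this

theorem det_mem_polyFun {ι : Type*} [Fintype ι] [DecidableEq ι] {M : S → Matrix ι ι ℂ}
    (h : ∀ i j, (fun s => M s i j) ∈ PolyFun S) : (fun s => (M s).det) ∈ PolyFun S := by
  have : (fun s => (M s).det) =
      fun s => ∑ σ : Equiv.Perm ι, ((Equiv.Perm.sign σ : ℤ) : ℂ) * ∏ i, M s (σ i) i := by
    ext s; simp [Matrix.det_apply']
  rw [this]
  refine IsPolyMap.mem (IsPolyMap.sum _ fun σ _ => isPolyMap_of_mem ?_)
  refine (PolyFun S).mul_mem (const_mem_polyFun _) ?_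
  have := (PolyFun S).prod_mem (t := Finset.univ) (f := fun i s => M s (σ i) i) fun i _ => h _ _
  convert this using 1
  ext s; simp

theorem adjugate_mem_polyFun {ι : Type*} [Fintype ι] [DecidableEq ι] {M : S → Matrix ι ι ℂ}
    (h : ∀ i j, (fun s => M s i j) ∈ PolyFun S) (i j : ι) :
    (fun s => (M s).adjugate i j) ∈ PolyFun S := by
  simp only [Matrix.adjugate_apply]
  refine det_mem_polyFun fun a b => ?_
  by_cases ha : a = j
  · subst ha
    simp only [Matrix.updateRow_self]
    exact const_mem_polyFun _
  · have : (fun s => (M s).updateRow j (Pi.single i 1) a b) = fun s => M s a b := by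
      ext s; rw [Matrix.updateRow_ne ha]
    rw [this]
    exact h a b

/-- Polynomial functions of one variable are given by polynomials. -/
theorem exists_polynomial_of_mem {f : ℂ → ℂ} (hf : f ∈ PolyFun ℂ) :
    ∃ P : Polynomial ℂ, ∀ t, f t = P.eval t := by
  induction hf using Algebra.adjoin_induction with
  | mem x hx =>
    obtain ⟨φ, rfl⟩ := hx
    refine ⟨Polynomial.C (φ 1) * Polynomial.X, fun t => ?_⟩
    have := φ.map_smul t 1
    simp only [smul_eq_mul, mul_one] at this
    show φ t = _
    rw [Polynomial.eval_mul, Polynomial.eval_C, Polynomial.eval_X, this, mul_comm]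
  | algebraMap r => exact ⟨Polynomial.C r, fun t => by simp [Pi.algebraMap_apply]⟩
  | add x y _ _ hx hy =>
    obtain ⟨P, hP⟩ := hx; obtain ⟨Q, hQ⟩ := hy
    exact ⟨P + Q, fun t => by simp [hP, hQ]⟩
  | mul x y _ _ hx hy =>
    obtain ⟨P, hP⟩ := hx; obtain ⟨Q, hQ⟩ := hy
    exact ⟨P * Q, fun t => by simp [hP, hQ]⟩

/-- ℂ[t] is a domain and ℂ is infinite. The irreducibility arguments below all come down to this. -/
theorem exists_ne_zero_of_curve {f g : ℂ → ℂ} (hf : f ∈ PolyFun ℂ) (hg : g ∈ PolyFun ℂ)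
    (a b : ℂ) (ha : f a ≠ 0) (hb : g b ≠ 0) : ∃ t, f t ≠ 0 ∧ g t ≠ 0 := by
  obtain ⟨P, hP⟩ := exists_polynomial_of_mem hf
  obtain ⟨Q, hQ⟩ := exists_polynomial_of_mem hg
  have hPQ : P * Q ≠ 0 := by
    refine mul_ne_zero ?_ ?_
    · rintro rfl; exact ha (by simp [hP])
    · rintro rfl; exact hb (by simp [hQ])
  by_contra! hcon
  refine hPQ (Polynomial.funext fun t => ?_)
  simp only [Polynomial.eval_mul, Polynomial.eval_zero, mul_eq_zero, ← hP, ← hQ]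
  by_cases h : f t = 0
  · exact Or.inl h
  · exact Or.inr (hcon t h)

/-- The polynomial curve through two points. -/
theorem isPolyMap_line (a b : S) : IsPolyMap (fun t : ℂ => a + t • (b - a)) :=
  (isPolyMap_const a).add (IsPolyMap.smul (IsPolyMap.mem fun φ => dual_mem_polyFun φ)
    (isPolyMap_const _))

/-- Restriction to the line through a and b reduces this to one variable. -/
theorem exists_ne_zero_of_mem {f g : S → ℂ} (hf : f ∈ PolyFun S) (hg : g ∈ PolyFun S)
    {a b : S} (ha : f a ≠ 0) (hb : g b ≠ 0) : ∃ s, f s ≠ 0 ∧ g s ≠ 0 := by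
  obtain ⟨t, ht⟩ := exists_ne_zero_of_curve ((isPolyMap_line a b).comp_mem hf)
    ((isPolyMap_line a b).comp_mem hg) 0 1 (by simpa using ha) (by simpa using hb)
  exact ⟨_, ht⟩

/-- `PolyFun S` is the range of the evaluation of polynomials in the linear functionals, so formal
polynomials can be replaced by functions from here on. -/
theorem isClosed_zariski_iff {Z : Set S} :
    IsClosed[zariskiTopology S] Z ↔
      ∃ T : Set (S → ℂ), T ⊆ PolyFun S ∧ Z = {s | ∀ f ∈ T, f s = 0} := by
  have hev : ∀ p : MvPolynomial (Module.Dual ℂ S) ℂ,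
      (fun s => MvPolynomial.eval (fun φ : Module.Dual ℂ S => φ s) p) =
        MvPolynomial.aeval (fun φ : Module.Dual ℂ S => (φ : S → ℂ)) p := by
    intro p
    induction p using MvPolynomial.induction_on with
    | C a => ext s; simp
    | add p q hp hq => simp only [map_add, ← hp, ← hq]; rfl
    | mul_X p φ hp => simp only [map_mul, ← hp, MvPolynomial.eval_X, MvPolynomial.aeval_X]; rfl
  have hrange : ∀ f, f ∈ PolyFun S ↔ ∃ p : MvPolynomial (Module.Dual ℂ S) ℂ,
      (fun s => MvPolynomial.eval (fun φ : Module.Dual ℂ S => φ s) p) = f := by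
    intro f
    rw [PolyFun, Algebra.adjoin_range_eq_range_aeval]
    simp only [AlgHom.mem_range, hev]
  have hcl : IsClosed[zariskiTopology S] Z ↔ ∃ T, Z = zeroLocus S T := by
    rw [← @isOpen_compl_iff _ _ (zariskiTopology S)]
    show Zᶜᶜ ∈ _ ↔ _
    rw [compl_compl]; rfl
  rw [hcl]
  constructor
  · rintro ⟨T, rfl⟩
    refine ⟨(fun p s => MvPolynomial.eval (fun φ : Module.Dual ℂ S => φ s) p) '' T, ?_, ?_⟩
    · rintro _ ⟨p, -, rfl⟩; exact (hrange _).2 ⟨p, rfl⟩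
    · ext s; simp [zeroLocus]
  · rintro ⟨T, hT, rfl⟩
    refine ⟨{p | (fun s => MvPolynomial.eval (fun φ : Module.Dual ℂ S => φ s) p) ∈ T}, ?_⟩
    ext s
    constructor
    · intro h p hp; exact h _ hp
    · intro h f hf
      obtain ⟨p, rfl⟩ := (hrange f).1 (hT hf)
      exact h p hf

theorem isOpen_ne_zero {f : S → ℂ} (hf : f ∈ PolyFun S) :
    IsOpen[zariskiTopology S] {s | f s ≠ 0} := by
  rw [← @isClosed_compl_iff _ (zariskiTopology S), isClosed_zariski_iff]
  refine ⟨{f}, by simpa using hf, ?_⟩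
  ext s; simp

/-- Principal open sets form a basis of the topology. -/
theorem exists_polyFun_of_isOpen {O : Set S} (hO : IsOpen[zariskiTopology S] O) {s : S}
    (hs : s ∈ O) : ∃ f ∈ PolyFun S, f s ≠ 0 ∧ ∀ t, f t ≠ 0 → t ∈ O := by
  rw [← @isClosed_compl_iff _ (zariskiTopology S), isClosed_zariski_iff] at hO
  obtain ⟨T, hT, hOT⟩ := hO
  have : s ∉ Oᶜ := by simpa using hs
  rw [hOT] at this
  simp only [Set.mem_ofPred_eq, not_forall] at this
  obtain ⟨f, hf, hfs⟩ := this
  refine ⟨f, hT hf, hfs, fun t ht => ?_⟩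
  by_contra h
  have : t ∈ Oᶜ := h
  rw [hOT] at this
  exact ht (this f hf)

end PolyFun

/-! ### Open sets of the Grassmannian -/

section Gr

variable {k : ℕ} {V : Type*} [AddCommGroup V] [Module ℂ V]

/-- The action of square matrices on tuples of vectors. -/
def matAct (g : Matrix (Fin k) (Fin k) ℂ) : (Fin k → V) →ₗ[ℂ] (Fin k → V) where
  toFun c := fun i => ∑ j, g i j • c j
  map_add' c d := by ext i; simp [Finset.sum_add_distrib]
  map_smul' a c := by ext i; simp [Finset.smul_sum, smul_comm a]

theorem matAct_apply (g : Matrix (Fin k) (Fin k) ℂ) (c : Fin k → V) (i : Fin k) :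
    matAct g c i = ∑ j, g i j • c j := rfl

theorem matAct_mul (g h : Matrix (Fin k) (Fin k) ℂ) (c : Fin k → V) :
    matAct (g * h) c = matAct g (matAct h c) := by
  ext i
  simp only [matAct_apply, Matrix.mul_apply, Finset.sum_smul, Finset.smul_sum, mul_smul]
  exact Finset.sum_comm

theorem matAct_one (c : Fin k → V) : matAct 1 c = c := by
  ext i
  simp [matAct_apply, Matrix.one_apply]

/-- The frame given by a linearly independent tuple. -/
def Frame.of (b : Fin k → V) (h : LinearIndependent ℂ b) : Frame k V := ⟨b, h⟩

theorem span_matAct_le (g : Matrix (Fin k) (Fin k) ℂ) (c : Fin k → V) :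
    Submodule.span ℂ (Set.range (matAct g c)) ≤ Submodule.span ℂ (Set.range c) := by
  rw [Submodule.span_le]
  rintro _ ⟨i, rfl⟩
  rw [matAct_apply]
  exact Submodule.sum_mem _ fun j _ =>
    Submodule.smul_mem _ _ (Submodule.subset_span (Set.mem_range_self j))

theorem span_matAct {g : Matrix (Fin k) (Fin k) ℂ} (hg : IsUnit g.det) (c : Fin k → V) :
    Submodule.span ℂ (Set.range (matAct g c)) = Submodule.span ℂ (Set.range c) := by
  refine le_antisymm (span_matAct_le g c) ?_
  conv_lhs => rw [← matAct_one c, ← Matrix.nonsing_inv_mul g hg, matAct_mul]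
  exact span_matAct_le _ _

theorem linearIndependent_matAct {g : Matrix (Fin k) (Fin k) ℂ} (hg : IsUnit g.det)
    {c : Fin k → V} (hc : LinearIndependent ℂ c) : LinearIndependent ℂ (matAct g c) := by
  rw [linearIndependent_iff_card_eq_finrank_span] at hc ⊢
  rw [hc, Set.finrank, Set.finrank, span_matAct hg]

/-- Each tuple is a matrix times the other, and independence of b makes the two matrices mutually
inverse. The fibres of `Frame.span` are thus orbits of GL_k. -/
theorem exists_matAct_of_span_eq {b c : Fin k → V} (hb : LinearIndependent ℂ b)
    (h : Submodule.span ℂ (Set.range b) = Submodule.span ℂ (Set.range c)) :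
    ∃ g : Matrix (Fin k) (Fin k) ℂ, IsUnit g.det ∧ matAct g b = c := by
  have key : ∀ {b c : Fin k → V},
      Submodule.span ℂ (Set.range b) = Submodule.span ℂ (Set.range c) →
      ∃ g : Matrix (Fin k) (Fin k) ℂ, matAct g b = c := by
    intro b c h
    have : ∀ i, ∃ a : Fin k → ℂ, ∑ j, a j • b j = c i := fun i => by
      have hi : c i ∈ Submodule.span ℂ (Set.range b) := h ▸ Submodule.subset_span ⟨i, rfl⟩
      exact (Submodule.mem_span_range_iff_exists_fun ℂ).1 hi
    choose a ha using this
    exact ⟨Matrix.of a, funext fun i => by simpa [matAct_apply] using ha i⟩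
  obtain ⟨g, hg⟩ := key h
  obtain ⟨g', hg'⟩ := key h.symm
  refine ⟨g, ?_, hg⟩
  have h1 : matAct (g' * g) b = b := by rw [matAct_mul, hg, hg']
  have h2 : g' * g = 1 := by
    ext i j
    have h3 := congrFun h1 i
    rw [matAct_apply] at h3
    have h4 : ∑ j, ((g' * g) i j - (1 : Matrix (Fin k) (Fin k) ℂ) i j) • b j = 0 := by
      simp only [sub_smul, Finset.sum_sub_distrib, h3]
      simp [Matrix.one_apply]
    exact sub_eq_zero.1 (Fintype.linearIndependent_iff.1 hb _ h4 j)
  exact (Matrix.isUnit_iff_isUnit_det g).1 (IsUnit.of_mul_eq_one_right _ h2)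

theorem Frame.span_eq_iff {b c : Frame k V} : b.span = c.span ↔
    Submodule.span ℂ (Set.range b.1) = Submodule.span ℂ (Set.range c.1) := Subtype.ext_iff

theorem Frame.exists_span_eq [FiniteDimensional ℂ V] (F : Gr k V) :
    ∃ b : Frame k V, b.span = F := by
  let b := Module.finBasisOfFinrankEq ℂ F.1 F.2
  have hb : LinearIndependent ℂ (fun i => (b i : V)) :=
    b.linearIndependent.map' F.1.subtype (by simp)
  refine ⟨⟨_, hb⟩, Subtype.ext ?_⟩
  show Submodule.span ℂ (Set.range (F.1.subtype ∘ b)) = F.1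
  rw [Set.range_comp, ← Submodule.map_span, b.span_eq]
  simp

/-- The open subset of the Grassmannian of subspaces with a frame on which `f` does not vanish. -/
theorem isOpen_exists_frame_ne_zero {f : (Fin k → V) → ℂ} (hf : f ∈ PolyFun (Fin k → V)) :
    IsOpen {F : Gr k V | ∃ b : Frame k V, b.span = F ∧ f b.1 ≠ 0} := by
  refine isOpen_coinduced.2 ?_
  -- f need not be invariant under change of basis; the preimage is the union of the translates of
  -- its nonvanishing locus by all invertible matrices.
  have : Frame.span ⁻¹' {F : Gr k V | ∃ b : Frame k V, b.span = F ∧ f b.1 ≠ 0} =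
      Subtype.val ⁻¹' ⋃ g : {g : Matrix (Fin k) (Fin k) ℂ // IsUnit g.det},
        {c : Fin k → V | f (matAct g.1 c) ≠ 0} := by
    refine Set.ext fun c => Iff.trans ?_ (Set.mem_iUnion (x := c.1)).symm
    constructor
    · rintro ⟨b, hbc, hb⟩
      obtain ⟨g, hg, rfl'⟩ := exists_matAct_of_span_eq c.2 (Frame.span_eq_iff.1 hbc).symm
      exact ⟨⟨g, hg⟩, by
        show f (matAct g c.1) ≠ 0
        rwa [rfl']⟩
    · rintro ⟨⟨g, hg⟩, h⟩
      exact ⟨⟨matAct g c.1, linearIndependent_matAct hg c.2⟩,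
        Frame.span_eq_iff.2 (span_matAct hg c.1), h⟩
  rw [this]
  refine @isOpen_induced _ _ (zariskiTopology (Fin k → V)) _ _ ?_
  refine @isOpen_iUnion _ _ (zariskiTopology (Fin k → V)) _ fun g => isOpen_ne_zero ?_
  exact (isPolyMap_linear (matAct g.1)).comp_mem hf

/-- Together with `isOpen_exists_frame_ne_zero` this is the working form of the quotient topology:
neighbourhoods are tested by polynomial functions on frames. -/
theorem exists_polyFun_of_isOpen_gr {O : Set (Gr k V)} (hO : IsOpen O) {b : Frame k V}
    (hb : b.span ∈ O) : ∃ f ∈ PolyFun (Fin k → V), f b.1 ≠ 0 ∧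
      ∀ c : Frame k V, f c.1 ≠ 0 → c.span ∈ O := by
  have h1 : IsOpen (Frame.span ⁻¹' O) := isOpen_coinduced.1 hO
  obtain ⟨U, hU, hUO⟩ := (@isOpen_induced_iff _ _ (zariskiTopology (Fin k → V)) _ _).1 h1
  have hbU : b.1 ∈ U := (Set.ext_iff.1 hUO b).2 hb
  obtain ⟨f, hf, hfb, hfU⟩ := exists_polyFun_of_isOpen hU hbU
  refine ⟨f, hf, hfb, fun c hc => ?_⟩
  exact (Set.ext_iff.1 hUO c).1 (hfU _ hc)

/-- A set of subspaces is irreducible if any two members are joined by a polynomial curve of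
frames almost all of whose members span elements of the set. -/
theorem isIrreducible_of_curves {X : Set (Gr k V)} (hne : X.Nonempty)
    (h : ∀ F₀ ∈ X, ∀ F₁ ∈ X, ∃ γ : ℂ → Fin k → V, IsPolyMap γ ∧
      (∃ b : Frame k V, b.span = F₀ ∧ γ 0 = b.1) ∧ (∃ b : Frame k V, b.span = F₁ ∧ γ 1 = b.1) ∧
      ∃ δ ∈ PolyFun ℂ, δ 0 ≠ 0 ∧
        ∀ t, δ t ≠ 0 → ∃ b : Frame k V, b.span ∈ X ∧ γ t = b.1) :
    IsIrreducible X := by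
  refine ⟨hne, ?_⟩
  rintro O₀ O₁ hO₀ hO₁ ⟨F₀, hF₀, hFO₀⟩ ⟨F₁, hF₁, hFO₁⟩
  obtain ⟨γ, hγ, ⟨b₀, rfl, hb₀⟩, ⟨b₁, rfl, hb₁⟩, δ, hδ, hδ0, hX⟩ := h F₀ hF₀ F₁ hF₁
  obtain ⟨f₀, hf₀, hf₀b, hf₀O⟩ := exists_polyFun_of_isOpen_gr hO₀ hFO₀
  obtain ⟨f₁, hf₁, hf₁b, hf₁O⟩ := exists_polyFun_of_isOpen_gr hO₁ hFO₁
  -- The factor δ guarantees that the common parameter belongs to a member of X; f₀ puts this member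
  -- into O₀ and f₁ puts it into O₁.
  obtain ⟨t, ht, ht1⟩ := exists_ne_zero_of_curve
    (f := fun t => δ t * f₀ (γ t)) (g := fun t => f₁ (γ t))
    ((PolyFun ℂ).mul_mem hδ (hγ.comp_mem hf₀)) (hγ.comp_mem hf₁) 0 1
    (mul_ne_zero hδ0 (by rwa [hb₀])) (by rwa [hb₁])
  obtain ⟨b, hb, hγb⟩ := hX t (left_ne_zero_of_mul ht)
  have ht0 := right_ne_zero_of_mul ht
  rw [hγb] at ht0 ht1
  exact ⟨b.span, hb, hf₀O b ht0, hf₁O b ht1⟩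

/-! ### Functoriality -/

/-- The map of Grassmannians induced by an injective linear map. -/
def Gr.map {U : Type*} [AddCommGroup U] [Module ℂ U] (ι : U →ₗ[ℂ] V) (hι : Function.Injective ι)
    (F : Gr k U) : Gr k V :=
  ⟨F.1.map ι,
    ((LinearEquiv.finrank_eq (Submodule.equivMapOfInjective ι hι F.1)).symm).trans F.2⟩

/-- A linear retraction r of ι extends polynomial functions on tuples of U to tuples of V, which
extends open sets; continuity is composition with ι. -/
theorem isInducing_grMap {U : Type*} [AddCommGroup U] [Module ℂ U] [FiniteDimensional ℂ U]
    (ι : U →ₗ[ℂ] V) (hι : Function.Injective ι) :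
    IsInducing (Gr.map (k := k) ι hι) := by
  have hspan : ∀ c : Frame k U, (Frame.of (fun i => ι (c.1 i))
      (c.2.map' ι (LinearMap.ker_eq_bot.2 hι))).span = Gr.map ι hι c.span := fun c => by
    refine Subtype.ext ?_
    show Submodule.span ℂ (Set.range (ι ∘ c.1)) = (Submodule.span ℂ (Set.range c.1)).map ι
    rw [Set.range_comp, Submodule.map_span]
  have hpoly : IsPolyMap fun c : Fin k → U => fun i => ι (c i) :=
    isPolyMap_linear (LinearMap.pi fun i => ι ∘ₗ LinearMap.proj i)
  obtain ⟨r, hr⟩ := ι.exists_leftInverse_of_injective (LinearMap.ker_eq_bot.2 hι)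
  have hr' : ∀ u, r (ι u) = u := fun u => LinearMap.congr_fun hr u
  have hpolyr : IsPolyMap fun c : Fin k → V => fun i => r (c i) :=
    isPolyMap_linear (LinearMap.pi fun i => r ∘ₗ LinearMap.proj i)
  refine ⟨?_⟩
  ext O
  constructor
  · intro hO
    rw [isOpen_induced_iff]
    -- The largest open set whose preimage lies in O; it remains to find enough open sets of this
    -- kind.
    refine ⟨⋃₀ {O' | IsOpen O' ∧ Gr.map ι hι ⁻¹' O' ⊆ O}, isOpen_sUnion fun O' h => h.1, ?_⟩
    refine Set.Subset.antisymm ?_ ?_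
    · rintro F ⟨O', hO', hF⟩
      exact hO'.2 hF
    · intro F hF
      obtain ⟨b, rfl⟩ := Frame.exists_span_eq F
      obtain ⟨f, hf, hfb, hfO⟩ := exists_polyFun_of_isOpen_gr hO hF
      refine ⟨_, ⟨isOpen_exists_frame_ne_zero (hpolyr.comp_mem hf), ?_⟩, _, hspan b, ?_⟩
      · rintro F' ⟨c, hc, hfc⟩
        -- A frame of a subspace of the image of ι is fixed by ι ∘ r, so r carries it back to a
        -- frame in U.
        have hc' : ∀ i, ι (r (c.1 i)) = c.1 i := fun i => by
          have h1 : c.1 i ∈ F'.1.map ι := by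
            rw [show F'.1.map ι = (Gr.map ι hι F').1 from rfl, ← hc]
            exact Submodule.subset_span ⟨i, rfl⟩
          obtain ⟨u, -, hu⟩ := h1
          rw [← hu, hr']
        have hli : LinearIndependent ℂ (fun i => r (c.1 i)) := by
          refine LinearIndependent.of_comp ι ?_
          have : ι ∘ (fun i => r (c.1 i)) = c.1 := funext hc'
          rw [this]; exact c.2
        have h2 := hfO (Frame.of _ hli) hfc
        have h3 : (Frame.of (fun i => r (c.1 i)) hli).span = F' := by
          have h4 := hspan (Frame.of _ hli)
          have h5 : Frame.of (fun i => ι (r (c.1 i))) (hli.map' ι (LinearMap.ker_eq_bot.2 hι)) =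
              c := Subtype.ext (funext hc')
          replace h4 := (congrArg Frame.span h5).symm.trans h4
          rw [hc] at h4
          refine Subtype.ext ?_
          exact (Submodule.map_injective_of_injective hι (congrArg Subtype.val h4)).symm
        rwa [h3] at h2
      · show f (fun i => r (ι (b.1 i))) ≠ 0
        simpa only [hr'] using hfb
  · intro hO
    obtain ⟨O', hO', rfl⟩ := isOpen_induced_iff.1 hO
    rw [isOpen_iff_mem_nhds]
    intro F hF
    obtain ⟨b, rfl⟩ := Frame.exists_span_eq F
    have hF' : (Frame.of (fun i => ι (b.1 i))
      (b.2.map' ι (LinearMap.ker_eq_bot.2 hι))).span ∈ O' := by rw [hspan]; exact hF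
    obtain ⟨f, hf, hfb, hfO⟩ := exists_polyFun_of_isOpen_gr hO' hF'
    refine Filter.mem_of_superset ((isOpen_exists_frame_ne_zero (hpoly.comp_mem hf)).mem_nhds
      ⟨b, rfl, hfb⟩) ?_
    rintro _ ⟨c, rfl, hc⟩
    have := hfO (Frame.of _ (c.2.map' ι (LinearMap.ker_eq_bot.2 hι))) hc
    exact (congrArg (· ∈ O') (hspan c)).mp this

end Gr

/-! ### Algebraic independence and an upper bound for the dimension -/

section AlgIndepOn

variable {E : Type*} [AddCommGroup E] [Module ℂ E]

/-- Algebraic independence of functions restricted to a set. -/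
def AlgIndepOn (T : Set E) {N : ℕ} (x : Fin N → E → ℂ) : Prop :=
  ∀ P : MvPolynomial (Fin N) ℂ, (∀ b ∈ T, MvPolynomial.eval (fun i => x i b) P = 0) → P = 0

theorem eval_mem_polyFun {ι : Type*} {x : ι → E → ℂ} (hx : ∀ i, x i ∈ PolyFun E)
    (P : MvPolynomial ι ℂ) : (fun b => MvPolynomial.eval (fun i => x i b) P) ∈ PolyFun E := by
  induction P using MvPolynomial.induction_on with
  | C a => simpa using const_mem_polyFun a
  | add p q hp hq => simp only [map_add]; exact (PolyFun E).add_mem hp hq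
  | mul_X p i hp => simp only [map_mul, MvPolynomial.eval_X]; exact (PolyFun E).mul_mem hp (hx i)

/-- The transcendence degree grows strictly along T ⊂ T'. A relation on T' is a polynomial in h over
the polynomials in x. On T, where h = 0, only its constant coefficient survives, and this is zero by
independence; then one factor h is cancelled on T' by `hdom`, and the degree drops. -/
theorem AlgIndepOn.cons {T T' : Set E} (hTT' : T ⊆ T') {N : ℕ} {x : Fin N → E → ℂ}
    (hxp : ∀ i, x i ∈ PolyFun E) (hx : AlgIndepOn T x)
    (hdom : ∀ f ∈ PolyFun E, ∀ g ∈ PolyFun E, (∀ b ∈ T', f b * g b = 0) →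
      (∀ b ∈ T', f b = 0) ∨ ∀ b ∈ T', g b = 0)
    {h : E → ℂ} (hh : h ∈ PolyFun E) (hT : ∀ b ∈ T, h b = 0) (hT' : ∃ b ∈ T', h b ≠ 0) :
    AlgIndepOn T' (Fin.cons h x : Fin (N + 1) → E → ℂ) := by
  have hcons : ∀ b, (fun i => (Fin.cons h x : Fin (N + 1) → E → ℂ) i b) =
      Fin.cons (h b) (fun i => x i b) := by
    intro b; ext i; refine Fin.cases ?_ (fun j => ?_) i <;> simp
  have hmem : ∀ i, (Fin.cons h x : Fin (N + 1) → E → ℂ) i ∈ PolyFun E := by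
    intro i; refine Fin.cases ?_ (fun j => ?_) i
    · simpa using hh
    · simpa using hxp j
  have key : ∀ n (Q : Polynomial (MvPolynomial (Fin N) ℂ)), Q.natDegree ≤ n →
      (∀ b ∈ T', (Q.map (MvPolynomial.eval fun i => x i b)).eval (h b) = 0) → Q = 0 := by
    intro n
    induction n with
    | zero =>
      intro Q hQ hz
      rw [Polynomial.eq_C_of_natDegree_le_zero hQ] at hz ⊢
      have := hx (Q.coeff 0) fun b hb => by simpa using hz b (hTT' hb)
      rw [this, map_zero]
    | succ n ih =>
      intro Q hQ hz
      have h0 : Q.coeff 0 = 0 := hx _ fun b hb => by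
        have := hz b (hTT' hb)
        rw [hT b hb, ← Polynomial.coeff_zero_eq_eval_zero, Polynomial.coeff_map] at this
        exact this
      have hQX : Q = Q.divX * Polynomial.X := by
        conv_lhs => rw [← Polynomial.divX_mul_X_add Q, h0]
        simp
      have hdiv : Q.divX = 0 := by
        refine ih _ ?_ ?_
        · rw [Polynomial.natDegree_divX_eq_natDegree_tsub_one]; omega
        -- The quotient by h must be a polynomial function on E in order that `hdom` applies to it.
        · have hpoly : (fun b => (Q.divX.map (MvPolynomial.eval fun i => x i b)).eval (h b)) ∈
              PolyFun E := by
            have := eval_mem_polyFun hmem ((MvPolynomial.finSuccEquiv ℂ N).symm Q.divX)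
            simp only [hcons, MvPolynomial.eval_eq_eval_mv_eval', AlgEquiv.apply_symm_apply] at this
            exact this
          refine (hdom _ hpoly _ hh fun b hb => ?_).resolve_right ?_
          · have := hz b hb
            rw [hQX] at this
            simpa using this
          · obtain ⟨b, hb, hne⟩ := hT'
            exact fun hcon => hne (hcon b hb)
      rw [hQX, hdiv, zero_mul]
  intro P hP
  have := key _ (MvPolynomial.finSuccEquiv ℂ N P) le_rfl fun b hb => by
    rw [← MvPolynomial.eval_eq_eval_mv_eval', ← hcons]
    exact hP b hb
  simpa using this

/-- `PolyFun E` is a quotient of a polynomial ring in dim E variables, and passing to a quotient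
does not raise the transcendence degree. -/
theorem AlgIndepOn.le_finrank [FiniteDimensional ℂ E] {N : ℕ} {x : Fin N → E → ℂ}
    (hxp : ∀ i, x i ∈ PolyFun E) (hx : AlgIndepOn Set.univ x) : N ≤ Module.finrank ℂ E := by
  let b := Module.finBasis ℂ E
  have hb : ∀ i, (fun s => b.coord i s) ∈ PolyFun E := fun i => dual_mem_polyFun (b.coord i)
  let f : MvPolynomial (Fin (Module.finrank ℂ E)) ℂ →ₐ[ℂ] PolyFun E :=
    MvPolynomial.aeval fun i => ⟨fun s => b.coord i s, hb i⟩
  have hf : Function.Surjective f := by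
    rintro ⟨g, hg⟩
    suffices h : g ∈ ((PolyFun E).val.comp f).range by
      obtain ⟨P, hP⟩ := h
      exact ⟨P, Subtype.ext hP⟩
    refine (Algebra.adjoin_le (S := ((PolyFun E).val.comp f).range) ?_) hg
    rintro _ ⟨φ, rfl⟩
    have : (φ : E → ℂ) = ∑ i, φ (b i) • (fun s => b.coord i s) := by
      ext s
      conv_lhs => rw [← b.sum_repr s, map_sum]
      simp [mul_comm]
    show (φ : E → ℂ) ∈ _
    rw [this]
    refine Subalgebra.sum_mem _ fun i _ => Subalgebra.smul_mem _ ?_ _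
    exact ⟨MvPolynomial.X i, by simp [f]⟩
  have hai : AlgebraicIndependent ℂ (fun i => (⟨x i, hxp i⟩ : PolyFun E)) := by
    rw [algebraicIndependent_iff]
    intro P hP
    refine hx P fun s _ => ?_
    have h1 : ∀ P : MvPolynomial (Fin N) ℂ,
        ((MvPolynomial.aeval (fun i => (⟨x i, hxp i⟩ : PolyFun E)) P : PolyFun E) : E → ℂ) s =
        MvPolynomial.eval (fun i => x i s) P := by
      intro P
      induction P using MvPolynomial.induction_on with
      | C a => simp
      | add p q hp hq => simp only [map_add, ← hp, ← hq]; rfl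
      | mul_X p i hp =>
        simp only [map_mul, ← hp, MvPolynomial.eval_X, MvPolynomial.aeval_X]; rfl
    rw [← h1, hP]; rfl
  have h1 := hai.lift_cardinalMk_le_trdeg
  have h2 := lift_trdeg_le_of_surjective f hf
  rw [MvPolynomial.trdeg_of_isDomain] at h2
  simp only [Cardinal.mk_fin, Cardinal.lift_natCast, Cardinal.lift_id'] at h1 h2
  have h3 : (N : Cardinal) ≤ (Module.finrank ℂ E : ℕ) := by
    refine le_trans ?_ h2
    simpa using h1
  exact_mod_cast h3

end AlgIndepOn

/-! ### Upper and lower bounds for the Krull dimension of a set of subspaces -/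

section Dimension

variable {k : ℕ} {V : Type*} [AddCommGroup V] [Module ℂ V]

/-- The tuples that are frames of a member of a set of subspaces. -/
def framesOver (Z : Set (Gr k V)) : Set (Fin k → V) := {b | ∃ c : Frame k V, c.1 = b ∧ c.span ∈ Z}

/-- If neither f nor g vanishes identically, irreducibility of Z provides one subspace with a frame
where f ≠ 0 and another frame where g ≠ 0. These differ by an invertible matrix, and matrices form a
vector space, where nonvanishing loci meet. -/
theorem framesOver_domain {Z : Set (Gr k V)} (hZ : IsIrreducible Z) {f g : (Fin k → V) → ℂ}
    (hf : f ∈ PolyFun (Fin k → V)) (hg : g ∈ PolyFun (Fin k → V))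
    (h : ∀ b ∈ framesOver Z, f b * g b = 0) :
    (∀ b ∈ framesOver Z, f b = 0) ∨ ∀ b ∈ framesOver Z, g b = 0 := by
  by_contra! hcon
  obtain ⟨⟨_, ⟨b, rfl, hb⟩, hfb⟩, _, ⟨c, rfl, hc⟩, hgc⟩ := hcon
  obtain ⟨F, hF, ⟨b', rfl, hb'⟩, c', hc'b, hc'⟩ := hZ.2 _ _ (isOpen_exists_frame_ne_zero hf)
    (isOpen_exists_frame_ne_zero hg) ⟨_, hb, b, rfl, hfb⟩ ⟨_, hc, c, rfl, hgc⟩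
  obtain ⟨m, hm, hmc⟩ := exists_matAct_of_span_eq b'.2 (Frame.span_eq_iff.1 hc'b).symm
  have hact : IsPolyMap fun m : Matrix (Fin k) (Fin k) ℂ => matAct m b'.1 := by
    refine isPolyMap_linear ⟨⟨fun m => matAct m b'.1, ?_⟩, ?_⟩
    · intro m n; ext i; simp [matAct_apply, add_smul, Finset.sum_add_distrib]
    · intro a m; ext i; simp [matAct_apply, mul_smul, Finset.smul_sum]
  have hdet : (fun m : Matrix (Fin k) (Fin k) ℂ => m.det) ∈
      PolyFun (Matrix (Fin k) (Fin k) ℂ) :=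
    det_mem_polyFun fun i j => dual_mem_polyFun (Matrix.entryLinearMap ℂ ℂ i j)
  -- The determinant is included so that the matrix found is invertible and yields a frame of the
  -- same subspace.
  obtain ⟨m', hm1, hm2⟩ := exists_ne_zero_of_mem
    ((PolyFun _).mul_mem (hact.comp_mem hf) hdet) (hact.comp_mem hg) (a := 1) (b := m)
    (by simpa [matAct_one] using hb') (by simpa [hmc] using hc')
  have hm1' : f (matAct m' b'.1) * m'.det ≠ 0 := hm1
  have hu : IsUnit m'.det := isUnit_iff_ne_zero.2 (right_ne_zero_of_mul hm1')
  refine mul_ne_zero (left_ne_zero_of_mul hm1') hm2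
    (h _ ⟨Frame.of _ (linearIndependent_matAct hu b'.2), rfl, ?_⟩)
  have : (Frame.of _ (linearIndependent_matAct hu b'.2)).span = b'.span :=
    Frame.span_eq_iff.2 (span_matAct hu _)
  rwa [this]

/-- The fibre over a single subspace is a copy of GL_k, whose k² matrix entries are independent; the
retraction r extends them to all tuples. -/
theorem exists_algIndepOn_framesOver {Z : Set (Gr k V)} {b : Frame k V} (hb : b.span ∈ Z) :
    ∃ x : Fin (k * k) → (Fin k → V) → ℂ, (∀ i, x i ∈ PolyFun _) ∧
      AlgIndepOn (framesOver Z) x := by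
  obtain ⟨r, hr⟩ := (Fintype.linearCombination ℂ b.1).exists_leftInverse_of_injective
    (LinearMap.ker_eq_bot.2 b.2.fintypeLinearCombination_injective)
  have hrb : ∀ j, r (b.1 j) = Pi.single j 1 := fun j => by
    have := LinearMap.congr_fun hr (Pi.single j 1)
    simpa [Fintype.linearCombination_apply_single] using this
  refine ⟨fun l c => r (c (finProdFinEquiv.symm l).1) (finProdFinEquiv.symm l).2, fun l => ?_, ?_⟩
  · exact dual_mem_polyFun ((LinearMap.proj (finProdFinEquiv.symm l).2 : (Fin k → ℂ) →ₗ[ℂ] ℂ) ∘ₗ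
      r ∘ₗ (LinearMap.proj (finProdFinEquiv.symm l).1 : (Fin k → V) →ₗ[ℂ] V))
  · intro P hP
    refine MvPolynomial.funext fun w => ?_
    by_contra hne
    let ev : Matrix (Fin k) (Fin k) ℂ → ℂ := fun m =>
      MvPolynomial.eval (fun l => m (finProdFinEquiv.symm l).1 (finProdFinEquiv.symm l).2) P
    have hev : ev ∈ PolyFun (Matrix (Fin k) (Fin k) ℂ) := eval_mem_polyFun (fun l =>
      dual_mem_polyFun (Matrix.entryLinearMap ℂ ℂ (finProdFinEquiv.symm l).1
        (finProdFinEquiv.symm l).2)) P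
    have hdet : (fun m : Matrix (Fin k) (Fin k) ℂ => m.det) ∈
        PolyFun (Matrix (Fin k) (Fin k) ℂ) :=
      det_mem_polyFun fun i j => dual_mem_polyFun (Matrix.entryLinearMap ℂ ℂ i j)
    obtain ⟨m, hm1, hm2⟩ := exists_ne_zero_of_mem hev hdet
      (a := Matrix.of fun i j => w (finProdFinEquiv (i, j))) (b := 1)
      (by
        simp only [ev, Matrix.of_apply, Prod.mk.eta, Equiv.apply_symm_apply]
        simpa using hne) (by simp)
    have hu : IsUnit m.det := isUnit_iff_ne_zero.2 hm2
    refine hm1 ?_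
    have h1 := hP _ ⟨Frame.of _ (linearIndependent_matAct hu b.2), rfl, by
      have : (Frame.of _ (linearIndependent_matAct hu b.2)).span = b.span :=
        Frame.span_eq_iff.2 (span_matAct hu _)
      rwa [this]⟩
    convert h1 using 3
    ext l
    show _ = r (matAct m b.1 _) _
    rw [matAct_apply, map_sum]
    simp only [map_smul, hrb]
    simp [Finset.sum_apply, Pi.single_apply]

/-- A set of subspaces in the closure of the subspaces parametrized by a polynomial map on a
vector space `S` has dimension at most `dim S`. -/
theorem topologicalKrullDim_le_of_dominant {S : Type*} [AddCommGroup S] [Module ℂ S]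
    [FiniteDimensional ℂ S] [FiniteDimensional ℂ V] {X : Set (Gr k V)} {ψ : S → Fin k → V}
    (hψ : IsPolyMap ψ)
    (hX : X ⊆ closure {F | ∃ s, ∃ b : Frame k V, b.1 = ψ s ∧ b.span = F}) :
    topologicalKrullDim X ≤ (Module.finrank ℂ S : ℕ) := by
  refine iSup_le fun p => ?_
  have hirr : ∀ i, IsIrreducible (Subtype.val '' (p i : Set X) : Set (Gr k V)) := fun i =>
    (p i).isIrreducible'.image _ continuous_subtype_val.continuousOn
  -- The fibres of frames contribute k² functions, and each strict inclusion in the chain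
  -- contributes one more, which vanishes over the smaller set and not over the larger.
  have key : ∀ i (hi : i < p.length + 1), ∃ x : Fin (k * k + i) → (Fin k → V) → ℂ,
      (∀ j, x j ∈ PolyFun _) ∧
      AlgIndepOn (framesOver (Subtype.val '' (p ⟨i, hi⟩ : Set X) : Set (Gr k V))) x := by
    intro i
    induction i with
    | zero =>
      intro hi
      obtain ⟨F, hF⟩ := (hirr ⟨0, hi⟩).1
      obtain ⟨b, rfl⟩ := Frame.exists_span_eq F
      exact exists_algIndepOn_framesOver hF
    | succ i ih =>
      intro hi
      obtain ⟨x, hxp, hx⟩ := ih (by omega)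
      have hlt : p ⟨i, by omega⟩ < p ⟨i + 1, hi⟩ := p.strictMono (by simp)
      obtain ⟨z, hz, hz'⟩ := Set.exists_of_ssubset
        (show (p ⟨i, by omega⟩ : Set X) ⊂ (p ⟨i + 1, hi⟩ : Set X) from hlt)
      obtain ⟨O, hO, hOz⟩ := isOpen_induced_iff.1 (p ⟨i, by omega⟩).isClosed'.isOpen_compl
      obtain ⟨b, hb⟩ := Frame.exists_span_eq z.1
      have hzO : z.1 ∈ O := (Set.ext_iff.1 hOz z).2 hz'
      obtain ⟨f, hf, hfb, hfO⟩ := exists_polyFun_of_isOpen_gr hO (hb ▸ hzO)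
      refine ⟨Fin.cons f x, fun j => ?_, AlgIndepOn.cons ?_ hxp hx
        (fun f hf g hg => framesOver_domain (hirr _) hf hg) hf ?_ ⟨b.1, ⟨b, rfl, z, hz, hb.symm⟩, hfb⟩⟩
      · refine Fin.cases ?_ (fun j => ?_) j
        · exact hf
        · exact hxp j
      · rintro _ ⟨c, rfl, w, hw, hwc⟩
        exact ⟨c, rfl, w, hlt.le hw, hwc⟩
      · rintro _ ⟨c, rfl, w, hw, hwc⟩
        by_contra hne
        have : w.1 ∈ O := by rw [hwc]; exact hfO c hne
        exact (Set.ext_iff.1 hOz w).1 this hw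
  obtain ⟨x, hxp, hx⟩ := key p.length (by omega)
  -- All frames of the parametrized subspaces lie in the image of this map, whose source has
  -- dimension dim S + k²; the k² cancels against the fibre contribution.
  have hΨ : IsPolyMap fun y : S × Matrix (Fin k) (Fin k) ℂ => matAct y.2 (ψ y.1) := by
    refine isPolyMap_pi.2 fun i => ?_
    simp only [matAct_apply]
    refine IsPolyMap.sum _ fun j _ => IsPolyMap.smul ?_ ?_
    · exact dual_mem_polyFun (Matrix.entryLinearMap ℂ ℂ i j ∘ₗ
        (LinearMap.snd ℂ S (Matrix (Fin k) (Fin k) ℂ)))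
    · exact (isPolyMap_pi.1 hψ j).comp (isPolyMap_linear (LinearMap.fst ℂ S (Matrix (Fin k) (Fin k) ℂ)))
  have hle : k * k + p.length ≤ Module.finrank ℂ (S × Matrix (Fin k) (Fin k) ℂ) := by
    refine AlgIndepOn.le_finrank (x := fun i y => x i (matAct y.2 (ψ y.1)))
      (fun i => hΨ.comp_mem (hxp i)) ?_
    intro P hP
    refine hx P ?_
    rintro _ ⟨c, rfl, w, hw, hwc⟩
    -- The nonvanishing of the relation at one frame is an open condition on subspaces, hence holds
    -- at a parametrized subspace by density.
    by_contra hne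
    have hcl : c.span ∈ closure {F | ∃ s, ∃ b : Frame k V, b.1 = ψ s ∧ b.span = F} :=
      hX (hwc ▸ w.2)
    rw [mem_closure_iff] at hcl
    obtain ⟨_, ⟨b', hb', hne'⟩, s, b, hbs, rfl⟩ := hcl _
      (isOpen_exists_frame_ne_zero (eval_mem_polyFun hxp P)) ⟨c, rfl, hne⟩
    obtain ⟨g, hg, hgb⟩ := exists_matAct_of_span_eq b.2 (Frame.span_eq_iff.1 hb').symm
    refine hne' ?_
    have := hP (s, g) trivial
    simpa [← hbs, hgb] using this
  rw [Module.finrank_prod, Module.finrank_matrix] at hle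
  simp only [Fintype.card_fin, Module.finrank_self, mul_one] at hle
  exact_mod_cast (by omega : p.length ≤ Module.finrank ℂ S)

/-- If the subspaces parametrized by a nonempty principal open subset of a vector space `S` lie in
`X`, and the parameter depends algebraically on the subspace, then `X` has dimension at least
`dim S`. -/
theorem le_topologicalKrullDim {S : Type*} [AddCommGroup S] [Module ℂ S]
    [FiniteDimensional ℂ S] {X : Set (Gr k V)} {ψ : S → Fin k → V}
    (hψ : IsPolyMap ψ) {D : S → ℂ} (hD : D ∈ PolyFun S)
    (hDX : ∀ s, D s ≠ 0 → ∃ b : Frame k V, b.1 = ψ s ∧ b.span ∈ X) {s₀ : S} (hs₀ : D s₀ ≠ 0)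
    (hsep : ∀ f ∈ PolyFun S, ∀ s, D s ≠ 0 → f s ≠ 0 → ∃ f' ∈ PolyFun (Fin k → V),
      f' (ψ s) ≠ 0 ∧ ∀ s', D s' ≠ 0 → f s' = 0 → ∀ b c : Frame k V, b.1 = ψ s' →
        c.span = b.span → f' c.1 = 0) :
    ((Module.finrank ℂ S : ℕ) : WithBot ℕ∞) ≤ topologicalKrullDim X := by
  let e := Module.finBasis ℂ S
  -- A flag of affine subspaces through s₀: only the coordinates of index below i are free, so `L i`
  -- has dimension i.
  let L : ℕ → Set S := fun i => {s | ∀ j : Fin (Module.finrank ℂ S), i ≤ j →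
    e.coord j s = e.coord j s₀}
  let A : ℕ → Set X := fun i => {x | ∃ s ∈ L i, D s ≠ 0 ∧ ∃ b : Frame k V, b.1 = ψ s ∧ b.span = x.1}
  have hLline : ∀ i, ∀ s ∈ L i, ∀ s' ∈ L i, ∀ t : ℂ, s + t • (s' - s) ∈ L i := by
    intro i s hs s' hs' t j hj
    rw [map_add, map_smul, map_sub, hs j hj, hs' j hj]
    simp
  have hirr : ∀ i, IsIrreducible (A i) := by
    intro i
    have h0 : s₀ ∈ L i := fun j _ => rfl
    obtain ⟨b₀, hb₀, hbX₀⟩ := hDX s₀ hs₀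
    refine ⟨⟨⟨_, hbX₀⟩, s₀, h0, hs₀, b₀, hb₀, rfl⟩, ?_⟩
    rintro O₀ O₁ hO₀ hO₁ ⟨x, ⟨s, hs, hDs, b, hb, hbx⟩, hx⟩ ⟨y, ⟨s', hs', hDs', c, hc, hcy⟩, hy⟩
    obtain ⟨U₀, hU₀, rfl⟩ := isOpen_induced_iff.1 hO₀
    obtain ⟨U₁, hU₁, rfl⟩ := isOpen_induced_iff.1 hO₁
    obtain ⟨f, hf, hfb, hfU⟩ := exists_polyFun_of_isOpen_gr hU₀ (b := b) (hbx ▸ hx)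
    obtain ⟨g, hg, hgc, hgU⟩ := exists_polyFun_of_isOpen_gr hU₁ (b := c) (hcy ▸ hy)
    have hl := isPolyMap_line s s'
    obtain ⟨t, ht0, ht1⟩ := exists_ne_zero_of_curve
      (f := fun t => D (s + t • (s' - s)) * f (ψ (s + t • (s' - s))))
      (g := fun t => g (ψ (s + t • (s' - s))))
      ((PolyFun ℂ).mul_mem (hl.comp_mem hD) ((hψ.comp hl).comp_mem hf))
      ((hψ.comp hl).comp_mem hg) 0 1 (by simpa [← hb] using ⟨hDs, hfb⟩) (by simpa [← hc] using hgc)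
    obtain ⟨a, ha, haX⟩ := hDX _ (left_ne_zero_of_mul ht0)
    exact ⟨⟨_, haX⟩, ⟨_, hLline i s hs s' hs' t, left_ne_zero_of_mul ht0, a, ha, rfl⟩,
      hfU a (by rw [ha]; exact right_ne_zero_of_mul ht0), hgU a (by rw [ha]; exact ht1)⟩
  let Z : Fin (Module.finrank ℂ S + 1) → TopologicalSpace.IrreducibleCloseds X := fun i =>
    ⟨closure (A i), (hirr i).closure, isClosed_closure⟩
  have hZ : StrictMono Z := by
    refine Fin.strictMono_iff_lt_succ.2 fun i => ?_
    have hle : A i ⊆ A (i + 1) := by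
      rintro x ⟨s, hs, h⟩
      exact ⟨s, fun j hj => hs j (by omega), h⟩
    refine lt_of_le_not_ge (closure_mono hle) fun hge => ?_
    have hf : (fun s => e.coord i s - e.coord i s₀) ∈ PolyFun S :=
      (PolyFun S).sub_mem (dual_mem_polyFun (e.coord i)) (const_mem_polyFun _)
    have hl := isPolyMap_line s₀ (s₀ + e i)
    obtain ⟨t, htD, htf⟩ := exists_ne_zero_of_curve (hl.comp_mem hD) (hl.comp_mem hf) 0 1
      (by simpa using hs₀) (by simp)
    -- The i-th coordinate is constant on `L i` but not on `L (i + 1)`; f' carries this distinction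
    -- over to frames, and so separates a point from the closure of `A i`.
    obtain ⟨f', hf', hf'ψ, hf'0⟩ := hsep _ hf _ htD htf
    obtain ⟨b, hb, hbX⟩ := hDX _ htD
    have hmem : (⟨b.span, hbX⟩ : X) ∈ A (i + 1) := by
      refine ⟨_, fun j hj => ?_, htD, b, hb, rfl⟩
      have : j ≠ i := by rintro rfl; omega
      simp [this.symm]
    have hcl := hge (subset_closure hmem)
    change _ ∈ closure (A i) at hcl
    rw [mem_closure_iff] at hcl
    obtain ⟨x, ⟨c, hcx, hc0⟩, s, hs, hDs, a, ha, hax⟩ := hcl _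
      ((isOpen_exists_frame_ne_zero hf').preimage continuous_subtype_val) ⟨b, rfl, by rwa [hb]⟩
    exact hc0 (hf'0 s hDs (by simpa [sub_eq_zero] using hs i le_rfl) a c ha (hcx.trans hax.symm))
  exact le_iSup (fun p : LTSeries (TopologicalSpace.IrreducibleCloseds X) =>
    (p.length : WithBot ℕ∞)) (LTSeries.mk _ Z hZ)

end Dimension

/-! ### Symplectic linear algebra -/

section Symplectic

open Module LinearMap.BilinForm

variable {W : Type*} [AddCommGroup W] [Module ℂ W] [FiniteDimensional ℂ W]

theorem exists_submodule_between {A B : Submodule ℂ W} (hAB : A ≤ B) {d : ℕ}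
    (hA : finrank ℂ A ≤ d) (hB : d ≤ finrank ℂ B) :
    ∃ C, A ≤ C ∧ C ≤ B ∧ finrank ℂ C = d := by
  obtain ⟨e, rfl⟩ := Nat.exists_eq_add_of_le hA
  clear hA
  induction e with
  | zero => exact ⟨A, le_rfl, hAB, rfl⟩
  | succ e ih =>
    obtain ⟨C, hAC, hCB, hC⟩ := ih (by omega)
    have hlt : C < B := lt_of_le_of_ne hCB (by rintro rfl; omega)
    obtain ⟨x, hxB, hxC⟩ := Set.exists_of_ssubset hlt
    refine ⟨C ⊔ ℂ ∙ x, hAC.trans le_sup_left, sup_le hCB (by simpa using hxB), ?_⟩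
    have h1 := Submodule.finrank_sup_add_finrank_inf_eq C (ℂ ∙ x)
    have hx0 : x ≠ 0 := by rintro rfl; exact hxC C.zero_mem
    have h2 : C ⊓ ℂ ∙ x = ⊥ := by
      rw [← disjoint_iff]
      exact Submodule.disjoint_span_singleton_of_notMem hxC
    rw [h2, finrank_bot, finrank_span_singleton hx0, hC] at h1
    omega

variable {B : LinearMap.BilinForm ℂ W}

omit [FiniteDimensional ℂ W] in
theorem orthogonal_sup (M N : Submodule ℂ W) :
    B.orthogonal (M ⊔ N) = B.orthogonal M ⊓ B.orthogonal N := by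
  refine le_antisymm (le_inf (orthogonal_le le_sup_left) (orthogonal_le le_sup_right)) ?_
  rintro w ⟨h1, h2⟩ x hx
  obtain ⟨m, hm, n, hn, rfl⟩ := Submodule.mem_sup.1 hx
  have h3 : B m w = 0 := h1 m hm
  have h4 : B n w = 0 := h2 n hn
  show B (m + n) w = 0
  rw [map_add, LinearMap.add_apply, h3, h4, add_zero]

/-- E ∩ R^⊥ is the orthogonal of E^⊥ + R, and the rest is a dimension count. When rad E ⊆ R ⊆ E the
last term is dim rad E. -/
theorem finrank_inf_orthogonal (hB : B.IsAlt) (hn : B.Nondegenerate) (E R : Submodule ℂ W) :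
    finrank ℂ (E ⊓ B.orthogonal R : Submodule ℂ W) + finrank ℂ R =
      finrank ℂ E + finrank ℂ (R ⊓ B.orthogonal E : Submodule ℂ W) := by
  have h1 : E ⊓ B.orthogonal R = B.orthogonal (B.orthogonal E ⊔ R) := by
    rw [orthogonal_sup, orthogonal_orthogonal hn hB.isRefl]
  have h2 := Submodule.finrank_sup_add_finrank_inf_eq (B.orthogonal E) R
  rw [inf_comm] at h2
  have h3 := finrank_orthogonal hn (B.orthogonal E ⊔ R)
  have h4 := finrank_orthogonal hn E
  have h5 := Submodule.finrank_le E
  have h6 := Submodule.finrank_le (B.orthogonal E ⊔ R)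
  rw [h1]
  omega

/-- Extension of an isotropic subspace to one that is maximal in a given subspace. -/
theorem exists_maximal_isotropic (hB : B.IsAlt) (hn : B.Nondegenerate) {E S : Submodule ℂ W}
    (hSE : S ≤ E) (hS : S ≤ B.orthogonal S) :
    ∃ L, S ≤ L ∧ L ≤ E ∧ E ⊓ B.orthogonal E ≤ L ∧ L ≤ B.orthogonal L ∧
      2 * finrank ℂ L = finrank ℂ E + finrank ℂ (E ⊓ B.orthogonal E : Submodule ℂ W) := by
  have key : ∀ d (S : Submodule ℂ W), finrank ℂ E - finrank ℂ S ≤ d → S ≤ E → S ≤ B.orthogonal S →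
      E ⊓ B.orthogonal E ≤ S → ∃ L, S ≤ L ∧ L ≤ E ∧ L ≤ B.orthogonal L ∧
      2 * finrank ℂ L = finrank ℂ E + finrank ℂ (E ⊓ B.orthogonal E : Submodule ℂ W) := by
    intro d
    induction d with
    | zero =>
      intro S hd hSE hS hrad
      have : S = E := Submodule.eq_of_le_of_finrank_le hSE (by omega)
      subst this
      refine ⟨S, le_rfl, le_rfl, hS, ?_⟩
      rw [inf_eq_left.2 hS]; ring
    | succ d ih =>
      intro S hd hSE hS hrad
      -- If S is its own orthogonal within E, the dimension formula gives the answer; otherwise any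
      -- vector of E orthogonal to S and outside it enlarges S.
      by_cases hmax : E ⊓ B.orthogonal S ≤ S
      · refine ⟨S, le_rfl, hSE, hS, ?_⟩
        have h1 := finrank_inf_orthogonal hB hn E S
        have h2 : E ⊓ B.orthogonal S = S := le_antisymm hmax (le_inf hSE hS)
        have h3 : S ⊓ B.orthogonal E = E ⊓ B.orthogonal E :=
          le_antisymm (inf_le_inf_right _ hSE) (le_inf hrad inf_le_right)
        rw [h2, h3] at h1
        omega
      · obtain ⟨x, hx, hxS⟩ := SetLike.not_le_iff_exists.1 hmax
        have hx0 : x ≠ 0 := by rintro rfl; exact hxS S.zero_mem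
        have hlt : S < S ⊔ ℂ ∙ x := by
          refine lt_of_le_of_ne le_sup_left fun h => hxS ?_
          rw [h]; exact Submodule.mem_sup_right (Submodule.mem_span_singleton_self x)
        have hle : S ⊔ ℂ ∙ x ≤ E := sup_le hSE (by simpa using hx.1)
        have h1 := Submodule.finrank_lt_finrank_of_lt hlt
        have h2 := Submodule.finrank_mono hle
        have hxx : ℂ ∙ x ≤ B.orthogonal S := by simpa using hx.2
        have hxS' : S ≤ B.orthogonal (ℂ ∙ x) := fun s hs y hy => by
          exact hB.isRefl _ _ (hxx hy s hs)
        have hxx' : ℂ ∙ x ≤ B.orthogonal (ℂ ∙ x) := by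
          rw [Submodule.span_singleton_le_iff_mem]
          intro y hy
          obtain ⟨c, rfl⟩ := Submodule.mem_span_singleton.1 hy
          show B (c • x) x = 0
          rw [map_smul, LinearMap.smul_apply, hB.self_eq_zero, smul_zero]
        obtain ⟨L, hL⟩ := ih (S ⊔ ℂ ∙ x) (by omega) hle
          (by rw [orthogonal_sup]; exact sup_le (le_inf hS hxS') (le_inf hxx hxx'))
          (hrad.trans le_sup_left)
        exact ⟨L, le_sup_left.trans hL.1, hL.2⟩
  have hSE' : S ≤ B.orthogonal (E ⊓ B.orthogonal E) := fun s hs y hy =>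
    hB.isRefl _ _ (hy.2 s (hSE hs))
  -- The radical is orthogonal to all of E, so adding it at the start keeps S isotropic.
  obtain ⟨L, hL⟩ := key _ (S ⊔ E ⊓ B.orthogonal E) le_rfl (sup_le hSE inf_le_left)
    (by
      rw [orthogonal_sup]
      refine sup_le (le_inf hS hSE') (le_inf ?_ ?_)
      · exact inf_le_right.trans (orthogonal_le hSE)
      · exact inf_le_right.trans (orthogonal_le inf_le_left)) le_sup_right
  exact ⟨L, le_sup_left.trans hL.1, hL.2.1, le_sup_right.trans hL.1, hL.2.2⟩

theorem exists_dual_family (hn : B.Nondegenerate) {ι : Type*} [Fintype ι]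
    [DecidableEq ι] {a : ι → W} (ha : LinearIndependent ℂ a) :
    ∃ f : ι → W, ∀ i j, B (a i) (f j) = if i = j then 1 else 0 := by
  obtain ⟨r, hr⟩ := (Fintype.linearCombination ℂ a).exists_leftInverse_of_injective
    (LinearMap.ker_eq_bot.2 ha.fintypeLinearCombination_injective)
  have hra : ∀ j, r (a j) = Pi.single j 1 := fun j => by
    have := LinearMap.congr_fun hr (Pi.single j 1)
    simpa [Fintype.linearCombination_apply_single] using this
  refine ⟨fun j => (B.flip.toDual hn.flip).symm (LinearMap.proj j ∘ₗ r), fun i j => ?_⟩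
  have := apply_toDual_symm_apply (B := B.flip) (hB := hn.flip) (LinearMap.proj j ∘ₗ r) (a i)
  refine Eq.trans this ?_
  simp [hra, Pi.single_apply, eq_comm]

/-- Interpolation of a vector orthogonal to given polynomial curves. -/
theorem exists_orthogonal_curve (hn : B.Nondegenerate) {ι : Type*} [Fintype ι]
    {a : ι → ℂ → W} (ha : ∀ i, IsPolyMap (a i)) (h0 : LinearIndependent ℂ fun i => a i 0)
    (h1 : LinearIndependent ℂ fun i => a i 1) {w₀ w₁ : W} (hw₀ : ∀ i, B (a i 0) w₀ = 0)
    (hw₁ : ∀ i, B (a i 1) w₁ = 0) :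
    ∃ w : ℂ → W, IsPolyMap w ∧ w 0 = w₀ ∧ w 1 = w₁ ∧ ∀ i t, B (a i t) (w t) = 0 := by
  classical
  obtain ⟨f₀, hf₀⟩ := exists_dual_family hn h0
  obtain ⟨f₁, hf₁⟩ := exists_dual_family hn h1
  -- Families dual to a at both ends are interpolated, so that the matrix of pairings is the
  -- identity at t = 0 and t = 1.
  let f : ι → ℂ → W := fun j t => f₀ j + t • (f₁ j - f₀ j)
  have hf : ∀ j, IsPolyMap (f j) := fun j => isPolyMap_line _ _
  let M : ℂ → Matrix ι ι ℂ := fun t => Matrix.of fun i j => B (a i t) (f j t)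
  have hM : ∀ i j, (fun t => M t i j) ∈ PolyFun ℂ := fun i j => (ha i).bilin (hf j) B
  let l : ℂ → W := fun t => w₀ + t • (w₁ - w₀)
  have hl : IsPolyMap l := isPolyMap_line _ _
  have hM0 : M 0 = 1 := by ext i j; simp [M, f, hf₀, Matrix.one_apply]
  have hM1 : M 1 = 1 := by ext i j; simp [M, f, hf₁, Matrix.one_apply]
  -- The projection of the line l along the span of f to the orthogonal of a, multiplied by det M to
  -- remove denominators. At both ends det M = 1 and the correction vanishes, so the endpoints are
  -- kept.
  refine ⟨fun t => (M t).det • l t - ∑ j, ((M t).adjugate.mulVec fun i => B (a i t) (l t)) j • f j t,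
    ?_, ?_, ?_, ?_⟩
  · refine (IsPolyMap.smul (det_mem_polyFun hM) hl).sub (IsPolyMap.sum _ fun j _ =>
      IsPolyMap.smul ?_ (hf j))
    simp only [Matrix.mulVec, dotProduct]
    refine IsPolyMap.mem (IsPolyMap.sum _ fun i _ => isPolyMap_of_mem ?_)
    exact (PolyFun ℂ).mul_mem (adjugate_mem_polyFun hM j i) ((ha i).bilin hl B)
  · have : (fun i => B (a i 0) (l 0)) = 0 := by ext i; simp [l, hw₀]
    simp only [hM0, this, Matrix.mulVec_zero]
    simp [l]
  · have : (fun i => B (a i 1) (l 1)) = 0 := by ext i; simp [l, hw₁]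
    simp only [hM1, this, Matrix.mulVec_zero]
    simp [l]
  · intro i t
    have h := congrFun (Matrix.mulVec_mulVec (fun i => B (a i t) (l t)) (M t) (M t).adjugate) i
    rw [Matrix.mul_adjugate] at h
    simp only [map_sub, map_smul, map_sum]
    rw [Matrix.mulVec, dotProduct] at h
    simp only [Matrix.smul_mulVec, Matrix.one_mulVec, Pi.smul_apply] at h
    rw [sub_eq_zero, ← h]
    refine Finset.sum_congr rfl fun j _ => ?_
    rw [smul_eq_mul, mul_comm]; rfl

/-- Interpolation of isotropic tuples orthogonal to given polynomial curves. -/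
theorem exists_isotropic_curve (hB : B.IsAlt) (hn : B.Nondegenerate) {ι : Type*} [Fintype ι]
    {a : ι → ℂ → W} (ha : ∀ i, IsPolyMap (a i)) {m : ℕ} {b₀ b₁ : Fin m → W}
    (h0 : LinearIndependent ℂ (Sum.elim (fun i => a i 0) b₀))
    (h1 : LinearIndependent ℂ (Sum.elim (fun i => a i 1) b₁))
    (hb₀ : ∀ i j, B (b₀ i) (b₀ j) = 0) (hb₁ : ∀ i j, B (b₁ i) (b₁ j) = 0)
    (hab₀ : ∀ i j, B (a i 0) (b₀ j) = 0) (hab₁ : ∀ i j, B (a i 1) (b₁ j) = 0) :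
    ∃ b : Fin m → ℂ → W, (∀ i, IsPolyMap (b i)) ∧ (∀ i, b i 0 = b₀ i) ∧ (∀ i, b i 1 = b₁ i) ∧
      (∀ i j t, B (b i t) (b j t) = 0) ∧ ∀ i j t, B (a i t) (b j t) = 0 := by
  induction m with
  | zero => exact ⟨Fin.elim0, fun i => i.elim0, fun i => i.elim0, fun i => i.elim0,
      fun i => i.elim0, fun i j => j.elim0⟩
  | succ m ih =>
    have hinj : Function.Injective (Sum.map id Fin.castSucc : ι ⊕ Fin m → ι ⊕ Fin (m + 1)) :=
      Function.Injective.sumMap Function.injective_id (Fin.castSucc_injective m)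
    have e0 : ∀ (a : ι → W) (b : Fin (m + 1) → W),
        Sum.elim a b ∘ Sum.map id Fin.castSucc = Sum.elim a (fun i => b i.castSucc) := by
      intro a b; ext (i | i) <;> rfl
    obtain ⟨c, hc, hc0, hc1, hcc, hac⟩ := ih (b₀ := fun i => b₀ i.castSucc)
      (b₁ := fun i => b₁ i.castSucc) (e0 _ _ ▸ h0.comp _ hinj) (e0 _ _ ▸ h1.comp _ hinj)
      (fun i j => hb₀ _ _) (fun i j => hb₁ _ _) (fun i j => hab₀ _ _) (fun i j => hab₁ _ _)
    -- The last vector is made orthogonal to a and to the curves already found; it is orthogonal to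
    -- itself since the form is alternating.
    obtain ⟨w, hw, hw0, hw1, hww⟩ := exists_orthogonal_curve hn (a := Sum.elim a c)
      (w₀ := b₀ (Fin.last m)) (w₁ := b₁ (Fin.last m))
      (by rintro (i | i); exacts [ha i, hc i])
      (by
        have := e0 _ _ ▸ h0.comp _ hinj
        convert this using 1
        ext (i | i) <;> simp [hc0])
      (by
        have := e0 _ _ ▸ h1.comp _ hinj
        convert this using 1
        ext (i | i) <;> simp [hc1])
      (by rintro (i | i); exacts [hab₀ _ _, by simp [hc0, hb₀]])
      (by rintro (i | i); exacts [hab₁ _ _, by simp [hc1, hb₁]])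
    refine ⟨Fin.snoc c w, ?_, ?_, ?_, ?_, ?_⟩
    · intro i; refine Fin.lastCases ?_ (fun i => ?_) i <;> simp [hw, hc]
    · intro i; refine Fin.lastCases ?_ (fun i => ?_) i <;> simp [hw0, hc0]
    · intro i; refine Fin.lastCases ?_ (fun i => ?_) i <;> simp [hw1, hc1]
    · intro i j t
      refine Fin.lastCases ?_ (fun i => ?_) i <;> refine Fin.lastCases ?_ (fun j => ?_) j
      · simpa using hB.self_eq_zero _
      · simpa using hB.isRefl _ _ (hww (Sum.inr j) t)
      · simpa using hww (Sum.inr i) t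
      · simpa using hcc i j t
    · intro i j t
      refine Fin.lastCases ?_ (fun j => ?_) j
      · simpa using hww (Sum.inl i) t
      · simpa using hac i j t

/-- Symplectic families. -/
structure IsSympFam (B : LinearMap.BilinForm ℂ W) {p : ℕ} (e f : Fin p → W) : Prop where
  left : ∀ i j, B (e i) (e j) = 0
  right : ∀ i j, B (f i) (f j) = 0
  pairing : ∀ i j, B (e i) (f j) = if i = j then 1 else 0

omit [FiniteDimensional ℂ W] in
theorem IsSympFam.pairing' (hB : B.IsAlt) {p : ℕ} {e f : Fin p → W} (h : IsSympFam B e f)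
    (i j : Fin p) : B (f i) (e j) = if i = j then -1 else 0 := by
  rw [← hB.neg_eq, h.pairing]
  by_cases hij : i = j
  · simp [hij]
  · simp [hij, Ne.symm hij]

omit [FiniteDimensional ℂ W] in
theorem IsSympFam.linearIndependent {p : ℕ} {e f : Fin p → W} (h : IsSympFam B e f) :
    LinearIndependent ℂ (Sum.elim e f) := by
  rw [Fintype.linearIndependent_iff]
  intro g hg
  rw [Fintype.sum_sum_type] at hg
  simp only [Sum.elim_inl, Sum.elim_inr] at hg
  rintro (i | i)
  · have := congrArg (fun w => B w (f i)) hg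
    simpa [h.pairing, h.right] using this
  · have := congrArg (fun w => B (e i) w) hg
    simpa [h.pairing, h.left] using this

theorem exists_sympFam (hB : B.IsAlt) (hn : B.Nondegenerate) :
    ∃ (p : ℕ) (e f : Fin p → W), finrank ℂ W = 2 * p ∧ IsSympFam B e f := by
  obtain ⟨L, -, -, -, hL, hdim⟩ := exists_maximal_isotropic hB hn (E := ⊤) (S := ⊥) bot_le bot_le
  rw [orthogonal_top_eq_bot hn, inf_bot_eq, finrank_bot, add_zero, finrank_top] at hdim
  let b := finBasis ℂ L
  have hb : LinearIndependent ℂ (fun i => (b i : W)) :=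
    b.linearIndependent.map' L.subtype (by simp)
  obtain ⟨f, hf⟩ := exists_dual_family hn hb
  -- The dual family of a basis of a Lagrangian subspace need not be isotropic; the coefficients 1/2
  -- cancel its pairings, and the change within L does not affect duality.
  refine ⟨finrank ℂ L, fun i => b i,
    fun j => f j + ∑ i, ((1 / 2) * B (f i) (f j)) • (b i : W), hdim.symm, ?_, ?_, ?_⟩
  · exact fun i j => hL (b j).2 _ (b i).2
  · intro i j
    have hbb : ∀ i j, B (b i : W) (b j : W) = 0 := fun i j => hL (b j).2 _ (b i).2
    have hfb : ∀ i j, B (f i) (b j : W) = if j = i then -1 else 0 := fun i j => by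
      rw [← hB.neg_eq, hf]; split_ifs <;> simp
    simp only [map_add, LinearMap.add_apply, map_sum, LinearMap.sum_apply, map_smul,
      LinearMap.smul_apply, hbb, hf, hfb]
    simp only [smul_eq_mul, mul_zero, Finset.sum_const_zero, mul_ite, mul_one, mul_neg,
      Finset.sum_ite_eq', Finset.mem_univ, if_true, add_zero]
    rw [← hB.neg_eq (f i) (f j)]
    ring
  · intro i j
    have hbb : ∀ i j, B (b i : W) (b j : W) = 0 := fun i j => hL (b j).2 _ (b i).2
    simp [hbb, hf]

/-- The basis given by a symplectic family of full size. -/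
noncomputable def IsSympFam.basis {p : ℕ} {e f : Fin p → W}
    (h : IsSympFam B e f) (hp : finrank ℂ W = 2 * p) : Basis (Fin p ⊕ Fin p) ℂ W :=
  basisOfLinearIndependentOfCardEqFinrank' (Sum.elim e f) (h.linearIndependent) (by simp [hp, two_mul])

theorem IsSympFam.coe_basis {p : ℕ} {e f : Fin p → W}
    (h : IsSympFam B e f) (hp : finrank ℂ W = 2 * p) : ⇑(h.basis hp) = Sum.elim e f := by
  simp [IsSympFam.basis]

variable {W' : Type*} [AddCommGroup W'] [Module ℂ W'] [FiniteDimensional ℂ W']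
  {B' : LinearMap.BilinForm ℂ W'}

theorem exists_isometry (hB : B.IsAlt) (hn : B.Nondegenerate) (hB' : B'.IsAlt)
    (hn' : B'.Nondegenerate) (h : finrank ℂ W = finrank ℂ W') :
    ∃ g : W ≃ₗ[ℂ] W', ∀ x y, B' (g x) (g y) = B x y := by
  obtain ⟨p, e, f, hp, hef⟩ := exists_sympFam hB hn
  obtain ⟨p', e', f', hp', hef'⟩ := exists_sympFam hB' hn'
  obtain rfl : p = p' := by omega
  let g := (hef.basis hp).equiv (hef'.basis hp') (Equiv.refl _)
  have hg : ∀ i, g (hef.basis hp i) = hef'.basis hp' i := fun i => by simp [g]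
  have key : B'.comp g.toLinearMap g.toLinearMap = B := by
    refine LinearMap.BilinForm.ext_basis (hef.basis hp) fun i j => ?_
    rw [LinearMap.BilinForm.comp_apply]
    simp only [LinearEquiv.coe_coe, hg]
    rw [IsSympFam.coe_basis, IsSympFam.coe_basis]
    rcases i with i | i <;> rcases j with j | j <;>
      simp [hef.left, hef'.left, hef.right, hef'.right, hef.pairing, hef'.pairing,
        hef.pairing' hB, hef'.pairing' hB']
  exact ⟨g, fun x y => by rw [← key]; rfl⟩

/-- The isometry given by a transvection. -/
theorem exists_transvection (hB : B.IsAlt) (hn : B.Nondegenerate) {u u' : W} (h : B u u' ≠ 0) :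
    ∃ g : W ≃ₗ[ℂ] W, (∀ x y, B (g x) (g y) = B x y) ∧ g u = u' := by
  let T : W →ₗ[ℂ] W := LinearMap.id +
    ((B u u')⁻¹ • (B.flip (u' - u))).smulRight (u' - u)
  have hT : ∀ x, T x = x + ((B u u')⁻¹ * B x (u' - u)) • (u' - u) := fun x => by simp [T]
  have hiso : ∀ x y, B (T x) (T y) = B x y := by
    intro x y
    rw [hT, hT]
    simp only [map_add, LinearMap.add_apply, map_smul, LinearMap.smul_apply, hB.self_eq_zero,
      smul_eq_mul]
    rw [← hB.neg_eq (u' - u) y]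
    ring
  have hinj : Function.Injective T := by
    rw [← LinearMap.ker_eq_bot, LinearMap.ker_eq_bot']
    intro x hx
    refine hn.1 x fun y => ?_
    rw [← hiso x y, hx, map_zero, LinearMap.zero_apply]
  refine ⟨LinearEquiv.ofInjectiveEndo T hinj, hiso, ?_⟩
  show T u = u'
  rw [hT, map_sub, hB.self_eq_zero, sub_zero, inv_mul_cancel₀ h, one_smul]
  abel

/-- A transvection moves u to u' only if they pair nontrivially, so an intermediate w that pairs
nontrivially with both is used. It exists since two nonzero functionals are nonzero at a common
vector. -/
theorem exists_isometry_self (hB : B.IsAlt) (hn : B.Nondegenerate) {u u' : W} (hu : u ≠ 0)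
    (hu' : u' ≠ 0) : ∃ g : W ≃ₗ[ℂ] W, (∀ x y, B (g x) (g y) = B x y) ∧ g u = u' := by
  have hex : ∀ u : W, u ≠ 0 → ∃ w, B u w ≠ 0 := fun u hu => by
    by_contra! h; exact hu (hn.1 u h)
  obtain ⟨w, hw, hw'⟩ : ∃ w, B u w ≠ 0 ∧ B w u' ≠ 0 := by
    obtain ⟨a, ha⟩ := hex u hu
    obtain ⟨b, hb⟩ := hex u' hu'
    obtain ⟨w, hw⟩ := exists_ne_zero_of_mem (f := fun w => B u w) (g := fun w => B w u')
      (dual_mem_polyFun (B u)) (dual_mem_polyFun (B.flip u')) ha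
      (b := b) (by rw [← hB.neg_eq]; simpa using hb)
    exact ⟨w, hw⟩
  obtain ⟨g, hg, hgu⟩ := exists_transvection hB hn hw
  obtain ⟨g', hg', hgu'⟩ := exists_transvection hB hn hw'
  exact ⟨g.trans g', fun x y => by simp [hg, hg'], by simp [hgu, hgu']⟩

theorem exists_sympFam_of_finrank (hB : B.IsAlt) (hn : B.Nondegenerate) {p : ℕ}
    (hp : finrank ℂ W = 2 * p) : ∃ e f : Fin p → W, IsSympFam B e f := by
  obtain ⟨p', e, f, hp', h⟩ := exists_sympFam hB hn
  obtain rfl : p = p' := by omega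
  exact ⟨e, f, h⟩

end Symplectic

/-! ### Subspaces of a product of two symplectic spaces -/

section Pair

open Module LinearMap.BilinForm

/-- Independence at t = 0 gives a retraction onto coordinates; the determinant of the coordinates of
a(t) is 1 at t = 0 and serves as δ. -/
theorem exists_linearIndependent_of_curve {W : Type*} [AddCommGroup W] [Module ℂ W]
    {ι : Type*} [Fintype ι] {a : ι → ℂ → W} (ha : ∀ i, IsPolyMap (a i))
    (h0 : LinearIndependent ℂ fun i => a i 0) :
    ∃ δ ∈ PolyFun ℂ, δ 0 ≠ 0 ∧ ∀ t, δ t ≠ 0 → LinearIndependent ℂ fun i => a i t := by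
  classical
  obtain ⟨r, hr⟩ := (Fintype.linearCombination ℂ fun i => a i 0).exists_leftInverse_of_injective
    (LinearMap.ker_eq_bot.2 h0.fintypeLinearCombination_injective)
  have hra : ∀ j, r (a j 0) = Pi.single j 1 := fun j => by
    have := LinearMap.congr_fun hr (Pi.single j 1)
    simpa [Fintype.linearCombination_apply_single] using this
  let M : ℂ → Matrix ι ι ℂ := fun t => Matrix.of fun i j => r (a i t) j
  have hM0 : M 0 = 1 := by
    ext i j; simp [M, hra, Matrix.one_apply, Pi.single_apply, eq_comm]
  refine ⟨fun t => (M t).det, det_mem_polyFun fun i j =>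
    ha i ((LinearMap.proj j : (ι → ℂ) →ₗ[ℂ] ℂ) ∘ₗ r), by simp [hM0], fun t ht => ?_⟩
  have h1 : LinearIndependent ℂ (M t).row := Matrix.linearIndependent_rows_of_det_ne_zero ht
  exact LinearIndependent.of_comp r h1

variable {I Q : Type*} [AddCommGroup I] [Module ℂ I] [FiniteDimensional ℂ I]
  [AddCommGroup Q] [Module ℂ Q] [FiniteDimensional ℂ Q]
  {β : LinearMap.BilinForm ℂ I} {γ : LinearMap.BilinForm ℂ Q}

omit [FiniteDimensional ℂ I] in
theorem eq_zero_of_gram_ne_zero {d : ℕ} {N : Fin d → I}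
    (hN : (Matrix.of fun a b => β (N a) (N b)).det ≠ 0) {x : I}
    (hx : x ∈ Submodule.span ℂ (Set.range N)) (h : ∀ b, β x (N b) = 0) : x = 0 := by
  obtain ⟨g, rfl⟩ := (Submodule.mem_span_range_iff_exists_fun ℂ).1 hx
  have hg : Matrix.vecMul g (Matrix.of fun a b => β (N a) (N b)) = 0 := by
    ext b
    have := h b
    simpa [Matrix.vecMul, dotProduct] using this
  have := Matrix.eq_zero_of_vecMul_eq_zero hN hg
  simp [this]

omit [FiniteDimensional ℂ I] in
theorem linearIndependent_of_gram_ne_zero {d : ℕ} {N : Fin d → I}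
    (hN : (Matrix.of fun a b => β (N a) (N b)).det ≠ 0) : LinearIndependent ℂ N := by
  rw [Fintype.linearIndependent_iff]
  intro g hg
  have : Matrix.vecMul g (Matrix.of fun a b => β (N a) (N b)) = 0 := by
    ext b
    have := congrArg (fun x => β x (N b)) hg
    simpa [Matrix.vecMul, dotProduct] using this
  exact fun i => congrFun (Matrix.eq_zero_of_vecMul_eq_zero hN this) i

/-- If `E` contains `ε`, and `R ⊥ ε`, and `E^⊥` contains a nondegenerate subspace of the maximal
possible dimension, then the radical of `E` is contained in the span of `R`. -/
theorem radical_of_nondegenerate (hβ : β.IsAlt) (hβn : β.Nondegenerate) {E : Submodule ℂ I}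
    {κ κ' : Type*} [Fintype κ] [Fintype κ'] {d : ℕ} {ε : κ → I} {R : κ' → I} {N : Fin d → I}
    (hε : LinearIndependent ℂ ε) (hR : LinearIndependent ℂ R) (hεE : ∀ i, ε i ∈ E)
    (hRE : ∀ i, R i ∈ E) (hRε : ∀ i j, β (R i) (ε j) = 0) (hNE : ∀ a, N a ∈ β.orthogonal E)
    (hN : (Matrix.of fun a b => β (N a) (N b)).det ≠ 0) (hd : finrank ℂ I = d + (Fintype.card κ + Fintype.card κ')) :
    finrank ℂ E + finrank ℂ (E ⊓ β.orthogonal E : Submodule ℂ I) =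
      Fintype.card κ + Fintype.card κ' ∧
      E ⊓ β.orthogonal E ≤ Submodule.span ℂ (Set.range R) ∧
      β.orthogonal E ≤ Submodule.span ℂ (Set.range N) ⊔ E ⊓ β.orthogonal E := by
  set Rs := Submodule.span ℂ (Set.range R) with hRs
  set Ns := Submodule.span ℂ (Set.range N) with hNs
  set E₀ := Submodule.span ℂ (Set.range ε) with hE₀
  have hE₀E : E₀ ≤ E := Submodule.span_le.2 (by rintro _ ⟨i, rfl⟩; exact hεE i)
  have hRsE : Rs ≤ E := Submodule.span_le.2 (by rintro _ ⟨i, rfl⟩; exact hRE i)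
  have hNsE : Ns ≤ β.orthogonal E := Submodule.span_le.2 (by rintro _ ⟨i, rfl⟩; exact hNE i)
  have hRs0 : Rs ≤ β.orthogonal E₀ := by
    refine Submodule.span_le.2 ?_
    rintro _ ⟨i, rfl⟩ x hx
    refine hβ.isRefl _ _ ?_
    have : E₀ ≤ LinearMap.ker (β (R i)) := Submodule.span_le.2 (by
      rintro _ ⟨j, rfl⟩; exact hRε i j)
    exact this hx
  have hNs0 : Ns ≤ β.orthogonal E₀ := hNsE.trans (orthogonal_le hE₀E)
  have hENs : ∀ x ∈ E, ∀ b, β x (N b) = 0 := fun x hx b => hNE b x hx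
  have hdisj : Ns ⊓ Rs = ⊥ := by
    rw [eq_bot_iff]
    rintro x ⟨hx1, hx2⟩
    exact eq_zero_of_gram_ne_zero hN hx1 (hENs x (hRsE hx2))
  -- The two summands are disjoint because R lies in E, which is orthogonal to N, and N is
  -- nondegenerate; `hd` is the dimension count that makes them fill the orthogonal of ε.
  have hdim : β.orthogonal E₀ = Ns ⊔ Rs := by
    refine (Submodule.eq_of_le_of_finrank_le (sup_le hNs0 hRs0) ?_).symm
    have h1 := Submodule.finrank_sup_add_finrank_inf_eq Ns Rs
    rw [hdisj, finrank_bot, finrank_span_eq_card hR,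
      finrank_span_eq_card (linearIndependent_of_gram_ne_zero hN)] at h1
    rw [finrank_orthogonal hβn, finrank_span_eq_card hε]
    simp only [Fintype.card_fin] at h1 ⊢
    omega
  -- A radical vector lies in N + R; it and its R-component are orthogonal to N, so its N-component
  -- is zero.
  have hrad : E ⊓ β.orthogonal E ≤ Rs := by
    rintro x ⟨hxE, hxE'⟩
    have hx : x ∈ Ns ⊔ Rs := hdim ▸ orthogonal_le hE₀E hxE'
    obtain ⟨n, hn, y, hy, rfl⟩ := Submodule.mem_sup.1 hx
    have : n = 0 := eq_zero_of_gram_ne_zero hN hn fun b => by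
      have h1 := hENs _ hxE b
      have h2 := hENs _ (hRsE hy) b
      rwa [map_add, LinearMap.add_apply, h2, add_zero] at h1
    simpa [this] using hy
  have hperp : β.orthogonal E ≤ Ns ⊔ E ⊓ β.orthogonal E := by
    intro x hx
    have hx' : x ∈ Ns ⊔ Rs := hdim ▸ orthogonal_le hE₀E hx
    obtain ⟨n, hn, y, hy, rfl⟩ := Submodule.mem_sup.1 hx'
    refine Submodule.add_mem_sup hn ⟨hRsE hy, ?_⟩
    have := (β.orthogonal E).sub_mem hx (hNsE hn)
    simpa using this
  refine ⟨?_, hrad, hperp⟩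
  have h1 : β.orthogonal E = Ns ⊔ E ⊓ β.orthogonal E :=
    le_antisymm hperp (sup_le hNsE inf_le_right)
  have h2 := Submodule.finrank_sup_add_finrank_inf_eq Ns (E ⊓ β.orthogonal E)
  have h3 : Ns ⊓ (E ⊓ β.orthogonal E) = ⊥ :=
    eq_bot_iff.2 ((inf_le_inf_left _ hrad).trans hdisj.le)
  rw [h3, finrank_bot, ← h1, finrank_orthogonal hβn,
    finrank_span_eq_card (linearIndependent_of_gram_ne_zero hN)] at h2
  have h4 := Submodule.finrank_le E
  simp only [Fintype.card_fin] at h2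
  omega

/-- The intersection of a subspace of `I × Q` with `I`. -/
def interLeft (F : Submodule ℂ (I × Q)) : Submodule ℂ I := F.comap (LinearMap.inl ℂ I Q)

omit [FiniteDimensional ℂ I] [FiniteDimensional ℂ Q] in
theorem mem_interLeft {F : Submodule ℂ (I × Q)} {i : I} : i ∈ interLeft F ↔ (i, (0 : Q)) ∈ F :=
  Iff.rfl

/-- The `k`-dimensional subspaces of `I × Q` that are isotropic for the form on `Q`, and whose
intersection with `I` has a prescribed rank. -/
structure IsPairMember (β : LinearMap.BilinForm ℂ I) (γ : LinearMap.BilinForm ℂ Q) (c : ℕ)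
    (F : Submodule ℂ (I × Q)) : Prop where
  isotropic : ∀ a ∈ F, ∀ b ∈ F, γ a.2 b.2 = 0
  rank : finrank ℂ (interLeft F) +
    finrank ℂ (interLeft F ⊓ β.orthogonal (interLeft F) : Submodule ℂ I) = 2 * c

/-- The sum of a subspace of `I × Q` and the orthogonal of its intersection with `I`. -/
def supPerp (β : LinearMap.BilinForm ℂ I) (F : Submodule ℂ (I × Q)) : Submodule ℂ (I × Q) :=
  F ⊔ (β.orthogonal (interLeft F)).map (LinearMap.inl ℂ I Q)

/-- The orthogonal sum of two forms. -/
def prodForm (β : LinearMap.BilinForm ℂ I) (γ : LinearMap.BilinForm ℂ Q) :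
    LinearMap.BilinForm ℂ (I × Q) :=
  β.comp (LinearMap.fst ℂ I Q) (LinearMap.fst ℂ I Q) +
    γ.comp (LinearMap.snd ℂ I Q) (LinearMap.snd ℂ I Q)

omit [FiniteDimensional ℂ I] [FiniteDimensional ℂ Q] in
theorem prodForm_apply (x y : I × Q) : prodForm β γ x y = β x.1 y.1 + γ x.2 y.2 := rfl

omit [FiniteDimensional ℂ I] [FiniteDimensional ℂ Q] in
theorem prodForm_nondegenerate (hβ : β.Nondegenerate) (hγ : γ.Nondegenerate) :
    (prodForm β γ).Nondegenerate := by
  constructor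
  · intro x hx
    refine Prod.ext (hβ.1 _ fun y => ?_) (hγ.1 _ fun y => ?_)
    · simpa [prodForm_apply] using hx (y, 0)
    · simpa [prodForm_apply] using hx (0, y)
  · intro x hx
    refine Prod.ext (hβ.2 _ fun y => ?_) (hγ.2 _ fun y => ?_)
    · simpa [prodForm_apply] using hx (y, 0)
    · simpa [prodForm_apply] using hx (0, y)

omit [FiniteDimensional ℂ I] in
/-- A vector orthogonal to the intersection with `I` extends to a vector orthogonal to the
subspace. -/
theorem exists_lift_orthogonal (hγ : γ.Nondegenerate) {F : Submodule ℂ (I × Q)} {i : I}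
    (hi : i ∈ β.orthogonal (interLeft F)) :
    ∃ q : Q, ∀ x ∈ F, prodForm β γ x (i, q) = 0 := by
  let pr : F →ₗ[ℂ] Q := LinearMap.snd ℂ I Q ∘ₗ F.subtype
  let φ : Module.Dual ℂ F := β.flip i ∘ₗ LinearMap.fst ℂ I Q ∘ₗ F.subtype
  -- Pairing with i kills F ∩ I, so as a functional on F it factors through the projection to Q,
  -- where γ represents it.
  have hker : LinearMap.ker pr ≤ LinearMap.ker φ := by
    rintro ⟨⟨a, b⟩, hab⟩ hb
    have hb' : b = 0 := hb
    subst hb'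
    exact hi a hab
  obtain ⟨ψ, hψ⟩ := (LinearMap.range_dualMap_eq_dualAnnihilator_ker pr).symm.le
    (show φ ∈ (LinearMap.ker pr).dualAnnihilator from by
      rw [Submodule.mem_dualAnnihilator]; exact fun w hw => hker hw)
  refine ⟨-(γ.flip.toDual hγ.flip).symm ψ, fun x hx => ?_⟩
  have h1 := apply_toDual_symm_apply (B := γ.flip) (hB := hγ.flip) ψ x.2
  have h2 : ψ x.2 = β x.1 i := LinearMap.congr_fun hψ ⟨x, hx⟩
  have h3 : γ x.2 ((γ.flip.toDual hγ.flip).symm ψ) = ψ x.2 := h1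
  rw [prodForm_apply, map_neg, h3, h2, add_neg_cancel]

/-- Semicontinuity along polynomial curves of frames. -/
theorem pair_curve (hβ : β.IsAlt) (hβn : β.Nondegenerate) (hγn : γ.Nondegenerate)
    {ι κ κ' : Type*} [Fintype ι] [Fintype κ] [Fintype κ'] {c : ℕ}
    (hc : Fintype.card κ + Fintype.card κ' = 2 * c) {φ : ι → ℂ → I × Q} (hφ : ∀ i, IsPolyMap (φ i))
    (h0 : LinearIndependent ℂ fun i => φ i 0) (h1 : LinearIndependent ℂ fun i => φ i 1)
    (hF₀ : IsPairMember β γ c (Submodule.span ℂ (Set.range fun i => φ i 0)))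
    {ε : κ → ℂ → I} (hεp : ∀ i, IsPolyMap (ε i)) (hε0 : LinearIndependent ℂ fun i => ε i 0)
    {R : κ' → ℂ → I} (hRp : ∀ i, IsPolyMap (R i)) (hR0 : LinearIndependent ℂ fun i => R i 0)
    (hεF : ∀ t i, (ε i t, (0 : Q)) ∈ Submodule.span ℂ (Set.range fun i => φ i t))
    (hRF : ∀ t i, (R i t, (0 : Q)) ∈ Submodule.span ℂ (Set.range fun i => φ i t))
    (hRε : ∀ t i j, β (R i t) (ε j t) = 0) (hiso : ∀ t i j, γ (φ i t).2 (φ j t).2 = 0)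
    (y : I × Q) :
    ∃ δ ∈ PolyFun ℂ, δ 0 ≠ 0 ∧ ∀ t, δ t ≠ 0 → (LinearIndependent ℂ fun i => φ i t) ∧
      (LinearIndependent ℂ fun i => R i t) ∧
      IsPairMember β γ c (Submodule.span ℂ (Set.range fun i => φ i t)) ∧
      (interLeft (Submodule.span ℂ (Set.range fun i => φ i t)) ⊓
        β.orthogonal (interLeft (Submodule.span ℂ (Set.range fun i => φ i t))) ≤
        Submodule.span ℂ (Set.range fun i => R i t)) ∧
      (y ∉ supPerp β (Submodule.span ℂ (Set.range fun i => φ i 0)) →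
        y ∉ supPerp β (Submodule.span ℂ (Set.range fun i => φ i t))) ∧
      (y ∉ Submodule.span ℂ (Set.range fun i => φ i 0) →
        y ∉ Submodule.span ℂ (Set.range fun i => φ i t)) := by
  set F : ℂ → Submodule ℂ (I × Q) := fun t => Submodule.span ℂ (Set.range fun i => φ i t) with hF
  set E := interLeft (F 0) with hE
  -- A complement of the radical in E^⊥ at t = 0 is nondegenerate of dimension dim I - 2c. Its
  -- persistence along the curve fixes the rank.
  obtain ⟨N₀, hN₀rad, hN₀sup⟩ : ∃ N₀ : Submodule ℂ I, N₀ ⊓ (E ⊓ β.orthogonal E) = ⊥ ∧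
      N₀ ⊔ (E ⊓ β.orthogonal E) = β.orthogonal E := by
    obtain ⟨C, hC⟩ := Submodule.exists_isCompl (E ⊓ β.orthogonal E)
    refine ⟨C ⊓ β.orthogonal E, ?_, ?_⟩
    · rw [eq_bot_iff, ← hC.inf_eq_bot]
      exact fun x hx => ⟨hx.2, hx.1.1⟩
    · rw [sup_comm, ← sup_inf_assoc_of_le _ inf_le_right, hC.sup_eq_top, top_inf_eq]
  have hdimN : finrank ℂ I = finrank ℂ N₀ + (Fintype.card κ + Fintype.card κ') := by
    have e1 := Submodule.finrank_sup_add_finrank_inf_eq N₀ (E ⊓ β.orthogonal E)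
    rw [hN₀rad, finrank_bot, hN₀sup, finrank_orthogonal hβn] at e1
    have e2 : finrank ℂ E + finrank ℂ (E ⊓ β.orthogonal E : Submodule ℂ I) = 2 * c := hF₀.rank
    have e3 := Submodule.finrank_le E
    rw [hc, ← e2]
    omega
  let bN := finBasis ℂ N₀
  have hbN : ∀ a, (bN a : I) ∈ β.orthogonal E := fun a =>
    hN₀sup ▸ Submodule.mem_sup_left (bN a).2
  have hbNs : Submodule.span ℂ (Set.range fun a => (bN a : I)) = N₀ := by
    have : (Set.range fun a => (bN a : I)) = N₀.subtype '' Set.range bN := by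
      rw [← Set.range_comp]; rfl
    rw [this, ← Submodule.map_span, bN.span_eq]
    simp
  -- A vector of N₀ orthogonal to N₀ is orthogonal to all of E^⊥, hence lies in E, hence in N₀ ∩ rad
  -- E = 0.
  have hgram0 : (Matrix.of fun a b => β (bN a : I) (bN b)).det ≠ 0 := by
    intro hdet
    obtain ⟨v, hv, hv0⟩ := Matrix.exists_vecMul_eq_zero_iff.2 hdet
    have hx : ((∑ a, v a • bN a : N₀) : I) = 0 := by
      set x : N₀ := ∑ a, v a • bN a with hxdef
      have hxb : ∀ b, β (x : I) (bN b) = 0 := fun b => by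
        have := congrFun hv0 b
        simpa [hxdef, Matrix.vecMul, dotProduct] using this
      have hxN : ∀ n ∈ N₀, β (x : I) n = 0 := fun n hn => by
        rw [← hbNs] at hn
        have : Submodule.span ℂ (Set.range fun a => (bN a : I)) ≤ LinearMap.ker (β (x : I)) :=
          Submodule.span_le.2 (by rintro _ ⟨b, rfl⟩; exact hxb b)
        exact this hn
      have hxE' : (x : I) ∈ β.orthogonal E := hN₀sup ▸ Submodule.mem_sup_left x.2
      have hxE : (x : I) ∈ E := by
        rw [← orthogonal_orthogonal hβn hβ.isRefl E]
        intro w hw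
        rw [← hN₀sup] at hw
        obtain ⟨n, hn, z, hz, rfl⟩ := Submodule.mem_sup.1 hw
        have e1 : β n x = 0 := hβ.isRefl _ _ (hxN n hn)
        have e2 : β z x = 0 := hxE' z hz.1
        show β (n + z) x = 0
        rw [map_add, LinearMap.add_apply, e1, e2, add_zero]
      have : (x : I) ∈ N₀ ⊓ (E ⊓ β.orthogonal E) := ⟨x.2, hxE, hxE'⟩
      rw [hN₀rad] at this
      exact this
    have := Fintype.linearIndependent_iff.1 bN.linearIndependent v (Subtype.ext hx)
    exact hv (funext this)
  -- The intersection of F(t) with I need not vary polynomially, but vectors orthogonal to all of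
  -- F(t) can be continued. Their I-components are automatically orthogonal to this intersection.
  have hlift : ∀ a, ∃ w : ℂ → I × Q, IsPolyMap w ∧ (w 0).1 = bN a ∧
      ∀ i t, prodForm β γ (φ i t) (w t) = 0 := fun a => by
    obtain ⟨q, hq⟩ := exists_lift_orthogonal (F := F 0) hγn (hbN a)
    obtain ⟨w, hw, hw0, -, hww⟩ := exists_orthogonal_curve (prodForm_nondegenerate hβn hγn) hφ h0 h1
      (w₀ := (bN a, q)) (w₁ := 0) (fun i => hq _ (Submodule.subset_span ⟨i, rfl⟩)) (by simp)
    exact ⟨w, hw, by rw [hw0], hww⟩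
  choose w hw hw0 hww using hlift
  have hwp : ∀ a, IsPolyMap fun t => (w a t).1 := fun a => (hw a).linear_comp (LinearMap.fst ℂ I Q)
  have hwE : ∀ a t, (w a t).1 ∈ β.orthogonal (interLeft (F t)) := by
    intro a t x hx
    have h2 : F t ≤ LinearMap.ker ((prodForm β γ).flip (w a t)) := Submodule.span_le.2 (by
      rintro _ ⟨i, rfl⟩; exact hww a i t)
    have h3 : prodForm β γ (x, 0) (w a t) = 0 := h2 hx
    simpa [prodForm_apply] using h3
  let G : ℂ → ℂ := fun t => (Matrix.of fun a b => β (w a t).1 (w b t).1).det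
  have hG : G ∈ PolyFun ℂ := det_mem_polyFun fun a b => (hwp a).bilin (hwp b) β
  have hG0 : G 0 ≠ 0 := by simpa [G, hw0] using hgram0
  obtain ⟨δ₁, hδ₁, hδ₁0, hδ₁t⟩ := exists_linearIndependent_of_curve hεp hε0
  obtain ⟨δ₂, hδ₂, hδ₂0, hδ₂t⟩ := exists_linearIndependent_of_curve hRp hR0
  obtain ⟨δ₃, hδ₃, hδ₃0, hδ₃t⟩ := exists_linearIndependent_of_curve hφ h0
  have hopen : ∀ t, δ₁ t ≠ 0 → δ₂ t ≠ 0 → G t ≠ 0 → 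
      finrank ℂ (interLeft (F t)) +
        finrank ℂ (interLeft (F t) ⊓ β.orthogonal (interLeft (F t)) : Submodule ℂ I) =
          Fintype.card κ + Fintype.card κ' ∧
      interLeft (F t) ⊓ β.orthogonal (interLeft (F t)) ≤
        Submodule.span ℂ (Set.range fun i => R i t) ∧
      β.orthogonal (interLeft (F t)) ≤ Submodule.span ℂ (Set.range fun a => (w a t).1) ⊔
        interLeft (F t) ⊓ β.orthogonal (interLeft (F t)) := fun t h1 h2 h3 =>
    radical_of_nondegenerate hβ hβn (hδ₁t t h1) (hδ₂t t h2) (hεF t) (hRF t) (hRε t)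
      (fun a => hwE a t) h3 hdimN
  -- F(t) plus the span of the continued vectors has a polynomial spanning family that is a basis at
  -- t = 0, so avoiding y is an open condition. For good t this sum contains `supPerp β (F t)`, as
  -- the radical lies in F(t).
  have hy : ∃ δ₄ ∈ PolyFun ℂ, δ₄ 0 ≠ 0 ∧ ∀ t, δ₄ t ≠ 0 → y ∉ supPerp β (F 0) →
      y ∉ F t ⊔ (Submodule.span ℂ (Set.range fun a => (w a t).1)).map (LinearMap.inl ℂ I Q) := by
    by_cases hy : y ∈ supPerp β (F 0)
    · exact ⟨1, (PolyFun ℂ).one_mem, one_ne_zero, fun t _ h => absurd hy h⟩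
    let fam : (ι ⊕ Fin (finrank ℂ N₀)) ⊕ Unit → ℂ → I × Q :=
      Sum.elim (Sum.elim φ fun a t => ((w a t).1, 0)) fun _ _ => y
    have hspan : ∀ t, Submodule.span ℂ (Set.range fun i => fam (Sum.inl i) t) =
        F t ⊔ (Submodule.span ℂ (Set.range fun a => (w a t).1)).map (LinearMap.inl ℂ I Q) := by
      intro t
      have : (Set.range fun i => fam (Sum.inl i) t) = (Set.range fun i => φ i t) ∪
          (LinearMap.inl ℂ I Q) '' (Set.range fun a => (w a t).1) := by
        rw [← Set.range_comp]
        ext z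
        simp [fam]
      rw [this, Submodule.span_union, Submodule.map_span]
    have hfam : ∀ j, IsPolyMap (fam j) := by
      rintro ((i | a) | _)
      · exact hφ i
      · exact (hwp a).linear_comp (LinearMap.inl ℂ I Q)
      · exact isPolyMap_const y
    have hind : LinearIndependent ℂ fun j => fam j 0 := by
      have e1 : LinearIndependent ℂ fun j => fam (Sum.inl j) 0 := by
        have e2 : LinearIndependent ℂ fun a => ((bN a : I), (0 : Q)) := by
          have := bN.linearIndependent.map' (LinearMap.inl ℂ I Q ∘ₗ N₀.subtype) (by
            rw [LinearMap.ker_eq_bot]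
            exact LinearMap.inl_injective.comp Subtype.val_injective)
          exact this
        have e3 := LinearIndependent.sum_type h0 e2 (by
          rw [Submodule.disjoint_def]
          intro z hz hz'
          have e4 : (Set.range fun a => ((bN a : I), (0 : Q))) =
              (LinearMap.inl ℂ I Q) '' (Set.range fun a => (bN a : I)) := by
            rw [← Set.range_comp]; rfl
          rw [e4, ← Submodule.map_span, hbNs] at hz'
          obtain ⟨n, hn, rfl⟩ := hz'
          have e5 : n ∈ N₀ ⊓ (E ⊓ β.orthogonal E) :=
            ⟨hn, hz, hN₀sup ▸ Submodule.mem_sup_left hn⟩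
          rw [hN₀rad] at e5
          rw [(Submodule.mem_bot ℂ).1 e5, map_zero])
        have e7 : (fun j => fam (Sum.inl j) 0) =
            Sum.elim (fun i => φ i 0) fun a => ((bN a : I), (0 : Q)) := by
          ext1 (i | a)
          · rfl
          · simp [fam, hw0]
        rw [e7]
        exact e3
      have e6 := LinearIndependent.sum_type e1
        (v' := fun _ : Unit => y) (LinearIndependent.of_subsingleton () (by
          rintro rfl; exact hy (Submodule.zero_mem _))) (by
          rw [hspan 0, Set.range_const]
          refine Submodule.disjoint_span_singleton_of_notMem fun h => hy ?_
          have hle : F 0 ⊔ (Submodule.span ℂ (Set.range fun a => (w a 0).1)).map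
              (LinearMap.inl ℂ I Q) ≤ supPerp β (F 0) := by
            refine sup_le_sup_left (Submodule.map_mono (Submodule.span_le.2 ?_)) _
            rintro _ ⟨a, rfl⟩
            exact hwE a 0
          exact hle h)
      have e7 : (fun j => fam j 0) =
          Sum.elim (fun j => fam (Sum.inl j) 0) fun _ : Unit => y := by
        ext1 (i | a) <;> rfl
      rw [e7]
      exact e6
    obtain ⟨δ, hδ, hδ0, hδt⟩ := exists_linearIndependent_of_curve hfam hind
    refine ⟨δ, hδ, hδ0, fun t ht _ hmem => ?_⟩
    have h2 := hδt t ht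
    rw [linearIndependent_sum] at h2
    have h3 := h2.2.2
    rw [← hspan t] at hmem
    have h4 : y = 0 := Submodule.disjoint_def.1 h3 y hmem
      (Submodule.subset_span ⟨(), rfl⟩)
    exact hy (h4 ▸ Submodule.zero_mem _)
  have hy' : ∃ δ₅ ∈ PolyFun ℂ, δ₅ 0 ≠ 0 ∧ ∀ t, δ₅ t ≠ 0 → y ∉ F 0 → y ∉ F t := by
    by_cases hy : y ∈ F 0
    · exact ⟨1, (PolyFun ℂ).one_mem, one_ne_zero, fun t _ h => absurd hy h⟩
    let fam : ι ⊕ Unit → ℂ → I × Q := Sum.elim φ fun _ _ => y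
    have hind : LinearIndependent ℂ fun j => fam j 0 := by
      have e6 := LinearIndependent.sum_type h0
        (v' := fun _ : Unit => y) (LinearIndependent.of_subsingleton () (by
          rintro rfl; exact hy (Submodule.zero_mem _))) (by
          rw [Set.range_const]
          exact Submodule.disjoint_span_singleton_of_notMem hy)
      have e7 : (fun j => fam j 0) = Sum.elim (fun i => φ i 0) fun _ : Unit => y := by
        ext1 (i | a) <;> rfl
      rw [e7]
      exact e6
    obtain ⟨δ, hδ, hδ0, hδt⟩ := exists_linearIndependent_of_curve (a := fam) (by
      rintro (i | _)
      · exact hφ i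
      · exact isPolyMap_const y) hind
    refine ⟨δ, hδ, hδ0, fun t ht _ hmem => ?_⟩
    have h2 := hδt t ht
    rw [linearIndependent_sum] at h2
    have h4 : y = 0 := Submodule.disjoint_def.1 h2.2.2 y hmem (Submodule.subset_span ⟨(), rfl⟩)
    exact hy (h4 ▸ Submodule.zero_mem _)
  obtain ⟨δ₄, hδ₄, hδ₄0, hδ₄t⟩ := hy
  obtain ⟨δ₅, hδ₅, hδ₅0, hδ₅t⟩ := hy'
  refine ⟨δ₁ * δ₂ * δ₃ * δ₄ * δ₅ * G, ?_, ?_, fun t ht => ?_⟩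
  · exact (PolyFun ℂ).mul_mem ((PolyFun ℂ).mul_mem ((PolyFun ℂ).mul_mem ((PolyFun ℂ).mul_mem
      ((PolyFun ℂ).mul_mem hδ₁ hδ₂) hδ₃) hδ₄) hδ₅) hG
  · simp only [Pi.mul_apply]
    exact mul_ne_zero (mul_ne_zero (mul_ne_zero (mul_ne_zero (mul_ne_zero hδ₁0 hδ₂0) hδ₃0)
      hδ₄0) hδ₅0) hG0
  · simp only [Pi.mul_apply, mul_ne_zero_iff] at ht
    obtain ⟨⟨⟨⟨⟨ht1, ht2⟩, ht3⟩, ht4⟩, ht5⟩, htG⟩ := ht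
    obtain ⟨hrk, hrad, hperp⟩ := hopen t ht1 ht2 htG
    refine ⟨hδ₃t t ht3, hδ₂t t ht2, ⟨?_, hrk.trans hc⟩, hrad, fun hy hmem => ?_, hδ₅t t ht5⟩
    · intro a ha b hb
      have e1 : ∀ i, ∀ b ∈ F t, γ (φ i t).2 b.2 = 0 := fun i b hb => by
        have : F t ≤ LinearMap.ker (γ (φ i t).2 ∘ₗ LinearMap.snd ℂ I Q) := Submodule.span_le.2 (by
          rintro _ ⟨j, rfl⟩; exact hiso t i j)
        exact this hb
      have : F t ≤ LinearMap.ker (γ.flip b.2 ∘ₗ LinearMap.snd ℂ I Q) := Submodule.span_le.2 (by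
          rintro _ ⟨j, rfl⟩; exact e1 j b hb)
      exact this ha
    · have hle : supPerp β (F t) ≤ F t ⊔
          (Submodule.span ℂ (Set.range fun a => (w a t).1)).map (LinearMap.inl ℂ I Q) := ?_
      · exact hδ₄t t ht4 hy (hle hmem)
      refine sup_le le_sup_left ((Submodule.map_mono hperp).trans ?_)
      rw [Submodule.map_sup]
      refine sup_le le_sup_right (le_trans ?_ le_sup_left)
      rintro _ ⟨x, hx, rfl⟩
      exact hx.1

end Pair

/-! ### Joining adapted frames by polynomial curves -/

section PairCurves

open Module LinearMap.BilinForm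

variable {I Q : Type*} [AddCommGroup I] [Module ℂ I] [FiniteDimensional ℂ I]
  [AddCommGroup Q] [Module ℂ Q] [FiniteDimensional ℂ Q]
  {β : LinearMap.BilinForm ℂ I} {γ : LinearMap.BilinForm ℂ Q}

theorem exists_line_combination {W : Type*} [AddCommGroup W] [Module ℂ W] {ι : Type*} [Fintype ι]
    {a : ι → ℂ → W} (ha : ∀ i, IsPolyMap (a i)) {w₀ w₁ : W}
    (h0 : w₀ ∈ Submodule.span ℂ (Set.range fun i => a i 0))
    (h1 : w₁ ∈ Submodule.span ℂ (Set.range fun i => a i 1)) :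
    ∃ w : ℂ → W, IsPolyMap w ∧ w 0 = w₀ ∧ w 1 = w₁ ∧
      ∀ t, w t ∈ Submodule.span ℂ (Set.range fun i => a i t) := by
  obtain ⟨g₀, rfl⟩ := (Submodule.mem_span_range_iff_exists_fun ℂ).1 h0
  obtain ⟨g₁, rfl⟩ := (Submodule.mem_span_range_iff_exists_fun ℂ).1 h1
  refine ⟨fun t => ∑ i, (g₀ i + t * (g₁ i - g₀ i)) • a i t, ?_, by simp, by simp, fun t => ?_⟩
  · exact IsPolyMap.sum _ fun i _ => IsPolyMap.smul (isPolyMap_line (g₀ i) (g₁ i)).mem (ha i)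
  · exact (Submodule.mem_span_range_iff_exists_fun ℂ).2 ⟨_, rfl⟩

/-- Curves of isotropic tuples `R` orthogonal to `a`, together with vectors orthogonal to `R` and to
some of the `a`. -/
theorem exists_adapted_curve (hβ : β.IsAlt) (hβn : β.Nondegenerate) {ι ι' κ : Type*} [Fintype ι]
    [Fintype ι'] {a : ι → I} (s : ι' → ι) (hs : Function.Injective s) {ρ : ℕ} {R₀ R₁ : Fin ρ → I}
    {h₀ h₁ : κ → I} (hR₀ : LinearIndependent ℂ (Sum.elim a R₀))
    (hR₁ : LinearIndependent ℂ (Sum.elim a R₁)) (hi₀ : ∀ i j, β (R₀ i) (R₀ j) = 0)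
    (hi₁ : ∀ i j, β (R₁ i) (R₁ j) = 0) (ha₀ : ∀ i j, β (a i) (R₀ j) = 0)
    (ha₁ : ∀ i j, β (a i) (R₁ j) = 0) (hRh₀ : ∀ i j, β (R₀ i) (h₀ j) = 0)
    (hRh₁ : ∀ i j, β (R₁ i) (h₁ j) = 0) (hah₀ : ∀ i j, β (a (s i)) (h₀ j) = 0)
    (hah₁ : ∀ i j, β (a (s i)) (h₁ j) = 0) :
    ∃ (R : Fin ρ → ℂ → I) (h : κ → ℂ → I), (∀ i, IsPolyMap (R i)) ∧ (∀ i, IsPolyMap (h i)) ∧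
      (∀ i, R i 0 = R₀ i) ∧ (∀ i, R i 1 = R₁ i) ∧ (∀ i, h i 0 = h₀ i) ∧ (∀ i, h i 1 = h₁ i) ∧
      (∀ i j t, β (R i t) (R j t) = 0) ∧ (∀ i j t, β (a i) (R j t) = 0) ∧
      (∀ i j t, β (R i t) (h j t) = 0) ∧ ∀ i j t, β (a (s i)) (h j t) = 0 := by
  obtain ⟨R, hR, hR0, hR1, hRR, haR⟩ := exists_isotropic_curve (a := fun i _ => a i) hβ hβn
    (fun i => isPolyMap_const (a i)) hR₀ hR₁ hi₀ hi₁ ha₀ ha₁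
  have key : ∀ j, ∃ w : ℂ → I, IsPolyMap w ∧ w 0 = h₀ j ∧ w 1 = h₁ j ∧
      ∀ i t, β ((Sum.elim (fun i _ => a (s i)) R : ι' ⊕ Fin ρ → ℂ → I) i t) (w t) = 0 := by
    have hsub : ∀ {R' : Fin ρ → I}, LinearIndependent ℂ (Sum.elim a R') →
        LinearIndependent ℂ (Sum.elim (fun i => a (s i)) R') := fun {R'} h => by
      have := h.comp (Sum.map s id) (hs.sumMap Function.injective_id)
      rwa [Sum.elim_comp_map] at this
    intro j
    refine exists_orthogonal_curve hβn ?_ ?_ ?_ ?_ ?_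
    · rintro (i | i)
      · exact isPolyMap_const _
      · exact hR i
    · convert hsub hR₀ using 1
      ext1 (i | i)
      · rfl
      · exact hR0 i
    · convert hsub hR₁ using 1
      ext1 (i | i)
      · rfl
      · exact hR1 i
    · rintro (i | i)
      · exact hah₀ i j
      · simpa [hR0] using hRh₀ i j
    · rintro (i | i)
      · exact hah₁ i j
      · simpa [hR1] using hRh₁ i j
  choose h hh hh0 hh1 hhh using key
  exact ⟨R, h, hR, hh, hR0, hR1, hh0, hh1, hRR, haR, fun i j t => hhh j (Sum.inr i) t,
    fun i j t => hhh j (Sum.inl i) t⟩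

/-- Curves of isotropic tuples `b` together with tuples `R` of combinations of `u` and `b`
and vectors `h` orthogonal to `R`. -/
theorem exists_adapted_curve_of_mem (hβ : β.IsAlt) (hβn : β.Nondegenerate) {κ : Type*} {u : I}
    {s ρ : ℕ} {b₀ b₁ : Fin s → I} {R₀ R₁ : Fin ρ → I} {h₀ h₁ : κ → I}
    (hb₀ : LinearIndependent ℂ (Sum.elim (fun _ : Unit => u) b₀))
    (hb₁ : LinearIndependent ℂ (Sum.elim (fun _ : Unit => u) b₁))
    (hi₀ : ∀ i j, β (b₀ i) (b₀ j) = 0) (hi₁ : ∀ i j, β (b₁ i) (b₁ j) = 0)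
    (hu₀ : ∀ j, β u (b₀ j) = 0) (hu₁ : ∀ j, β u (b₁ j) = 0)
    (hR₀ : LinearIndependent ℂ R₀) (hR₁ : LinearIndependent ℂ R₁)
    (hRb₀ : ∀ i, R₀ i ∈ Submodule.span ℂ (Set.range (Sum.elim (fun _ : Unit => u) b₀)))
    (hRb₁ : ∀ i, R₁ i ∈ Submodule.span ℂ (Set.range (Sum.elim (fun _ : Unit => u) b₁)))
    (hRh₀ : ∀ i j, β (R₀ i) (h₀ j) = 0) (hRh₁ : ∀ i j, β (R₁ i) (h₁ j) = 0) :
    ∃ (b : Fin s → ℂ → I) (R : Fin ρ → ℂ → I) (h : κ → ℂ → I),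
      (∀ i, IsPolyMap (b i)) ∧ (∀ i, IsPolyMap (R i)) ∧ (∀ i, IsPolyMap (h i)) ∧
      (∀ i, b i 0 = b₀ i) ∧ (∀ i, b i 1 = b₁ i) ∧
      (∀ i, R i 0 = R₀ i) ∧ (∀ i, R i 1 = R₁ i) ∧ (∀ i, h i 0 = h₀ i) ∧ (∀ i, h i 1 = h₁ i) ∧
      (∀ i j t, β (b i t) (b j t) = 0) ∧ (∀ j t, β u (b j t) = 0) ∧
      (∀ i t, R i t ∈ Submodule.span ℂ
        (Set.range (Sum.elim (fun _ : Unit => u) fun j => b j t))) ∧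
      ∀ i j t, β (R i t) (h j t) = 0 := by
  obtain ⟨b, hb, hb0, hb1, hbb, hub⟩ := exists_isotropic_curve (a := fun (_ : Unit) _ => u) hβ hβn
    (fun i => isPolyMap_const u) hb₀ hb₁ hi₀ hi₁ (fun _ => hu₀) (fun _ => hu₁)
  have e0 : (fun i => (Sum.elim (fun _ _ => u) b : Unit ⊕ Fin s → ℂ → I) i 0) =
      Sum.elim (fun _ : Unit => u) b₀ := by
    ext1 (i | i)
    · rfl
    · exact hb0 i
  have e1 : (fun i => (Sum.elim (fun _ _ => u) b : Unit ⊕ Fin s → ℂ → I) i 1) =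
      Sum.elim (fun _ : Unit => u) b₁ := by
    ext1 (i | i)
    · rfl
    · exact hb1 i
  have et : ∀ t, (fun i => (Sum.elim (fun _ _ => u) b : Unit ⊕ Fin s → ℂ → I) i t) =
      Sum.elim (fun _ : Unit => u) fun j => b j t := fun t => by
    ext1 (i | i) <;> rfl
  have key : ∀ i, ∃ w : ℂ → I, IsPolyMap w ∧ w 0 = R₀ i ∧ w 1 = R₁ i ∧ ∀ t, w t ∈
      Submodule.span ℂ (Set.range (Sum.elim (fun _ : Unit => u) fun j => b j t)) := fun i => by
    have := exists_line_combination (a := (Sum.elim (fun _ _ => u) b : Unit ⊕ Fin s → ℂ → I))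
      (by
        rintro (i | i)
        · exact isPolyMap_const u
        · exact hb i) (w₀ := R₀ i) (w₁ := R₁ i) (by rw [e0]; exact hRb₀ i)
        (by rw [e1]; exact hRb₁ i)
    simpa only [et] using this
  choose R hR hR0 hR1 hRb using key
  have key2 : ∀ j, ∃ w : ℂ → I, IsPolyMap w ∧ w 0 = h₀ j ∧ w 1 = h₁ j ∧
      ∀ i t, β (R i t) (w t) = 0 := fun j =>
    exists_orthogonal_curve hβn hR (by simpa only [hR0] using hR₀) (by simpa only [hR1] using hR₁)
      (fun i => by simpa only [hR0] using hRh₀ i j) (fun i => by simpa only [hR1] using hRh₁ i j)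
  choose h hh hh0 hh1 hhh using key2
  exact ⟨b, R, h, hb, hR, hh, hb0, hb1, hR0, hR1, hh0, hh1, hbb, fun j t => hub () j t,
    fun i t => hRb i t, fun i j t => hhh j i t⟩

omit [FiniteDimensional ℂ I] in
/-- Curves of tuples in `I × Q` with isotropic images in `Q`. -/
theorem exists_rows_curve (hγ : γ.IsAlt) (hγn : γ.Nondegenerate) {ι μ : Type*} [Fintype ι]
    {a : ι → Q} (haa : ∀ i j, γ (a i) (a j) = 0) {m : ℕ} {q₀ q₁ : Fin m → Q}
    (hq₀ : LinearIndependent ℂ (Sum.elim a q₀)) (hq₁ : LinearIndependent ℂ (Sum.elim a q₁))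
    (hi₀ : ∀ i j, γ (q₀ i) (q₀ j) = 0) (hi₁ : ∀ i j, γ (q₁ i) (q₁ j) = 0)
    (ha₀ : ∀ i j, γ (a i) (q₀ j) = 0) (ha₁ : ∀ i j, γ (a i) (q₁ j) = 0)
    (T : Submodule ℂ I) {G₀ G₁ : μ → I × Q}
    (hG₀ : ∀ j, (G₀ j).1 ∈ T ∧ (G₀ j).2 ∈ Submodule.span ℂ (Set.range (Sum.elim a q₀)))
    (hG₁ : ∀ j, (G₁ j).1 ∈ T ∧ (G₁ j).2 ∈ Submodule.span ℂ (Set.range (Sum.elim a q₁))) :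
    ∃ G : μ → ℂ → I × Q, (∀ j, IsPolyMap (G j)) ∧ (∀ j, G j 0 = G₀ j) ∧ (∀ j, G j 1 = G₁ j) ∧
      (∀ j t, (G j t).1 ∈ T) ∧ (∀ i j t, γ (G i t).2 (G j t).2 = 0) ∧
      ∀ i j t, γ (a i) (G j t).2 = 0 := by
  obtain ⟨b, hb, hb0, hb1, hbb, hab⟩ := exists_isotropic_curve (a := fun i _ => a i) hγ hγn
    (fun i => isPolyMap_const (a i)) hq₀ hq₁ hi₀ hi₁ ha₀ ha₁
  let c : ι ⊕ Fin m → ℂ → Q := Sum.elim (fun i _ => a i) b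
  have hc : ∀ i, IsPolyMap (c i) := by
    rintro (i | i)
    · exact isPolyMap_const _
    · exact hb i
  have e0 : (fun i => c i 0) = Sum.elim a q₀ := by
    ext1 (i | i)
    · rfl
    · exact hb0 i
  have e1 : (fun i => c i 1) = Sum.elim a q₁ := by
    ext1 (i | i)
    · rfl
    · exact hb1 i
  have hcc : ∀ i j t, γ (c i t) (c j t) = 0 := by
    rintro (i | i) (j | j) t
    · exact haa i j
    · exact hab i j t
    · exact hγ.isRefl _ _ (hab j i t)
    · exact hbb i j t
  have key := fun j => exists_line_combination hc (w₀ := (G₀ j).2) (w₁ := (G₁ j).2)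
    (by rw [e0]; exact (hG₀ j).2) (by rw [e1]; exact (hG₁ j).2)
  choose w hw hw0 hw1 hwt using key
  have hcs : ∀ i t, ∀ x ∈ Submodule.span ℂ (Set.range fun i => c i t), γ (c i t) x = 0 := by
    intro i t x hx
    have : Submodule.span ℂ (Set.range fun i => c i t) ≤ LinearMap.ker (γ (c i t)) :=
      Submodule.span_le.2 (by rintro _ ⟨j, rfl⟩; exact hcc i j t)
    exact this hx
  refine ⟨fun j t => ((G₀ j).1 + t • ((G₁ j).1 - (G₀ j).1), w j t), fun j =>
    isPolyMap_prod.2 ⟨isPolyMap_line _ _, hw j⟩, fun j => ?_, fun j => ?_, fun j t => ?_,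
    fun i j t => ?_, fun i j t => hcs (Sum.inl i) t _ (hwt j t)⟩
  · simp [hw0]
  · simp [hw1]
  · exact T.add_mem (hG₀ j).1 (T.smul_mem _ (T.sub_mem (hG₁ j).1 (hG₀ j).1))
  · have : Submodule.span ℂ (Set.range fun i => c i t) ≤ LinearMap.ker (γ.flip (w j t)) :=
      Submodule.span_le.2 (by rintro _ ⟨l, rfl⟩; exact hcs l t _ (hwt j t))
    exact this (hwt i t)

/-- The rows of a frame adapted to a subspace of `I × Q`. -/
def pairRows {κ μ : Type*} (ε : κ → I) (G : μ → I × Q) : κ ⊕ μ → I × Q :=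
  Sum.elim (fun i => (ε i, 0)) G

/-- A set of subspaces of `I × Q` whose adapted frames can be joined by curves is irreducible. -/
theorem pair_irreducible (hβ : β.IsAlt) (hβn : β.Nondegenerate) (hγn : γ.Nondegenerate)
    {k c : ℕ} {κ κ' μ : Type*} [Fintype κ] [Fintype κ'] [Fintype μ]
    (hc : Fintype.card κ + Fintype.card κ' = 2 * c) (hk : Fintype.card κ + Fintype.card μ = k)
    {X : Set (Gr k (I × Q))} (hne : X.Nonempty) (y : I × Q)
    (D D' : Set ((κ → I) × (κ' → I) × (μ → I × Q)))
    (hD' : ∀ d ∈ D', (∀ i, d.2.1 i ∈ Submodule.span ℂ (Set.range d.1)) ∧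
      (∀ i j, β (d.2.1 i) (d.1 j) = 0) ∧ ∀ i j, γ (d.2.2 i).2 (d.2.2 j).2 = 0)
    (hconn : ∀ a ∈ D, ∀ b ∈ D, ∃ ζ : ℂ → (κ → I) × (κ' → I) × (μ → I × Q), IsPolyMap ζ ∧
      ζ 0 = a ∧ ζ 1 = b ∧ ∀ t, ζ t ∈ D')
    (hext : ∀ F ∈ X, ∃ d ∈ D, LinearIndependent ℂ d.2.1 ∧
      Submodule.span ℂ (Set.range (pairRows d.1 d.2.2)) = F.1)
    (hX : ∀ F ∈ X, IsPairMember β γ c F.1)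
    (hgen : ∀ F₀ ∈ X, ∀ d ∈ D', ∀ F : Gr k (I × Q),
      Submodule.span ℂ (Set.range (pairRows d.1 d.2.2)) = F.1 → IsPairMember β γ c F.1 →
      LinearIndependent ℂ d.2.1 → interLeft F.1 ⊓ β.orthogonal (interLeft F.1) ≤ Submodule.span ℂ (Set.range d.2.1) →
      (y ∉ supPerp β F₀.1 → y ∉ supPerp β F.1) → (y ∉ F₀.1 → y ∉ F.1) → F ∈ X) :
    IsIrreducible X := by
  obtain ⟨e⟩ : Nonempty (Fin k ≃ κ ⊕ μ) := ⟨(Fintype.equivFinOfCardEq (by simp [hk])).symm⟩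
  -- The number of rows is k, so rows that span a member are independent.
  have hLI : ∀ (F : Gr k (I × Q)) (ε : κ → I) (G : μ → I × Q),
      Submodule.span ℂ (Set.range (pairRows ε G)) = F.1 → LinearIndependent ℂ (pairRows ε G) := by
    intro F ε G h
    rw [linearIndependent_iff_card_eq_finrank_span, Set.finrank, h, F.2]
    simp [hk]
  -- The roles of the ends differ: membership is propagated from t = 0, while t = 1 only has to be a
  -- frame of F₁. The conditions D hold at the ends, the weaker D' along the whole curve.
  refine isIrreducible_of_curves hne fun F₀ hF₀ F₁ hF₁ => ?_
  obtain ⟨d₀, hd₀, hR₀, hs₀⟩ := hext F₀ hF₀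
  obtain ⟨d₁, hd₁, hR₁, hs₁⟩ := hext F₁ hF₁
  obtain ⟨ζ, hζ, hζ0, hζ1, hζt⟩ := hconn d₀ hd₀ d₁ hd₁
  have hL₀ := hLI F₀ _ _ hs₀
  have hL₁ := hLI F₁ _ _ hs₁
  obtain ⟨hζa, hζbc⟩ := isPolyMap_prod.1 hζ
  obtain ⟨hζb, hζc⟩ := isPolyMap_prod.1 hζbc
  have hε := isPolyMap_pi.1 hζa
  have hR := isPolyMap_pi.1 hζb
  have hG := isPolyMap_pi.1 hζc
  have hφ : ∀ i, IsPolyMap fun t => pairRows (ζ t).1 (ζ t).2.2 i := by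
    rintro (i | i)
    · exact (hε i).linear_comp (LinearMap.inl ℂ I Q)
    · exact hG i
  have hε0 : LinearIndependent ℂ d₀.1 := by
    have := hL₀.comp _ Sum.inl_injective
    exact LinearIndependent.of_comp (LinearMap.inl ℂ I Q) this
  subst hζ0 hζ1
  obtain ⟨δ, hδ, hδ0, hδt⟩ := pair_curve (β := β) (γ := γ) hβ hβn hγn hc hφ hL₀ hL₁
    (by have := hX F₀ hF₀; rw [← hs₀] at this; exact this) hε hε0 hR hR₀
    (fun t i => Submodule.subset_span ⟨Sum.inl i, rfl⟩)
    (fun t i => by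
      have h1 : Submodule.span ℂ (Set.range (ζ t).1) ≤ (Submodule.span ℂ
          (Set.range (pairRows (ζ t).1 (ζ t).2.2))).comap (LinearMap.inl ℂ I Q) :=
        Submodule.span_le.2 (by
          rintro _ ⟨j, rfl⟩
          exact Submodule.subset_span ⟨Sum.inl j, rfl⟩)
      exact h1 ((hD' _ (hζt t)).1 i))
    (fun t => (hD' _ (hζt t)).2.1)
    (fun t => by
      rintro (i | i) (j | j)
      · simp [pairRows]
      · simp [pairRows]
      · simp [pairRows]
      · exact (hD' _ (hζt t)).2.2 i j) y
  have hre : ∀ t, Set.range (fun i => pairRows (ζ t).1 (ζ t).2.2 (e i)) =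
      Set.range (pairRows (ζ t).1 (ζ t).2.2) := fun t => e.surjective.range_comp _
  refine ⟨fun t i => pairRows (ζ t).1 (ζ t).2.2 (e i), isPolyMap_pi.2 fun i => hφ (e i),
    ⟨⟨_, hL₀.comp _ e.injective⟩, Subtype.ext ?_, rfl⟩,
    ⟨⟨_, hL₁.comp _ e.injective⟩, Subtype.ext ?_, rfl⟩, δ, hδ, hδ0, fun t ht => ?_⟩
  · exact (congrArg (Submodule.span ℂ) (hre 0)).trans hs₀
  · exact (congrArg (Submodule.span ℂ) (hre 1)).trans hs₁
  · obtain ⟨h1, hRt, h2, h3, h4, h5⟩ := hδt t ht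
    let b : Frame k (I × Q) := ⟨_, h1.comp _ e.injective⟩
    have hb : Submodule.span ℂ (Set.range (pairRows (ζ t).1 (ζ t).2.2)) = b.span.1 :=
      (congrArg (Submodule.span ℂ) (hre t)).symm
    refine ⟨b, hgen F₀ hF₀ _ (hζt t) b.span hb ?_ hRt ?_ ?_ ?_, rfl⟩
    · rw [← hb]; exact h2
    · rw [← hb]; exact h3
    · rw [← hb, ← hs₀]; exact h4
    · rw [← hb, ← hs₀]; exact h5

end PairCurves

/-! ### Adapted frames of arbitrary members -/

section PairExtraction

open Module LinearMap.BilinForm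

variable {I Q : Type*} [AddCommGroup I] [Module ℂ I] [FiniteDimensional ℂ I]
  [AddCommGroup Q] [Module ℂ Q] [FiniteDimensional ℂ Q]
  {β : LinearMap.BilinForm ℂ I} {γ : LinearMap.BilinForm ℂ Q}

theorem exists_extend {W : Type*} [AddCommGroup W] [Module ℂ W] [FiniteDimensional ℂ W]
    {ι : Type*} [Fintype ι] {a : ι → W} (ha : LinearIndependent ℂ a) {B : Submodule ℂ W}
    (hB : ∀ i, a i ∈ B) {n : ℕ} (hn : finrank ℂ B = Fintype.card ι + n) :
    ∃ b : Fin n → W, LinearIndependent ℂ (Sum.elim a b) ∧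
      Submodule.span ℂ (Set.range (Sum.elim a b)) = B := by
  have hA : Submodule.span ℂ (Set.range a) ≤ B := Submodule.span_le.2 (by
    rintro _ ⟨i, rfl⟩; exact hB i)
  obtain ⟨C', hC'⟩ := Submodule.exists_isCompl (Submodule.span ℂ (Set.range a))
  set C := C' ⊓ B with hC
  have hsup : Submodule.span ℂ (Set.range a) ⊔ C = B := by
    rw [hC, ← sup_inf_assoc_of_le _ hA, hC'.sup_eq_top, top_inf_eq]
  have hinf : Submodule.span ℂ (Set.range a) ⊓ C = ⊥ := by
    rw [eq_bot_iff, ← hC'.inf_eq_bot]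
    exact fun x hx => ⟨hx.1, hx.2.1⟩
  have hd : finrank ℂ C = n := by
    have := Submodule.finrank_sup_add_finrank_inf_eq (Submodule.span ℂ (Set.range a)) C
    rw [hsup, hinf, finrank_bot, finrank_span_eq_card ha] at this
    omega
  let bC := finBasisOfFinrankEq ℂ C hd
  have hspan : Submodule.span ℂ (Set.range fun i => (bC i : W)) = C := by
    have : (Set.range fun i => (bC i : W)) = C.subtype '' Set.range bC := by
      rw [← Set.range_comp]; rfl
    rw [this, ← Submodule.map_span, bC.span_eq]
    simp
  refine ⟨fun i => bC i, ha.sum_type ?_ ?_, ?_⟩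
  · exact bC.linearIndependent.map' C.subtype C.ker_subtype
  · rw [hspan, disjoint_iff, hinf]
  · rw [Set.Sum.elim_range, Submodule.span_union, hspan, hsup]

omit [FiniteDimensional ℂ Q] [FiniteDimensional ℂ I] in
theorem finrank_interLeft_add [FiniteDimensional ℂ Q] [FiniteDimensional ℂ I]
    (F : Submodule ℂ (I × Q)) :
    finrank ℂ (interLeft F) + finrank ℂ (F.map (LinearMap.snd ℂ I Q)) = finrank ℂ F := by
  have h1 := LinearMap.finrank_range_add_finrank_ker (LinearMap.snd ℂ I Q ∘ₗ F.subtype)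
  rw [LinearMap.range_comp, Submodule.range_subtype] at h1
  have e : interLeft F ≃ₗ[ℂ] LinearMap.ker (LinearMap.snd ℂ I Q ∘ₗ F.subtype) :=
    { toFun := fun x => ⟨⟨(x.1, 0), x.2⟩, rfl⟩
      map_add' := fun x y => by ext <;> simp
      map_smul' := fun c x => by ext <;> simp
      invFun := fun x => ⟨x.1.1.1, by
        have h : x.1.1.2 = 0 := x.2
        have h2 := x.1.2
        show (x.1.1.1, (0 : Q)) ∈ F
        rw [← h]; exact h2⟩
      left_inv := fun x => rfl
      right_inv := fun x => by
        have h : x.1.1.2 = 0 := x.2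
        ext
        · rfl
        · exact h.symm }
  rw [e.finrank_eq]
  omega

/-- The isotropic subspaces of a symplectic space have at most half the dimension. -/
theorem exists_isotropic_family (hγ : γ.IsAlt) (hγn : γ.Nondegenerate) {q : ℕ}
    (hq : finrank ℂ Q = 2 * q) {ι : Type*} [Fintype ι] {a : ι → Q} (ha : LinearIndependent ℂ a)
    {P : Submodule ℂ Q} (hP : P ≤ γ.orthogonal P) (haP : ∀ i, a i ∈ P) {m : ℕ}
    (hm : finrank ℂ P ≤ Fintype.card ι + m) (hmq : Fintype.card ι + m ≤ q) :
    ∃ b : Fin m → Q, LinearIndependent ℂ (Sum.elim a b) ∧ (∀ i j, γ (b i) (b j) = 0) ∧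
      (∀ i j, γ (a i) (b j) = 0) ∧ P ≤ Submodule.span ℂ (Set.range (Sum.elim a b)) := by
  obtain ⟨L, hPL, -, -, hL, hLd⟩ := exists_maximal_isotropic hγ hγn (E := ⊤) le_top hP
  have htop : (⊤ ⊓ γ.orthogonal ⊤ : Submodule ℂ Q) = ⊥ := by
    have := finrank_orthogonal hγn (⊤ : Submodule ℂ Q)
    rw [finrank_top, Nat.sub_self, Submodule.finrank_eq_zero] at this
    rw [this, inf_bot_eq]
  rw [htop, finrank_bot, finrank_top, hq] at hLd
  obtain ⟨C, hPC, hCL, hC⟩ := exists_submodule_between hPL hm (by omega)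
  obtain ⟨b, hb, hbC⟩ := exists_extend ha (fun i => hPC (haP i)) hC
  have hbm : ∀ i, Sum.elim a b i ∈ L := fun i => hCL (hbC ▸ Submodule.subset_span ⟨i, rfl⟩)
  exact ⟨b, hb, fun i j => hL (hbm (Sum.inr j)) _ (hbm (Sum.inr i)),
    fun i j => hL (hbm (Sum.inr j)) _ (hbm (Sum.inl i)), hbC ▸ hPC⟩

omit [FiniteDimensional ℂ I] [FiniteDimensional ℂ Q] in
theorem IsPairMember.map_snd_le {c : ℕ} {F : Submodule ℂ (I × Q)} (hF : IsPairMember β γ c F) :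
    F.map (LinearMap.snd ℂ I Q) ≤ γ.orthogonal (F.map (LinearMap.snd ℂ I Q)) := by
  rintro _ ⟨x, hx, rfl⟩ _ ⟨y, hy, rfl⟩
  exact hF.isotropic y hy x hx

theorem finrank_le_of_isotropic (hγn : γ.Nondegenerate) {q : ℕ}
    (hq : finrank ℂ Q = 2 * q) {P : Submodule ℂ Q} (hP : P ≤ γ.orthogonal P) :
    finrank ℂ P ≤ q := by
  have h1 := Submodule.finrank_mono hP
  rw [finrank_orthogonal hγn] at h1
  have := Submodule.finrank_le P
  omega

/-- The numerical bounds satisfied by a member. -/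
theorem IsPairMember.bounds (hγn : γ.Nondegenerate) {q : ℕ}
    (hq : finrank ℂ Q = 2 * q) {c : ℕ} {F : Submodule ℂ (I × Q)} (hF : IsPairMember β γ c F) :
    c ≤ finrank ℂ (interLeft F) ∧ finrank ℂ F ≤ finrank ℂ (interLeft F) + q ∧
      finrank ℂ (interLeft F) ≤ finrank ℂ F ∧ finrank ℂ (interLeft F) ≤ 2 * c := by
  have h1 := hF.rank
  have h2 : finrank ℂ (interLeft F ⊓ β.orthogonal (interLeft F) : Submodule ℂ I) ≤
    finrank ℂ (interLeft F) := Submodule.finrank_mono inf_le_left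
  have h3 := finrank_interLeft_add F
  have h4 := finrank_le_of_isotropic hγn hq hF.map_snd_le
  omega

/-- An isotropic subspace of `E` together with the vectors of `E` orthogonal to it. -/
theorem exists_radical_pair (hβ : β.IsAlt) (hβn : β.Nondegenerate) {E : Submodule ℂ I} {c ρ r : ℕ}
    (hE : finrank ℂ E + finrank ℂ (E ⊓ β.orthogonal E : Submodule ℂ I) = 2 * c) {R : Submodule ℂ I}
    (h1 : E ⊓ β.orthogonal E ≤ R) (hRE : R ≤ E) (hR : finrank ℂ R = ρ)
    (hr : r + ρ = 2 * c) : finrank ℂ (E ⊓ β.orthogonal R : Submodule ℂ I) = r := by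
  have h2 := finrank_inf_orthogonal hβ hβn E R
  have h3 : R ⊓ β.orthogonal E = E ⊓ β.orthogonal E :=
    le_antisymm (inf_le_inf_right _ hRE) (le_inf h1 inf_le_right)
  rw [h3] at h2
  omega

/-- R spans a ρ-dimensional space between rad E and a maximal isotropic subspace of E that contains
S. The rank condition then gives E ∩ R^⊥ the dimension ρ + σ, whatever dim E is. So a member with
larger E still has rows of the generic format; the rest of E is left to the other rows. -/
theorem exists_adapted (hβ : β.IsAlt) (hβn : β.Nondegenerate) {E S : Submodule ℂ I} {c ρ σ : ℕ}
    (hE : finrank ℂ E + finrank ℂ (E ⊓ β.orthogonal E : Submodule ℂ I) = 2 * c)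
    (hSE : S ≤ E) (hS : S ≤ β.orthogonal S) (hc : ρ + σ + ρ = 2 * c) (hr : ρ + σ ≤ finrank ℂ E) :
    ∃ (R : Fin ρ → I) (h : Fin σ → I), LinearIndependent ℂ (Sum.elim R h) ∧
      (∀ i j, β (R i) (R j) = 0) ∧ (∀ i j, β (R i) (h j) = 0) ∧ (∀ i, R i ∈ E) ∧ (∀ i, h i ∈ E) ∧
      ∀ s ∈ S, ∀ j, β s (R j) = 0 := by
  obtain ⟨L, hSL, hLE, hradL, hL, hLd⟩ := exists_maximal_isotropic hβ hβn hSE hS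
  obtain ⟨R, hradR, hRL, hR⟩ := exists_submodule_between hradL (d := ρ) (by omega) (by omega)
  have h1 := exists_radical_pair hβ hβn hE hradR (hRL.trans hLE) hR hc
  let bR := finBasisOfFinrankEq ℂ R hR
  have hb : LinearIndependent ℂ fun i => (bR i : I) :=
    bR.linearIndependent.map' R.subtype R.ker_subtype
  obtain ⟨h, hh, hhs⟩ := exists_extend hb (B := E ⊓ β.orthogonal R) (n := σ)
    (fun i => ⟨hLE (hRL (bR i).2), fun x hx => hL (hRL (bR i).2) _ (hRL hx)⟩) (by simp [h1])
  have hm : ∀ i, h i ∈ E ⊓ β.orthogonal R := fun i => by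
    rw [← hhs]
    exact Submodule.subset_span ⟨Sum.inr i, rfl⟩
  exact ⟨fun i => bR i, h, hh, fun i j => hL (hRL (bR j).2) _ (hRL (bR i).2),
    fun i j => (hm j).2 _ (bR i).2, fun i => hLE (hRL (bR i).2), fun i => (hm i).1,
    fun s hs j => hL (hRL (bR j).2) _ (hSL hs)⟩

/-- The frame has to contain the prescribed vector u. An isotropic P of dimension 1 + s that
contains u and rad E is spanned by u and b, and R is taken inside P. -/
theorem exists_adapted_of_mem (hβ : β.IsAlt) (hβn : β.Nondegenerate) {E : Submodule ℂ I}
    {c ρ s τ : ℕ} (hE : finrank ℂ E + finrank ℂ (E ⊓ β.orthogonal E : Submodule ℂ I) = 2 * c)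
    {u : I} (hu : u ∈ E) (hu0 : u ≠ 0) (hc : 1 + s + τ + ρ = 2 * c)
    (hr : 1 + s + τ ≤ finrank ℂ E) (hρ : ρ ≤ 1 + s) (hs : 1 + s ≤ c)
    (hs' : 1 + s = c ∨ s = ρ ∨ (1 + s = ρ ∧ u ∈ β.orthogonal E)) :
    ∃ (b : Fin s → I) (R : Fin ρ → I) (h : Fin τ → I),
      LinearIndependent ℂ (Sum.elim (Sum.elim (fun _ : Unit => u) b) h) ∧
      LinearIndependent ℂ R ∧ (∀ i j, β (b i) (b j) = 0) ∧ (∀ j, β u (b j) = 0) ∧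
      (∀ i, R i ∈ Submodule.span ℂ (Set.range (Sum.elim (fun _ : Unit => u) b))) ∧
      (∀ i j, β (R i) (h j) = 0) ∧ (∀ i, b i ∈ E) ∧ ∀ i, h i ∈ E := by
  have hSE : Submodule.span ℂ {u} ≤ E := (Submodule.span_singleton_le_iff_mem _ _).2 hu
  obtain ⟨L, hSL, hLE, hradL, hL, hLd⟩ := exists_maximal_isotropic hβ hβn hSE (by
    rw [Submodule.span_singleton_le_iff_mem]
    intro x hx
    obtain ⟨t, rfl⟩ := Submodule.mem_span_singleton.1 hx
    show β (t • u) u = 0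
    rw [map_smul, LinearMap.smul_apply, hβ.self_eq_zero, smul_zero])
  -- The three alternatives: P may be all of L, of dimension c; or there is one dimension to spare
  -- beyond dim rad E ≤ ρ; or u already lies in the radical.
  have hdim : finrank ℂ ((E ⊓ β.orthogonal E) ⊔ Submodule.span ℂ {u} : Submodule ℂ I) ≤ 1 + s := by
    rcases hs' with h | h | ⟨h, h'⟩
    · have := Submodule.finrank_mono (sup_le hradL hSL)
      omega
    · have h1 := Submodule.finrank_add_le_finrank_add_finrank (E ⊓ β.orthogonal E)
        (Submodule.span ℂ {u})
      have h2 := finrank_span_singleton (K := ℂ) hu0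
      omega
    · rw [sup_eq_left.2 ((Submodule.span_singleton_le_iff_mem _ _).2 (Submodule.mem_inf.2 ⟨hu, h'⟩))]
      omega
  obtain ⟨P, hradP, hPL, hP⟩ := exists_submodule_between (sup_le hradL hSL) hdim (by omega)
  obtain ⟨R, hradR, hRP, hR⟩ := exists_submodule_between (le_sup_left.trans hradP) (d := ρ)
    (by omega) (by omega)
  have h1 := exists_radical_pair (r := 1 + s + τ) hβ hβn hE hradR (hRP.trans (hPL.trans hLE)) hR hc
  have huP : u ∈ P := hradP (Submodule.mem_sup_right (Submodule.mem_span_singleton_self u))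
  obtain ⟨b, hb, hbP⟩ := exists_extend (a := fun _ : Unit => u) (n := s)
    (LinearIndependent.of_subsingleton () hu0) (fun _ => huP) (by simp [hP])
  have hbm : ∀ i, Sum.elim (fun _ : Unit => u) b i ∈ P := fun i => by
    rw [← hbP]
    exact Submodule.subset_span ⟨i, rfl⟩
  obtain ⟨h, hh, hhs⟩ := exists_extend hb (B := E ⊓ β.orthogonal R) (n := τ)
    (fun i => ⟨hLE (hPL (hbm i)), fun x hx => hL (hPL (hbm i)) _ (hPL (hRP hx))⟩) (by simp [h1])
  have hm : ∀ i, h i ∈ E ⊓ β.orthogonal R := fun i => by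
    rw [← hhs]
    exact Submodule.subset_span ⟨Sum.inr i, rfl⟩
  let bR := finBasisOfFinrankEq ℂ R hR
  exact ⟨b, fun i => bR i, h, hh, bR.linearIndependent.map' R.subtype R.ker_subtype,
    fun i j => hL (hPL (hbm (Sum.inr j))) _ (hPL (hbm (Sum.inr i))),
    fun j => hL (hPL (hbm (Sum.inr j))) _ (hPL huP), fun i => by rw [hbP]; exact hRP (bR i).2,
    fun i j => (hm j).2 _ (bR i).2, fun i => hLE (hPL (hbm (Sum.inr i))), fun i => (hm i).1⟩

/-- The members contained in a given subspace. -/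
def pairSet (β : LinearMap.BilinForm ℂ I) (γ : LinearMap.BilinForm ℂ Q) (k c : ℕ)
    (T : Submodule ℂ (I × Q)) : Set (Gr k (I × Q)) :=
  {F | IsPairMember β γ c F.1 ∧ F.1 ≤ T}

end PairExtraction

/-! ### Three formats of adapted frames that imply irreducibility -/

section PairIrreducible

open Module LinearMap.BilinForm

variable {I Q : Type*} [AddCommGroup I] [Module ℂ I] [FiniteDimensional ℂ I]
  [AddCommGroup Q] [Module ℂ Q] [FiniteDimensional ℂ Q]
  {β : LinearMap.BilinForm ℂ I} {γ : LinearMap.BilinForm ℂ Q}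

theorem range_sumElim_empty {I ι : Type*} (q : ι → I) :
    Set.range (Sum.elim (Empty.elim : Empty → I) q) = Set.range q := by
  rw [Set.Sum.elim_range, Set.range_eq_empty, Set.empty_union]

omit [FiniteDimensional ℂ I] in
theorem linearIndependent_sumElim_empty {ι : Type*} {q : ι → I} (hq : LinearIndependent ℂ q) :
    LinearIndependent ℂ (Sum.elim (Empty.elim : Empty → I) q) :=
  linearIndependent_empty_type.sum_type hq (by
    rw [Set.range_eq_empty, Submodule.span_empty]
    exact disjoint_bot_left)

/-- The vectors `a` of I and `aQ` of Q, and the subspace T, encode closed conditions that the curves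
preserve: R is orthogonal to all of `a`, h only to the part selected by s. The vector y encodes the
open conditions. The isotropic tuple q only has to span, with `aQ`, a space that contains the
Q-components, so its length m₁ may differ from the number m of rows. -/
theorem irreducible_of_adapted (hβ : β.IsAlt) (hβn : β.Nondegenerate) (hγ : γ.IsAlt)
    (hγn : γ.Nondegenerate) {k c ρ σ m m₁ : ℕ} (hc : ρ + σ + ρ = 2 * c) (hk : ρ + σ + m = k)
    {X : Set (Gr k (I × Q))} (hne : X.Nonempty) (y : I × Q) {ι ι' ιQ : Type*} [Fintype ι]
    [Fintype ι'] [Fintype ιQ] (a : ι → I) (s : ι' → ι) (hs : Function.Injective s)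
    (aQ : ιQ → Q) (haQ : ∀ i j, γ (aQ i) (aQ j) = 0) (T : Submodule ℂ I)
    (hX : ∀ F ∈ X, IsPairMember β γ c F.1)
    (hext : ∀ F ∈ X, ∃ (R : Fin ρ → I) (h : Fin σ → I) (G : Fin m → I × Q) (q : Fin m₁ → Q),
      LinearIndependent ℂ (Sum.elim a R) ∧ (∀ i j, β (R i) (R j) = 0) ∧
      (∀ i j, β (a i) (R j) = 0) ∧ (∀ i j, β (R i) (h j) = 0) ∧
      (∀ i j, β (a (s i)) (h j) = 0) ∧ LinearIndependent ℂ (Sum.elim aQ q) ∧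
      (∀ i j, γ (q i) (q j) = 0) ∧ (∀ i j, γ (aQ i) (q j) = 0) ∧
      (∀ j, (G j).1 ∈ T ∧ (G j).2 ∈ Submodule.span ℂ (Set.range (Sum.elim aQ q))) ∧
      Submodule.span ℂ (Set.range (pairRows (Sum.elim R h) G)) = F.1)
    (hgen : ∀ F₀ ∈ X, ∀ (R : Fin ρ → I) (h : Fin σ → I) (G : Fin m → I × Q),
      (∀ i j, β (a i) (R j) = 0) → (∀ i j, β (a (s i)) (h j) = 0) → (∀ j, (G j).1 ∈ T) →
      (∀ i j, γ (aQ i) (G j).2 = 0) → ∀ F : Gr k (I × Q),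
      Submodule.span ℂ (Set.range (pairRows (Sum.elim R h) G)) = F.1 → IsPairMember β γ c F.1 →
      interLeft F.1 ⊓ β.orthogonal (interLeft F.1) ≤ Submodule.span ℂ (Set.range R) →
      (y ∉ supPerp β F₀.1 → y ∉ supPerp β F.1) → (y ∉ F₀.1 → y ∉ F.1) → F ∈ X) :
    IsIrreducible X := by
  refine pair_irreducible (κ := Fin ρ ⊕ Fin σ) (κ' := Fin ρ) (μ := Fin m) hβ hβn hγn
    (by simpa using hc) (by simpa using hk) hne y
    {d | ∃ (h : Fin σ → I) (q : Fin m₁ → Q), d.1 = Sum.elim d.2.1 h ∧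
      LinearIndependent ℂ (Sum.elim a d.2.1) ∧ (∀ i j, β (d.2.1 i) (d.2.1 j) = 0) ∧
      (∀ i j, β (a i) (d.2.1 j) = 0) ∧ (∀ i j, β (d.2.1 i) (h j) = 0) ∧
      (∀ i j, β (a (s i)) (h j) = 0) ∧ LinearIndependent ℂ (Sum.elim aQ q) ∧
      (∀ i j, γ (q i) (q j) = 0) ∧ (∀ i j, γ (aQ i) (q j) = 0) ∧
      (∀ j, (d.2.2 j).1 ∈ T ∧ (d.2.2 j).2 ∈ Submodule.span ℂ (Set.range (Sum.elim aQ q)))}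
    {d | ∃ h : Fin σ → I, d.1 = Sum.elim d.2.1 h ∧ (∀ i j, β (d.2.1 i) (d.2.1 j) = 0) ∧
      (∀ i j, β (a i) (d.2.1 j) = 0) ∧ (∀ i j, β (d.2.1 i) (h j) = 0) ∧
      (∀ i j, β (a (s i)) (h j) = 0) ∧ (∀ j, (d.2.2 j).1 ∈ T) ∧
      (∀ i j, γ (d.2.2 i).2 (d.2.2 j).2 = 0) ∧ ∀ i j, γ (aQ i) (d.2.2 j).2 = 0} ?_ ?_ ?_ hX ?_
  · rintro ⟨ε, R, G⟩ ⟨h, hε, h1, -, h2, -, -, h3, -⟩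
    dsimp only at hε h1 h2 h3 ⊢
    subst hε
    refine ⟨fun i => Submodule.subset_span ⟨Sum.inl i, rfl⟩, ?_, h3⟩
    rintro i (j | j)
    · exact h1 i j
    · exact h2 i j
  · rintro ⟨ε₀, R₀, G₀⟩ ⟨h₀, q₀, hε₀, a1, a2, a3, a4, a5, a6, a7, a8, a9⟩
      ⟨ε₁, R₁, G₁⟩ ⟨h₁, q₁, hε₁, b1, b2, b3, b4, b5, b6, b7, b8, b9⟩
    dsimp only at *
    subst hε₀ hε₁
    obtain ⟨R, h, hR, hh, hR0, hR1, hh0, hh1, c1, c2, c3, c4⟩ := exists_adapted_curve hβ hβn s hs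
      a1 b1 a2 b2 a3 b3 a4 b4 a5 b5
    obtain ⟨G, hG, hG0, hG1, d1, d2, d3⟩ := exists_rows_curve hγ hγn haQ a6 b6 a7 b7 a8 b8 T a9 b9
    refine ⟨fun t => (Sum.elim (fun i => R i t) fun i => h i t, fun i => R i t, fun i => G i t),
      isPolyMap_prod.2 ⟨isPolyMap_pi.2 ?_, isPolyMap_prod.2 ⟨isPolyMap_pi.2 hR,
        isPolyMap_pi.2 hG⟩⟩, ?_, ?_, fun t => ⟨fun i => h i t, rfl, fun i j => c1 i j t,
        fun i j => c2 i j t, fun i j => c3 i j t, fun i j => c4 i j t, fun j => d1 j t,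
        fun i j => d2 i j t, fun i j => d3 i j t⟩⟩
    · rintro (i | i)
      · exact hR i
      · exact hh i
    · simp only [hR0, hh0, hG0]
    · simp only [hR1, hh1, hG1]
  · intro F hF
    obtain ⟨R, h, G, q, a1, a2, a3, a4, a5, a6, a7, a8, a9, a10⟩ := hext F hF
    exact ⟨(Sum.elim R h, R, G), ⟨h, q, rfl, a1, a2, a3, a4, a5, a6, a7, a8, a9⟩,
      a1.comp _ Sum.inr_injective, a10⟩
  · rintro F₀ hF₀ ⟨ε, R, G⟩ ⟨h, hε, h1, h2, h3, h4, h5, h6, h7⟩ F hs hm - hrad e1 e2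
    dsimp only at *
    subst hε
    exact hgen F₀ hF₀ R h G h2 h4 h5 h7 F hs hm hrad e1 e2

/-- For members that contain u. As u need not belong to the radical, R is not part of the frame but
a tuple in the span of u and b. -/
theorem irreducible_of_adapted_mem (hβ : β.IsAlt) (hβn : β.Nondegenerate) (hγ : γ.IsAlt)
    (hγn : γ.Nondegenerate) {k c ρ s τ m : ℕ} (hc : 1 + s + τ + ρ = 2 * c)
    (hk : 1 + s + τ + m = k) {X : Set (Gr k (I × Q))} (hne : X.Nonempty) (u : I)
    (T : Submodule ℂ I) (hX : ∀ F ∈ X, IsPairMember β γ c F.1)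
    (hext : ∀ F ∈ X, ∃ (b : Fin s → I) (R : Fin ρ → I) (h : Fin τ → I) (G : Fin m → I × Q)
      (q : Fin m → Q), LinearIndependent ℂ (Sum.elim (fun _ : Unit => u) b) ∧
      LinearIndependent ℂ R ∧ (∀ i j, β (b i) (b j) = 0) ∧ (∀ j, β u (b j) = 0) ∧
      (∀ i, R i ∈ Submodule.span ℂ (Set.range (Sum.elim (fun _ : Unit => u) b))) ∧
      (∀ i j, β (R i) (h j) = 0) ∧ LinearIndependent ℂ q ∧ (∀ i j, γ (q i) (q j) = 0) ∧
      (∀ j, (G j).1 ∈ T ∧ (G j).2 ∈ Submodule.span ℂ (Set.range q)) ∧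
      Submodule.span ℂ (Set.range (pairRows (Sum.elim (Sum.elim (fun _ : Unit => u) b) h) G)) =
        F.1)
    (hgen : ∀ (b : Fin s → I) (R : Fin ρ → I) (h : Fin τ → I) (G : Fin m → I × Q),
      LinearIndependent ℂ R → (∀ i j, β (R i) (h j) = 0) → (∀ j, β u (b j) = 0) →
      (∀ j, (G j).1 ∈ T) → ∀ F : Gr k (I × Q),
      (∀ i, R i ∈ Submodule.span ℂ (Set.range (Sum.elim (fun _ : Unit => u) b))) →
      Submodule.span ℂ (Set.range (pairRows (Sum.elim (Sum.elim (fun _ : Unit => u) b) h) G)) =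
        F.1 → IsPairMember β γ c F.1 → F ∈ X) :
    IsIrreducible X := by
  refine pair_irreducible (κ := (Unit ⊕ Fin s) ⊕ Fin τ) (κ' := Fin ρ) (μ := Fin m) hβ hβn hγn
    (by simpa using hc) (by simpa using hk) hne 0
    {d | ∃ (b : Fin s → I) (h : Fin τ → I) (q : Fin m → Q),
      d.1 = Sum.elim (Sum.elim (fun _ : Unit => u) b) h ∧
      LinearIndependent ℂ (Sum.elim (fun _ : Unit => u) b) ∧
      LinearIndependent ℂ d.2.1 ∧ (∀ i j, β (b i) (b j) = 0) ∧ (∀ j, β u (b j) = 0) ∧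
      (∀ i, d.2.1 i ∈ Submodule.span ℂ (Set.range (Sum.elim (fun _ : Unit => u) b))) ∧
      (∀ i j, β (d.2.1 i) (h j) = 0) ∧ LinearIndependent ℂ q ∧ (∀ i j, γ (q i) (q j) = 0) ∧
      (∀ j, (d.2.2 j).1 ∈ T ∧ (d.2.2 j).2 ∈ Submodule.span ℂ (Set.range q))}
    {d | ∃ (b : Fin s → I) (h : Fin τ → I),
      d.1 = Sum.elim (Sum.elim (fun _ : Unit => u) b) h ∧
      (∀ i j, β (b i) (b j) = 0) ∧ (∀ j, β u (b j) = 0) ∧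
      (∀ i, d.2.1 i ∈ Submodule.span ℂ (Set.range (Sum.elim (fun _ : Unit => u) b))) ∧
      (∀ i j, β (d.2.1 i) (h j) = 0) ∧ (∀ j, (d.2.2 j).1 ∈ T) ∧
      (∀ i j, γ (d.2.2 i).2 (d.2.2 j).2 = 0)} ?_ ?_ ?_ hX ?_
  · rintro ⟨ε, R, G⟩ ⟨b, h, hε, h1, h2, h3, h4, -, h5⟩
    dsimp only at *
    subst hε
    have hle : Submodule.span ℂ (Set.range (Sum.elim (fun _ : Unit => u) b)) ≤
        Submodule.span ℂ (Set.range (Sum.elim (Sum.elim (fun _ : Unit => u) b) h)) :=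
      Submodule.span_mono (by rintro _ ⟨i, rfl⟩; exact ⟨Sum.inl i, rfl⟩)
    refine ⟨fun i => hle (h3 i), ?_, h5⟩
    have hbb : ∀ i j, β (Sum.elim (fun _ : Unit => u) b i) (Sum.elim (fun _ : Unit => u) b j) =
        0 := by
      rintro (i | i) (j | j)
      · exact hβ.self_eq_zero u
      · exact h2 j
      · exact hβ.isRefl _ _ (h2 i)
      · exact h1 i j
    rintro i (j | j)
    · have : Submodule.span ℂ (Set.range (Sum.elim (fun _ : Unit => u) b)) ≤
          LinearMap.ker (β.flip (Sum.elim (fun _ : Unit => u) b j)) := Submodule.span_le.2 (by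
        rintro _ ⟨l, rfl⟩; exact hbb l j)
      exact this (h3 i)
    · exact h4 i j
  · rintro ⟨ε₀, R₀, G₀⟩ ⟨b₀, h₀, q₀, hε₀, a1, a2, a3, a4, a5, a6, a7, a8, a9⟩
      ⟨ε₁, R₁, G₁⟩ ⟨b₁, h₁, q₁, hε₁, b1, b2, b3, b4, b5, b6, b7, b8, b9⟩
    dsimp only at *
    subst hε₀ hε₁
    obtain ⟨b, R, h, hb, hR, hh, hb0, hb1, hR0, hR1, hh0, hh1, c1, c2, c3, c4⟩ :=
      exists_adapted_curve_of_mem hβ hβn a1 b1 a3 b3 a4 b4 a2 b2 a5 b5 a6 b6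
    have hE : ∀ q : Fin m → Q, Set.range (Sum.elim (Empty.elim : Empty → Q) q) = Set.range q :=
      range_sumElim_empty
    have hI : ∀ q : Fin m → Q, LinearIndependent ℂ q →
        LinearIndependent ℂ (Sum.elim (Empty.elim : Empty → Q) q) := fun q hq =>
      linearIndependent_sumElim_empty hq
    obtain ⟨G, hG, hG0, hG1, d1, d2, -⟩ := exists_rows_curve (a := (Empty.elim : Empty → Q)) hγ hγn
      (fun i => i.elim) (hI q₀ a7) (hI q₁ b7) a8 b8 (fun i => i.elim) (fun i => i.elim) T
      (by rw [hE]; exact a9) (by rw [hE]; exact b9)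
    refine ⟨fun t => (Sum.elim (Sum.elim (fun _ : Unit => u) fun i => b i t) fun i => h i t,
      fun i => R i t, fun i => G i t),
      isPolyMap_prod.2 ⟨isPolyMap_pi.2 ?_, isPolyMap_prod.2 ⟨isPolyMap_pi.2 hR,
        isPolyMap_pi.2 hG⟩⟩, ?_, ?_, fun t => ⟨fun i => b i t, fun i => h i t, rfl,
        fun i j => c1 i j t, fun j => c2 j t, fun i => c3 i t, fun i j => c4 i j t,
        fun j => d1 j t, fun i j => d2 i j t⟩⟩
    · rintro ((i | i) | i)
      · exact isPolyMap_const u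
      · exact hb i
      · exact hh i
    · simp only [hR0, hh0, hG0, hb0]
    · simp only [hR1, hh1, hG1, hb1]
  · intro F hF
    obtain ⟨b, R, h, G, q, a1, a2, a3, a4, a5, a6, a7, a8, a9, a10⟩ := hext F hF
    exact ⟨(Sum.elim (Sum.elim (fun _ : Unit => u) b) h, R, G),
      ⟨b, h, q, rfl, a1, a2, a3, a4, a5, a6, a7, a8, a9⟩, a2, a10⟩
  · rintro F₀ hF₀ ⟨ε, R, G⟩ ⟨b, h, hε, h1, h2, h3, h4, h5, h6⟩ F hs hm hR hrad e1 e2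
    dsimp only at *
    subst hε
    exact hgen b R h G hR h4 h2 h5 F h3 hs hm

/-- The version in which the first row is `(i, v)` with `i` orthogonal to the radical. -/
theorem irreducible_of_adapted_cons (hβ : β.IsAlt) (hβn : β.Nondegenerate) (hγ : γ.IsAlt)
    (hγn : γ.Nondegenerate) {k c ρ σ m : ℕ} (hc : ρ + σ + ρ = 2 * c)
    (hk : ρ + σ + (1 + m) = k) {X : Set (Gr k (I × Q))} (hne : X.Nonempty) (y : I × Q) (v : Q)
    (P : Prop) (hX : ∀ F ∈ X, IsPairMember β γ c F.1)
    (hext : ∀ F ∈ X, ∃ (R : Fin ρ → I) (h : Fin σ → I) (i : I) (G : Fin m → I × Q)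
      (q : Fin m → Q), LinearIndependent ℂ R ∧ (∀ i j, β (R i) (R j) = 0) ∧
      (∀ i j, β (R i) (h j) = 0) ∧ (∀ j, β (R j) i = 0) ∧ (P → i = 0) ∧
      LinearIndependent ℂ (Sum.elim (fun _ : Unit => v) q) ∧
      (∀ i j, γ (q i) (q j) = 0) ∧ (∀ j, γ v (q j) = 0) ∧
      (∀ j, (G j).2 ∈ Submodule.span ℂ (Set.range (Sum.elim (fun _ : Unit => v) q))) ∧
      Submodule.span ℂ (Set.range (pairRows (Sum.elim R h)
        (Sum.elim (fun _ : Unit => (i, v)) G))) = F.1)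
    (hgen : ∀ F₀ ∈ X, ∀ (R : Fin ρ → I) (h : Fin σ → I) (i : I) (G : Fin m → I × Q),
      (∀ j, β (R j) i = 0) → (P → i = 0) → (∀ j, γ v (G j).2 = 0) → ∀ F : Gr k (I × Q),
      Submodule.span ℂ (Set.range (pairRows (Sum.elim R h)
        (Sum.elim (fun _ : Unit => (i, v)) G))) = F.1 → IsPairMember β γ c F.1 →
      interLeft F.1 ⊓ β.orthogonal (interLeft F.1) ≤ Submodule.span ℂ (Set.range R) →
      (y ∉ F₀.1 → y ∉ F.1) → F ∈ X) :
    IsIrreducible X := by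
  refine pair_irreducible (κ := Fin ρ ⊕ Fin σ) (κ' := Fin ρ) (μ := Unit ⊕ Fin m) hβ hβn hγn
    (by simpa using hc) (by simpa using hk) hne y
    {d | ∃ (h : Fin σ → I) (i : I) (G : Fin m → I × Q) (q : Fin m → Q),
      d.1 = Sum.elim d.2.1 h ∧ d.2.2 = Sum.elim (fun _ : Unit => (i, v)) G ∧
      LinearIndependent ℂ d.2.1 ∧ (∀ i j, β (d.2.1 i) (d.2.1 j) = 0) ∧
      (∀ i j, β (d.2.1 i) (h j) = 0) ∧ (∀ j, β (d.2.1 j) i = 0) ∧ (P → i = 0) ∧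
      LinearIndependent ℂ (Sum.elim (fun _ : Unit => v) q) ∧
      (∀ i j, γ (q i) (q j) = 0) ∧ (∀ j, γ v (q j) = 0) ∧
      (∀ j, (G j).2 ∈ Submodule.span ℂ (Set.range (Sum.elim (fun _ : Unit => v) q)))}
    {d | ∃ (h : Fin σ → I) (i : I) (G : Fin m → I × Q),
      d.1 = Sum.elim d.2.1 h ∧ d.2.2 = Sum.elim (fun _ : Unit => (i, v)) G ∧
      (∀ i j, β (d.2.1 i) (d.2.1 j) = 0) ∧
      (∀ i j, β (d.2.1 i) (h j) = 0) ∧ (∀ j, β (d.2.1 j) i = 0) ∧ (P → i = 0) ∧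
      (∀ i j, γ (G i).2 (G j).2 = 0) ∧ ∀ j, γ v (G j).2 = 0} ?_ ?_ ?_ hX ?_
  · rintro ⟨ε, R, G'⟩ ⟨h, i, G, hε, hG, h1, h2, -, -, h3, h4⟩
    dsimp only at *
    subst hε hG
    refine ⟨fun i => Submodule.subset_span ⟨Sum.inl i, rfl⟩, ?_, ?_⟩
    · rintro i (j | j)
      · exact h1 i j
      · exact h2 i j
    · rintro (i | i) (j | j)
      · exact hγ.self_eq_zero v
      · exact h4 j
      · exact hγ.isRefl _ _ (h4 i)
      · exact h3 i j
  · rintro ⟨ε₀, R₀, G'₀⟩ ⟨h₀, i₀, G₀, q₀, hε₀, hG₀, a1, a2, a3, a4, a5, a6, a7, a8, a9⟩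
      ⟨ε₁, R₁, G'₁⟩ ⟨h₁, i₁, G₁, q₁, hε₁, hG₁, b1, b2, b3, b4, b5, b6, b7, b8, b9⟩
    dsimp only at *
    subst hε₀ hε₁ hG₀ hG₁
    have hI : ∀ q : Fin ρ → I, LinearIndependent ℂ q →
        LinearIndependent ℂ (Sum.elim (Empty.elim : Empty → I) q) := fun q hq =>
      linearIndependent_sumElim_empty hq
    obtain ⟨R, h, hR, hh, hR0, hR1, hh0, hh1, c1, -, c3, -⟩ :=
      exists_adapted_curve (a := (Empty.elim : Empty → I)) hβ hβn (id : Empty → Empty)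
      Function.injective_id (hI R₀ a1) (hI R₁ b1) a2 b2 (fun i => i.elim) (fun i => i.elim) a3 b3
      (fun i => i.elim) (fun i => i.elim)
    obtain ⟨w, hw, hw0, hw1, hRw, hPw⟩ : ∃ w : ℂ → I, IsPolyMap w ∧ w 0 = i₀ ∧ w 1 = i₁ ∧
        (∀ i t, β (R i t) (w t) = 0) ∧ (P → ∀ t, w t = 0) := by
      by_cases hP : P
      · exact ⟨fun _ => 0, isPolyMap_const 0, (a5 hP).symm, (b5 hP).symm, by simp, fun _ _ => rfl⟩
      · obtain ⟨w, hw, hw0, hw1, hRw⟩ := exists_orthogonal_curve hβn hR (by simpa only [hR0])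
          (by simpa only [hR1]) (fun i => by simpa only [hR0] using a4 i)
          (fun i => by simpa only [hR1] using b4 i)
        exact ⟨w, hw, hw0, hw1, hRw, fun h => absurd h hP⟩
    obtain ⟨G, hG, hG0, hG1, -, d2, d3⟩ := exists_rows_curve hγ hγn
      (fun _ _ => hγ.self_eq_zero v) a6 b6 a7 b7 (fun _ => a8) (fun _ => b8) ⊤
      (fun j => ⟨trivial, a9 j⟩) (fun j => ⟨trivial, b9 j⟩)
    refine ⟨fun t => (Sum.elim (fun i => R i t) fun i => h i t, fun i => R i t,
      Sum.elim (fun _ : Unit => (w t, v)) fun i => G i t),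
      isPolyMap_prod.2 ⟨isPolyMap_pi.2 ?_, isPolyMap_prod.2 ⟨isPolyMap_pi.2 hR,
        isPolyMap_pi.2 ?_⟩⟩, ?_, ?_, fun t => ⟨fun i => h i t, w t, fun i => G i t, rfl, rfl,
        fun i j => c1 i j t, fun i j => c3 i j t, fun j => hRw j t, fun hP => hPw hP t,
        fun i j => d2 i j t, fun j => d3 () j t⟩⟩
    · rintro (i | i)
      · exact hR i
      · exact hh i
    · rintro (i | i)
      · exact isPolyMap_prod.2 ⟨hw, isPolyMap_const v⟩
      · exact hG i
    · simp only [hR0, hh0, hG0, hw0]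
    · simp only [hR1, hh1, hG1, hw1]
  · intro F hF
    obtain ⟨R, h, i, G, q, a1, a2, a3, a4, a5, a6, a7, a8, a9, a10⟩ := hext F hF
    exact ⟨(Sum.elim R h, R, _), ⟨h, i, G, q, rfl, rfl, a1, a2, a3, a4, a5, a6, a7, a8, a9⟩,
      a1, a10⟩
  · rintro F₀ hF₀ ⟨ε, R, G'⟩ ⟨h, i, G, hε, hG, h1, h2, h3, h4, h5, h6⟩ F hs hm - hrad - e2
    dsimp only at *
    subst hε hG
    exact hgen F₀ hF₀ R h i G h3 h4 h6 F hs hm hrad e2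

end PairIrreducible

/-! ### Irreducibility for each position of a vector -/

section PairCases

open Module LinearMap.BilinForm

variable {I Q : Type*} [AddCommGroup I] [Module ℂ I] [FiniteDimensional ℂ I]
  [AddCommGroup Q] [Module ℂ Q] [FiniteDimensional ℂ Q]
  {β : LinearMap.BilinForm ℂ I} {γ : LinearMap.BilinForm ℂ Q}

omit [FiniteDimensional ℂ I] [FiniteDimensional ℂ Q] in
theorem mem_supPerp_iff {F : Submodule ℂ (I × Q)} {x : I × Q} :
    x ∈ supPerp β F ↔ ∃ i ∈ β.orthogonal (interLeft F), x + (i, 0) ∈ F := by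
  constructor
  · intro h
    obtain ⟨f, hf, _, ⟨i, hi, rfl⟩, rfl⟩ := Submodule.mem_sup.1 h
    refine ⟨-i, Submodule.neg_mem _ hi, ?_⟩
    have : f + (LinearMap.inl ℂ I Q) i + (-i, 0) = f := by
      ext <;> simp
    rwa [this]
  · rintro ⟨i, hi, h⟩
    refine Submodule.mem_sup.2 ⟨_, h, _, ⟨-i, Submodule.neg_mem _ hi, rfl⟩, ?_⟩
    ext <;> simp

theorem orthogonal_inf_orthogonal (hβ : β.IsAlt) (hβn : β.Nondegenerate) (E : Submodule ℂ I) :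
    β.orthogonal (E ⊓ β.orthogonal E) = E ⊔ β.orthogonal E := by
  have h : β.orthogonal (E ⊔ β.orthogonal E) = E ⊓ β.orthogonal E := by
    rw [orthogonal_sup, orthogonal_orthogonal hβn hβ.isRefl, inf_comm]
  rw [← h, orthogonal_orthogonal hβn hβ.isRefl]

omit [FiniteDimensional ℂ I] [FiniteDimensional ℂ Q] in
theorem inl_mem_supPerp_iff {F : Submodule ℂ (I × Q)} {u : I} :
    (u, (0 : Q)) ∈ supPerp β F ↔ u ∈ interLeft F ⊔ β.orthogonal (interLeft F) := by
  rw [mem_supPerp_iff, Submodule.mem_sup]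
  constructor
  · rintro ⟨i, hi, h⟩
    refine ⟨u + i, ?_, -i, Submodule.neg_mem _ hi, by simp⟩
    simpa [mem_interLeft] using h
  · rintro ⟨e, he, i, hi, rfl⟩
    exact ⟨-i, Submodule.neg_mem _ hi, by simpa [mem_interLeft] using he⟩

/-- The vectors orthogonal to a family whose span contains the radical. -/
theorem mem_sup_orthogonal (hβ : β.IsAlt) (hβn : β.Nondegenerate) {E : Submodule ℂ I} {κ : Type*}
    {R : κ → I} (hR : E ⊓ β.orthogonal E ≤ Submodule.span ℂ (Set.range R)) {u : I}
    (hu : ∀ i, β (R i) u = 0) : u ∈ E ⊔ β.orthogonal E := by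
  rw [← orthogonal_inf_orthogonal hβ hβn]
  intro x hx
  have : Submodule.span ℂ (Set.range R) ≤ LinearMap.ker (β.flip u) :=
    Submodule.span_le.2 (by rintro _ ⟨l, rfl⟩; exact hu l)
  exact this (hR hx)

/-- The numbers that describe a generic member: the dimension of its radical, the rank of its
intersection with `I`, and the dimension of its image in `Q`. -/
structure PairNumbers (q k c ρ σ m : ℕ) : Prop where
  rank : ρ + σ + ρ = 2 * c
  dim : ρ + σ + m = k
  le : m ≤ q
  generic : ρ + σ = c ∨ ρ + σ + q = k

variable {q k c ρ σ m : ℕ}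

/-- dim E is at least c, since the radical is at most E, and at least k - q, since the image in Q is
isotropic. A generic member attains one of these bounds. -/
theorem IsPairMember.le_finrank (hγn : γ.Nondegenerate) (hq : finrank ℂ Q = 2 * q)
    (hN : PairNumbers q k c ρ σ m) {F : Gr k (I × Q)} (hF : IsPairMember β γ c F.1) :
    ρ + σ ≤ finrank ℂ (interLeft F.1) ∧ finrank ℂ (F.1.map (LinearMap.snd ℂ I Q)) ≤ m ∧
      finrank ℂ (interLeft F.1 ⊓ β.orthogonal (interLeft F.1) : Submodule ℂ I) ≤ ρ := by
  obtain ⟨h1, h2, h3, h4⟩ := hF.bounds hγn hq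
  have h5 := finrank_interLeft_add F.1
  have h6 := hF.rank
  rw [F.2] at h2 h3 h5
  obtain ⟨e1, e2, e3, e4⟩ := hN
  omega

theorem exists_rows {κ : Type*} [Fintype κ] {F : Gr k (I × Q)} {ε : κ → I}
    (hε : LinearIndependent ℂ ε) (hεF : ∀ i, ε i ∈ interLeft F.1) (hk : Fintype.card κ + m = k) :
    ∃ G : Fin m → I × Q, Submodule.span ℂ (Set.range (pairRows ε G)) = F.1 := by
  obtain ⟨G, -, hG⟩ := exists_extend (a := fun i => (ε i, (0 : Q)))
    (hε.map' (LinearMap.inl ℂ I Q) (LinearMap.ker_eq_bot.2 LinearMap.inl_injective)) (B := F.1)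
    hεF (n := m) (by rw [F.2, hk])
  exact ⟨G, hG⟩

omit [FiniteDimensional ℂ I] [FiniteDimensional ℂ Q] in
theorem row_mem {κ μ : Type*} {F : Submodule ℂ (I × Q)} {ε : κ → I} {G : μ → I × Q}
    (h : Submodule.span ℂ (Set.range (pairRows ε G)) = F) (j : μ) : G j ∈ F :=
  h ▸ Submodule.subset_span ⟨Sum.inr j, rfl⟩

omit [FiniteDimensional ℂ I] [FiniteDimensional ℂ Q] in
theorem span_pairRows_le {κ μ : Type*} {F T : Submodule ℂ (I × Q)} {ε : κ → I} {G : μ → I × Q}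
    (h : Submodule.span ℂ (Set.range (pairRows ε G)) = F) (hε : ∀ i, (ε i, (0 : Q)) ∈ T)
    (hG : ∀ j, G j ∈ T) : F ≤ T := by
  rw [← h, Submodule.span_le]
  rintro _ ⟨i | i, rfl⟩
  · exact hε i
  · exact hG i

/-- The proposition P switches the open condition on or off, so that one proof covers both a vector
that has to be avoided and no condition at all. -/
theorem irreducible_pairSet_out (hβ : β.IsAlt) (hβn : β.Nondegenerate) (hγ : γ.IsAlt)
    (hγn : γ.Nondegenerate) (hq : finrank ℂ Q = 2 * q) (hN : PairNumbers q k c ρ σ m) (P : Prop)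
    (y : I × Q) (hne : {F ∈ pairSet β γ k c ⊤ | P → y ∉ supPerp β F.1}.Nonempty) :
    IsIrreducible {F ∈ pairSet β γ k c ⊤ | P → y ∉ supPerp β F.1} := by
  refine irreducible_of_adapted (m₁ := m) hβ hβn hγ hγn hN.rank hN.dim hne y
    (Empty.elim : Empty → I) (id : Empty → Empty) Function.injective_id (Empty.elim : Empty → Q)
    (fun i => i.elim) ⊤ (fun F hF => hF.1.1) ?_ ?_
  · rintro F ⟨⟨hF, -⟩, -⟩
    obtain ⟨h1, h2, -⟩ := hF.le_finrank hγn hq hN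
    obtain ⟨R, h, hLI, hRR, hRh, hR, hh, -⟩ := exists_adapted hβ hβn (S := ⊥) hF.rank bot_le bot_le
      hN.rank h1
    obtain ⟨G, hG⟩ := exists_rows (F := F) hLI (by
      rintro (i | i)
      · exact hR i
      · exact hh i) (m := m) (by simpa using hN.dim)
    obtain ⟨b, hb, hbb, -, hP⟩ := exists_isotropic_family hγ hγn hq
      (linearIndependent_empty_type : LinearIndependent ℂ (Empty.elim : Empty → Q)) hF.map_snd_le
      (fun i => i.elim) (m := m) (by simpa using h2) (by simpa using hN.le)
    exact ⟨R, h, G, b, linearIndependent_sumElim_empty (hLI.comp _ Sum.inl_injective), hRR,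
      fun i => i.elim, hRh, fun i => i.elim, hb, hbb, fun i => i.elim,
      fun j => ⟨trivial, hP ⟨_, row_mem hG j, rfl⟩⟩, hG⟩
  · intro F₀ hF₀ R h G _ _ _ _ F _ hm _ hy _
    exact ⟨⟨hm, le_top⟩, fun hP => hy (hF₀.2 hP)⟩

/-- Since E + E^⊥ is the orthogonal of rad E, the closed condition amounts to R being orthogonal to
u, which curves preserve; avoiding u is open. -/
theorem irreducible_pairSet_mid (hβ : β.IsAlt) (hβn : β.Nondegenerate) (hγ : γ.IsAlt)
    (hγn : γ.Nondegenerate) (hq : finrank ℂ Q = 2 * q) (hN : PairNumbers q k c ρ σ m) (u : I)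
    (hne : {F ∈ pairSet β γ k c ⊤ | (u, (0 : Q)) ∈ supPerp β F.1 ∧ (u, 0) ∉ F.1}.Nonempty) :
    IsIrreducible {F ∈ pairSet β γ k c ⊤ | (u, (0 : Q)) ∈ supPerp β F.1 ∧ (u, 0) ∉ F.1} := by
  refine irreducible_of_adapted (m₁ := m) hβ hβn hγ hγn hN.rank hN.dim hne (u, 0)
    (fun _ : Unit => u) (Empty.elim : Empty → Unit) (fun i => i.elim) (Empty.elim : Empty → Q)
    (fun i => i.elim) ⊤ (fun F hF => hF.1.1) ?_ ?_
  · rintro F ⟨⟨hF, -⟩, hu1, hu2⟩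
    obtain ⟨h1, h2, -⟩ := hF.le_finrank hγn hq hN
    rw [inl_mem_supPerp_iff, Submodule.mem_sup] at hu1
    obtain ⟨e, he, i, hi, hei⟩ := hu1
    -- R lies in a maximal isotropic subspace through e, hence is orthogonal to e; being in E it is
    -- orthogonal to i too, so to u = e + i.
    obtain ⟨R, h, hLI, hRR, hRh, hR, hh, hS⟩ := exists_adapted hβ hβn (S := Submodule.span ℂ {e})
      hF.rank ((Submodule.span_singleton_le_iff_mem _ _).2 he) (by
        rw [Submodule.span_singleton_le_iff_mem]
        intro x hx
        obtain ⟨t, rfl⟩ := Submodule.mem_span_singleton.1 hx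
        show β (t • e) e = 0
        rw [map_smul, LinearMap.smul_apply, hβ.self_eq_zero, smul_zero]) hN.rank h1
    obtain ⟨G, hG⟩ := exists_rows (F := F) hLI (by
      rintro (i | i)
      · exact hR i
      · exact hh i) (m := m) (by simpa using hN.dim)
    obtain ⟨b, hb, hbb, -, hP⟩ := exists_isotropic_family hγ hγn hq
      (linearIndependent_empty_type : LinearIndependent ℂ (Empty.elim : Empty → Q)) hF.map_snd_le
      (fun i => i.elim) (m := m) (by simpa using h2) (by simpa using hN.le)
    refine ⟨R, h, G, b, ?_, hRR, fun _ j => ?_, hRh, fun i => i.elim, hb, hbb, fun i => i.elim,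
      fun j => ⟨trivial, hP ⟨_, row_mem hG j, rfl⟩⟩, hG⟩
    · refine LinearIndependent.sum_type (LinearIndependent.of_subsingleton () ?_)
        (hLI.comp _ Sum.inl_injective) ?_
      · rintro rfl
        exact hu2 (Submodule.zero_mem _)
      · rw [Set.range_const]
        refine (Submodule.disjoint_span_singleton_of_notMem fun h => hu2 ?_).symm
        have : Submodule.span ℂ (Set.range R) ≤ interLeft F.1 := Submodule.span_le.2 (by
          rintro _ ⟨i, rfl⟩; exact hR i)
        exact this h
    · rw [← hei, map_add, LinearMap.add_apply, hS e (Submodule.mem_span_singleton_self e),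
        hβ.isRefl _ _ (hi _ (hR j)), add_zero]
  · intro F₀ hF₀ R h G haR _ _ _ F _ hm hrad _ hy
    refine ⟨⟨hm, le_top⟩, ?_, hy hF₀.2.2⟩
    rw [inl_mem_supPerp_iff]
    exact mem_sup_orthogonal hβ hβn hrad fun i => hβ.isRefl _ _ (haR () i)

theorem irreducible_pairSet_in (hβ : β.IsAlt) (hβn : β.Nondegenerate) (hγ : γ.IsAlt)
    (hγn : γ.Nondegenerate) (hq : finrank ℂ Q = 2 * q) (hN : PairNumbers q k c ρ σ m) {u : I}
    (hu0 : u ≠ 0) (hne : {F ∈ pairSet β γ k c ⊤ | (u, (0 : Q)) ∈ F.1}.Nonempty) :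
    IsIrreducible {F ∈ pairSet β γ k c ⊤ | (u, (0 : Q)) ∈ F.1} := by
  -- The vector u takes one of the ρ + σ places: one of the last σ if there are any, otherwise one
  -- of the ρ isotropic ones, and then ρ = c.
  obtain ⟨s, τ, e1, e2, e3, e4⟩ : ∃ s τ, 1 + s + τ = ρ + σ ∧ ρ ≤ 1 + s ∧ 1 + s ≤ c ∧
      (1 + s = c ∨ s = ρ) := by
    obtain ⟨a, b, c, d⟩ := hN
    rcases Nat.eq_zero_or_pos σ with h | h
    · have : 0 < ρ := by
        obtain ⟨F, ⟨hF, -⟩, hu⟩ := hne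
        have h1 : 0 < finrank ℂ (interLeft F.1) :=
          finrank_pos_iff_exists_ne_zero.2 ⟨⟨u, hu⟩, fun h => hu0 (congrArg Subtype.val h)⟩
        have := hF.rank
        omega
      exact ⟨ρ - 1, 0, by omega, by omega, by omega, by omega⟩
    · exact ⟨ρ, σ - 1, by omega, by omega, by omega, by omega⟩
  have hrk := hN.rank
  have hdim := hN.dim
  refine irreducible_of_adapted_mem (s := s) (τ := τ) (ρ := ρ) (m := m) hβ hβn hγ hγn (c := c)
    (by omega) (by omega) hne u ⊤ (fun F hF => hF.1.1) ?_ ?_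
  · rintro F ⟨⟨hF, -⟩, hu⟩
    obtain ⟨h1, h2, -⟩ := hF.le_finrank hγn hq hN
    obtain ⟨b, R, h, hLI, hR, hbb, hub, hRb, hRh, hb, hh⟩ := exists_adapted_of_mem (s := s)
      (τ := τ) (ρ := ρ) hβ hβn hF.rank hu hu0 (by omega) (by omega) e2 e3 (by omega)
    obtain ⟨G, hG⟩ := exists_rows (F := F) hLI (by
      rintro ((i | i) | i)
      · exact hu
      · exact hb i
      · exact hh i) (m := m) (by simp; omega)
    obtain ⟨g, hg, hgg, -, hP⟩ := exists_isotropic_family hγ hγn hq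
      (linearIndependent_empty_type : LinearIndependent ℂ (Empty.elim : Empty → Q)) hF.map_snd_le
      (fun i => i.elim) (m := m) (by simpa using h2) (by simpa using hN.le)
    rw [range_sumElim_empty] at hP
    exact ⟨b, R, h, G, g, hLI.comp _ Sum.inl_injective, hR, hbb, hub, hRb, hRh,
      hg.comp _ Sum.inr_injective, hgg, fun j => ⟨trivial, hP ⟨_, row_mem hG j, rfl⟩⟩, hG⟩
  · intro b R h G _ _ _ _ F _ hF hm
    exact ⟨⟨hm, le_top⟩, hF ▸ Submodule.subset_span ⟨Sum.inl (Sum.inl (Sum.inl ())), rfl⟩⟩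

theorem irreducible_pairSet_perp_notMem (hβ : β.IsAlt) (hβn : β.Nondegenerate) (hγ : γ.IsAlt)
    (hγn : γ.Nondegenerate) (hq : finrank ℂ Q = 2 * q) (hN : PairNumbers q k c ρ σ m) (u : I)
    (hne : {F ∈ pairSet β γ k c ((LinearMap.ker (β u)).prod ⊤) | (u, 0) ∉ F.1}.Nonempty) :
    IsIrreducible {F ∈ pairSet β γ k c ((LinearMap.ker (β u)).prod ⊤) | (u, 0) ∉ F.1} := by
  refine irreducible_of_adapted (m₁ := m) hβ hβn hγ hγn hN.rank hN.dim hne (u, 0)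
    (fun _ : Unit => u) (id : Unit → Unit) Function.injective_id (Empty.elim : Empty → Q)
    (fun i => i.elim) (LinearMap.ker (β u)) (fun F hF => hF.1.1) ?_ ?_
  · rintro F ⟨⟨hF, hFT⟩, hu2⟩
    obtain ⟨h1, h2, -⟩ := hF.le_finrank hγn hq hN
    obtain ⟨R, h, hLI, hRR, hRh, hR, hh, -⟩ := exists_adapted hβ hβn (S := ⊥) hF.rank bot_le bot_le
      hN.rank h1
    obtain ⟨G, hG⟩ := exists_rows (F := F) hLI (by
      rintro (i | i)
      · exact hR i
      · exact hh i) (m := m) (by simpa using hN.dim)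
    obtain ⟨b, hb, hbb, -, hP⟩ := exists_isotropic_family hγ hγn hq
      (linearIndependent_empty_type : LinearIndependent ℂ (Empty.elim : Empty → Q)) hF.map_snd_le
      (fun i => i.elim) (m := m) (by simpa using h2) (by simpa using hN.le)
    refine ⟨R, h, G, b, ?_, hRR, fun _ j => (hFT (hR j)).1, hRh, fun _ j => (hFT (hh j)).1, hb,
      hbb, fun i => i.elim,
      fun j => ⟨(hFT (row_mem hG j)).1, hP ⟨_, row_mem hG j, rfl⟩⟩, hG⟩
    refine LinearIndependent.sum_type (LinearIndependent.of_subsingleton () ?_)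
      (hLI.comp _ Sum.inl_injective) ?_
    · rintro rfl
      exact hu2 (Submodule.zero_mem _)
    · rw [Set.range_const]
      refine (Submodule.disjoint_span_singleton_of_notMem fun h => hu2 ?_).symm
      have : Submodule.span ℂ (Set.range R) ≤ interLeft F.1 := Submodule.span_le.2 (by
        rintro _ ⟨i, rfl⟩; exact hR i)
      exact this h
  · intro F₀ hF₀ R h G haR hah hGT _ F hs hm hrad _ hy
    refine ⟨⟨hm, span_pairRows_le hs ?_ fun j => ⟨hGT j, trivial⟩⟩, hy hF₀.2⟩
    rintro (i | i)
    · exact ⟨haR () i, trivial⟩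
    · exact ⟨hah () i, trivial⟩

/-- A vector of E orthogonal to F lies in the radical. Thus R and (u, b) have the same size ρ and
the same span, and orthogonality of h to R entails orthogonality to u. -/
theorem irreducible_pairSet_perp_mem (hβ : β.IsAlt) (hβn : β.Nondegenerate) (hγ : γ.IsAlt)
    (hγn : γ.Nondegenerate) (hq : finrank ℂ Q = 2 * q) (hN : PairNumbers q k c ρ σ m) {u : I}
    (hu0 : u ≠ 0)
    (hne : {F ∈ pairSet β γ k c ((LinearMap.ker (β u)).prod ⊤) | (u, 0) ∈ F.1}.Nonempty) :
    IsIrreducible {F ∈ pairSet β γ k c ((LinearMap.ker (β u)).prod ⊤) | (u, 0) ∈ F.1} := by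
  have hrad : ∀ F ∈ {F ∈ pairSet β γ k c ((LinearMap.ker (β u)).prod ⊤) | (u, 0) ∈ F.1},
      u ∈ β.orthogonal (interLeft F.1) := by
    rintro F ⟨⟨hF, hFT⟩, hu⟩ x hx
    exact hβ.isRefl _ _ (hFT hx).1
  obtain ⟨s, hs⟩ : ∃ s, 1 + s = ρ := by
    have : 0 < ρ := by
      obtain ⟨F, hF⟩ := hne
      obtain ⟨-, -, h3⟩ := hF.1.1.le_finrank hγn hq hN
      refine lt_of_lt_of_le (finrank_pos_iff_exists_ne_zero.2
        ⟨⟨u, hF.2, hrad F hF⟩, fun h => hu0 (congrArg Subtype.val h)⟩) h3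
    exact ⟨ρ - 1, by omega⟩
  have hrk := hN.rank
  have hdim := hN.dim
  refine irreducible_of_adapted_mem (s := s) (τ := σ) (ρ := ρ) (m := m) hβ hβn hγ hγn (c := c)
    (by omega) (by omega) hne u (LinearMap.ker (β u)) (fun F hF => hF.1.1) ?_ ?_
  · rintro F hFX
    obtain ⟨⟨hF, hFT⟩, hu⟩ := id hFX
    obtain ⟨h1, h2, -⟩ := hF.le_finrank hγn hq hN
    obtain ⟨b, R, h, hLI, hR, hbb, hub, hRb, hRh, hb, hh⟩ := exists_adapted_of_mem (s := s)
      (τ := σ) (ρ := ρ) hβ hβn hF.rank hu hu0 (by omega) (by omega) (by omega) (by omega)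
      (Or.inr (Or.inr ⟨hs, hrad F hFX⟩))
    obtain ⟨G, hG⟩ := exists_rows (F := F) hLI (by
      rintro ((i | i) | i)
      · exact hu
      · exact hb i
      · exact hh i) (m := m) (by simp; omega)
    obtain ⟨g, hg, hgg, -, hP⟩ := exists_isotropic_family hγ hγn hq
      (linearIndependent_empty_type : LinearIndependent ℂ (Empty.elim : Empty → Q)) hF.map_snd_le
      (fun i => i.elim) (m := m) (by simpa using h2) (by simpa using hN.le)
    rw [range_sumElim_empty] at hP
    exact ⟨b, R, h, G, g, hLI.comp _ Sum.inl_injective, hR, hbb, hub, hRb, hRh,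
      hg.comp _ Sum.inr_injective, hgg,
      fun j => ⟨(hFT (row_mem hG j)).1, hP ⟨_, row_mem hG j, rfl⟩⟩, hG⟩
  · intro b R h G hR hRh hub hGT F hRb hF hm
    have hRs : Submodule.span ℂ (Set.range R) =
        Submodule.span ℂ (Set.range (Sum.elim (fun _ : Unit => u) b)) := by
      refine Submodule.eq_of_le_of_finrank_le (Submodule.span_le.2 (by
        rintro _ ⟨i, rfl⟩; exact hRb i)) ?_
      rw [finrank_span_eq_card hR]
      refine (finrank_range_le_card _).trans ?_
      simp [hs]
    have huR : u ∈ Submodule.span ℂ (Set.range R) := by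
      rw [hRs]
      exact Submodule.subset_span ⟨Sum.inl (), rfl⟩
    refine ⟨⟨hm, span_pairRows_le hF ?_ fun j => ⟨hGT j, trivial⟩⟩,
      hF ▸ Submodule.subset_span ⟨Sum.inl (Sum.inl (Sum.inl ())), rfl⟩⟩
    rintro ((i | i) | i)
    · exact ⟨hβ.self_eq_zero u, trivial⟩
    · exact ⟨hub i, trivial⟩
    · refine ⟨?_, trivial⟩
      have : Submodule.span ℂ (Set.range R) ≤ LinearMap.ker (β.flip (h i)) :=
        Submodule.span_le.2 (by rintro _ ⟨l, rfl⟩; exact hRh l i)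
      exact this huR

omit [FiniteDimensional ℂ I] [FiniteDimensional ℂ Q] in
theorem IsPairMember.sup_isotropic (hγ : γ.IsAlt) {F : Submodule ℂ (I × Q)} {v : Q}
    (hF : IsPairMember β γ c F) (hv : F ≤ (⊤ : Submodule ℂ I).prod (LinearMap.ker (γ v))) :
    F.map (LinearMap.snd ℂ I Q) ⊔ Submodule.span ℂ {v} ≤
      γ.orthogonal (F.map (LinearMap.snd ℂ I Q) ⊔ Submodule.span ℂ {v}) := by
  have h1 : ∀ x ∈ F.map (LinearMap.snd ℂ I Q), γ v x = 0 := by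
    rintro _ ⟨x, hx, rfl⟩
    exact (hv hx).2
  intro x hx y hy
  obtain ⟨a, ha, b, hb, rfl⟩ := Submodule.mem_sup.1 hx
  obtain ⟨a', ha', b', hb', rfl⟩ := Submodule.mem_sup.1 hy
  obtain ⟨s, rfl⟩ := Submodule.mem_span_singleton.1 hb
  obtain ⟨t, rfl⟩ := Submodule.mem_span_singleton.1 hb'
  have h2 : γ a' a = 0 := hF.map_snd_le ha _ ha'
  have h3 : γ a' v = 0 := hγ.isRefl _ _ (h1 _ ha')
  show γ (a' + t • v) (a + s • v) = 0
  simp [h2, h3, h1 _ ha, hγ.self_eq_zero]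

theorem irreducible_pairSet_right_out (hβ : β.IsAlt) (hβn : β.Nondegenerate) (hγ : γ.IsAlt)
    (hγn : γ.Nondegenerate) (hq : finrank ℂ Q = 2 * q) (hN : PairNumbers q k c ρ σ m) {v : Q}
    (hv0 : v ≠ 0) (hne : {F ∈ pairSet β γ k c ((⊤ : Submodule ℂ I).prod (LinearMap.ker (γ v))) |
      ((0 : I), v) ∉ supPerp β F.1}.Nonempty) :
    IsIrreducible {F ∈ pairSet β γ k c ((⊤ : Submodule ℂ I).prod (LinearMap.ker (γ v))) |
      ((0 : I), v) ∉ supPerp β F.1} := by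
  -- The image of F and v together span an isotropic space of dimension at most min(m + 1, q), and v
  -- accounts for one dimension.
  obtain ⟨m₁, h1, h2⟩ : ∃ m₁, 1 + m₁ ≤ q ∧ (m₁ = m ∨ 1 + m₁ = q) := by
    have : 0 < finrank ℂ Q := finrank_pos_iff_exists_ne_zero.2 ⟨v, hv0⟩
    have := hN.le
    rcases Nat.lt_or_ge m q with h | h
    · exact ⟨m, by omega, Or.inl rfl⟩
    · exact ⟨q - 1, by omega, by omega⟩
  refine irreducible_of_adapted (m₁ := m₁) hβ hβn hγ hγn hN.rank hN.dim hne (0, v)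
    (Empty.elim : Empty → I) (id : Empty → Empty) Function.injective_id (fun _ : Unit => v)
    (fun _ _ => hγ.self_eq_zero v) ⊤ (fun F hF => hF.1.1) ?_ ?_
  · rintro F ⟨⟨hF, hFT⟩, hy⟩
    obtain ⟨h3, h4, -⟩ := hF.le_finrank hγn hq hN
    obtain ⟨R, h, hLI, hRR, hRh, hR, hh, -⟩ := exists_adapted hβ hβn (S := ⊥) hF.rank bot_le bot_le
      hN.rank h3
    obtain ⟨G, hG⟩ := exists_rows (F := F) hLI (by
      rintro (i | i)
      · exact hR i
      · exact hh i) (m := m) (by simpa using hN.dim)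
    have hiso := hF.sup_isotropic hγ hFT
    obtain ⟨b, hb, hbb, hvb, hP⟩ := exists_isotropic_family hγ hγn hq (a := fun _ : Unit => v)
      (LinearIndependent.of_subsingleton () hv0) hiso
      (fun i => Submodule.mem_sup_right (Submodule.mem_span_singleton_self v)) (m := m₁) (by
        have e1 := Submodule.finrank_add_le_finrank_add_finrank (F.1.map (LinearMap.snd ℂ I Q))
          (Submodule.span ℂ {v})
        have e2 := finrank_span_singleton (K := ℂ) hv0
        have e3 := finrank_le_of_isotropic hγn hq hiso
        simp only [Fintype.card_unit]
        omega) (by simpa using h1)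
    exact ⟨R, h, G, b, linearIndependent_sumElim_empty (hLI.comp _ Sum.inl_injective), hRR,
      fun i => i.elim, hRh, fun i => i.elim, hb, hbb, hvb,
      fun j => ⟨trivial, hP (Submodule.mem_sup_left ⟨_, row_mem hG j, rfl⟩)⟩, hG⟩
  · intro F₀ hF₀ R h G _ _ _ hvG F hs hm _ hy _
    exact ⟨⟨hm, span_pairRows_le hs (fun i => ⟨trivial, map_zero _⟩)
      fun j => ⟨trivial, hvG () j⟩⟩, hy hF₀.2⟩

/-- The members that meet `E^⊥ + v`; with `P` those that contain `v`. -/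
theorem irreducible_pairSet_right_aux (hβ : β.IsAlt) (hβn : β.Nondegenerate) (hγ : γ.IsAlt)
    (hγn : γ.Nondegenerate) (hq : finrank ℂ Q = 2 * q) (hN : PairNumbers q k c ρ σ m) {v : Q}
    (hv0 : v ≠ 0) (P : Prop)
    {X : Set (Gr k (I × Q))}
    (hX : X = {F ∈ pairSet β γ k c ((⊤ : Submodule ℂ I).prod (LinearMap.ker (γ v))) |
      ((0 : I), v) ∈ supPerp β F.1 ∧ (P ↔ ((0 : I), v) ∈ F.1)}) (hne : X.Nonempty) :
    IsIrreducible X := by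
  -- A member contains some (i, v), so its image in Q is nonzero; this row is set apart from the
  -- remaining m' ones.
  obtain ⟨m', hm'⟩ : ∃ m', 1 + m' = m := by
    obtain ⟨F, hF⟩ := hne
    rw [hX] at hF
    obtain ⟨⟨hF, -⟩, h, -⟩ := hF
    obtain ⟨i, -, hi⟩ := mem_supPerp_iff.1 h
    obtain ⟨-, h2, -⟩ := hF.le_finrank hγn hq hN
    have : 0 < finrank ℂ (F.1.map (LinearMap.snd ℂ I Q)) :=
      finrank_pos_iff_exists_ne_zero.2 ⟨⟨v, _, hi, by simp⟩, fun h =>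
        hv0 (congrArg Subtype.val h)⟩
    exact ⟨m - 1, by omega⟩
  have hdim := hN.dim
  refine irreducible_of_adapted_cons (m := m') hβ hβn hγ hγn hN.rank (by omega) hne (0, v) v P
    (fun F hF => by rw [hX] at hF; exact hF.1.1) ?_ ?_
  · intro F hFX
    rw [hX] at hFX
    obtain ⟨⟨hF, hFT⟩, hy, hP⟩ := hFX
    obtain ⟨h3, h4, -⟩ := hF.le_finrank hγn hq hN
    obtain ⟨i, hi, hiF, hPi⟩ : ∃ i ∈ β.orthogonal (interLeft F.1), (i, v) ∈ F.1 ∧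
        (P → i = 0) := by
      by_cases h : P
      · exact ⟨0, Submodule.zero_mem _, hP.1 h, fun _ => rfl⟩
      · obtain ⟨i, hi, hiF⟩ := mem_supPerp_iff.1 hy
        exact ⟨i, hi, by simpa using hiF, fun h' => absurd h' h⟩
    obtain ⟨R, h, hLI, hRR, hRh, hR, hh, -⟩ := exists_adapted hβ hβn (S := ⊥) hF.rank bot_le bot_le
      hN.rank h3
    have hLI' : LinearIndependent ℂ (pairRows (Sum.elim R h) fun _ : Unit => (i, v)) := by
      refine LinearIndependent.sum_type
        (hLI.map' (LinearMap.inl ℂ I Q) (LinearMap.ker_eq_bot.2 LinearMap.inl_injective))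
        (LinearIndependent.of_subsingleton () fun h => hv0 (congrArg Prod.snd h)) ?_
      rw [Set.range_const]
      refine Submodule.disjoint_span_singleton_of_notMem fun h => hv0 ?_
      have : Submodule.span ℂ (Set.range (LinearMap.inl ℂ I Q ∘ Sum.elim R ‹Fin σ → I›)) ≤
          LinearMap.ker (LinearMap.snd ℂ I Q) := Submodule.span_le.2 (by
        rintro _ ⟨i, rfl⟩; rfl)
      exact this h
    obtain ⟨G, -, hG⟩ := exists_extend hLI' (B := F.1) (n := m') (by
      rintro ((i | i) | i)
      · exact hR i
      · exact hh i
      · exact hiF) (by rw [F.2]; simp; omega)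
    have hG' : Submodule.span ℂ (Set.range (pairRows (Sum.elim R h)
        (Sum.elim (fun _ : Unit => (i, v)) G))) = F.1 := by
      rw [← hG]
      congr 1
      ext x
      simp [pairRows, or_assoc]
    have hiso := hF.map_snd_le
    obtain ⟨b, hb, hbb, hvb, hP'⟩ := exists_isotropic_family hγ hγn hq (a := fun _ : Unit => v)
      (LinearIndependent.of_subsingleton () hv0) hiso (fun _ => ⟨_, hiF, rfl⟩) (m := m')
      (by simpa [hm'] using h4) (by simpa [hm'] using hN.le)
    exact ⟨R, h, i, G, b, hLI.comp _ Sum.inl_injective, hRR, hRh, fun j => hi _ (hR j), hPi, hb,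
      hbb, fun j => hvb () j, fun j => hP' ⟨_, row_mem hG' (Sum.inr j), rfl⟩, hG'⟩
  · intro F₀ hF₀ R h i G hRi hPi hvG F hs hm hrad hy
    rw [hX] at hF₀ ⊢
    have hiF : (i, v) ∈ F.1 := row_mem hs (Sum.inl ())
    refine ⟨⟨hm, span_pairRows_le hs (fun i => ⟨trivial, map_zero _⟩) ?_⟩, ?_, fun hP => ?_,
      fun h => ?_⟩
    · rintro (j | j)
      · exact ⟨trivial, hγ.self_eq_zero v⟩
      · exact ⟨trivial, hvG j⟩
    -- Along the curve i is only known to be orthogonal to the radical, so i = e + j with e in E and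
    -- j in E^⊥; subtracting (e, 0) from the row (i, v) leaves (j, v).
    · obtain ⟨e, he, j, hj, hej⟩ := Submodule.mem_sup.1 (mem_sup_orthogonal hβ hβn hrad hRi)
      refine mem_supPerp_iff.2 ⟨j, hj, ?_⟩
      have := F.1.sub_mem hiF (show (e, (0 : Q)) ∈ F.1 from he)
      rw [← hej] at this
      simpa using this
    · rw [hPi hP] at hiF
      exact hiF
    · by_contra hP
      exact hy (fun h => hP (hF₀.2.2.2 h)) h

end PairCases

/-! ### A chart -/

section Hyperbolic

theorem apply_eq_zero_of_mem_span {W : Type*} [AddCommGroup W] [Module ℂ W]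
    {B : LinearMap.BilinForm ℂ W} {ι : Type*} {a : ι → W} {x y : W} (h : ∀ i, B (a i) y = 0)
    (hx : x ∈ Submodule.span ℂ (Set.range a)) : B x y = 0 := by
  have : Submodule.span ℂ (Set.range a) ≤ LinearMap.ker (B.flip y) :=
    Submodule.span_le.2 (by rintro _ ⟨i, rfl⟩; exact h i)
  exact this hx

theorem apply_eq_zero_of_mem_span_right {W : Type*} [AddCommGroup W] [Module ℂ W]
    {B : LinearMap.BilinForm ℂ W} {ι : Type*} {a : ι → W} {x y : W} (h : ∀ i, B x (a i) = 0)
    (hy : y ∈ Submodule.span ℂ (Set.range a)) : B x y = 0 := by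
  have : Submodule.span ℂ (Set.range a) ≤ LinearMap.ker (B x) :=
    Submodule.span_le.2 (by rintro _ ⟨i, rfl⟩; exact h i)
  exact this hy

variable {M : Type*} [AddCommGroup M] [Module ℂ M] {ρ : ℕ}

/-- The orthogonal sum of `ρ` hyperbolic planes and a given space with a form. -/
def hypForm (ρ : ℕ) (η : LinearMap.BilinForm ℂ M) :
    LinearMap.BilinForm ℂ ((Fin ρ → ℂ) × (Fin ρ → ℂ) × M) :=
  LinearMap.mk₂ ℂ (fun x y => x.1 ⬝ᵥ y.2.1 - x.2.1 ⬝ᵥ y.1 + η x.2.2 y.2.2)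
    (fun x x' y => by simp [add_dotProduct]; ring)
    (fun a x y => by simp [smul_dotProduct]; ring)
    (fun x y y' => by simp [dotProduct_add]; ring)
    (fun a x y => by simp [dotProduct_smul]; ring)

variable {η : LinearMap.BilinForm ℂ M}

theorem hypForm_apply (x y : (Fin ρ → ℂ) × (Fin ρ → ℂ) × M) :
    hypForm ρ η x y = x.1 ⬝ᵥ y.2.1 - x.2.1 ⬝ᵥ y.1 + η x.2.2 y.2.2 := rfl

theorem hypForm_isAlt (hη : η.IsAlt) : (hypForm ρ η).IsAlt := fun x => by
  rw [hypForm_apply, dotProduct_comm, hη.self_eq_zero]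
  ring

theorem hypForm_nondegenerate (hη : η.IsAlt) (hn : η.Nondegenerate) :
    (hypForm ρ η).Nondegenerate := by
  have h : ∀ x, (∀ y, hypForm ρ η x y = 0) → x = 0 := by
    intro x hx
    refine Prod.ext ?_ (Prod.ext ?_ ?_)
    · ext i
      simpa [hypForm_apply] using hx (0, Pi.single i 1, 0)
    · ext i
      simpa [hypForm_apply] using hx (Pi.single i 1, 0, 0)
    · exact hn.1 _ fun y => by simpa [hypForm_apply] using hx (0, 0, y)
  exact ⟨h, fun x hx => h x fun y => (hypForm_isAlt hη).isRefl _ _ (hx y)⟩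

theorem finrank_hyp [FiniteDimensional ℂ M] :
    Module.finrank ℂ ((Fin ρ → ℂ) × (Fin ρ → ℂ) × M) = 2 * ρ + Module.finrank ℂ M := by
  simp only [Module.finrank_prod, Module.finrank_fin_fun]
  ring

theorem prodForm_isAlt {N : Type*} [AddCommGroup N] [Module ℂ N] {θ : LinearMap.BilinForm ℂ N}
    (hη : η.IsAlt) (hθ : θ.IsAlt) : (prodForm η θ).IsAlt := fun x => by
  rw [prodForm_apply, hη.self_eq_zero, hθ.self_eq_zero, add_zero]

/-- The rows of the matrix of an isotropic subspace that is complementary to a given one. -/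
noncomputable def isoRow (η : LinearMap.BilinForm ℂ M) (S : Sym2 (Fin ρ) → ℂ) (w : Fin ρ → M) (i : Fin ρ) :
    (Fin ρ → ℂ) × (Fin ρ → ℂ) × M :=
  (Pi.single i 1, fun j => S s(i, j) + 1 / 2 * η (w i) (w j), w i)

theorem hypForm_isoRow (hη : η.IsAlt) (S : Sym2 (Fin ρ) → ℂ) (w : Fin ρ → M) (i j : Fin ρ) :
    hypForm ρ η (isoRow η S w i) (isoRow η S w j) = 0 := by
  simp only [hypForm_apply, isoRow, single_one_dotProduct, dotProduct_single_one]
  rw [Sym2.eq_swap, ← hη.neg_eq (w j) (w i)]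
  ring

/-- Isotropy fixes the antisymmetric part of the matrix of second components as half the form of the
last components; the symmetric part is free, hence the parameters on `Sym2`. -/
theorem exists_eq_isoRow (hη : η.IsAlt) {x : Fin ρ → (Fin ρ → ℂ) × (Fin ρ → ℂ) × M}
    (hx : ∀ i, (x i).1 = Pi.single i 1) (hxx : ∀ i j, hypForm ρ η (x i) (x j) = 0) :
    ∃ S, x = isoRow η S fun i => (x i).2.2 := by
  refine ⟨Sym2.lift ⟨fun i j => (x i).2.1 j - 1 / 2 * η (x i).2.2 (x j).2.2, fun i j => ?_⟩, ?_⟩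
  · have h := hxx i j
    simp only [hypForm_apply, hx, single_one_dotProduct, dotProduct_single_one] at h
    linear_combination -h - 1 / 2 * hη.neg_eq (x i).2.2 (x j).2.2
  · ext1 i
    refine Prod.ext (hx i) (Prod.ext ?_ rfl)
    ext j
    simp [isoRow]

end Hyperbolic

/-! ### The rows of the chart and the subspace they span -/

section Chart

set_option linter.unusedSectionVars false

open Module LinearMap.BilinForm

variable (ρ σ m : ℕ) (W Z : Type*) [AddCommGroup W] [Module ℂ W] [AddCommGroup Z] [Module ℂ Z]

/-- The model of the space `I`. -/
abbrev ModelI : Type _ := (Fin ρ → ℂ) × (Fin ρ → ℂ) × (Fin σ → ℂ) × W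

/-- The model of the space `Q`. -/
abbrev ModelQ : Type _ := (Fin m → ℂ) × (Fin m → ℂ) × Z

/-- The parameters of the chart. -/
abbrev Params : Type _ :=
  (Sym2 (Fin ρ) → ℂ) × (Fin ρ → (Fin σ → ℂ) × W) × (Fin σ → W) × (Sym2 (Fin m) → ℂ) ×
    (Fin m → Z) × (Fin m → Fin ρ → ℂ) × (Fin m → W)

/-- The index type of the rows. -/
abbrev RowIndex : Type := (Fin ρ ⊕ Fin σ) ⊕ Fin m

variable {ρ σ m W Z}
variable (ηH : LinearMap.BilinForm ℂ (Fin σ → ℂ)) (ηW : LinearMap.BilinForm ℂ W)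
  (ηZ : LinearMap.BilinForm ℂ Z)

/-- The form of the model of `I`. -/
abbrev modelFormI (ρ : ℕ) : LinearMap.BilinForm ℂ (ModelI ρ σ W) := hypForm ρ (prodForm ηH ηW)

/-- The form of the model of `Q`. -/
abbrev modelFormQ (m : ℕ) : LinearMap.BilinForm ℂ (ModelQ m Z) := hypForm m ηZ

/-- The rows that span the radical. -/
noncomputable def rowR (s : Params ρ σ m W Z) (i : Fin ρ) : ModelI ρ σ W :=
  isoRow (prodForm ηH ηW) s.1 s.2.1 i

/-- The rows that complete those of the radical to a basis of the intersection with `I`. -/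
def rowE (s : Params ρ σ m W Z) (l : Fin σ) : ModelI ρ σ W :=
  (0, fun i => -prodForm ηH ηW (s.2.1 i) (Pi.single l 1, s.2.2.1 l), Pi.single l 1, s.2.2.1 l)

/-- The `I`-components of the remaining rows. -/
def rowG (s : Params ρ σ m W Z) (j : Fin m) : ModelI ρ σ W :=
  (0, fun i => s.2.2.2.2.2.1 j i - ηW (s.2.1 i).2 (s.2.2.2.2.2.2 j), 0, s.2.2.2.2.2.2 j)

/-- The `Q`-components of the remaining rows. -/
noncomputable def rowQ (s : Params ρ σ m W Z) (j : Fin m) : ModelQ m Z := isoRow ηZ s.2.2.2.1 s.2.2.2.2.1 j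

/-- All the rows. -/
noncomputable def chartRows (s : Params ρ σ m W Z) : RowIndex ρ σ m → ModelI ρ σ W × ModelQ m Z :=
  pairRows (Sum.elim (rowR ηH ηW s) (rowE ηH ηW s)) fun j => (rowG ηW s j, rowQ ηZ s j)

/-- The subspace with given parameters. -/
noncomputable def chartSpan (s : Params ρ σ m W Z) : Submodule ℂ (ModelI ρ σ W × ModelQ m Z) :=
  Submodule.span ℂ (Set.range (chartRows ηH ηW ηZ s))

/-- The Gram determinant of the second group of rows. -/
noncomputable def chartGram (s : Params ρ σ m W Z) : ℂ :=
  (Matrix.of fun l l' => modelFormI ηH ηW ρ (rowE ηH ηW s l) (rowE ηH ηW s l')).det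

/-- The coordinates that determine the elements of the subspace. -/
def pivot : (ModelI ρ σ W × ModelQ m Z) →ₗ[ℂ] (RowIndex ρ σ m → ℂ) where
  toFun x := Sum.elim (Sum.elim x.1.1 x.1.2.2.1) x.2.1
  map_add' x y := by ext ((i | i) | i) <;> rfl
  map_smul' a x := by ext ((i | i) | i) <;> rfl

theorem pivot_eq_zero_iff (x : ModelI ρ σ W × ModelQ m Z) :
    pivot x = 0 ↔ x.1.1 = 0 ∧ x.1.2.2.1 = 0 ∧ x.2.1 = 0 := by
  constructor
  · intro h
    exact ⟨funext fun i => congrFun h (Sum.inl (Sum.inl i)),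
      funext fun i => congrFun h (Sum.inl (Sum.inr i)), funext fun i => congrFun h (Sum.inr i)⟩
  · rintro ⟨h1, h2, h3⟩
    ext ((i | i) | i)
    · exact congrFun h1 i
    · exact congrFun h2 i
    · exact congrFun h3 i

variable {ηH ηW ηZ}

theorem modelForm_rowR (hH : ηH.IsAlt) (hW : ηW.IsAlt) (s : Params ρ σ m W Z) (i j : Fin ρ) :
    modelFormI ηH ηW ρ (rowR ηH ηW s i) (rowR ηH ηW s j) = 0 :=
  hypForm_isoRow (prodForm_isAlt hH hW) _ _ i j

/-- The second component of `rowE` is defined so as to cancel the pairing of the last components. -/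
theorem modelForm_rowE (s : Params ρ σ m W Z) (i : Fin ρ) (l : Fin σ) :
    modelFormI ηH ηW ρ (rowR ηH ηW s i) (rowE ηH ηW s l) = 0 := by
  simp [hypForm_apply, rowR, rowE, isoRow]

/-- The coordinates of `rowG` are shifted so that this pairing is itself a parameter; orthogonality
to the radical is then a linear equation. -/
theorem modelForm_rowG (s : Params ρ σ m W Z) (i : Fin ρ) (j : Fin m) :
    modelFormI ηH ηW ρ (rowR ηH ηW s i) (rowG ηW s j) = s.2.2.2.2.2.1 j i := by
  simp [hypForm_apply, rowR, rowG, isoRow, prodForm_apply]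

theorem modelForm_rowQ (hZ : ηZ.IsAlt) (s : Params ρ σ m W Z) (i j : Fin m) :
    modelFormQ ηZ m (rowQ ηZ s i) (rowQ ηZ s j) = 0 :=
  hypForm_isoRow hZ _ _ i j

/-- The matrix of pivot coordinates is unitriangular: the only entries off the diagonal are the
components of `rowR` in the σ middle coordinates. -/
theorem pivot_sum_chartRows (s : Params ρ σ m W Z) (g : RowIndex ρ σ m → ℂ) :
    pivot (∑ r, g r • chartRows ηH ηW ηZ s r) = Sum.elim (Sum.elim (fun i => g (Sum.inl (Sum.inl i)))
      fun l => (∑ i, g (Sum.inl (Sum.inl i)) * (s.2.1 i).1 l) + g (Sum.inl (Sum.inr l)))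
      fun j => g (Sum.inr j) := by
  ext ((i | i) | i) <;>
  simp [pivot, chartRows, pairRows, rowR, rowE, rowG, rowQ, isoRow, Fintype.sum_sum_type,
    Prod.fst_sum, Prod.snd_sum, Pi.single_apply, Finset.sum_apply]

theorem eq_zero_of_pivot_eq_zero {s : Params ρ σ m W Z} {x : ModelI ρ σ W × ModelQ m Z}
    (hx : x ∈ chartSpan ηH ηW ηZ s) (h : pivot x = 0) : x = 0 := by
  obtain ⟨g, rfl⟩ := (Submodule.mem_span_range_iff_exists_fun ℂ).1 hx
  rw [pivot_sum_chartRows] at h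
  have h1 : ∀ i, g (Sum.inl (Sum.inl i)) = 0 := fun i => congrFun h (Sum.inl (Sum.inl i))
  have h2 : ∀ i, g (Sum.inr i) = 0 := fun i => congrFun h (Sum.inr i)
  have h3 : ∀ l, g (Sum.inl (Sum.inr l)) = 0 := fun l => by
    have := congrFun h (Sum.inl (Sum.inr l))
    simpa [h1] using this
  refine Finset.sum_eq_zero ?_
  rintro ((i | i) | i) - <;> simp [h1, h2, h3]

theorem linearIndependent_chartRows (s : Params ρ σ m W Z) :
    LinearIndependent ℂ (chartRows ηH ηW ηZ s) := by
  rw [Fintype.linearIndependent_iff]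
  intro g hg
  have h := pivot_sum_chartRows (ηH := ηH) (ηW := ηW) (ηZ := ηZ) s g
  rw [hg, map_zero] at h
  have h1 : ∀ i, g (Sum.inl (Sum.inl i)) = 0 := fun i => (congrFun h (Sum.inl (Sum.inl i))).symm
  rintro ((i | l) | i)
  · exact h1 i
  · have := congrFun h (Sum.inl (Sum.inr l))
    simpa [h1] using this.symm
  · exact (congrFun h (Sum.inr i)).symm

theorem interLeft_chartSpan (s : Params ρ σ m W Z) : interLeft (chartSpan ηH ηW ηZ s) =
    Submodule.span ℂ (Set.range (Sum.elim (rowR ηH ηW s) (rowE ηH ηW s))) := by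
  apply le_antisymm
  · intro x hx
    obtain ⟨g, hg⟩ := (Submodule.mem_span_range_iff_exists_fun ℂ).1 hx
    have h := pivot_sum_chartRows (ηH := ηH) (ηW := ηW) (ηZ := ηZ) s g
    rw [hg] at h
    have h2 : ∀ i, g (Sum.inr i) = 0 := fun i => (congrFun h (Sum.inr i)).symm
    refine (Submodule.mem_span_range_iff_exists_fun ℂ).2 ⟨fun i => g (Sum.inl i), ?_⟩
    rw [Fintype.sum_sum_type] at hg
    simp only [h2, zero_smul, Finset.sum_const_zero, add_zero] at hg
    have := congrArg Prod.fst hg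
    simpa [Prod.fst_sum, chartRows, pairRows] using this
  · rw [Submodule.span_le]
    rintro _ ⟨i, rfl⟩
    exact Submodule.subset_span ⟨Sum.inl i, rfl⟩

theorem linearIndependent_rowsRE (s : Params ρ σ m W Z) :
    LinearIndependent ℂ (Sum.elim (rowR ηH ηW s) (rowE ηH ηW s)) := by
  have h : LinearIndependent ℂ (chartRows ηH ηW (0 : LinearMap.BilinForm ℂ Z) s ∘ Sum.inl) :=
    (linearIndependent_chartRows s).comp _ Sum.inl_injective
  exact LinearIndependent.of_comp (LinearMap.inl ℂ _ (ModelQ m Z)) h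

theorem linearIndependent_rowR (s : Params ρ σ m W Z) :
    LinearIndependent ℂ (rowR ηH ηW s) := by
  have h : LinearIndependent ℂ (Sum.elim (rowR ηH ηW s) (rowE ηH ηW s) ∘ Sum.inl) :=
    (linearIndependent_rowsRE s).comp _ Sum.inl_injective
  exact h

theorem modelFormI_isAlt (hH : ηH.IsAlt) (hW : ηW.IsAlt) : (modelFormI ηH ηW ρ).IsAlt :=
  hypForm_isAlt (prodForm_isAlt hH hW)

/-- `rowR` is orthogonal to itself and to `rowE`, while the form is nondegenerate on the span of
`rowE` by the Gram condition. -/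
theorem radical_chartSpan (hH : ηH.IsAlt) (hW : ηW.IsAlt) {s : Params ρ σ m W Z}
    (hs : chartGram ηH ηW s ≠ 0) : interLeft (chartSpan ηH ηW ηZ s) ⊓
      (modelFormI ηH ηW ρ).orthogonal (interLeft (chartSpan ηH ηW ηZ s)) =
      Submodule.span ℂ (Set.range (rowR ηH ηW s)) := by
  rw [interLeft_chartSpan]
  apply le_antisymm
  · rintro x ⟨hx, hx'⟩
    rw [SetLike.mem_coe, Set.Sum.elim_range, Submodule.span_union] at hx
    obtain ⟨r, hr, e, he, rfl⟩ := Submodule.mem_sup.1 hx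
    have : e = 0 := eq_zero_of_gram_ne_zero hs he fun l => by
      have h1 := (modelFormI_isAlt hH hW).isRefl _ _ (hx' _ (Submodule.subset_span ⟨Sum.inr l, rfl⟩))
      have h3 : modelFormI ηH ηW ρ r (rowE ηH ηW s l) = 0 :=
        apply_eq_zero_of_mem_span (fun i => modelForm_rowE s i l) hr
      rw [map_add, LinearMap.add_apply, Sum.elim_inr, h3, zero_add] at h1
      exact h1
    rwa [this, add_zero]
  · rw [Submodule.span_le]
    rintro _ ⟨i, rfl⟩
    refine ⟨Submodule.subset_span ⟨Sum.inl i, rfl⟩, fun x hx =>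
      (modelFormI_isAlt hH hW).isRefl _ _ (apply_eq_zero_of_mem_span_right ?_ hx)⟩
    rintro (j | j)
    · exact modelForm_rowR hH hW s i j
    · exact modelForm_rowE s i j

theorem isPairMember_chartSpan (hH : ηH.IsAlt) (hW : ηW.IsAlt) (hZ : ηZ.IsAlt)
    {s : Params ρ σ m W Z} (hs : chartGram ηH ηW s ≠ 0) {c : ℕ} (hc : ρ + σ + ρ = 2 * c) :
    IsPairMember (modelFormI ηH ηW ρ) (modelFormQ ηZ m) c (chartSpan ηH ηW ηZ s) := by
  refine ⟨?_, ?_⟩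
  · set B : LinearMap.BilinForm ℂ (ModelI ρ σ W × ModelQ m Z) :=
      (modelFormQ ηZ m).comp (LinearMap.snd ℂ _ _) (LinearMap.snd ℂ _ _) with hB
    have h0 : ∀ y, modelFormQ ηZ m 0 y = 0 := fun y => by rw [map_zero, LinearMap.zero_apply]
    have h1 : ∀ r r', B (chartRows ηH ηW ηZ s r) (chartRows ηH ηW ηZ s r') = 0 := by
      rintro (i | i) (j | j)
      · exact h0 _
      · exact h0 _
      · exact map_zero (modelFormQ ηZ m _)
      · exact modelForm_rowQ hZ s i j
    intro a ha b hb
    exact apply_eq_zero_of_mem_span (B := B)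
      (fun r => apply_eq_zero_of_mem_span_right (B := B) (h1 r) hb) ha
  · have h1 := finrank_span_eq_card (linearIndependent_rowsRE (ηH := ηH) (ηW := ηW) s)
    have h2 := finrank_span_eq_card (linearIndependent_rowR (ηH := ηH) (ηW := ηW) s)
    rw [radical_chartSpan hH hW hs, interLeft_chartSpan, h1, h2]
    simpa using hc

end Chart

/-! ### A member with a row reduced frame and nonzero Gram determinant lies in the chart -/

section ChartSurjective

open Module LinearMap.BilinForm

set_option linter.unusedSectionVars false

variable {ρ σ m : ℕ} {W Z : Type*} [AddCommGroup W] [Module ℂ W] [AddCommGroup Z] [Module ℂ Z]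
  [FiniteDimensional ℂ W] [FiniteDimensional ℂ Z]
  {ηH : LinearMap.BilinForm ℂ (Fin σ → ℂ)} {ηW : LinearMap.BilinForm ℂ W}
  {ηZ : LinearMap.BilinForm ℂ Z}

/-- A linear map that is injective on a subspace of the right dimension is onto. -/
theorem exists_mem_apply_eq {U : Type*} [AddCommGroup U] [Module ℂ U] [FiniteDimensional ℂ U]
    {ι : Type*} [Fintype ι] {E : Submodule ℂ U} (f : U →ₗ[ℂ] (ι → ℂ))
    (hinj : ∀ x ∈ E, f x = 0 → x = 0) (hd : Fintype.card ι ≤ finrank ℂ E) (t : ι → ℂ) :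
    ∃ x ∈ E, f x = t := by
  have h1 : Function.Injective (f.domRestrict E) := by
    rw [← LinearMap.ker_eq_bot, LinearMap.ker_eq_bot']
    exact fun x hx => Subtype.ext (hinj x x.2 hx)
  have h2 := LinearMap.finrank_le_finrank_of_injective h1
  rw [finrank_fintype_fun_eq_card] at h2
  have h3 : finrank ℂ E = finrank ℂ (ι → ℂ) := by
    rw [finrank_fintype_fun_eq_card]; omega
  obtain ⟨x, hx⟩ := (LinearMap.injective_iff_surjective_of_finrank_eq_finrank h3).1 h1 t
  exact ⟨x, x.2, hx⟩

theorem finrank_le_of_injOn {U : Type*} [AddCommGroup U] [Module ℂ U] [FiniteDimensional ℂ U]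
    {ι : Type*} [Fintype ι] {E : Submodule ℂ U} (f : U →ₗ[ℂ] (ι → ℂ))
    (hinj : ∀ x ∈ E, f x = 0 → x = 0) : finrank ℂ E ≤ Fintype.card ι := by
  have h1 : Function.Injective (f.domRestrict E) := by
    rw [← LinearMap.ker_eq_bot, LinearMap.ker_eq_bot']
    exact fun x hx => Subtype.ext (hinj x x.2 hx)
  have h2 := LinearMap.finrank_le_finrank_of_injective h1
  rwa [finrank_fintype_fun_eq_card] at h2

theorem eq_zero_of_pivot_rows {F : Submodule ℂ (ModelI ρ σ W × ModelQ m Z)}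
    (hk : finrank ℂ F = ρ + σ + m) {x : RowIndex ρ σ m → ModelI ρ σ W × ModelQ m Z}
    (hxF : ∀ r, x r ∈ F) (hx : ∀ r, pivot (x r) = Pi.single r 1)
    {y : ModelI ρ σ W × ModelQ m Z} (hy : y ∈ F) (h : pivot y = 0) : y = 0 := by
  have hLI : LinearIndependent ℂ x := by
    refine LinearIndependent.of_comp pivot ?_
    have : pivot ∘ x = fun r => Pi.single r (1 : ℂ) := funext hx
    rw [this]
    exact Pi.linearIndependent_single_one _ ℂ
  have hs : Submodule.span ℂ (Set.range x) = F := by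
    refine Submodule.eq_of_le_of_finrank_le (Submodule.span_le.2 (by
      rintro _ ⟨r, rfl⟩; exact hxF r)) ?_
    rw [finrank_span_eq_card hLI, hk]
    simp
  rw [← hs] at hy
  obtain ⟨g, rfl⟩ := (Submodule.mem_span_range_iff_exists_fun ℂ).1 hy
  simp only [map_sum, map_smul, hx] at h
  refine Finset.sum_eq_zero fun r _ => ?_
  have := congrFun h r
  simp [Pi.single_apply] at this
  rw [this, zero_smul]

/-- The pivots are coordinates on F. They force dim E = ρ + σ, so E is spanned by the first ρ + σ
reduced rows. The rows of the first group are then replaced by the basis of rad E dual to the first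
ρ coordinates, and all parameters are read off. -/
theorem exists_params (hH : ηH.IsAlt) (hW : ηW.IsAlt) (hZ : ηZ.IsAlt) {c : ℕ}
    {F : Submodule ℂ (ModelI ρ σ W × ModelQ m Z)}
    (hF : IsPairMember (modelFormI ηH ηW ρ) (modelFormQ ηZ m) c F) (hc : ρ + σ + ρ = 2 * c)
    (hr : ρ + σ ≤ finrank ℂ (interLeft F)) (hk : finrank ℂ F = ρ + σ + m)
    {x : RowIndex ρ σ m → ModelI ρ σ W × ModelQ m Z}
    (hxF : ∀ r, x r ∈ F) (hx : ∀ r, pivot (x r) = Pi.single r 1)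
    (hg : (Matrix.of fun l l' => modelFormI ηH ηW ρ (x (Sum.inl (Sum.inr l))).1
      (x (Sum.inl (Sum.inr l'))).1).det ≠ 0) :
    ∃ s, chartGram ηH ηW s ≠ 0 ∧ chartSpan ηH ηW ηZ s = F := by
  have hβ : (modelFormI ηH ηW ρ).IsAlt := modelFormI_isAlt hH hW
  have hinj : ∀ y ∈ F, pivot y = 0 → y = 0 := fun y hy => eq_zero_of_pivot_rows hk hxF hx hy
  let pE : ModelI ρ σ W →ₗ[ℂ] (Fin ρ ⊕ Fin σ → ℂ) :=
    LinearMap.funLeft ℂ ℂ Sum.inl ∘ₗ pivot ∘ₗ LinearMap.inl ℂ _ (ModelQ m Z)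
  have hpE : ∀ y ∈ interLeft F, pE y = 0 → y = 0 := fun y hy h => by
    have : pivot (y, (0 : ModelQ m Z)) = 0 := by
      ext (a | j)
      · exact congrFun h a
      · rfl
    exact congrArg Prod.fst (hinj _ hy this)
  have hE : finrank ℂ (interLeft F) = ρ + σ :=
    le_antisymm ((finrank_le_of_injOn pE hpE).trans (by simp)) hr
  -- E already contains a vector with the same pivots, and pivots determine elements of F.
  have hxE : ∀ a, (x (Sum.inl a)).2 = 0 := fun a => by
    obtain ⟨y, hy, hya⟩ := exists_mem_apply_eq pE hpE (by simp [hE]) (Pi.single a 1)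
    have h1 : pivot (x (Sum.inl a) - (y, 0)) = 0 := by
      rw [map_sub, hx, sub_eq_zero]
      ext (b | j)
      · have := congrFun hya b
        simp only [Pi.single_apply, Sum.inl.injEq] at this ⊢
        exact this.symm
      · simp [pivot]
    have h2 := hinj _ (F.sub_mem (hxF _) hy) h1
    have h3 := congrArg Prod.snd (sub_eq_zero.1 h2)
    exact h3
  have hxE' : ∀ a, (x (Sum.inl a)).1 ∈ interLeft F := fun a => by
    rw [mem_interLeft, ← hxE a]
    exact hxF _
  have hx1 : ∀ r i, (x r).1.1 i = (Pi.single r 1 : RowIndex ρ σ m → ℂ) (Sum.inl (Sum.inl i)) :=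
    fun r i => congrFun (hx r) (Sum.inl (Sum.inl i))
  have hx2 : ∀ r i, (x r).1.2.2.1 i =
      (Pi.single r 1 : RowIndex ρ σ m → ℂ) (Sum.inl (Sum.inr i)) :=
    fun r i => congrFun (hx r) (Sum.inl (Sum.inr i))
  have hx3 : ∀ r i, (x r).2.1 i = (Pi.single r 1 : RowIndex ρ σ m → ℂ) (Sum.inr i) :=
    fun r i => congrFun (hx r) (Sum.inr i)
  set E : Fin σ → ModelI ρ σ W := fun l => (x (Sum.inl (Sum.inr l))).1 with hEdef
  have hrad : finrank ℂ (interLeft F ⊓ (modelFormI ηH ηW ρ).orthogonal (interLeft F) :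
      Submodule ℂ (ModelI ρ σ W)) = ρ := by
    have := hF.rank
    omega
  -- A radical vector whose first coordinates vanish is a combination of the σ middle rows and
  -- orthogonal to them, hence zero by the Gram condition. As the radical has dimension ρ, the first
  -- coordinates are bijective on it.
  have hRex : ∀ i, ∃ y ∈ (interLeft F ⊓ (modelFormI ηH ηW ρ).orthogonal (interLeft F) :
      Submodule ℂ (ModelI ρ σ W)), y.1 = Pi.single i 1 := by
    intro i
    let p1 : ModelI ρ σ W →ₗ[ℂ] (Fin ρ → ℂ) := LinearMap.fst ℂ _ _
    refine exists_mem_apply_eq p1 (fun y hy h => ?_) (by rw [hrad]; simp) _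
    have h' : y.1 = 0 := h
    have hys : y = ∑ l, y.2.2.1 l • E l := by
      have h1 : y - ∑ l, y.2.2.1 l • E l ∈ interLeft F := Submodule.sub_mem _ hy.1
        (Submodule.sum_mem _ fun l _ => Submodule.smul_mem _ _ (hxE' _))
      refine sub_eq_zero.1 (hpE _ h1 ?_)
      ext (a | a)
      · simp [pE, pivot, LinearMap.funLeft_apply, h', Prod.fst_sum, hEdef, hx1]
      · simp [pE, pivot, LinearMap.funLeft_apply, Prod.fst_sum, Prod.snd_sum, hEdef, hx2,
          Pi.single_apply]
    refine eq_zero_of_gram_ne_zero hg ?_ fun l => hβ.isRefl _ _ (hy.2 _ (hxE' _))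
    rw [hys]
    exact Submodule.sum_mem _ fun l _ => Submodule.smul_mem _ _ (Submodule.subset_span ⟨l, rfl⟩)
  choose R hR hR1 using hRex
  obtain ⟨S, hS⟩ := exists_eq_isoRow (prodForm_isAlt hH hW) hR1
    fun i j => (hR j).2 _ (hR i).1
  obtain ⟨S', hS'⟩ := exists_eq_isoRow hZ (x := fun j => (x (Sum.inr j)).2) (fun j => by
    ext i
    rw [hx3]
    simp [Pi.single_apply]) fun i j => hF.isotropic _ (hxF _) _ (hxF _)
  let s : Params ρ σ m W Z := (S, fun i => (R i).2.2, fun l => (E l).2.2.2, S',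
    fun j => (x (Sum.inr j)).2.2.2, fun j i => (x (Sum.inr j)).1.2.1 i +
      ηW (R i).2.2.2 (x (Sum.inr j)).1.2.2.2, fun j => (x (Sum.inr j)).1.2.2.2)
  have e1 : ∀ i, rowR ηH ηW s i = R i := fun i => (congrFun hS i).symm
  have e2 : ∀ l, rowE ηH ηW s l = E l := fun l => by
    have h1 : (E l).1 = 0 := by
      ext i
      simp [hEdef, hx1]
    have h2 : (E l).2.2.1 = Pi.single l 1 := by
      ext i
      simp [hEdef, hx2, Pi.single_apply]
    refine Prod.ext h1.symm (Prod.ext ?_ (Prod.ext h2.symm rfl))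
    ext i
    have h3 : modelFormI ηH ηW ρ (R i) (E l) = 0 := hβ.isRefl _ _ ((hR i).2 _ (hxE' _))
    rw [hypForm_apply, hR1, h1, single_one_dotProduct, dotProduct_zero, sub_zero] at h3
    rw [eq_neg_of_add_eq_zero_left h3]
    simp only [rowE, s, ← h2]
  have e3 : ∀ j, (rowG ηW s j, rowQ ηZ s j) = x (Sum.inr j) := fun j => by
    refine Prod.ext (Prod.ext ?_ (Prod.ext ?_ (Prod.ext ?_ rfl))) (congrFun hS' j).symm
    · ext i
      simp [rowG, hx1]
    · ext i
      simp [rowG, s]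
    · ext i
      simp [rowG, hx2]
  refine ⟨s, ?_, ?_⟩
  · simpa only [chartGram, e2] using hg
  · refine Submodule.eq_of_le_of_finrank_le (Submodule.span_le.2 ?_) ?_
    · rintro _ ⟨((i | l) | j), rfl⟩
      · show (rowR ηH ηW s i, (0 : ModelQ m Z)) ∈ F
        rw [e1]
        exact (hR i).1
      · show (rowE ηH ηW s l, (0 : ModelQ m Z)) ∈ F
        rw [e2]
        exact hxE' _
      · show (rowG ηW s j, rowQ ηZ s j) ∈ F
        rw [e3]
        exact hxF _
    · rw [chartSpan, finrank_span_eq_card (linearIndependent_chartRows s), hk]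
      simp

end ChartSurjective

/-! ### Rational recovery of the parameters from an arbitrary frame -/

section ChartRational

open Module LinearMap.BilinForm

set_option linter.unusedSectionVars false

section

variable {S A B : Type*} [AddCommGroup S] [Module ℂ S] [AddCommGroup A] [Module ℂ A]
  [AddCommGroup B] [Module ℂ B]

theorem isPolyMap_id : IsPolyMap fun s : S => s := isPolyMap_linear LinearMap.id

theorem IsPolyMap.fst {f : S → A × B} (hf : IsPolyMap f) : IsPolyMap fun s => (f s).1 :=
  (isPolyMap_prod.1 hf).1

theorem IsPolyMap.snd {f : S → A × B} (hf : IsPolyMap f) : IsPolyMap fun s => (f s).2 :=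
  (isPolyMap_prod.1 hf).2

theorem IsPolyMap.apply {ι : Type*} {f : S → ι → A} (hf : IsPolyMap f) (i : ι) :
    IsPolyMap fun s => f s i :=
  hf.linear_comp (LinearMap.proj i : (ι → A) →ₗ[ℂ] A)

/-- Clearing denominators. -/
theorem exists_homogenization {f : S → ℂ} (hf : f ∈ PolyFun S) :
    ∃ (N : ℕ) (g : S × ℂ → ℂ), g ∈ PolyFun (S × ℂ) ∧ ∀ s t, g (t • s, t) = t ^ N * f s := by
  have ht : (fun x : S × ℂ => x.2) ∈ PolyFun (S × ℂ) := (isPolyMap_id.snd).mem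
  induction hf using Algebra.adjoin_induction with
  | mem f hf =>
    obtain ⟨φ, rfl⟩ := hf
    exact ⟨1, fun x => φ x.1, dual_mem_polyFun (φ ∘ₗ LinearMap.fst ℂ S ℂ), fun s t => by simp⟩
  | algebraMap c => exact ⟨0, fun _ => c, const_mem_polyFun c, fun s t => by simp⟩
  | add f g _ _ hf hg =>
    obtain ⟨N, f', hf', hf''⟩ := hf
    obtain ⟨M, g', hg', hg''⟩ := hg
    refine ⟨N + M, (fun x => x.2) ^ M * f' + (fun x => x.2) ^ N * g',
      (PolyFun _).add_mem ((PolyFun _).mul_mem ((PolyFun _).pow_mem ht _) hf')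
        ((PolyFun _).mul_mem ((PolyFun _).pow_mem ht _) hg'), fun s t => ?_⟩
    simp only [Pi.add_apply, Pi.mul_apply, Pi.pow_apply, hf'', hg'']
    ring
  | mul f g _ _ hf hg =>
    obtain ⟨N, f', hf', hf''⟩ := hf
    obtain ⟨M, g', hg', hg''⟩ := hg
    refine ⟨N + M, f' * g', (PolyFun _).mul_mem hf' hg', fun s t => ?_⟩
    simp only [Pi.mul_apply, hf'', hg'']
    ring

theorem isPolyMap_isoRow [FiniteDimensional ℂ A] {ρ : ℕ} {η : LinearMap.BilinForm ℂ A}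
    {s : S → Sym2 (Fin ρ) → ℂ} {w : S → Fin ρ → A} (hs : IsPolyMap s) (hw : IsPolyMap w)
    (i : Fin ρ) : IsPolyMap fun x => isoRow η (s x) (w x) i := by
  refine isPolyMap_prod.2 ⟨isPolyMap_const _, isPolyMap_prod.2 ⟨isPolyMap_pi.2 fun j => ?_,
    hw.apply i⟩⟩
  exact (hs.apply _).add (isPolyMap_of_mem ((PolyFun S).mul_mem (const_mem_polyFun (1 / 2))
    ((hw.apply i).bilin (hw.apply j) η)))

end

variable {ρ σ m : ℕ} {W Z : Type*} [AddCommGroup W] [Module ℂ W] [AddCommGroup Z] [Module ℂ Z]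
  [FiniteDimensional ℂ W] [FiniteDimensional ℂ Z]
  (ηH : LinearMap.BilinForm ℂ (Fin σ → ℂ)) (ηW : LinearMap.BilinForm ℂ W)
  {ηZ : LinearMap.BilinForm ℂ Z}

variable {ηH ηW} in
theorem isPolyMap_rowE (l : Fin σ) :
    IsPolyMap fun s : Params ρ σ m W Z => rowE ηH ηW s l := by
  have h0 : IsPolyMap fun s : Params ρ σ m W Z => s := isPolyMap_id
  have hy : IsPolyMap fun s : Params ρ σ m W Z => s.2.2.1 l := h0.snd.snd.fst.apply l
  have hw : ∀ i, IsPolyMap fun s : Params ρ σ m W Z => s.2.1 i := fun i => h0.snd.fst.apply i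
  have he : IsPolyMap fun s : Params ρ σ m W Z => ((Pi.single l 1 : Fin σ → ℂ), s.2.2.1 l) :=
    isPolyMap_prod.2 ⟨isPolyMap_const _, hy⟩
  have hb : IsPolyMap fun (s : Params ρ σ m W Z) (i : Fin ρ) =>
      -prodForm ηH ηW (s.2.1 i) (Pi.single l 1, s.2.2.1 l) :=
    isPolyMap_pi.2 fun i => (isPolyMap_of_mem ((hw i).bilin he (prodForm ηH ηW))).neg
  exact isPolyMap_prod.2 ⟨isPolyMap_const _, isPolyMap_prod.2 ⟨hb, he⟩⟩

variable {ηW} in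
theorem isPolyMap_rowG (j : Fin m) :
    IsPolyMap fun s : Params ρ σ m W Z => rowG ηW s j := by
  have h0 : IsPolyMap fun s : Params ρ σ m W Z => s := isPolyMap_id
  have h1 : IsPolyMap fun s : Params ρ σ m W Z => s.2.2.2.2.2 := h0.snd.snd.snd.snd.snd
  have hy : IsPolyMap fun s : Params ρ σ m W Z => s.2.2.2.2.2.2 j := h1.snd.apply j
  have hw : ∀ i, IsPolyMap fun s : Params ρ σ m W Z => (s.2.1 i).2 :=
    fun i => (h0.snd.fst.apply i).snd
  have hb : IsPolyMap fun (s : Params ρ σ m W Z) (i : Fin ρ) =>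
      s.2.2.2.2.2.1 j i - ηW (s.2.1 i).2 (s.2.2.2.2.2.2 j) :=
    isPolyMap_pi.2 fun i => ((h1.fst.apply j).apply i).sub
      (isPolyMap_of_mem ((hw i).bilin hy ηW))
  exact isPolyMap_prod.2 ⟨isPolyMap_const _, isPolyMap_prod.2 ⟨hb, isPolyMap_prod.2
    ⟨isPolyMap_const _, hy⟩⟩⟩

variable {ηH ηW} in
theorem isPolyMap_chartRows (r : RowIndex ρ σ m) :
    IsPolyMap fun s : Params ρ σ m W Z => chartRows ηH ηW ηZ s r := by
  have h0 : IsPolyMap fun s : Params ρ σ m W Z => s := isPolyMap_id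
  rcases r with ((i | l) | j)
  · exact isPolyMap_prod.2 ⟨isPolyMap_isoRow h0.fst h0.snd.fst i, isPolyMap_const _⟩
  · exact isPolyMap_prod.2 ⟨isPolyMap_rowE l, isPolyMap_const _⟩
  · have hQ : IsPolyMap fun s : Params ρ σ m W Z => rowQ ηZ s j :=
      isPolyMap_isoRow h0.snd.snd.snd.fst h0.snd.snd.snd.snd.fst j
    exact isPolyMap_prod.2 ⟨isPolyMap_rowG j, hQ⟩

/-- The matrix of the pivot coordinates of a tuple. -/
def pivotMatrix (c : RowIndex ρ σ m → ModelI ρ σ W × ModelQ m Z) :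
    Matrix (RowIndex ρ σ m) (RowIndex ρ σ m) ℂ := Matrix.of fun r r' => pivot (c r) r'

/-- The row reduction of a tuple, up to a factor. -/
noncomputable def reducedRows (c : RowIndex ρ σ m → ModelI ρ σ W × ModelQ m Z)
    (r : RowIndex ρ σ m) : ModelI ρ σ W × ModelQ m Z :=
  ∑ r', (pivotMatrix c).adjugate r r' • c r'

/-- The pairings of the second group of reduced rows. -/
noncomputable def reducedGram (c : RowIndex ρ σ m → ModelI ρ σ W × ModelQ m Z) :
    Matrix (Fin σ) (Fin σ) ℂ := Matrix.of fun l l' => modelFormI ηH ηW ρ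
      (reducedRows c (Sum.inl (Sum.inr l))).1 (reducedRows c (Sum.inl (Sum.inr l'))).1

/-- The pairings of the first and the second group of reduced rows. -/
noncomputable def reducedPairing (c : RowIndex ρ σ m → ModelI ρ σ W × ModelQ m Z) :
    Matrix (Fin ρ) (Fin σ) ℂ := Matrix.of fun i l => modelFormI ηH ηW ρ
      (reducedRows c (Sum.inl (Sum.inl i))).1 (reducedRows c (Sum.inl (Sum.inr l))).1

/-- The common factor of the recovered rows. -/
noncomputable def recoverFactor (c : RowIndex ρ σ m → ModelI ρ σ W × ModelQ m Z) : ℂ :=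
  (reducedGram ηH ηW c).det * (pivotMatrix c).det

/-- The rows of the chart recovered, up to a factor, from an arbitrary frame. -/
noncomputable def recoverRows (c : RowIndex ρ σ m → ModelI ρ σ W × ModelQ m Z) :
    RowIndex ρ σ m → ModelI ρ σ W × ModelQ m Z
  | Sum.inl (Sum.inl i) => (reducedGram ηH ηW c).det • reducedRows c (Sum.inl (Sum.inl i)) -
      ∑ l, (∑ l', reducedPairing ηH ηW c i l' * (reducedGram ηH ηW c).adjugate l' l) •
        reducedRows c (Sum.inl (Sum.inr l))
  | Sum.inl (Sum.inr l) => (reducedGram ηH ηW c).det • reducedRows c (Sum.inl (Sum.inr l))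
  | Sum.inr j => (reducedGram ηH ηW c).det • reducedRows c (Sum.inr j)

variable {ηH ηW}

theorem pivotMatrix_mem_polyFun (r r' : RowIndex ρ σ m) :
    (fun c : RowIndex ρ σ m → ModelI ρ σ W × ModelQ m Z => pivotMatrix c r r') ∈ PolyFun _ := by
  let φ : Module.Dual ℂ (RowIndex ρ σ m → ModelI ρ σ W × ModelQ m Z) :=
    (LinearMap.proj r' : (RowIndex ρ σ m → ℂ) →ₗ[ℂ] ℂ) ∘ₗ pivot ∘ₗ LinearMap.proj r
  exact dual_mem_polyFun φ

theorem isPolyMap_reducedRows (r : RowIndex ρ σ m) :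
    IsPolyMap fun c : RowIndex ρ σ m → ModelI ρ σ W × ModelQ m Z => reducedRows c r :=
  IsPolyMap.sum _ fun r' _ => IsPolyMap.smul
    (adjugate_mem_polyFun pivotMatrix_mem_polyFun r r') (isPolyMap_id.apply r')

theorem reducedGram_mem_polyFun (l l' : Fin σ) :
    (fun c : RowIndex ρ σ m → ModelI ρ σ W × ModelQ m Z => reducedGram ηH ηW c l l') ∈ PolyFun _ := by
  have h := isPolyMap_reducedRows (ρ := ρ) (σ := σ) (m := m) (W := W) (Z := Z)
  exact (h (Sum.inl (Sum.inr l))).fst.bilin (h (Sum.inl (Sum.inr l'))).fst (modelFormI ηH ηW ρ)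

theorem reducedPairing_mem_polyFun (i : Fin ρ) (l : Fin σ) :
    (fun c : RowIndex ρ σ m → ModelI ρ σ W × ModelQ m Z => reducedPairing ηH ηW c i l) ∈
      PolyFun _ := by
  have h := isPolyMap_reducedRows (ρ := ρ) (σ := σ) (m := m) (W := W) (Z := Z)
  exact (h (Sum.inl (Sum.inl i))).fst.bilin (h (Sum.inl (Sum.inr l))).fst (modelFormI ηH ηW ρ)

theorem recoverFactor_mem_polyFun : (fun c : RowIndex ρ σ m → ModelI ρ σ W × ModelQ m Z =>
    recoverFactor ηH ηW c) ∈ PolyFun _ :=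
  (PolyFun _).mul_mem (det_mem_polyFun reducedGram_mem_polyFun)
    (det_mem_polyFun pivotMatrix_mem_polyFun)

theorem isPolyMap_recoverRows (r : RowIndex ρ σ m) :
    IsPolyMap fun c : RowIndex ρ σ m → ModelI ρ σ W × ModelQ m Z => recoverRows ηH ηW c r := by
  have hG := reducedGram_mem_polyFun (ηH := ηH) (ηW := ηW) (ρ := ρ) (m := m) (Z := Z)
  have hP := reducedPairing_mem_polyFun (ηH := ηH) (ηW := ηW) (ρ := ρ) (m := m) (Z := Z)
  have h1 := det_mem_polyFun hG
  rcases r with ((i | l) | j)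
  · have h2 : ∀ l, (fun c : RowIndex ρ σ m → ModelI ρ σ W × ModelQ m Z =>
        ∑ l', reducedPairing ηH ηW c i l' * (reducedGram ηH ηW c).adjugate l' l) ∈ PolyFun _ :=
      fun l => (IsPolyMap.sum _ fun l' _ => isPolyMap_of_mem ((PolyFun _).mul_mem
        (hP i l') (adjugate_mem_polyFun hG l' l))).mem
    exact (IsPolyMap.smul h1 (isPolyMap_reducedRows _)).sub
      (IsPolyMap.sum _ fun l _ => IsPolyMap.smul (h2 l) (isPolyMap_reducedRows _))
  · exact IsPolyMap.smul h1 (isPolyMap_reducedRows _)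
  · exact IsPolyMap.smul h1 (isPolyMap_reducedRows _)

theorem pivot_reducedRows (c : RowIndex ρ σ m → ModelI ρ σ W × ModelQ m Z) (r : RowIndex ρ σ m) :
    pivot (reducedRows c r) = (pivotMatrix c).det • Pi.single r 1 := by
  ext r'
  have h := congrFun (congrFun (Matrix.adjugate_mul (pivotMatrix c)) r) r'
  rw [Matrix.mul_apply] at h
  simp only [reducedRows, map_sum, map_smul, Finset.sum_apply, Pi.smul_apply, smul_eq_mul]
  refine h.trans ?_
  simp [Matrix.one_apply, Pi.single_apply, eq_comm]

/-- The row reduced basis of a member of the chart. -/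
noncomputable def tildeRows (ηH : LinearMap.BilinForm ℂ (Fin σ → ℂ)) (ηW : LinearMap.BilinForm ℂ W)
    (ηZ : LinearMap.BilinForm ℂ Z) (s : Params ρ σ m W Z) :
    RowIndex ρ σ m → ModelI ρ σ W × ModelQ m Z
  | Sum.inl (Sum.inl i) => chartRows ηH ηW ηZ s (Sum.inl (Sum.inl i)) -
      ∑ l, (s.2.1 i).1 l • chartRows ηH ηW ηZ s (Sum.inl (Sum.inr l))
  | Sum.inl (Sum.inr l) => chartRows ηH ηW ηZ s (Sum.inl (Sum.inr l))
  | Sum.inr j => chartRows ηH ηW ηZ s (Sum.inr j)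

theorem chartRows_mem (s : Params ρ σ m W Z) (r) :
    chartRows ηH ηW ηZ s r ∈ chartSpan ηH ηW ηZ s := Submodule.subset_span ⟨r, rfl⟩

theorem tildeRows_mem (s : Params ρ σ m W Z) (r) :
    tildeRows ηH ηW ηZ s r ∈ chartSpan ηH ηW ηZ s := by
  rcases r with ((i | l) | j)
  · exact Submodule.sub_mem _ (chartRows_mem s _)
      (Submodule.sum_mem _ fun l _ => Submodule.smul_mem _ _ (chartRows_mem s _))
  · exact chartRows_mem s _
  · exact chartRows_mem s _

theorem pivot_tildeRows (s : Params ρ σ m W Z) (r) :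
    pivot (tildeRows ηH ηW ηZ s r) = Pi.single r 1 := by
  rcases r with ((i | l) | j) <;> ext ((i' | l') | j') <;>
  simp [tildeRows, pivot, chartRows, pairRows, rowR, rowE, rowG, rowQ, isoRow, Pi.single_apply,
    Prod.fst_sum, Prod.snd_sum, Finset.sum_apply]

/-- Both sides lie in the chart subspace and have the same pivots. -/
theorem reducedRows_eq {s : Params ρ σ m W Z} {c : RowIndex ρ σ m → ModelI ρ σ W × ModelQ m Z}
    (hc : ∀ r, c r ∈ chartSpan ηH ηW ηZ s) (r : RowIndex ρ σ m) :
    reducedRows c r = (pivotMatrix c).det • tildeRows ηH ηW ηZ s r := by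
  refine sub_eq_zero.1 (eq_zero_of_pivot_eq_zero (s := s) (ηH := ηH) (ηW := ηW) (ηZ := ηZ)
    (Submodule.sub_mem _ (Submodule.sum_mem _ fun r' _ => Submodule.smul_mem _ _ (hc r'))
    (Submodule.smul_mem _ _ (tildeRows_mem s r))) ?_)
  rw [map_sub, pivot_reducedRows, map_smul, pivot_tildeRows, sub_self]

theorem reducedGram_eq {s : Params ρ σ m W Z} {c : RowIndex ρ σ m → ModelI ρ σ W × ModelQ m Z}
    (hc : ∀ r, c r ∈ chartSpan ηH ηW ηZ s) : reducedGram ηH ηW c =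
      (pivotMatrix c).det ^ 2 • Matrix.of fun l l' =>
        modelFormI ηH ηW ρ (rowE ηH ηW s l) (rowE ηH ηW s l') := by
  ext l l'
  have h : ∀ l, (reducedRows c (Sum.inl (Sum.inr l))).1 =
      (pivotMatrix c).det • rowE ηH ηW s l := fun l => by
    rw [reducedRows_eq hc]; rfl
  simp only [reducedGram, Matrix.of_apply, Matrix.smul_apply, h, map_smul, LinearMap.smul_apply,
    smul_eq_mul]
  ring

/-- Up to the pivot determinant, a reduced row of the first group is `rowR` minus a combination of
`rowE`. As `rowR` is orthogonal to `rowE`, the pairing sees only this combination. -/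
theorem reducedPairing_eq {s : Params ρ σ m W Z}
    {c : RowIndex ρ σ m → ModelI ρ σ W × ModelQ m Z}
    (hc : ∀ r, c r ∈ chartSpan ηH ηW ηZ s) : reducedPairing ηH ηW c =
      -((Matrix.of fun i l => (s.2.1 i).1 l) * reducedGram ηH ηW c) := by
  rw [reducedGram_eq hc]
  ext i l
  have h : (reducedRows c (Sum.inl (Sum.inr l))).1 =
      (pivotMatrix c).det • rowE ηH ηW s l := by rw [reducedRows_eq hc]; rfl
  have h2 : (reducedRows c (Sum.inl (Sum.inl i))).1 = (pivotMatrix c).det •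
      (rowR ηH ηW s i - ∑ l, (s.2.1 i).1 l • rowE ηH ηW s l) := by
    rw [reducedRows_eq hc, Prod.smul_fst]
    congr 1
    simp [tildeRows, Prod.fst_sum, chartRows, pairRows]
  rw [reducedPairing, Matrix.of_apply, h, h2, Matrix.neg_apply, Matrix.mul_apply]
  simp only [map_smul, LinearMap.smul_apply, map_sub, LinearMap.sub_apply, map_sum,
    LinearMap.sum_apply, modelForm_rowE, zero_sub, smul_eq_mul, Matrix.of_apply, Matrix.smul_apply,
    mul_neg, Finset.mul_sum]
  congr 1
  exact Finset.sum_congr rfl fun _ _ => by ring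

/-- By Cramer's rule the coefficients of the combination of `rowE` are obtained from the pairings up
to the Gram determinant; adding the combination back gives `rowR`. -/
theorem recoverRows_eq {s : Params ρ σ m W Z} {c : RowIndex ρ σ m → ModelI ρ σ W × ModelQ m Z}
    (hc : ∀ r, c r ∈ chartSpan ηH ηW ηZ s) :
    recoverRows ηH ηW c = recoverFactor ηH ηW c • chartRows ηH ηW ηZ s := by
  have hadj : ∀ i l, ∑ l', reducedPairing ηH ηW c i l' * (reducedGram ηH ηW c).adjugate l' l =
      -((reducedGram ηH ηW c).det * (s.2.1 i).1 l) := fun i l => by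
    rw [← Matrix.mul_apply, reducedPairing_eq hc, Matrix.neg_mul, Matrix.mul_assoc,
      Matrix.mul_adjugate]
    simp
  ext1 r
  rcases r with ((i | l) | j)
  · simp only [recoverRows, hadj, reducedRows_eq hc, Pi.smul_apply, recoverFactor, tildeRows,
      smul_sub, Finset.smul_sum, smul_smul]
    rw [sub_sub, sub_eq_self, ← Finset.sum_add_distrib]
    refine Finset.sum_eq_zero fun l _ => ?_
    rw [← add_smul]
    convert zero_smul ℂ _ using 2
    ring
  · simp only [recoverRows, reducedRows_eq hc, Pi.smul_apply, recoverFactor, tildeRows, smul_smul]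
  · simp only [recoverRows, reducedRows_eq hc, Pi.smul_apply, recoverFactor, tildeRows, smul_smul]

theorem recoverFactor_ne_zero {s : Params ρ σ m W Z} (hs : chartGram ηH ηW s ≠ 0)
    {c : RowIndex ρ σ m → ModelI ρ σ W × ModelQ m Z} (hLI : LinearIndependent ℂ c)
    (hc : ∀ r, c r ∈ chartSpan ηH ηW ηZ s) : recoverFactor ηH ηW c ≠ 0 := by
  have h1 : (pivotMatrix c).det ≠ 0 := by
    intro hdet
    obtain ⟨v, hv, hv0⟩ := Matrix.exists_vecMul_eq_zero_iff.2 hdet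
    have h2 : ∑ r, v r • c r = 0 := by
      refine eq_zero_of_pivot_eq_zero (s := s) (ηH := ηH) (ηW := ηW) (ηZ := ηZ)
        (Submodule.sum_mem _ fun r _ => Submodule.smul_mem _ _ (hc r)) ?_
      ext r'
      have := congrFun hv0 r'
      simpa [Matrix.vecMul, dotProduct, pivotMatrix, map_sum, Finset.sum_apply] using this
    exact hv (funext (Fintype.linearIndependent_iff.1 hLI v h2))
  refine mul_ne_zero ?_ h1
  rw [reducedGram_eq hc, Matrix.det_smul]
  exact mul_ne_zero (pow_ne_zero _ (pow_ne_zero _ h1)) hs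

/-- The parameters read off from the rows. -/
noncomputable def readParams (ηW : LinearMap.BilinForm ℂ W)
    (x : RowIndex ρ σ m → ModelI ρ σ W × ModelQ m Z) : Params ρ σ m W Z :=
  (Sym2.lift ⟨fun i j => 1 / 2 * ((x (Sum.inl (Sum.inl i))).1.2.1 j +
      (x (Sum.inl (Sum.inl j))).1.2.1 i), fun i j => by dsimp only; rw [add_comm]⟩,
    fun i => (x (Sum.inl (Sum.inl i))).1.2.2, fun l => (x (Sum.inl (Sum.inr l))).1.2.2.2,
    Sym2.lift ⟨fun i j => 1 / 2 * ((x (Sum.inr i)).2.2.1 j + (x (Sum.inr j)).2.2.1 i),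
      fun i j => by dsimp only; rw [add_comm]⟩,
    fun j => (x (Sum.inr j)).2.2.2,
    fun j i => (x (Sum.inr j)).1.2.1 i +
      ηW (x (Sum.inl (Sum.inl i))).1.2.2.2 (x (Sum.inr j)).1.2.2.2,
    fun j => (x (Sum.inr j)).1.2.2.2)

theorem isPolyMap_readParams : IsPolyMap fun x : RowIndex ρ σ m → ModelI ρ σ W × ModelQ m Z =>
    readParams ηW x := by
  have h0 : ∀ r, IsPolyMap fun x : RowIndex ρ σ m → ModelI ρ σ W × ModelQ m Z => x r :=
    fun r => isPolyMap_id.apply r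
  refine isPolyMap_prod.2 ⟨isPolyMap_pi.2 fun p => ?_, isPolyMap_prod.2 ⟨isPolyMap_pi.2 fun i =>
    (h0 _).fst.snd.snd, isPolyMap_prod.2 ⟨isPolyMap_pi.2 fun l => (h0 _).fst.snd.snd.snd,
    isPolyMap_prod.2 ⟨isPolyMap_pi.2 fun p => ?_, isPolyMap_prod.2 ⟨isPolyMap_pi.2 fun j =>
    (h0 _).snd.snd.snd, isPolyMap_prod.2 ⟨isPolyMap_pi.2 fun j => isPolyMap_pi.2 fun i => ?_,
    isPolyMap_pi.2 fun j => (h0 _).fst.snd.snd.snd⟩⟩⟩⟩⟩⟩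
  · induction p using Sym2.ind with
    | h i j => exact isPolyMap_of_mem ((PolyFun _).mul_mem (const_mem_polyFun (1 / 2))
        (((h0 _).fst.snd.fst.apply j).add ((h0 _).fst.snd.fst.apply i)).mem)
  · induction p using Sym2.ind with
    | h i j => exact isPolyMap_of_mem ((PolyFun _).mul_mem (const_mem_polyFun (1 / 2))
        (((h0 _).snd.snd.fst.apply j).add ((h0 _).snd.snd.fst.apply i)).mem)
  · exact ((h0 _).fst.snd.fst.apply i).add
      (isPolyMap_of_mem ((h0 _).fst.snd.snd.snd.bilin (h0 _).fst.snd.snd.snd ηW))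

/-- Symmetrization removes the half of the alternating form that `isoRow` adds to the symmetric
matrix. -/
theorem readParams_chartRows (hH : ηH.IsAlt) (hW : ηW.IsAlt) (hZ : ηZ.IsAlt)
    (s : Params ρ σ m W Z) : readParams ηW (chartRows ηH ηW ηZ s) = s := by
  refine Prod.ext ?_ (Prod.ext rfl (Prod.ext rfl (Prod.ext ?_ (Prod.ext rfl (Prod.ext ?_ rfl)))))
  · ext p
    induction p using Sym2.ind with
    | h i j =>
      have h := (prodForm_isAlt hH hW).neg_eq (s.2.1 i) (s.2.1 j)
      simp only [readParams, Sym2.lift_mk, chartRows, pairRows, Sum.elim_inl, rowR, isoRow]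
      rw [Sym2.eq_swap (a := j)]
      linear_combination -(1 / 4) * h
  · ext p
    induction p using Sym2.ind with
    | h i j =>
      have h := hZ.neg_eq (s.2.2.2.2.1 i) (s.2.2.2.2.1 j)
      simp only [readParams, Sym2.lift_mk, chartRows, pairRows, Sum.elim_inr, rowQ, isoRow]
      rw [Sym2.eq_swap (a := j)]
      linear_combination -(1 / 4) * h
  · ext j i
    simp [readParams, chartRows, pairRows, rowR, rowG, isoRow]

end ChartRational

/-! ### The dimension of a set that is linear on the chart -/

section ChartDimension

open Module LinearMap.BilinForm

variable {ρ σ m : ℕ} {W Z : Type*} [AddCommGroup W] [Module ℂ W] [AddCommGroup Z] [Module ℂ Z]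
  [FiniteDimensional ℂ W] [FiniteDimensional ℂ Z]
  {ηH : LinearMap.BilinForm ℂ (Fin σ → ℂ)} {ηW : LinearMap.BilinForm ℂ W}
  {ηZ : LinearMap.BilinForm ℂ Z}

theorem chartGram_mem_polyFun :
    (fun s : Params ρ σ m W Z => chartGram ηH ηW s) ∈ PolyFun (Params ρ σ m W Z) :=
  det_mem_polyFun fun l l' => (isPolyMap_rowE l).bilin (isPolyMap_rowE l') (modelFormI ηH ηW ρ)

/-- A set of subspaces that is, on the chart, given by a linear subspace of the parameters and an
open condition, has the dimension of this linear subspace. -/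
theorem topologicalKrullDim_eq_of_chart (hH : ηH.IsAlt) (hW : ηW.IsAlt) (hZ : ηZ.IsAlt) {k c : ℕ}
    (hc : ρ + σ + ρ = 2 * c) (hk : ρ + σ + m = k)
    {X : Set (Gr k (ModelI ρ σ W × ModelQ m Z))} (hirr : X.Nonempty → IsIrreducible X)
    (hX : ∀ F ∈ X, IsPairMember (modelFormI ηH ηW ρ) (modelFormQ ηZ m) c F.1 ∧
      ρ + σ ≤ finrank ℂ (interLeft F.1))
    (P : Submodule ℂ (Params ρ σ m W Z)) {D : Params ρ σ m W Z → ℂ} (hD : D ∈ PolyFun _)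
    (h1 : ∀ s ∈ P, chartGram ηH ηW s ≠ 0 → D s ≠ 0 →
      ∀ F : Gr k (ModelI ρ σ W × ModelQ m Z), F.1 = chartSpan ηH ηW ηZ s → F ∈ X)
    (h2 : ∀ s, chartGram ηH ηW s ≠ 0 → ∀ F ∈ X, F.1 = chartSpan ηH ηW ηZ s → s ∈ P)
    {s₀ : Params ρ σ m W Z} (hs₀ : s₀ ∈ P) (hs₀g : chartGram ηH ηW s₀ ≠ 0) (hs₀D : D s₀ ≠ 0) :
    topologicalKrullDim X = (finrank ℂ P : ℕ) := by
  obtain ⟨e⟩ : Nonempty (Fin k ≃ RowIndex ρ σ m) :=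
    ⟨(Fintype.equivFinOfCardEq (by simp [hk])).symm⟩
  let ψ : P → Fin k → ModelI ρ σ W × ModelQ m Z := fun s i => chartRows ηH ηW ηZ s.1 (e i)
  have hψ : IsPolyMap ψ := isPolyMap_pi.2 fun i =>
    (isPolyMap_chartRows (e i)).comp (isPolyMap_linear P.subtype)
  have hψLI : ∀ s, LinearIndependent ℂ (ψ s) := fun s =>
    (linearIndependent_chartRows s.1).comp _ e.injective
  have hψs : ∀ s, Submodule.span ℂ (Set.range (ψ s)) = chartSpan ηH ηW ηZ s.1 := fun s =>
    congrArg (Submodule.span ℂ) (e.surjective.range_comp (chartRows ηH ηW ηZ s.1))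
  let re : (Fin k → ModelI ρ σ W × ModelQ m Z) →ₗ[ℂ] (RowIndex ρ σ m → ModelI ρ σ W × ModelQ m Z) :=
    LinearMap.funLeft ℂ _ e.symm
  have hre : ∀ s, re (ψ s) = chartRows ηH ηW ηZ s.1 := fun s => by
    ext1 r
    show chartRows ηH ηW ηZ s.1 (e (e.symm r)) = _
    rw [e.apply_symm_apply]
  have hrange : ∀ b : Fin k → ModelI ρ σ W × ModelQ m Z, Set.range (re b) = Set.range b :=
    fun b => e.symm.surjective.range_comp b
  have hfac : (fun b => recoverFactor ηH ηW (re b)) ∈ PolyFun _ :=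
    (isPolyMap_linear re).comp_mem recoverFactor_mem_polyFun
  -- a frame of a member of the chart
  have hframe : ∀ (s : Params ρ σ m W Z) (b : Frame k (ModelI ρ σ W × ModelQ m Z)),
      b.span.1 = chartSpan ηH ηW ηZ s → LinearIndependent ℂ (re b.1) ∧
        ∀ r, re b.1 r ∈ chartSpan ηH ηW ηZ s := fun s b hb => by
    refine ⟨b.2.comp _ e.symm.injective, fun r => ?_⟩
    rw [← hb]
    exact Submodule.subset_span ⟨e.symm r, rfl⟩
  let F₀ : Frame k (ModelI ρ σ W × ModelQ m Z) := ⟨ψ ⟨s₀, hs₀⟩, hψLI _⟩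
  have hF₀ : F₀.span.1 = chartSpan ηH ηW ηZ s₀ := hψs ⟨s₀, hs₀⟩
  have hF₀X : F₀.span ∈ X := h1 s₀ hs₀ hs₀g hs₀D _ hF₀
  have hirr := hirr ⟨_, hF₀X⟩
  apply le_antisymm
  · refine topologicalKrullDim_le_of_dominant hψ ?_
    -- By irreducibility the chart, an open set that meets X at the subspace of s₀, is dense in X.
    have hdense : X ⊆ closure (X ∩ {F | ∃ b : Frame k (ModelI ρ σ W × ModelQ m Z), b.span = F ∧
        recoverFactor ηH ηW (re b.1) ≠ 0}) := by
      intro F hF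
      rw [mem_closure_iff]
      intro O hO hFO
      have hO' := isOpen_exists_frame_ne_zero hfac
      obtain ⟨F', hF'X, hF'O, hF'⟩ := hirr.2 O _ hO hO' ⟨F, hF, hFO⟩ ⟨_, hF₀X, F₀, rfl,
        recoverFactor_ne_zero hs₀g (hframe s₀ F₀ hF₀).1 (hframe s₀ F₀ hF₀).2⟩
      exact ⟨F', hF'O, hF'X, hF'⟩
    refine hdense.trans (closure_mono ?_)
    rintro F ⟨hF, b, rfl, hb⟩
    obtain ⟨hm, hr⟩ := hX _ hF
    have hb1 : (reducedGram ηH ηW (re b.1)).det ≠ 0 := left_ne_zero_of_mul hb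
    have hb2 : (pivotMatrix (re b.1)).det ≠ 0 := right_ne_zero_of_mul hb
    have hmem : ∀ r, re b.1 r ∈ b.span.1 := fun r => Submodule.subset_span ⟨e.symm r, rfl⟩
    obtain ⟨s, hsg, hs⟩ := exists_params hH hW hZ hm hc hr (by rw [b.span.2, hk])
      (x := fun r => (pivotMatrix (re b.1)).det⁻¹ • reducedRows (re b.1) r)
      (fun r => Submodule.smul_mem _ _ (Submodule.sum_mem _ fun r' _ =>
        Submodule.smul_mem _ _ (hmem r')))
      (fun r => by rw [map_smul, pivot_reducedRows, inv_smul_smul₀ hb2]) (by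
        have : (Matrix.of fun l l' : Fin σ => modelFormI ηH ηW ρ
            ((pivotMatrix (re b.1)).det⁻¹ • reducedRows (re b.1) (Sum.inl (Sum.inr l))).1
            ((pivotMatrix (re b.1)).det⁻¹ • reducedRows (re b.1) (Sum.inl (Sum.inr l'))).1) =
            ((pivotMatrix (re b.1)).det⁻¹ ^ 2) • reducedGram ηH ηW (re b.1) := by
          ext l l'
          simp only [reducedGram, Matrix.of_apply, Matrix.smul_apply, Prod.smul_fst, map_smul,
            LinearMap.smul_apply, smul_eq_mul]
          ring
        rw [this, Matrix.det_smul]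
        exact mul_ne_zero (pow_ne_zero _ (pow_ne_zero _ (inv_ne_zero hb2))) hb1)
    have hsP : s ∈ P := h2 s hsg _ hF hs.symm
    exact ⟨⟨s, hsP⟩, ⟨_, hψLI ⟨s, hsP⟩⟩, rfl, Subtype.ext ((hψs ⟨s, hsP⟩).trans hs)⟩
  · let D' : P → ℂ := fun s => chartGram ηH ηW s.1 * D s.1
    have hD' : D' ∈ PolyFun P := (isPolyMap_linear P.subtype).comp_mem
      ((PolyFun _).mul_mem chartGram_mem_polyFun hD)
    refine le_topologicalKrullDim hψ hD' (fun s hs => ⟨⟨_, hψLI s⟩, rfl, h1 s.1 s.2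
      (left_ne_zero_of_mul hs) (right_ne_zero_of_mul hs) _ (hψs s)⟩) (s₀ := ⟨s₀, hs₀⟩)
      (mul_ne_zero hs₀g hs₀D) ?_
    intro f hf s hs hfs
    -- A linear projection onto P extends functions on P to all parameters, so that they can be
    -- composed with `readParams`.
    obtain ⟨π, hπ⟩ := P.subtype.exists_leftInverse_of_injective P.ker_subtype
    have hπs : ∀ s : P, π s.1 = s := fun s => LinearMap.congr_fun hπ s
    have hg : (fun x : RowIndex ρ σ m → ModelI ρ σ W × ModelQ m Z => f (π (readParams ηW x))) ∈
        PolyFun _ :=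
      ((isPolyMap_linear π).comp isPolyMap_readParams).comp_mem hf
    -- The rows are recovered only up to the factor `recoverFactor`; a power of this nonzero factor
    -- makes the function polynomial in the frame.
    obtain ⟨N, g, hg, hgN⟩ := exists_homogenization hg
    have hval : ∀ (s' : P) (b : Frame k (ModelI ρ σ W × ModelQ m Z)),
        b.span.1 = chartSpan ηH ηW ηZ s'.1 →
        g (recoverRows ηH ηW (re b.1), recoverFactor ηH ηW (re b.1)) =
          recoverFactor ηH ηW (re b.1) ^ N * f s' := fun s' b hb => by
      rw [recoverRows_eq (hframe s'.1 b hb).2, hgN, readParams_chartRows hH hW hZ, hπs]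
    refine ⟨fun b => g (recoverRows ηH ηW (re b), recoverFactor ηH ηW (re b)), ?_, ?_, ?_⟩
    · exact IsPolyMap.comp_mem (f := fun b => (recoverRows ηH ηW (re b),
        recoverFactor ηH ηW (re b))) (isPolyMap_prod.2 ⟨isPolyMap_pi.2 fun r =>
        (isPolyMap_recoverRows r).comp (isPolyMap_linear re), isPolyMap_of_mem hfac⟩) hg
    · let b : Frame k (ModelI ρ σ W × ModelQ m Z) := ⟨ψ s, hψLI s⟩
      have hb : b.span.1 = chartSpan ηH ηW ηZ s.1 := hψs s
      refine (hval s b hb).trans_ne (mul_ne_zero (pow_ne_zero _ ?_) hfs)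
      exact recoverFactor_ne_zero (left_ne_zero_of_mul hs) (hframe _ b hb).1 (hframe _ b hb).2
    · intro s' hs' hfs' b c' hb hc'
      have : c'.span.1 = chartSpan ηH ηW ηZ s'.1 := by
        rw [hc', ← hψs s', ← hb]; rfl
      exact (hval s' c' this).trans (by rw [hfs', mul_zero])

end ChartDimension

/-! ### Counting parameters and equations -/

section ChartCases

open Module LinearMap.BilinForm

theorem topologicalKrullDim_empty {X : Type*} [TopologicalSpace X] :
    topologicalKrullDim (∅ : Set X) = ⊥ := by
  have : IsEmpty (TopologicalSpace.IrreducibleCloseds (∅ : Set X)) := ⟨fun Z => by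
    obtain ⟨x, -⟩ := Z.isIrreducible.nonempty
    exact x.2⟩
  exact Order.krullDim_eq_bot

theorem exists_symplectic_form {U : Type*} [AddCommGroup U] [Module ℂ U] [FiniteDimensional ℂ U]
    {a : ℕ} (hU : finrank ℂ U = 2 * a) :
    ∃ η : LinearMap.BilinForm ℂ U, η.IsAlt ∧ η.Nondegenerate := by
  have e : U ≃ₗ[ℂ] (Fin a → ℂ) × (Fin a → ℂ) × PUnit.{1} := LinearEquiv.ofFinrankEq _ _ (by
    rw [finrank_hyp, hU, finrank_zero_of_subsingleton (M := PUnit.{1}), add_zero])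
  have h1 : (0 : LinearMap.BilinForm ℂ PUnit.{1}).IsAlt := fun _ => rfl
  have h2 : (0 : LinearMap.BilinForm ℂ PUnit.{1}).Nondegenerate :=
    ⟨fun _ _ => Subsingleton.elim _ _, fun _ _ => Subsingleton.elim _ _⟩
  have h3 := hypForm_isAlt (ρ := a) h1
  have h4 := hypForm_nondegenerate (ρ := a) h1 h2
  refine ⟨(hypForm a 0).comp e.toLinearMap e.toLinearMap, fun x => h3 _, fun x hx => ?_,
    fun x hx => ?_⟩
  · exact e.map_eq_zero_iff.1 (h4.1 _ fun y => by simpa using hx (e.symm y))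
  · exact e.map_eq_zero_iff.1 (h4.2 _ fun y => by simpa using hx (e.symm y))

variable {ρ σ m : ℕ} {W Z : Type*} [AddCommGroup W] [Module ℂ W] [AddCommGroup Z] [Module ℂ Z]
  {ηH : LinearMap.BilinForm ℂ (Fin σ → ℂ)} {ηW : LinearMap.BilinForm ℂ W}
  {ηZ : LinearMap.BilinForm ℂ Z}

-- Without W-components the rows `rowE` pair as the standard basis does under ηH.
omit [AddCommGroup Z] [Module ℂ Z] in
theorem chartGram_ne_zero (hHn : ηH.Nondegenerate) {s : Params ρ σ m W Z} (hs : s.2.2.1 = 0) :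
    chartGram ηH ηW s ≠ 0 := by
  have h : (Matrix.of fun l l' => modelFormI ηH ηW ρ (rowE ηH ηW s l) (rowE ηH ηW s l')) =
      LinearMap.BilinForm.toMatrix (Pi.basisFun ℂ (Fin σ)) ηH := by
    ext l l'
    simp [hypForm_apply, rowE, hs, prodForm_apply, LinearMap.BilinForm.toMatrix_apply]
  rw [chartGram, h]
  exact (LinearMap.BilinForm.nondegenerate_iff_det_ne_zero (Pi.basisFun ℂ (Fin σ))).1 hHn

theorem eq_of_pivot_eq {s : Params ρ σ m W Z} {x y : ModelI ρ σ W × ModelQ m Z}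
    (hx : x ∈ chartSpan ηH ηW ηZ s) (hy : y ∈ chartSpan ηH ηW ηZ s) (h : pivot x = pivot y) :
    x = y :=
  sub_eq_zero.1 (eq_zero_of_pivot_eq_zero (Submodule.sub_mem _ hx hy) (by rw [map_sub, h, sub_self]))

theorem rowR_mem (s : Params ρ σ m W Z) (i : Fin ρ) :
    (rowR ηH ηW s i, (0 : ModelQ m Z)) ∈ chartSpan ηH ηW ηZ s :=
  Submodule.subset_span ⟨Sum.inl (Sum.inl i), rfl⟩

theorem rowE_mem (s : Params ρ σ m W Z) (l : Fin σ) :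
    (rowE ηH ηW s l, (0 : ModelQ m Z)) ∈ chartSpan ηH ηW ηZ s :=
  Submodule.subset_span ⟨Sum.inl (Sum.inr l), rfl⟩

theorem rowG_mem (s : Params ρ σ m W Z) (j : Fin m) :
    (rowG ηW s j, rowQ ηZ s j) ∈ chartSpan ηH ηW ηZ s :=
  Submodule.subset_span ⟨Sum.inr j, rfl⟩

theorem chartSpan_le_iff {s : Params ρ σ m W Z} {T : Submodule ℂ (ModelI ρ σ W × ModelQ m Z)} :
    chartSpan ηH ηW ηZ s ≤ T ↔ (∀ i, (rowR ηH ηW s i, (0 : ModelQ m Z)) ∈ T) ∧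
      (∀ l, (rowE ηH ηW s l, (0 : ModelQ m Z)) ∈ T) ∧ ∀ j, (rowG ηW s j, rowQ ηZ s j) ∈ T := by
  constructor
  · exact fun h => ⟨fun i => h (rowR_mem s i), fun i => h (rowE_mem s i), fun i => h (rowG_mem s i)⟩
  · rintro ⟨h1, h2, h3⟩
    rw [chartSpan, Submodule.span_le]
    rintro _ ⟨(i | l) | j, rfl⟩
    · exact h1 i
    · exact h2 l
    · exact h3 j

/-- E + E^⊥ is the orthogonal of the radical, which `rowR` spans. -/
theorem mem_chartSpan_sup_iff [FiniteDimensional ℂ W] (hH : ηH.IsAlt) (hW : ηW.IsAlt)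
    (hHn : ηH.Nondegenerate)
    (hWn : ηW.Nondegenerate) {s : Params ρ σ m W Z} (hs : chartGram ηH ηW s ≠ 0)
    {u : ModelI ρ σ W} : u ∈ interLeft (chartSpan ηH ηW ηZ s) ⊔
      (modelFormI ηH ηW ρ).orthogonal (interLeft (chartSpan ηH ηW ηZ s)) ↔
      ∀ i, modelFormI ηH ηW ρ (rowR ηH ηW s i) u = 0 := by
  have hn : (modelFormI ηH ηW ρ).Nondegenerate :=
    hypForm_nondegenerate (prodForm_isAlt hH hW) (prodForm_nondegenerate hHn hWn)
  rw [← orthogonal_inf_orthogonal (modelFormI_isAlt hH hW) hn, radical_chartSpan hH hW hs]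
  exact ⟨fun h i => h _ (Submodule.subset_span ⟨i, rfl⟩),
    fun h x hx => apply_eq_zero_of_mem_span h hx⟩

theorem finrank_params [FiniteDimensional ℂ W] [FiniteDimensional ℂ Z] :
    finrank ℂ (Params ρ σ m W Z) = (ρ + 1).choose 2 + ρ * (σ + finrank ℂ W) + σ * finrank ℂ W +
      (m + 1).choose 2 + m * finrank ℂ Z + m * ρ + m * finrank ℂ W := by
  simp only [finrank_prod, finrank_pi_fintype, finrank_self, Finset.sum_const, Finset.card_univ,
    Sym2.card, Fintype.card_fin, smul_eq_mul, mul_one]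
  ring

section

variable [FiniteDimensional ℂ W] [FiniteDimensional ℂ Z]

/-- The dimension of a set of subspaces that is given, on the chart, by independent linear
equations and an open condition. -/
theorem dim_of_equations (hH : ηH.IsAlt) (hHn : ηH.Nondegenerate) (hW : ηW.IsAlt) (hZ : ηZ.IsAlt)
    (hZn : ηZ.Nondegenerate) {q k c : ℕ} (hq : 2 * m + finrank ℂ Z = 2 * q)
    (hN : PairNumbers q k c ρ σ m) {T : Submodule ℂ (ModelI ρ σ W × ModelQ m Z)}
    {C : Submodule ℂ (ModelI ρ σ W × ModelQ m Z) → Prop}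
    (hirr : {F ∈ pairSet (modelFormI ηH ηW ρ) (modelFormQ ηZ m) k c T | C F.1}.Nonempty →
      IsIrreducible {F ∈ pairSet (modelFormI ηH ηW ρ) (modelFormQ ηZ m) k c T | C F.1})
    {A : Type*} [AddCommGroup A] [Module ℂ A] [FiniteDimensional ℂ A]
    (φ : Params ρ σ m W Z →ₗ[ℂ] A) (hφ : Function.Surjective φ)
    {D : Params ρ σ m W Z → ℂ} (hD : D ∈ PolyFun _)
    (h1 : ∀ s, chartGram ηH ηW s ≠ 0 → φ s = 0 → D s ≠ 0 →
      chartSpan ηH ηW ηZ s ≤ T ∧ C (chartSpan ηH ηW ηZ s))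
    (h2 : ∀ s, chartGram ηH ηW s ≠ 0 → chartSpan ηH ηW ηZ s ≤ T → C (chartSpan ηH ηW ηZ s) →
      φ s = 0)
    {s₀ : Params ρ σ m W Z} (hs₀ : φ s₀ = 0) (hs₀g : s₀.2.2.1 = 0) (hs₀D : D s₀ ≠ 0) {d : ℕ}
    (hd : d + finrank ℂ A = finrank ℂ (Params ρ σ m W Z)) :
    IsIrreducible {F ∈ pairSet (modelFormI ηH ηW ρ) (modelFormQ ηZ m) k c T | C F.1} ∧
      topologicalKrullDim {F ∈ pairSet (modelFormI ηH ηW ρ) (modelFormQ ηZ m) k c T | C F.1} =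
        d := by
  have hQn : (modelFormQ ηZ m).Nondegenerate := hypForm_nondegenerate hZ hZn
  have hQ : finrank ℂ (ModelQ m Z) = 2 * q := by rw [← hq]; exact finrank_hyp
  have hfr : finrank ℂ (LinearMap.ker φ) = d := by
    have h3 := φ.finrank_range_add_finrank_ker
    rw [LinearMap.range_eq_top.2 hφ, finrank_top] at h3
    omega
  have key := topologicalKrullDim_eq_of_chart hH hW hZ hN.rank hN.dim hirr
    (fun F hF => ⟨hF.1.1, (hF.1.1.le_finrank hQn hQ hN).1⟩) (LinearMap.ker φ) hD
    (fun s hs hg hDs F hF => by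
      obtain ⟨h3, h4⟩ := h1 s hg hs hDs
      refine ⟨⟨?_, ?_⟩, ?_⟩
      · rw [hF]; exact isPairMember_chartSpan hH hW hZ hg hN.rank
      · exact hF.le.trans h3
      · rw [hF]; exact h4)
    (fun s hg F hFX hF => h2 s hg (hF.ge.trans hFX.1.2) (hF ▸ hFX.2))
    hs₀ (chartGram_ne_zero hHn hs₀g) hs₀D
  rw [hfr] at key
  refine ⟨hirr ?_, key⟩
  by_contra h
  rw [Set.not_nonempty_iff_eq_empty] at h
  rw [h] at key
  rw [topologicalKrullDim_empty] at key
  exact absurd key (by simp)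

end
end ChartCases

/-! ### The model data; no vector, or a vector of I outside F -/

section ChartCases

set_option linter.unusedSectionVars false

open Module LinearMap.BilinForm

variable {ρ σ m : ℕ} {W Z : Type*} [AddCommGroup W] [Module ℂ W] [AddCommGroup Z] [Module ℂ Z]
  [FiniteDimensional ℂ W] [FiniteDimensional ℂ Z]
  {ηH : LinearMap.BilinForm ℂ (Fin σ → ℂ)} {ηW : LinearMap.BilinForm ℂ W}
  {ηZ : LinearMap.BilinForm ℂ Z}

/-- The data of the model. -/
structure ModelData (ηH : LinearMap.BilinForm ℂ (Fin σ → ℂ)) (ηW : LinearMap.BilinForm ℂ W)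
    (ηZ : LinearMap.BilinForm ℂ Z) (q k c ρ m : ℕ) : Prop where
  altH : ηH.IsAlt
  ndH : ηH.Nondegenerate
  altW : ηW.IsAlt
  ndW : ηW.Nondegenerate
  altZ : ηZ.IsAlt
  ndZ : ηZ.Nondegenerate
  dimQ : 2 * m + finrank ℂ Z = 2 * q
  num : PairNumbers q k c ρ σ m

namespace ModelData

variable {q k c : ℕ} (h : ModelData ηH ηW ηZ q k c ρ m)

include h

theorem altI : (modelFormI ηH ηW ρ).IsAlt := modelFormI_isAlt h.altH h.altW

theorem ndI : (modelFormI ηH ηW ρ).Nondegenerate :=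
  hypForm_nondegenerate (prodForm_isAlt h.altH h.altW) (prodForm_nondegenerate h.ndH h.ndW)

theorem altQ : (modelFormQ ηZ m).IsAlt := hypForm_isAlt h.altZ

theorem ndQ : (modelFormQ ηZ m).Nondegenerate := hypForm_nondegenerate h.altZ h.ndZ

theorem finrankQ : finrank ℂ (ModelQ m Z) = 2 * q := by rw [← h.dimQ]; exact finrank_hyp

theorem exists_apply_eq_one {w : W} (hw : w ≠ 0) : ∃ w', ηW w' w = 1 := by
  obtain ⟨w', hw'⟩ : ∃ w', ηW w' w ≠ 0 := by
    by_contra! hc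
    exact hw (h.ndW.2 _ hc)
  exact ⟨(ηW w' w)⁻¹ • w', by simp [hw']⟩

theorem dim_zero {d : ℕ} (hd : d = finrank ℂ (Params ρ σ m W Z)) :
    IsIrreducible (pairSet (modelFormI ηH ηW ρ) (modelFormQ ηZ m) k c ⊤) ∧
      topologicalKrullDim (pairSet (modelFormI ηH ηW ρ) (modelFormQ ηZ m) k c ⊤) = d := by
  have key := dim_of_equations h.altH h.ndH h.altW h.altZ h.ndZ h.dimQ h.num (T := ⊤)
    (C := fun F => False → (0 : ModelI ρ σ W × ModelQ m Z) ∉ supPerp (modelFormI ηH ηW ρ) F)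
    (irreducible_pairSet_out h.altI h.ndI h.altQ h.ndQ h.finrankQ h.num False 0)
    (0 : Params ρ σ m W Z →ₗ[ℂ] PUnit.{1}) (fun _ => ⟨0, rfl⟩) (D := fun _ => 1) (const_mem_polyFun 1)
    (fun _ _ _ _ => ⟨le_top, False.elim⟩) (fun _ _ _ _ => rfl) (s₀ := 0) rfl rfl one_ne_zero
    (d := d) (by rw [finrank_zero_of_subsingleton (M := PUnit.{1}), add_zero, hd])
  have e : {F ∈ pairSet (modelFormI ηH ηW ρ) (modelFormQ ηZ m) k c ⊤ |
      False → (0 : ModelI ρ σ W × ModelQ m Z) ∉ supPerp (modelFormI ηH ηW ρ) F.1} =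
      pairSet (modelFormI ηH ηW ρ) (modelFormQ ηZ m) k c ⊤ :=
    Set.ext fun F => ⟨fun h => h.1, fun h => ⟨h, False.elim⟩⟩
  rwa [e] at key

/-- One convenient u suffices, here and in the cases below, since isometries are transitive on
nonzero vectors. This u pairs to 1 with `rowR` at i₀ on the whole chart, so there is no equation. -/
theorem dim_inl_out (i₀ : Fin ρ) {d : ℕ} (hd : d = finrank ℂ (Params ρ σ m W Z)) :
    ∃ u : ModelI ρ σ W, u ≠ 0 ∧ ∀ X : Set (Gr k (ModelI ρ σ W × ModelQ m Z)),
      X = {F ∈ pairSet (modelFormI ηH ηW ρ) (modelFormQ ηZ m) k c ⊤ |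
        (u, (0 : ModelQ m Z)) ∉ supPerp (modelFormI ηH ηW ρ) F.1} →
      IsIrreducible X ∧ topologicalKrullDim X = d := by
  let u : ModelI ρ σ W := (0, Pi.single i₀ 1, 0)
  refine ⟨u, fun hu => ?_, ?_⟩
  · have := congrFun (congrArg (fun x : ModelI ρ σ W => x.2.1) hu) i₀
    simp [u] at this
  rintro X rfl
  have key := dim_of_equations h.altH h.ndH h.altW h.altZ h.ndZ h.dimQ h.num (T := ⊤)
    (C := fun F => True → (u, (0 : ModelQ m Z)) ∉ supPerp (modelFormI ηH ηW ρ) F)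
    (irreducible_pairSet_out h.altI h.ndI h.altQ h.ndQ h.finrankQ h.num True (u, 0))
    (0 : Params ρ σ m W Z →ₗ[ℂ] PUnit.{1}) (fun _ => ⟨0, rfl⟩) (D := fun _ => 1) (const_mem_polyFun 1)
    (fun s hs _ _ => ⟨le_top, fun _ hc => by
      rw [inl_mem_supPerp_iff, mem_chartSpan_sup_iff h.altH h.altW h.ndH h.ndW hs] at hc
      have := hc i₀
      simp [hypForm_apply, rowR, isoRow, u] at this⟩)
    (fun _ _ _ _ => rfl) (s₀ := 0) rfl rfl one_ne_zero
    (d := d) (by rw [finrank_zero_of_subsingleton (M := PUnit.{1}), add_zero, hd])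
  have e : {F ∈ pairSet (modelFormI ηH ηW ρ) (modelFormQ ηZ m) k c ⊤ |
      True → (u, (0 : ModelQ m Z)) ∉ supPerp (modelFormI ηH ηW ρ) F.1} =
      {F ∈ pairSet (modelFormI ηH ηW ρ) (modelFormQ ηZ m) k c ⊤ |
        (u, (0 : ModelQ m Z)) ∉ supPerp (modelFormI ηH ηW ρ) F.1} :=
    Set.ext fun F => ⟨fun h => ⟨h.1, h.2 trivial⟩, fun h => ⟨h.1, fun _ => h.2⟩⟩
  rwa [e] at key

/-- For u in W the equations are the orthogonality of u to the ρ rows `rowR`; u is never in F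
because its pivots vanish. -/
theorem dim_inl_mid {w : W} (hw : w ≠ 0) {d : ℕ} (hd : d + ρ = finrank ℂ (Params ρ σ m W Z)) :
    ∃ u : ModelI ρ σ W, u ≠ 0 ∧ ∀ X : Set (Gr k (ModelI ρ σ W × ModelQ m Z)),
      X = {F ∈ pairSet (modelFormI ηH ηW ρ) (modelFormQ ηZ m) k c ⊤ |
        (u, (0 : ModelQ m Z)) ∈ supPerp (modelFormI ηH ηW ρ) F.1 ∧ (u, 0) ∉ F.1} →
      IsIrreducible X ∧ topologicalKrullDim X = d := by
  let u : ModelI ρ σ W := (0, 0, 0, w)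
  have hu : u ≠ 0 := fun hu => hw (congrArg (fun x : ModelI ρ σ W => x.2.2.2) hu)
  refine ⟨u, hu, ?_⟩
  rintro X rfl
  let φ : Params ρ σ m W Z →ₗ[ℂ] (Fin ρ → ℂ) :=
    { toFun := fun s i => ηW (s.2.1 i).2 w
      map_add' := fun _ _ => by ext; simp
      map_smul' := fun _ _ => by ext; simp }
  have hφ : Function.Surjective φ := fun t => by
    obtain ⟨w', hw'⟩ := h.exists_apply_eq_one hw
    exact ⟨(0, fun i => (0, t i • w'), 0), by ext; simp [φ, hw']⟩
  have hiff : ∀ s, chartGram ηH ηW s ≠ 0 →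
      ((u, (0 : ModelQ m Z)) ∈ supPerp (modelFormI ηH ηW ρ) (chartSpan ηH ηW ηZ s) ↔ φ s = 0) := by
    intro s hs
    rw [inl_mem_supPerp_iff, mem_chartSpan_sup_iff h.altH h.altW h.ndH h.ndW hs, funext_iff]
    refine forall_congr' fun i => ?_
    simp [hypForm_apply, rowR, isoRow, u, φ, prodForm_apply]
  have hnot : ∀ s, (u, (0 : ModelQ m Z)) ∉ chartSpan ηH ηW ηZ s := fun s hs =>
    hu (congrArg Prod.fst (eq_zero_of_pivot_eq_zero hs ((pivot_eq_zero_iff _).2 ⟨rfl, rfl, rfl⟩)))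
  exact dim_of_equations h.altH h.ndH h.altW h.altZ h.ndZ h.dimQ h.num (T := ⊤)
    (C := fun F => (u, (0 : ModelQ m Z)) ∈ supPerp (modelFormI ηH ηW ρ) F ∧ (u, 0) ∉ F)
    (irreducible_pairSet_mid h.altI h.ndI h.altQ h.ndQ h.finrankQ h.num u)
    φ hφ (D := fun _ => 1) (const_mem_polyFun 1)
    (fun s hs hφs _ => ⟨le_top, (hiff s hs).2 hφs, hnot s⟩)
    (fun s hs _ hC => (hiff s hs).1 hC.1) (s₀ := 0) (map_zero φ) rfl one_ne_zero
    (d := d) (by rw [finrank_fin_fun, hd])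

end ModelData
end ChartCases

/-! ### Vectors of I that lie in F or are orthogonal to F -/

section ChartCases

set_option linter.unusedSectionVars false

open Module LinearMap.BilinForm

variable {ρ σ m : ℕ} {W Z : Type*} [AddCommGroup W] [Module ℂ W] [AddCommGroup Z] [Module ℂ Z]
  [FiniteDimensional ℂ W] [FiniteDimensional ℂ Z]
  {ηH : LinearMap.BilinForm ℂ (Fin σ → ℂ)} {ηW : LinearMap.BilinForm ℂ W}
  {ηZ : LinearMap.BilinForm ℂ Z}

theorem exists_sym2_row {n : ℕ} (i₀ : Fin n) (t : Fin n → ℂ) :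
    ∃ S : Sym2 (Fin n) → ℂ, ∀ j, S s(i₀, j) = t j := by
  have hinj : Function.Injective fun j : Fin n => s(i₀, j) := fun a b hab => Sym2.congr_right.1 hab
  exact ⟨Function.extend (fun j => s(i₀, j)) t 0, fun j => hinj.extend_apply t 0 j⟩

theorem snd_eq_sum_rowQ {s : Params ρ σ m W Z} {x : ModelI ρ σ W × ModelQ m Z}
    (hx : x ∈ chartSpan ηH ηW ηZ s) : x.2 = ∑ j, x.2.1 j • rowQ ηZ s j := by
  obtain ⟨g, rfl⟩ := (Submodule.mem_span_range_iff_exists_fun ℂ).1 hx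
  have h : ∀ j, (∑ r, g r • chartRows ηH ηW ηZ s r).2.1 j = g (Sum.inr j) := fun j =>
    congrFun (pivot_sum_chartRows (ηH := ηH) (ηW := ηW) (ηZ := ηZ) s g) (Sum.inr j)
  simp only [h]
  simp [Fintype.sum_sum_type, Prod.snd_sum, chartRows, pairRows]

theorem eq_rowQ_of_mem {s : Params ρ σ m W Z} {x : ModelI ρ σ W × ModelQ m Z} {j₀ : Fin m}
    (hx : x ∈ chartSpan ηH ηW ηZ s) (hj : x.2.1 = Pi.single j₀ 1) :
    x.2 = rowQ ηZ s j₀ ∧ x.1 - rowG ηW s j₀ ∈ interLeft (chartSpan ηH ηW ηZ s) := by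
  have h : x.2 = rowQ ηZ s j₀ := by
    rw [snd_eq_sum_rowQ hx, hj]
    simp [Pi.single_apply]
  refine ⟨h, ?_⟩
  rw [mem_interLeft]
  have := Submodule.sub_mem _ hx (rowG_mem s j₀)
  rwa [show x - (rowG ηW s j₀, rowQ ηZ s j₀) = (x.1 - rowG ηW s j₀, 0) from
    Prod.ext rfl (sub_eq_zero.2 h)] at this

theorem mem_span_rowR_iff {s : Params ρ σ m W Z} {i₀ : Fin ρ} {x : ModelI ρ σ W}
    (hx : x ∈ Submodule.span ℂ (Set.range (rowR ηH ηW s))) (hx1 : x.1 = Pi.single i₀ 1) :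
    x = rowR ηH ηW s i₀ := by
  obtain ⟨g, rfl⟩ := (Submodule.mem_span_range_iff_exists_fun ℂ).1 hx
  have : g = Pi.single i₀ 1 := by
    rw [← hx1]
    ext i
    simp [Prod.fst_sum, rowR, isoRow, Pi.single_apply]
  rw [this]
  simp [Pi.single_apply]

theorem rowR_eq_iff {s : Params ρ σ m W Z} {i₀ : Fin ρ} : rowR ηH ηW s i₀ = (Pi.single i₀ 1, 0, 0) ↔
    s.2.1 i₀ = 0 ∧ ∀ j, s.1 s(i₀, j) = 0 := by
  constructor
  · intro h
    have h1 : s.2.1 i₀ = 0 := congrArg (fun x : ModelI ρ σ W => x.2.2) h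
    refine ⟨h1, fun j => ?_⟩
    have h2 := congrFun (congrArg (fun x : ModelI ρ σ W => x.2.1) h) j
    simpa [rowR, isoRow, h1] using h2
  · rintro ⟨h1, h2⟩
    refine Prod.ext rfl (Prod.ext ?_ h1)
    ext j
    simp [rowR, isoRow, h1, h2]

theorem rowQ_eq_iff {s : Params ρ σ m W Z} {j₀ : Fin m} : rowQ ηZ s j₀ = (Pi.single j₀ 1, 0, 0) ↔
    s.2.2.2.2.1 j₀ = 0 ∧ ∀ j, s.2.2.2.1 s(j₀, j) = 0 := by
  constructor
  · intro h
    have h1 : s.2.2.2.2.1 j₀ = 0 := congrArg (fun x : ModelQ m Z => x.2.2) h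
    refine ⟨h1, fun j => ?_⟩
    have h2 := congrFun (congrArg (fun x : ModelQ m Z => x.2.1) h) j
    simpa [rowQ, isoRow, h1] using h2
  · rintro ⟨h1, h2⟩
    refine Prod.ext rfl (Prod.ext ?_ h1)
    ext j
    simp [rowQ, isoRow, h1, h2]

namespace ModelData

variable {q k c : ℕ} (h : ModelData ηH ηW ηZ q k c ρ m)

include h

/-- Here u is a middle pivot vector, and u ∈ F means that `rowE` at l₀ equals u: its W-component and
its ρ second coordinates vanish. -/
theorem dim_inl_mem_of_pos (l₀ : Fin σ) {d : ℕ}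
    (hd : d + (finrank ℂ W + ρ) = finrank ℂ (Params ρ σ m W Z)) :
    ∃ u : ModelI ρ σ W, u ≠ 0 ∧ ∀ X : Set (Gr k (ModelI ρ σ W × ModelQ m Z)),
      X = {F ∈ pairSet (modelFormI ηH ηW ρ) (modelFormQ ηZ m) k c ⊤ | (u, (0 : ModelQ m Z)) ∈ F.1} →
      IsIrreducible X ∧ topologicalKrullDim X = d := by
  let u : ModelI ρ σ W := (0, 0, Pi.single l₀ 1, 0)
  have hu : u ≠ 0 := fun hu => by
    have := congrFun (congrArg (fun x : ModelI ρ σ W => x.2.2.1) hu) l₀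
    simp [u] at this
  refine ⟨u, hu, ?_⟩
  rintro X rfl
  let φ : Params ρ σ m W Z →ₗ[ℂ] W × (Fin ρ → ℂ) :=
    { toFun := fun s => (s.2.2.1 l₀, fun i => ηH (s.2.1 i).1 (Pi.single l₀ 1))
      map_add' := fun _ _ => Prod.ext rfl (by ext; simp)
      map_smul' := fun _ _ => Prod.ext rfl (by ext; simp) }
  have hφ : Function.Surjective φ := fun t => by
    obtain ⟨a, ha⟩ : ∃ a, ηH a (Pi.single l₀ 1) ≠ 0 := by
      by_contra! hc
      have := h.ndH.2 _ hc
      simp at this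
    exact ⟨(0, fun i => ((t.2 i * (ηH a (Pi.single l₀ 1))⁻¹) • a, 0), fun _ => t.1, 0),
      Prod.ext rfl (by ext; simp [φ, ha])⟩
  have hiff : ∀ s, (u, (0 : ModelQ m Z)) ∈ chartSpan ηH ηW ηZ s ↔ φ s = 0 := by
    intro s
    constructor
    · intro hs
      have := congrArg Prod.fst (eq_of_pivot_eq hs (rowE_mem s l₀) (by
        ext ((i | i) | i) <;> rfl))
      have h1 : s.2.2.1 l₀ = 0 := (congrArg (fun x : ModelI ρ σ W => x.2.2.2) this).symm
      refine Prod.ext h1 ?_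
      ext i
      have h2 := congrFun (congrArg (fun x : ModelI ρ σ W => x.2.1) this) i
      simpa [rowE, prodForm_apply, h1, u, φ] using h2
    · intro hs
      have h1 : s.2.2.1 l₀ = 0 := congrArg Prod.fst hs
      have h2 : ∀ i, ηH (s.2.1 i).1 (Pi.single l₀ 1) = 0 := congrFun (congrArg Prod.snd hs)
      have : rowE ηH ηW s l₀ = u := by
        refine Prod.ext rfl (Prod.ext ?_ (Prod.ext rfl h1))
        ext i
        simp [rowE, prodForm_apply, h1, h2, u]
      rw [← this]
      exact rowE_mem s l₀
  exact dim_of_equations h.altH h.ndH h.altW h.altZ h.ndZ h.dimQ h.num (T := ⊤)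
    (C := fun F => (u, (0 : ModelQ m Z)) ∈ F)
    (irreducible_pairSet_in h.altI h.ndI h.altQ h.ndQ h.finrankQ h.num hu)
    φ hφ (D := fun _ => 1) (const_mem_polyFun 1)
    (fun s _ hφs _ => ⟨le_top, (hiff s).2 hφs⟩)
    (fun s _ _ hC => (hiff s).1 hC) (s₀ := 0) (map_zero φ) rfl one_ne_zero
    (d := d) (by rw [finrank_prod, finrank_fin_fun, hd])

/-- Without middle rows u is a pivot vector of the radical, and `rowR` at i₀ has to equal it; the
number of equations is the same as for σ > 0. -/
theorem dim_inl_mem_of_eq_zero (i₀ : Fin ρ) (hσ : σ = 0) {d : ℕ}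
    (hd : d + (finrank ℂ W + ρ) = finrank ℂ (Params ρ σ m W Z)) :
    ∃ u : ModelI ρ σ W, u ≠ 0 ∧ ∀ X : Set (Gr k (ModelI ρ σ W × ModelQ m Z)),
      X = {F ∈ pairSet (modelFormI ηH ηW ρ) (modelFormQ ηZ m) k c ⊤ | (u, (0 : ModelQ m Z)) ∈ F.1} →
      IsIrreducible X ∧ topologicalKrullDim X = d := by
  let u : ModelI ρ σ W := (Pi.single i₀ 1, 0, 0)
  have hu : u ≠ 0 := fun hu => by
    have := congrFun (congrArg (fun x : ModelI ρ σ W => x.1) hu) i₀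
    simp [u] at this
  refine ⟨u, hu, ?_⟩
  rintro X rfl
  have hσ' : IsEmpty (Fin σ) := by rw [hσ]; infer_instance
  let φ : Params ρ σ m W Z →ₗ[ℂ] W × (Fin ρ → ℂ) :=
    { toFun := fun s => ((s.2.1 i₀).2, fun j => s.1 s(i₀, j))
      map_add' := fun _ _ => rfl
      map_smul' := fun _ _ => rfl }
  have hφ : Function.Surjective φ := fun t => by
    obtain ⟨S, hS⟩ := exists_sym2_row i₀ t.2
    exact ⟨(S, fun _ => (0, t.1), 0), Prod.ext rfl (funext hS)⟩
  have hiff : ∀ s, (u, (0 : ModelQ m Z)) ∈ chartSpan ηH ηW ηZ s ↔ φ s = 0 := by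
    intro s
    have h1 : φ s = 0 ↔ s.2.1 i₀ = 0 ∧ ∀ j, s.1 s(i₀, j) = 0 :=
      ⟨fun hs => ⟨Prod.ext (Subsingleton.elim _ _) (congrArg Prod.fst hs),
        congrFun (congrArg Prod.snd hs)⟩, fun hs => Prod.ext (congrArg Prod.snd hs.1) (funext hs.2)⟩
    rw [h1, ← rowR_eq_iff (ηH := ηH) (ηW := ηW)]
    constructor
    · intro hs
      exact (congrArg Prod.fst (eq_of_pivot_eq hs (rowR_mem s i₀) (by
        ext ((i | i) | i)
        · rfl
        · exact isEmptyElim i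
        · rfl))).symm
    · intro hs
      have := rowR_mem (ηH := ηH) (ηW := ηW) (ηZ := ηZ) s i₀
      rwa [hs] at this
  exact dim_of_equations h.altH h.ndH h.altW h.altZ h.ndZ h.dimQ h.num (T := ⊤)
    (C := fun F => (u, (0 : ModelQ m Z)) ∈ F)
    (irreducible_pairSet_in h.altI h.ndI h.altQ h.ndQ h.finrankQ h.num hu)
    φ hφ (D := fun _ => 1) (const_mem_polyFun 1)
    (fun s _ hφs _ => ⟨le_top, (hiff s).2 hφs⟩)
    (fun s _ _ hC => (hiff s).1 hC) (s₀ := 0) (map_zero φ) rfl one_ne_zero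
    (d := d) (by rw [finrank_prod, finrank_fin_fun, hd])

/-- For u in W, orthogonality to F is one linear equation on the W-component of each of the k rows.
-/
theorem dim_perp_notMem {w : W} (hw : w ≠ 0) {d : ℕ} (hd : d + k = finrank ℂ (Params ρ σ m W Z)) :
    ∃ u : ModelI ρ σ W, u ≠ 0 ∧ ∀ X : Set (Gr k (ModelI ρ σ W × ModelQ m Z)),
      X = {F ∈ pairSet (modelFormI ηH ηW ρ) (modelFormQ ηZ m) k c
        ((LinearMap.ker (modelFormI ηH ηW ρ u)).prod ⊤) | (u, (0 : ModelQ m Z)) ∉ F.1} →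
      IsIrreducible X ∧ topologicalKrullDim X = d := by
  let u : ModelI ρ σ W := (0, 0, 0, w)
  have hu : u ≠ 0 := fun hu => hw (congrArg (fun x : ModelI ρ σ W => x.2.2.2) hu)
  refine ⟨u, hu, ?_⟩
  rintro X rfl
  let φ : Params ρ σ m W Z →ₗ[ℂ] (Fin ρ → ℂ) × (Fin σ → ℂ) × (Fin m → ℂ) :=
    { toFun := fun s => (fun i => ηW w (s.2.1 i).2, fun l => ηW w (s.2.2.1 l),
        fun j => ηW w (s.2.2.2.2.2.2 j))
      map_add' := fun _ _ => Prod.ext (by ext; simp) (Prod.ext (by ext; simp) (by ext; simp))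
      map_smul' := fun _ _ => Prod.ext (by ext; simp) (Prod.ext (by ext; simp) (by ext; simp)) }
  have hφ : Function.Surjective φ := fun t => by
    obtain ⟨w', hw'⟩ := h.exists_apply_eq_one hw
    have hw'' : ηW w (-w') = 1 := by rw [map_neg, h.altW.neg_eq, hw']
    exact ⟨(0, fun i => (0, t.1 i • -w'), fun l => t.2.1 l • -w', 0, 0, 0, fun j => t.2.2 j • -w'),
      Prod.ext (by ext; simp only [φ, LinearMap.coe_mk, AddHom.coe_mk, map_smul, hw'',
        smul_eq_mul, mul_one]) (Prod.ext (by ext; simp only [φ, LinearMap.coe_mk, AddHom.coe_mk,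
        map_smul, hw'', smul_eq_mul, mul_one]) (by ext; simp only [φ, LinearMap.coe_mk,
        AddHom.coe_mk, map_smul, hw'', smul_eq_mul, mul_one]))⟩
  have hiff : ∀ s, chartSpan ηH ηW ηZ s ≤ (LinearMap.ker (modelFormI ηH ηW ρ u)).prod ⊤ ↔
      φ s = 0 := by
    intro s
    rw [chartSpan_le_iff]
    simp only [Submodule.mem_prod, LinearMap.mem_ker, Submodule.mem_top, and_true]
    have h1 : ∀ x : ModelI ρ σ W, modelFormI ηH ηW ρ u x = ηW w x.2.2.2 := fun x => by
      simp [hypForm_apply, prodForm_apply, u]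
    simp only [h1]
    exact ⟨fun hs => Prod.ext (funext hs.1) (Prod.ext (funext hs.2.1) (funext hs.2.2)),
      fun hs => ⟨congrFun (congrArg Prod.fst hs), congrFun (congrArg (fun x => x.2.1) hs),
        congrFun (congrArg (fun x => x.2.2) hs)⟩⟩
  have hnot : ∀ s, (u, (0 : ModelQ m Z)) ∉ chartSpan ηH ηW ηZ s := fun s hs =>
    hu (congrArg Prod.fst (eq_zero_of_pivot_eq_zero hs ((pivot_eq_zero_iff _).2 ⟨rfl, rfl, rfl⟩)))
  exact dim_of_equations h.altH h.ndH h.altW h.altZ h.ndZ h.dimQ h.num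
    (T := (LinearMap.ker (modelFormI ηH ηW ρ u)).prod ⊤)
    (C := fun F => (u, (0 : ModelQ m Z)) ∉ F)
    (irreducible_pairSet_perp_notMem h.altI h.ndI h.altQ h.ndQ h.finrankQ h.num u)
    φ hφ (D := fun _ => 1) (const_mem_polyFun 1)
    (fun s _ hφs _ => ⟨(hiff s).2 hφs, hnot s⟩)
    (fun s _ hC _ => (hiff s).1 hC) (s₀ := 0) (map_zero φ) rfl one_ne_zero
    (d := d) (by
      rw [← hd]
      simp only [finrank_prod, finrank_fin_fun]
      have := h.num.dim
      omega)

/-- The condition that u is `rowR` at i₀ takes σ + dim W + ρ equations; orthogonality to the rows of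
E is then automatic, and the other m rows give one equation each. -/
theorem dim_perp_mem (i₀ : Fin ρ) {d : ℕ}
    (hd : d + (σ + finrank ℂ W + ρ + m) = finrank ℂ (Params ρ σ m W Z)) :
    ∃ u : ModelI ρ σ W, u ≠ 0 ∧ ∀ X : Set (Gr k (ModelI ρ σ W × ModelQ m Z)),
      X = {F ∈ pairSet (modelFormI ηH ηW ρ) (modelFormQ ηZ m) k c
        ((LinearMap.ker (modelFormI ηH ηW ρ u)).prod ⊤) | (u, (0 : ModelQ m Z)) ∈ F.1} →
      IsIrreducible X ∧ topologicalKrullDim X = d := by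
  let u : ModelI ρ σ W := (Pi.single i₀ 1, 0, 0)
  have hu : u ≠ 0 := fun hu => by
    have := congrFun (congrArg (fun x : ModelI ρ σ W => x.1) hu) i₀
    simp [u] at this
  refine ⟨u, hu, ?_⟩
  rintro X rfl
  let φ : Params ρ σ m W Z →ₗ[ℂ] ((Fin σ → ℂ) × W) × (Fin ρ → ℂ) × (Fin m → ℂ) :=
    { toFun := fun s => (s.2.1 i₀, fun j => s.1 s(i₀, j), fun j => s.2.2.2.2.2.1 j i₀)
      map_add' := fun _ _ => rfl
      map_smul' := fun _ _ => rfl }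
  have hφ : Function.Surjective φ := fun t => by
    obtain ⟨S, hS⟩ := exists_sym2_row i₀ t.2.1
    exact ⟨(S, fun _ => t.1, 0, 0, 0, fun j _ => t.2.2 j, 0), Prod.ext rfl (Prod.ext (funext hS) rfl)⟩
  exact dim_of_equations h.altH h.ndH h.altW h.altZ h.ndZ h.dimQ h.num
    (T := (LinearMap.ker (modelFormI ηH ηW ρ u)).prod ⊤)
    (C := fun F => (u, (0 : ModelQ m Z)) ∈ F)
    (irreducible_pairSet_perp_mem h.altI h.ndI h.altQ h.ndQ h.finrankQ h.num hu)
    φ hφ (D := fun _ => 1) (const_mem_polyFun 1)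
    (fun s _ hφs _ => by
      have hr : rowR ηH ηW s i₀ = u := rowR_eq_iff.2 ⟨congrArg Prod.fst hφs,
        congrFun (congrArg (fun x => x.2.1) hφs)⟩
      rw [← hr]
      exact ⟨chartSpan_le_iff.2 ⟨fun i => ⟨modelForm_rowR h.altH h.altW s i₀ i, trivial⟩,
        fun l => ⟨modelForm_rowE s i₀ l, trivial⟩, fun j => ⟨(modelForm_rowG s i₀ j).trans
          (congrFun (congrArg (fun x => x.2.2) hφs) j), trivial⟩⟩, rowR_mem s i₀⟩)
    (fun s hs hT hC => by
      -- A vector of E orthogonal to F is in the radical, where the first coordinates determine it.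
      have hr : rowR ηH ηW s i₀ = u := by
        refine (mem_span_rowR_iff ?_ rfl).symm
        rw [← radical_chartSpan (ηZ := ηZ) h.altH h.altW hs]
        exact ⟨hC, fun x hx => h.altI.isRefl _ _ (hT hx).1⟩
      obtain ⟨h1, h2⟩ := rowR_eq_iff.1 hr
      refine Prod.ext h1 (Prod.ext (funext h2) (funext fun j => ?_))
      have h3 := (chartSpan_le_iff.1 hT).2.2 j
      have h4 : modelFormI ηH ηW ρ u (rowG ηW s j) = 0 := h3.1
      rw [← hr, modelForm_rowG] at h4
      exact h4) (s₀ := 0) (map_zero φ) rfl one_ne_zero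
    (d := d) (by rw [← hd]; simp only [finrank_prod, finrank_fin_fun]; omega)

end ModelData
end ChartCases

/-! ### Vectors of Q -/

section ChartCases

set_option linter.unusedSectionVars false

open Module LinearMap.BilinForm

variable {ρ σ m : ℕ} {W Z : Type*} [AddCommGroup W] [Module ℂ W] [AddCommGroup Z] [Module ℂ Z]
  [FiniteDimensional ℂ W] [FiniteDimensional ℂ Z]
  {ηH : LinearMap.BilinForm ℂ (Fin σ → ℂ)} {ηW : LinearMap.BilinForm ℂ W}
  {ηZ : LinearMap.BilinForm ℂ Z}

namespace ModelData

variable {q k c : ℕ} (h : ModelData ηH ηW ηZ q k c ρ m)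

include h

/-- For v in Z, orthogonality is one equation per row of Q, and v is never in the image of F because
its pivots vanish. -/
theorem dim_inr_out_of_ne {z : Z} (hz : z ≠ 0) {d : ℕ}
    (hd : d + m = finrank ℂ (Params ρ σ m W Z)) :
    ∃ v : ModelQ m Z, v ≠ 0 ∧ ∀ X : Set (Gr k (ModelI ρ σ W × ModelQ m Z)),
      X = {F ∈ pairSet (modelFormI ηH ηW ρ) (modelFormQ ηZ m) k c
        ((⊤ : Submodule ℂ (ModelI ρ σ W)).prod (LinearMap.ker (modelFormQ ηZ m v))) |
        ((0 : ModelI ρ σ W), v) ∉ supPerp (modelFormI ηH ηW ρ) F.1} →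
      IsIrreducible X ∧ topologicalKrullDim X = d := by
  let v : ModelQ m Z := (0, 0, z)
  have hv : v ≠ 0 := fun hv => hz (congrArg (fun x : ModelQ m Z => x.2.2) hv)
  refine ⟨v, hv, ?_⟩
  rintro X rfl
  let φ : Params ρ σ m W Z →ₗ[ℂ] (Fin m → ℂ) :=
    { toFun := fun s j => ηZ z (s.2.2.2.2.1 j)
      map_add' := fun _ _ => by ext; simp
      map_smul' := fun _ _ => by ext; simp }
  have hφ : Function.Surjective φ := fun t => by
    obtain ⟨z', hz'⟩ : ∃ z', ηZ z z' ≠ 0 := by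
      by_contra! hc
      exact hz (h.ndZ.1 _ hc)
    exact ⟨(0, 0, 0, 0, fun j => (t j * (ηZ z z')⁻¹) • z', 0, 0), by ext; simp [φ, hz']⟩
  have hiff : ∀ s, chartSpan ηH ηW ηZ s ≤
      (⊤ : Submodule ℂ (ModelI ρ σ W)).prod (LinearMap.ker (modelFormQ ηZ m v)) ↔ φ s = 0 := by
    intro s
    rw [chartSpan_le_iff, funext_iff]
    simp [Submodule.mem_prod, hypForm_apply, rowQ, isoRow, v, φ]
  exact dim_of_equations h.altH h.ndH h.altW h.altZ h.ndZ h.dimQ h.num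
    (T := (⊤ : Submodule ℂ (ModelI ρ σ W)).prod (LinearMap.ker (modelFormQ ηZ m v)))
    (C := fun F => ((0 : ModelI ρ σ W), v) ∉ supPerp (modelFormI ηH ηW ρ) F)
    (irreducible_pairSet_right_out h.altI h.ndI h.altQ h.ndQ h.finrankQ h.num hv)
    φ hφ (D := fun _ => 1) (const_mem_polyFun 1)
    (fun s _ hφs _ => ⟨(hiff s).2 hφs, fun hc => by
      obtain ⟨i, -, hi⟩ := mem_supPerp_iff.1 hc
      have h1 := snd_eq_sum_rowQ hi
      have h2 : ((((0 : ModelI ρ σ W), v) + (i, 0)).2).1 = 0 := add_zero _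
      rw [h2] at h1
      simp only [Pi.zero_apply, zero_smul, Finset.sum_const_zero, Prod.snd_add, add_zero] at h1
      exact hv h1⟩)
    (fun s _ hC _ => (hiff s).1 hC) (s₀ := 0) (map_zero φ) rfl one_ne_zero
    (d := d) (by rw [← hd, finrank_fin_fun])

/-- If (i, v) ∈ F with i orthogonal to E, then i differs from `rowG` at j₀ by an element of E, so
this row also pairs to zero with the radical. -/
theorem rowR_apply_of_mem_orthogonal {s : Params ρ σ m W Z} (hs : chartGram ηH ηW s ≠ 0)
    {j₀ : Fin m} {v : ModelQ m Z} (hv : v.1 = Pi.single j₀ 1)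
    (hC : ((0 : ModelI ρ σ W), v) ∈ supPerp (modelFormI ηH ηW ρ) (chartSpan ηH ηW ηZ s)) :
    rowQ ηZ s j₀ = v ∧ ∀ i, s.2.2.2.2.2.1 j₀ i = 0 := by
  obtain ⟨i, hi, hF⟩ := mem_supPerp_iff.1 hC
  have e : ((0 : ModelI ρ σ W), v) + (i, 0) = (i, v) := by simp
  rw [e] at hF
  obtain ⟨h1, h2⟩ := eq_rowQ_of_mem hF hv
  refine ⟨h1.symm, fun l => ?_⟩
  rw [← modelForm_rowG (ηH := ηH)]
  have h3 : modelFormI ηH ηW ρ (rowR ηH ηW s l) i = 0 := hi _ (rowR_mem s l)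
  have h4 : rowR ηH ηW s l ∈ interLeft (chartSpan ηH ηW ηZ s) ⊓
      (modelFormI ηH ηW ρ).orthogonal (interLeft (chartSpan ηH ηW ηZ s)) := by
    rw [radical_chartSpan h.altH h.altW hs]
    exact Submodule.subset_span ⟨l, rfl⟩
  have h5 := h.altI.isRefl _ _ (h4.2 _ h2)
  rw [map_sub, h3, zero_sub, neg_eq_zero] at h5
  exact h5

/-- With Z = 0 the image of F in Q is Lagrangian, so v has to lie in it: row j₀ of the symmetric
matrix vanishes. That v stays outside F + E^⊥ is ensured by a nonzero pairing of the row at j₀ with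
`rowR` at i₀, the function D. -/
theorem dim_inr_out_of_subsingleton [Subsingleton Z] (i₀ : Fin ρ) (j₀ : Fin m) {d : ℕ}
    (hd : d + m = finrank ℂ (Params ρ σ m W Z)) :
    ∃ v : ModelQ m Z, v ≠ 0 ∧ ∀ X : Set (Gr k (ModelI ρ σ W × ModelQ m Z)),
      X = {F ∈ pairSet (modelFormI ηH ηW ρ) (modelFormQ ηZ m) k c
        ((⊤ : Submodule ℂ (ModelI ρ σ W)).prod (LinearMap.ker (modelFormQ ηZ m v))) |
        ((0 : ModelI ρ σ W), v) ∉ supPerp (modelFormI ηH ηW ρ) F.1} →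
      IsIrreducible X ∧ topologicalKrullDim X = d := by
  let v : ModelQ m Z := (Pi.single j₀ 1, 0, 0)
  have hv : v ≠ 0 := fun hv => by
    have := congrFun (congrArg (fun x : ModelQ m Z => x.1) hv) j₀
    simp [v] at this
  refine ⟨v, hv, ?_⟩
  rintro X rfl
  let φ : Params ρ σ m W Z →ₗ[ℂ] (Fin m → ℂ) :=
    { toFun := fun s j => s.2.2.2.1 s(j₀, j)
      map_add' := fun _ _ => rfl
      map_smul' := fun _ _ => rfl }
  have hφ : Function.Surjective φ := fun t => by
    obtain ⟨S, hS⟩ := exists_sym2_row j₀ t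
    exact ⟨(0, 0, 0, S, 0, 0, 0), funext hS⟩
  have hiff : ∀ s, chartSpan ηH ηW ηZ s ≤
      (⊤ : Submodule ℂ (ModelI ρ σ W)).prod (LinearMap.ker (modelFormQ ηZ m v)) ↔ φ s = 0 := by
    intro s
    have hz : ∀ a b, ηZ a b = 0 := fun a b => by
      rw [Subsingleton.elim a 0, map_zero, LinearMap.zero_apply]
    rw [chartSpan_le_iff, funext_iff]
    simp [Submodule.mem_prod, hypForm_apply, rowQ, isoRow, v, φ, hz, Sym2.eq_swap]
  let D : Module.Dual ℂ (Params ρ σ m W Z) :=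
    { toFun := fun s => s.2.2.2.2.2.1 j₀ i₀
      map_add' := fun _ _ => rfl
      map_smul' := fun _ _ => rfl }
  exact dim_of_equations h.altH h.ndH h.altW h.altZ h.ndZ h.dimQ h.num
    (T := (⊤ : Submodule ℂ (ModelI ρ σ W)).prod (LinearMap.ker (modelFormQ ηZ m v)))
    (C := fun F => ((0 : ModelI ρ σ W), v) ∉ supPerp (modelFormI ηH ηW ρ) F)
    (irreducible_pairSet_right_out h.altI h.ndI h.altQ h.ndQ h.finrankQ h.num hv)
    φ hφ (D := D) (dual_mem_polyFun D)
    (fun s hs hφs hDs => ⟨(hiff s).2 hφs, fun hc =>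
      hDs ((h.rowR_apply_of_mem_orthogonal hs rfl hc).2 i₀)⟩)
    (fun s _ hC _ => (hiff s).1 hC) (s₀ := (0, 0, 0, 0, 0, 1, 0)) rfl rfl one_ne_zero
    (d := d) (by rw [← hd, finrank_fin_fun])

theorem inr_mem_supPerp_iff {s : Params ρ σ m W Z} (hs : chartGram ηH ηW s ≠ 0) {j₀ : Fin m} :
    ((0 : ModelI ρ σ W), ((Pi.single j₀ 1, 0, 0) : ModelQ m Z)) ∈
      supPerp (modelFormI ηH ηW ρ) (chartSpan ηH ηW ηZ s) ↔
      rowQ ηZ s j₀ = (Pi.single j₀ 1, 0, 0) ∧ ∀ i, s.2.2.2.2.2.1 j₀ i = 0 := by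
  refine ⟨h.rowR_apply_of_mem_orthogonal hs rfl, fun ⟨h1, h2⟩ => ?_⟩
  have h3 : rowG ηW s j₀ ∈ interLeft (chartSpan ηH ηW ηZ s) ⊔
      (modelFormI ηH ηW ρ).orthogonal (interLeft (chartSpan ηH ηW ηZ s)) :=
    (mem_chartSpan_sup_iff h.altH h.altW h.ndH h.ndW hs).2 fun i => by rw [modelForm_rowG, h2]
  obtain ⟨e, he, i, hi, hei⟩ := Submodule.mem_sup.1 h3
  refine mem_supPerp_iff.2 ⟨i, hi, ?_⟩
  have h4 := Submodule.sub_mem _ (rowG_mem (ηZ := ηZ) s j₀) he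
  rwa [h1, ← hei, show (e + i, ((Pi.single j₀ 1, 0, 0) : ModelQ m Z)) - LinearMap.inl ℂ _ _ e =
    ((0 : ModelI ρ σ W), ((Pi.single j₀ 1, 0, 0) : ModelQ m Z)) + (i, 0) by
      refine Prod.ext ?_ ?_
      · simp
      · simp] at h4

theorem inr_mem_iff {s : Params ρ σ m W Z} (hs : chartGram ηH ηW s ≠ 0) {j₀ : Fin m}
    (hC : ((0 : ModelI ρ σ W), ((Pi.single j₀ 1, 0, 0) : ModelQ m Z)) ∈
      supPerp (modelFormI ηH ηW ρ) (chartSpan ηH ηW ηZ s)) :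
    ((0 : ModelI ρ σ W), ((Pi.single j₀ 1, 0, 0) : ModelQ m Z)) ∈ chartSpan ηH ηW ηZ s ↔
      s.2.2.2.2.2.2 j₀ = 0 := by
  obtain ⟨h1, h2⟩ := (h.inr_mem_supPerp_iff hs).1 hC
  constructor
  · intro hF
    have h3 := Prod.ext_iff.1 (eq_of_pivot_eq hF (rowG_mem s j₀) (by
      rw [h1]
      ext ((i | i) | i) <;> rfl))
    exact (congrArg (fun x : ModelI ρ σ W => x.2.2.2) h3.1).symm
  · intro hw
    have h3 : rowG ηW s j₀ = (0 : ModelI ρ σ W) := by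
      refine Prod.ext rfl (Prod.ext ?_ (Prod.ext rfl hw))
      ext i
      simp [rowG, h2, hw]
    have h4 := rowG_mem (ηH := ηH) (ηW := ηW) (ηZ := ηZ) s j₀
    rwa [h1, h3] at h4

theorem chartSpan_le_of_rowQ {s : Params ρ σ m W Z} {j₀ : Fin m}
    (hr : rowQ ηZ s j₀ = (Pi.single j₀ 1, 0, 0)) : chartSpan ηH ηW ηZ s ≤
      (⊤ : Submodule ℂ (ModelI ρ σ W)).prod
        (LinearMap.ker (modelFormQ ηZ m ((Pi.single j₀ 1, 0, 0) : ModelQ m Z))) := by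
  rw [← hr]
  exact chartSpan_le_iff.2 ⟨fun i => ⟨trivial, map_zero (modelFormQ ηZ m _)⟩,
    fun l => ⟨trivial, map_zero (modelFormQ ηZ m _)⟩,
    fun j => ⟨trivial, modelForm_rowQ h.altZ s j₀ j⟩⟩

/-- The equations say that the Q-row at j₀ is v (dim Z + m of them) and that its I-component is
orthogonal to the radical (ρ). A nonzero W-component keeps v itself out of F. -/
theorem dim_inr_mid (j₀ : Fin m) {w : W} (hw : w ≠ 0) {d : ℕ}
    (hd : d + (finrank ℂ Z + m + ρ) = finrank ℂ (Params ρ σ m W Z)) :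
    ∃ v : ModelQ m Z, v ≠ 0 ∧ ∀ X : Set (Gr k (ModelI ρ σ W × ModelQ m Z)),
      X = {F ∈ pairSet (modelFormI ηH ηW ρ) (modelFormQ ηZ m) k c
        ((⊤ : Submodule ℂ (ModelI ρ σ W)).prod (LinearMap.ker (modelFormQ ηZ m v))) |
        ((0 : ModelI ρ σ W), v) ∈ supPerp (modelFormI ηH ηW ρ) F.1 ∧
          (False ↔ ((0 : ModelI ρ σ W), v) ∈ F.1)} →
      IsIrreducible X ∧ topologicalKrullDim X = d := by
  let v : ModelQ m Z := (Pi.single j₀ 1, 0, 0)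
  have hv : v ≠ 0 := fun hv => by
    have := congrFun (congrArg (fun x : ModelQ m Z => x.1) hv) j₀
    simp [v] at this
  refine ⟨v, hv, ?_⟩
  rintro X rfl
  let φ : Params ρ σ m W Z →ₗ[ℂ] Z × (Fin m → ℂ) × (Fin ρ → ℂ) :=
    { toFun := fun s => (s.2.2.2.2.1 j₀, fun j => s.2.2.2.1 s(j₀, j), s.2.2.2.2.2.1 j₀)
      map_add' := fun _ _ => rfl
      map_smul' := fun _ _ => rfl }
  have hφ : Function.Surjective φ := fun t => by
    obtain ⟨S, hS⟩ := exists_sym2_row j₀ t.2.1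
    exact ⟨(0, 0, 0, S, fun _ => t.1, fun _ => t.2.2, 0), Prod.ext rfl (Prod.ext (funext hS) rfl)⟩
  have hiff : ∀ s, φ s = 0 ↔ rowQ ηZ s j₀ = v ∧ ∀ i, s.2.2.2.2.2.1 j₀ i = 0 := fun s => by
    rw [rowQ_eq_iff]
    exact ⟨fun hs => ⟨⟨congrArg Prod.fst hs, congrFun (congrArg (fun x => x.2.1) hs)⟩,
      congrFun (congrArg (fun x => x.2.2) hs)⟩,
      fun hs => Prod.ext hs.1.1 (Prod.ext (funext hs.1.2) (funext hs.2))⟩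
  obtain ⟨w', hw'⟩ := h.exists_apply_eq_one hw
  let D : Module.Dual ℂ (Params ρ σ m W Z) :=
    { toFun := fun s => ηW w' (s.2.2.2.2.2.2 j₀)
      map_add' := fun _ _ => map_add _ _ _
      map_smul' := fun _ _ => map_smul _ _ _ }
  exact dim_of_equations h.altH h.ndH h.altW h.altZ h.ndZ h.dimQ h.num
    (T := (⊤ : Submodule ℂ (ModelI ρ σ W)).prod (LinearMap.ker (modelFormQ ηZ m v)))
    (C := fun F => ((0 : ModelI ρ σ W), v) ∈ supPerp (modelFormI ηH ηW ρ) F ∧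
      (False ↔ ((0 : ModelI ρ σ W), v) ∈ F))
    (irreducible_pairSet_right_aux h.altI h.ndI h.altQ h.ndQ h.finrankQ h.num hv False rfl)
    φ hφ (D := D) (dual_mem_polyFun D)
    (fun s hs hφs hDs => by
      have h1 := (hiff s).1 hφs
      have h2 := (h.inr_mem_supPerp_iff hs).2 h1
      refine ⟨h.chartSpan_le_of_rowQ h1.1, h2, False.elim, fun hF => hDs ?_⟩
      show ηW w' (s.2.2.2.2.2.2 j₀) = 0
      rw [(h.inr_mem_iff hs h2).1 hF, map_zero])
    (fun s hs _ hC => (hiff s).2 ((h.inr_mem_supPerp_iff hs).1 hC.1))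
    (s₀ := (0, 0, 0, 0, 0, 0, fun _ => w)) rfl rfl (hw'.trans_ne one_ne_zero)
    (d := d) (by rw [← hd]; simp only [finrank_prod, finrank_fin_fun]; omega)

/-- As in `dim_inr_mid`, with the W-component of the row required to vanish, which costs dim W
further equations. -/
theorem dim_inr_mem (j₀ : Fin m) {d : ℕ}
    (hd : d + (finrank ℂ Z + m + ρ + finrank ℂ W) = finrank ℂ (Params ρ σ m W Z)) :
    ∃ v : ModelQ m Z, v ≠ 0 ∧ ∀ X : Set (Gr k (ModelI ρ σ W × ModelQ m Z)),
      X = {F ∈ pairSet (modelFormI ηH ηW ρ) (modelFormQ ηZ m) k c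
        ((⊤ : Submodule ℂ (ModelI ρ σ W)).prod (LinearMap.ker (modelFormQ ηZ m v))) |
        ((0 : ModelI ρ σ W), v) ∈ supPerp (modelFormI ηH ηW ρ) F.1 ∧
          (True ↔ ((0 : ModelI ρ σ W), v) ∈ F.1)} →
      IsIrreducible X ∧ topologicalKrullDim X = d := by
  let v : ModelQ m Z := (Pi.single j₀ 1, 0, 0)
  have hv : v ≠ 0 := fun hv => by
    have := congrFun (congrArg (fun x : ModelQ m Z => x.1) hv) j₀
    simp [v] at this
  refine ⟨v, hv, ?_⟩
  rintro X rfl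
  let φ : Params ρ σ m W Z →ₗ[ℂ] Z × (Fin m → ℂ) × (Fin ρ → ℂ) × W :=
    { toFun := fun s => (s.2.2.2.2.1 j₀, fun j => s.2.2.2.1 s(j₀, j), s.2.2.2.2.2.1 j₀,
        s.2.2.2.2.2.2 j₀)
      map_add' := fun _ _ => rfl
      map_smul' := fun _ _ => rfl }
  have hφ : Function.Surjective φ := fun t => by
    obtain ⟨S, hS⟩ := exists_sym2_row j₀ t.2.1
    exact ⟨(0, 0, 0, S, fun _ => t.1, fun _ => t.2.2.1, fun _ => t.2.2.2),
      Prod.ext rfl (Prod.ext (funext hS) rfl)⟩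
  have hiff : ∀ s, φ s = 0 ↔ (rowQ ηZ s j₀ = v ∧ ∀ i, s.2.2.2.2.2.1 j₀ i = 0) ∧
      s.2.2.2.2.2.2 j₀ = 0 := fun s => by
    rw [rowQ_eq_iff]
    exact ⟨fun hs => ⟨⟨⟨congrArg Prod.fst hs, congrFun (congrArg (fun x => x.2.1) hs)⟩,
      congrFun (congrArg (fun x => x.2.2.1) hs)⟩, congrArg (fun x => x.2.2.2) hs⟩,
      fun hs => Prod.ext hs.1.1.1 (Prod.ext (funext hs.1.1.2) (Prod.ext (funext hs.1.2) hs.2))⟩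
  exact dim_of_equations h.altH h.ndH h.altW h.altZ h.ndZ h.dimQ h.num
    (T := (⊤ : Submodule ℂ (ModelI ρ σ W)).prod (LinearMap.ker (modelFormQ ηZ m v)))
    (C := fun F => ((0 : ModelI ρ σ W), v) ∈ supPerp (modelFormI ηH ηW ρ) F ∧
      (True ↔ ((0 : ModelI ρ σ W), v) ∈ F))
    (irreducible_pairSet_right_aux h.altI h.ndI h.altQ h.ndQ h.finrankQ h.num hv True rfl)
    φ hφ (D := fun _ => 1) (const_mem_polyFun 1)
    (fun s hs hφs _ => by
      have h1 := (hiff s).1 hφs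
      have h2 := (h.inr_mem_supPerp_iff hs).2 h1.1
      exact ⟨h.chartSpan_le_of_rowQ h1.1.1, h2, fun _ => (h.inr_mem_iff hs h2).2 h1.2,
        fun _ => trivial⟩)
    (fun s hs _ hC => (hiff s).2 ⟨(h.inr_mem_supPerp_iff hs).1 hC.1,
      (h.inr_mem_iff hs hC.1).1 (hC.2.1 trivial)⟩)
    (s₀ := 0) (map_zero φ) rfl one_ne_zero
    (d := d) (by rw [← hd]; simp only [finrank_prod, finrank_fin_fun]; omega)

end ModelData
end ChartCases

/-! ### The normal form of a self-adjoint endomorphism of square zero -/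

section Standard

open Module LinearMap.BilinForm

variable {V I Q : Type*} [AddCommGroup V] [Module ℂ V] [AddCommGroup I] [Module ℂ I]
  [AddCommGroup Q] [Module ℂ Q]

/-- `Φ` identifies `I × Q × I` with `V` in such a way that the endomorphism `x` maps the last
factor to the first one, and the form pairs these two factors by `β`. -/
structure IsStandard (ω : LinearMap.BilinForm ℂ V) (x : End ℂ V) (β : LinearMap.BilinForm ℂ I)
    (γ : LinearMap.BilinForm ℂ Q) (Φ : (I × Q × I) ≃ₗ[ℂ] V) : Prop where
  form : ∀ a b, ω (Φ a) (Φ b) = β a.1 b.2.2 + β a.2.2 b.1 + γ a.2.1 b.2.1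
  apply : ∀ a, x (Φ a) = Φ (a.2.2, 0, 0)

variable {ω : LinearMap.BilinForm ℂ V} {x : End ℂ V} {β : LinearMap.BilinForm ℂ I}
  {γ : LinearMap.BilinForm ℂ Q}

/-- The linear automorphism given by a pair of mutually inverse endomorphisms. -/
def autOf {U : Type*} [AddCommGroup U] [Module ℂ U] (f g : U →ₗ[ℂ] U) (h1 : ∀ u, g (f u) = u)
    (h2 : ∀ u, f (g u) = u) : U ≃ₗ[ℂ] U :=
  { f with invFun := g, left_inv := h1, right_inv := h2 }

theorem IsStandard.trans {Φ : (I × Q × I) ≃ₗ[ℂ] V} (h : IsStandard ω x β γ Φ)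
    (g : (I × Q × I) ≃ₗ[ℂ] I × Q × I)
    (h1 : ∀ a b, β (g a).1 (g b).2.2 + β (g a).2.2 (g b).1 + γ (g a).2.1 (g b).2.1 =
      β a.1 b.2.2 + β a.2.2 b.1 + γ a.2.1 b.2.1)
    (h2 : ∀ a, g (a.2.2, 0, 0) = ((g a).2.2, 0, 0)) : IsStandard ω x β γ (g.trans Φ) where
  form a b := by rw [LinearEquiv.trans_apply, LinearEquiv.trans_apply, h.form, h1]
  apply a := by rw [LinearEquiv.trans_apply, LinearEquiv.trans_apply, h.apply, h2]

theorem IsStandard.map_isometry {Φ : (I × Q × I) ≃ₗ[ℂ] V} (h : IsStandard ω x β γ Φ)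
    {g : I ≃ₗ[ℂ] I} (hg : ∀ a b, β (g a) (g b) = β a b) {f : Q ≃ₗ[ℂ] Q}
    (hf : ∀ a b, γ (f a) (f b) = γ a b) :
    IsStandard ω x β γ ((g.prodCongr (f.prodCongr g)).trans Φ) := by
  refine h.trans _ (fun a b => ?_) fun a => ?_
  · simp [hg, hf]
  · simp

/-- The transvections that do not change the form and commute with the endomorphism. -/
def shear (β : LinearMap.BilinForm ℂ I) (γ : LinearMap.BilinForm ℂ Q) (t : I) (q : Q) :
    (I × Q × I) →ₗ[ℂ] I × Q × I :=
  LinearMap.prod (LinearMap.fst ℂ _ _ - (γ.flip q ∘ₗ LinearMap.fst ℂ _ _ ∘ₗ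
      LinearMap.snd ℂ _ _).smulRight t)
    (LinearMap.prod (LinearMap.fst ℂ _ _ ∘ₗ LinearMap.snd ℂ _ _ +
      (β t ∘ₗ LinearMap.snd ℂ _ _ ∘ₗ LinearMap.snd ℂ _ _).smulRight q)
      (LinearMap.snd ℂ _ _ ∘ₗ LinearMap.snd ℂ _ _))

theorem shear_apply (t : I) (q : Q) (a : I × Q × I) :
    shear β γ t q a = (a.1 - γ a.2.1 q • t, a.2.1 + β t a.2.2 • q, a.2.2) := rfl

theorem exists_shear {Φ : (I × Q × I) ≃ₗ[ℂ] V} (h : IsStandard ω x β γ Φ) (hβ : β.IsAlt)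
    (hγ : γ.IsAlt) (t : I) (q : Q) :
    ∃ Φ', IsStandard ω x β γ Φ' ∧ ∀ a, Φ' a = Φ (shear β γ t q a) := by
  refine ⟨(autOf (shear β γ t q) (shear β γ t (-q)) (fun u => ?_) fun u => ?_).trans Φ,
    h.trans _ (fun a b => ?_) (fun a => ?_), fun a => rfl⟩
  · simp only [shear_apply]
    refine Prod.ext ?_ (Prod.ext ?_ rfl)
    · simp [hγ.self_eq_zero]
    · simp
  · simp only [shear_apply]
    refine Prod.ext ?_ (Prod.ext ?_ rfl)
    · simp [hγ.self_eq_zero]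
    · simp
  · show β (shear β γ t q a).1 (shear β γ t q b).2.2 + β (shear β γ t q a).2.2 (shear β γ t q b).1 +
      γ (shear β γ t q a).2.1 (shear β γ t q b).2.1 = _
    simp only [shear_apply, map_sub, map_add, map_smul, LinearMap.sub_apply, LinearMap.add_apply,
      LinearMap.smul_apply, smul_eq_mul, hγ.self_eq_zero]
    rw [← hβ.neg_eq t a.2.2, ← hγ.neg_eq q b.2.1]
    ring
  · show shear β γ t q _ = ((shear β γ t q a).2.2, 0, 0)
    simp [shear_apply]

/-- The automorphisms given by an endomorphism of `I`. -/
def unip (B : I →ₗ[ℂ] I) : (I × Q × I) →ₗ[ℂ] I × Q × I :=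
  LinearMap.prod (LinearMap.fst ℂ _ _ + B ∘ₗ LinearMap.snd ℂ _ _ ∘ₗ LinearMap.snd ℂ _ _)
    (LinearMap.snd ℂ _ _)

theorem exists_unip {Φ : (I × Q × I) ≃ₗ[ℂ] V} (h : IsStandard ω x β γ Φ) {B : I →ₗ[ℂ] I}
    (hB : ∀ i j, β (B i) j + β i (B j) = 0) :
    ∃ Φ', IsStandard ω x β γ Φ' ∧ ∀ a, Φ' a = Φ (a.1 + B a.2.2, a.2) := by
  refine ⟨(autOf (unip B) (unip (-B)) (fun u => ?_) fun u => ?_).trans Φ,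
    h.trans _ (fun a b => ?_) (fun a => ?_), fun a => rfl⟩
  · exact Prod.ext (by simp [unip]) rfl
  · exact Prod.ext (by simp [unip]) rfl
  · show β (a.1 + B a.2.2) b.2.2 + β a.2.2 (b.1 + B b.2.2) + γ a.2.1 b.2.1 = _
    rw [map_add, LinearMap.add_apply, map_add]
    linear_combination hB a.2.2 b.2.2
  · show (a.2.2 + B 0, ((0 : Q), (0 : I))) = _
    rw [map_zero, add_zero]
    rfl

/-- Under sp(I) ≅ Sym² I the element r·t' with β(u, t') = 1 sends u to r up to a multiple of t',
which a multiple of t'·t' corrects. -/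
theorem exists_infinitesimal (hβ : β.IsAlt) (hβn : β.Nondegenerate) {u : I} (hu : u ≠ 0) (r : I) :
    ∃ B : I →ₗ[ℂ] I, (∀ i j, β (B i) j + β i (B j) = 0) ∧ B u = r := by
  obtain ⟨t, ht⟩ : ∃ t, β u t ≠ 0 := by
    by_contra! hc
    exact hu (hβn.1 u hc)
  let t' := (β u t)⁻¹ • t
  have ht' : β u t' = 1 := by simp [t', ht]
  refine ⟨(β.flip t').smulRight r + (β.flip r).smulRight t' - (β.flip t').smulRight (β u r • t'),
    fun i j => ?_, ?_⟩
  · have hf : ∀ a b, β.flip a b = β b a := fun _ _ => rfl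
    simp only [LinearMap.add_apply, LinearMap.sub_apply, LinearMap.smulRight_apply, hf, map_add, map_sub, map_smul, LinearMap.smul_apply, smul_eq_mul]
    rw [← hβ.neg_eq j r, ← hβ.neg_eq j t']
    ring
  · simp [ht']

variable [FiniteDimensional ℂ V] [FiniteDimensional ℂ I] [FiniteDimensional ℂ Q]

/-- im x is symplectic under (xu, xw) ↦ ω(u, xw). An isotropic section of x spans with im x a
nondegenerate subspace, and Q is its orthogonal complement. -/
theorem exists_isStandard (hω : ω.IsAlt) (hωn : ω.Nondegenerate)
    (hx : ∀ u w, ω (x u) w = ω u (x w)) (hx2 : ∀ u, x (x u) = 0) (hβ : β.IsAlt)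
    (hβn : β.Nondegenerate) (hγ : γ.IsAlt) (hγn : γ.Nondegenerate)
    (hI : finrank ℂ (LinearMap.range x) = finrank ℂ I)
    (hV : finrank ℂ V = 2 * finrank ℂ I + finrank ℂ Q) :
    ∃ Φ, IsStandard ω x β γ Φ := by
  obtain ⟨s₀, hs₀⟩ := x.rangeRestrict.exists_rightInverse_of_surjective x.range_rangeRestrict
  have hs₀ : ∀ r, x (s₀ r) = r := fun r => congrArg Subtype.val (LinearMap.congr_fun hs₀ r)
  let R := LinearMap.range x
  have hker : ∀ w, x w = 0 → ∀ r ∈ R, ω w r = 0 := by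
    rintro w hw _ ⟨a, rfl⟩
    rw [← hx, hw, map_zero, LinearMap.zero_apply]
  have hxR : ∀ r ∈ R, x r = 0 := by rintro _ ⟨a, rfl⟩; exact hx2 a
  let βR : LinearMap.BilinForm ℂ R := ω.comp s₀ R.subtype
  have hβR : ∀ r r', βR r r' = ω (s₀ r) r' := fun _ _ => rfl
  -- Self-adjointness makes ω(s, xs) equal to ω(xs, s), which is its own negative.
  have hβRa : βR.IsAlt := fun r => by
    have h1 : ω (s₀ r) (x (s₀ r)) = ω (x (s₀ r)) (s₀ r) := (hx _ _).symm
    rw [← hω.neg_eq (s₀ r), hs₀] at h1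
    rw [hβR]
    exact self_eq_neg.1 h1
  have hβRn : βR.Nondegenerate := by
    have h : ∀ r', (∀ r, βR r r' = 0) → r' = 0 := fun r' h => Subtype.ext (hωn.2 _ fun a => by
      have h1 := h ⟨x a, a, rfl⟩
      rw [hβR] at h1
      have h2 := hker (a - s₀ ⟨x a, a, rfl⟩) (by rw [map_sub, hs₀, sub_self]) r' r'.2
      rw [map_sub, LinearMap.sub_apply, h1, sub_zero] at h2
      exact h2)
    exact ⟨fun r hr => h r fun r' => hβRa.isRefl _ _ (hr r'), h⟩
  obtain ⟨ψ, hψ⟩ := exists_isometry hβ hβn hβRa hβRn hI.symm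
  let a : I →ₗ[ℂ] V := R.subtype ∘ₗ ψ.toLinearMap
  let s₁ : I →ₗ[ℂ] V := s₀ ∘ₗ ψ.toLinearMap
  have haR : ∀ i, a i ∈ R := fun i => (ψ i).2
  have hs₁a : ∀ i j, ω (s₁ i) (a j) = β i j := fun i j => hψ i j
  have hxs₁ : ∀ i, x (s₁ i) = a i := fun i => hs₀ _
  have haa : ∀ i j, ω (a i) (a j) = 0 := fun i j => hker _ (hxR _ (haR i)) _ (haR j)
  -- The section s₁ is corrected by elements of im x so as to become isotropic; the factor 1/2
  -- appears because both arguments are corrected.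
  let C : I →ₗ[ℂ] I := (toDual β hβn).symm.toLinearMap ∘ₗ
    ((-(1 / 2 : ℂ)) • (ω.comp s₁ s₁ : LinearMap.BilinForm ℂ I))
  have hC : ∀ i j, β (C i) j = -(1 / 2 : ℂ) * ω (s₁ i) (s₁ j) := fun i j => by
    rw [← toDual_def (B := β) hβn]
    simp [C]
  let s : I →ₗ[ℂ] V := s₁ + a ∘ₗ C
  have hs : ∀ i, s i = s₁ i + a (C i) := fun _ => rfl
  have hsa : ∀ i j, ω (s i) (a j) = β i j := fun i j => by
    rw [hs, map_add, LinearMap.add_apply, hs₁a, haa, add_zero]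
  have has : ∀ i j, ω (a i) (s j) = β i j := fun i j => by
    rw [← hω.neg_eq, hsa, hβ.neg_eq]
  have hss : ∀ i j, ω (s i) (s j) = 0 := fun i j => by
    have h1 : ω (a (C i)) (s₁ j) = β (C i) j := by rw [← hω.neg_eq, hs₁a, hβ.neg_eq]
    rw [hs, hs, map_add, map_add, LinearMap.add_apply, LinearMap.add_apply, hs₁a, haa, h1, hC]
    linear_combination -hβ.neg_eq i (C j) - hC j i - 1 / 2 * hω.neg_eq (s₁ i) (s₁ j)
  have hxs : ∀ i, x (s i) = a i := fun i => by rw [hs, map_add, hxs₁, hxR _ (haR _), add_zero]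
  let f : I × I →ₗ[ℂ] V := a.coprod s
  have hf : ∀ i j, f (i, j) = a i + s j := fun i j => LinearMap.coprod_apply _ _ _
  have hfa : ∀ y j, ω (f y) (a j) = β y.2 j := fun y j => by
    rw [hf, map_add, LinearMap.add_apply, haa, hsa, zero_add]
  have hfs : ∀ y j, ω (f y) (s j) = β y.1 j := fun y j => by
    rw [hf, map_add, LinearMap.add_apply, hss, has, add_zero]
  have hfinj : ∀ y, (∀ j, ω (f y) (a j) = 0) → (∀ j, ω (f y) (s j) = 0) → y = 0 :=
    fun y h1 h2 => Prod.ext (hβn.1 _ fun j => (hfs y j).symm.trans (h2 j))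
      (hβn.1 _ fun j => (hfa y j).symm.trans (h1 j))
  have hfker : LinearMap.ker f = ⊥ := LinearMap.ker_eq_bot'.2 fun y hy =>
    hfinj y (fun j => by rw [hy, map_zero, LinearMap.zero_apply])
      (fun j => by rw [hy, map_zero, LinearMap.zero_apply])
  let T := LinearMap.range f
  have haT : ∀ i, a i ∈ T := fun i => ⟨(i, 0), by rw [hf, map_zero, add_zero]⟩
  have hsT : ∀ i, s i ∈ T := fun i => ⟨(0, i), by rw [hf, map_zero, zero_add]⟩
  have hT : finrank ℂ T = 2 * finrank ℂ I := by
    have := LinearMap.finrank_range_of_inj (LinearMap.ker_eq_bot.1 hfker)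
    rw [this, finrank_prod]
    ring
  have hdisj : Disjoint T (ω.orthogonal T) := by
    rw [Submodule.disjoint_def]
    rintro _ ⟨y, rfl⟩ hy
    rw [hfinj y (fun j => hω.isRefl _ _ (hy _ (haT j))) (fun j => hω.isRefl _ _ (hy _ (hsT j))),
      map_zero]
  have hQn : (ω.restrict (ω.orthogonal T)).Nondegenerate := by
    rw [restrict_nondegenerate_iff_isCompl_orthogonal hω.isRefl,
      orthogonal_orthogonal hωn hω.isRefl]
    exact ((isCompl_orthogonal_iff_disjoint hω.isRefl).2 hdisj).symm
  have hQa : (ω.restrict (ω.orthogonal T)).IsAlt := fun y => hω _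
  obtain ⟨χ, hχ⟩ := exists_isometry hγ hγn hQa hQn (by
    have h1 := finrank_orthogonal hωn T
    have h2 := Submodule.finrank_le T
    omega)
  have hχ : ∀ q q', ω (χ q).1 (χ q').1 = γ q q' := hχ
  have haχ : ∀ i q, ω (a i) (χ q).1 = 0 := fun i q => (χ q).2 _ (haT i)
  have hsχ : ∀ i q, ω (s i) (χ q).1 = 0 := fun i q => (χ q).2 _ (hsT i)
  have hχa : ∀ i q, ω (χ q).1 (a i) = 0 := fun i q => hω.isRefl _ _ (haχ i q)
  have hχs : ∀ i q, ω (χ q).1 (s i) = 0 := fun i q => hω.isRefl _ _ (hsχ i q)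
  -- Vectors orthogonal to im x are killed by the self-adjoint x.
  have hxχ : ∀ q, x (χ q).1 = 0 := fun q => hωn.1 _ fun w => by
    obtain ⟨i, hi⟩ : ∃ i, a i = x w := ⟨ψ.symm ⟨x w, w, rfl⟩, by simp [a]⟩
    rw [hx, ← hi, hχa]
  let Φ₀ : (I × Q × I) →ₗ[ℂ] V :=
    a.coprod (((ω.orthogonal T).subtype ∘ₗ χ.toLinearMap).coprod s)
  have hΦ₀ : ∀ y, Φ₀ y = a y.1 + ((χ y.2.1).1 + s y.2.2) := fun y => by
    simp [Φ₀]
  have hform : ∀ y y', ω (Φ₀ y) (Φ₀ y') = β y.1 y'.2.2 + β y.2.2 y'.1 + γ y.2.1 y'.2.1 := by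
    intro y y'
    simp only [hΦ₀, map_add, LinearMap.add_apply, haa, has, hsa, hss, hχ, haχ, hsχ, hχa, hχs]
    ring
  have hinj : LinearMap.ker Φ₀ = ⊥ := LinearMap.ker_eq_bot'.2 fun y hy => by
    have h1 : ∀ y' : I × Q × I, β y.1 y'.2.2 + β y.2.2 y'.1 + γ y.2.1 y'.2.1 = 0 := fun y' => by
      rw [← hform, hy, map_zero, LinearMap.zero_apply]
    refine Prod.ext (hβn.1 _ fun j => ?_) (Prod.ext (hγn.1 _ fun j => ?_) (hβn.1 _ fun j => ?_))
    · simpa using h1 (0, 0, j)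
    · simpa using h1 (0, j, 0)
    · simpa using h1 (j, 0, 0)
  have hdim : finrank ℂ (I × Q × I) = finrank ℂ V := by
    simp only [finrank_prod]
    omega
  refine ⟨LinearEquiv.ofInjectiveOfFinrankEq Φ₀ (LinearMap.ker_eq_bot.1 hinj) hdim, hform,
    fun y => ?_⟩
  show x (Φ₀ y) = Φ₀ (y.2.2, 0, 0)
  rw [hΦ₀, hΦ₀, map_add, map_add, hxR _ (haR _), hxχ, hxs]
  simp

end Standard

/-! ### Position of the vector -/

/-- The position of a vector with respect to the kernel and the image of an endomorphism of square
zero. -/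
inductive Position
  /-- outside the kernel -/
  | out
  /-- in the kernel and outside the image -/
  | ker
  /-- in the image, and nonzero -/
  | im
  /-- zero -/
  | zero

section Position

set_option linter.unusedSectionVars false

open Module LinearMap.BilinForm

variable {V : Type*} [AddCommGroup V] [Module ℂ V]

/-- The vector `v` is in the given position with respect to `x`. -/
def Position.Holds (x : End ℂ V) (v : V) : Position → Prop
  | out => x v ≠ 0
  | ker => x v = 0 ∧ v ∉ LinearMap.range x
  | im => v ∈ LinearMap.range x ∧ v ≠ 0
  | zero => v = 0

variable {I Q : Type*} [AddCommGroup I] [Module ℂ I] [AddCommGroup Q] [Module ℂ Q]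
  {ω : LinearMap.BilinForm ℂ V} {x : End ℂ V} {β : LinearMap.BilinForm ℂ I}
  {γ : LinearMap.BilinForm ℂ Q} {Φ : (I × Q × I) ≃ₗ[ℂ] V} [FiniteDimensional ℂ V]
  [FiniteDimensional ℂ I] [FiniteDimensional ℂ Q] {v : V}

/-- The coordinates are adjusted one at a time: an isometry of I brings the last to u, a shear the
middle one to q, and a unipotent map the first to 0. The last two leave the coordinates already
adjusted unchanged. -/
theorem IsStandard.exists_out (h : IsStandard ω x β γ Φ) (hβ : β.IsAlt) (hβn : β.Nondegenerate)
    (hγ : γ.IsAlt) (hv : x v ≠ 0) {u : I} (hu : u ≠ 0) (q : Q) :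
    ∃ Φ, IsStandard ω x β γ Φ ∧ Φ (0, q, u) = v := by
  obtain ⟨⟨i, q₁, j⟩, rfl⟩ := Φ.surjective v
  have hj : j ≠ 0 := by
    rintro rfl
    apply hv
    rw [h.apply]
    exact map_zero Φ
  obtain ⟨g, hg, hgu⟩ := exists_isometry_self hβ hβn hu hj
  have h1 := h.map_isometry hg (f := LinearEquiv.refl ℂ Q) fun _ _ => rfl
  obtain ⟨t, ht⟩ : ∃ t, β t u = 1 := by
    obtain ⟨t, ht⟩ : ∃ t, β t u ≠ 0 := by
      by_contra! hc
      exact hu (hβn.2 u hc)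
    exact ⟨(β t u)⁻¹ • t, by simp [ht]⟩
  obtain ⟨Φ₂, h2, hΦ₂⟩ := exists_shear h1 hβ hγ t (q₁ - q)
  obtain ⟨B, hB, hBu⟩ := exists_infinitesimal hβ hβn hu (g.symm i + γ q (q₁ - q) • t)
  obtain ⟨Φ₃, h3, hΦ₃⟩ := exists_unip h2 hB
  refine ⟨Φ₃, h3, ?_⟩
  rw [hΦ₃, hΦ₂, shear_apply]
  simp [hBu, ht, hgu]

/-- The Q-coordinate is nonzero, so an isometry of Q brings it to q, and a shear then changes the
first coordinate at will. -/
theorem IsStandard.exists_ker (h : IsStandard ω x β γ Φ) (hβ : β.IsAlt)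
    (hγ : γ.IsAlt) (hγn : γ.Nondegenerate) (hv : x v = 0) (hv' : v ∉ LinearMap.range x) (u : I)
    {q : Q} (hq : q ≠ 0) : ∃ Φ, IsStandard ω x β γ Φ ∧ Φ (u, q, 0) = v := by
  obtain ⟨⟨i, q₁, j⟩, rfl⟩ := Φ.surjective v
  obtain rfl : j = 0 := by
    rw [h.apply, LinearEquiv.map_eq_zero_iff] at hv
    exact congrArg Prod.fst hv
  have hq₁ : q₁ ≠ 0 := by
    rintro rfl
    exact hv' ⟨Φ (0, 0, i), h.apply _⟩
  obtain ⟨f, hf, hfq⟩ := exists_isometry_self hγ hγn hq hq₁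
  have h1 := h.map_isometry (g := LinearEquiv.refl ℂ I) (fun _ _ => rfl) hf
  obtain ⟨t, ht⟩ : ∃ t, γ q t = 1 := by
    obtain ⟨t, ht⟩ : ∃ t, γ q t ≠ 0 := by
      by_contra! hc
      exact hq (hγn.1 q hc)
    exact ⟨(γ q t)⁻¹ • t, by simp [ht]⟩
  obtain ⟨Φ₂, h2, hΦ₂⟩ := exists_shear h1 hβ hγ (u - i) t
  refine ⟨Φ₂, h2, ?_⟩
  rw [hΦ₂, shear_apply]
  simp [hfq, ht]

theorem IsStandard.exists_im (h : IsStandard ω x β γ Φ) (hβ : β.IsAlt) (hβn : β.Nondegenerate)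
    (hv : v ∈ LinearMap.range x) (hv0 : v ≠ 0) {u : I} (hu : u ≠ 0) :
    ∃ Φ, IsStandard ω x β γ Φ ∧ Φ (u, 0, 0) = v := by
  obtain ⟨w, rfl⟩ := hv
  obtain ⟨⟨i, q₁, j⟩, rfl⟩ := Φ.surjective w
  have hj : j ≠ 0 := by
    rintro rfl
    apply hv0
    rw [h.apply]
    exact map_zero Φ
  obtain ⟨g, hg, hgu⟩ := exists_isometry_self hβ hβn hu hj
  exact ⟨_, h.map_isometry hg (f := LinearEquiv.refl ℂ Q) fun _ _ => rfl, by
    rw [h.apply]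
    simp [hgu]⟩

end Position

/-! ### Bipartitions with at most two columns -/

section Diagrams

/-- The diagram `μ` has two columns, of lengths `a` and `b`. -/
structure HasCols (μ : YoungDiagram) (a b : ℕ) : Prop where
  zero : μ.colLen 0 = a
  one : μ.colLen 1 = b
  two : μ.colLen 2 = 0

variable {μ ν : YoungDiagram} {a b p q : ℕ}

theorem lt_rowLen_iff (μ : YoungDiagram) (i j : ℕ) : j < μ.rowLen i ↔ i < μ.colLen j := by
  rw [← YoungDiagram.mem_iff_lt_rowLen, YoungDiagram.mem_iff_lt_colLen]

theorem HasCols.rowLen (h : HasCols μ a b) (i : ℕ) :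
    μ.rowLen i = if i < b then 2 else if i < a then 1 else 0 := by
  have h0 := lt_rowLen_iff μ i 0
  have h1 := lt_rowLen_iff μ i 1
  have h2 := lt_rowLen_iff μ i 2
  rw [h.zero] at h0
  rw [h.one] at h1
  rw [h.two] at h2
  split_ifs <;> omega

theorem HasCols.le (h : HasCols μ a b) : b ≤ a := by
  rw [← h.zero, ← h.one]
  exact μ.colLen_anti 0 1 zero_le_one

theorem hasCols_of_rowLen_le (h : μ.rowLen 0 ≤ 2) : HasCols μ (μ.colLen 0) (μ.colLen 1) :=
  ⟨rfl, rfl, by have := lt_rowLen_iff μ 0 2; omega⟩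

/-- The bipartitions of the exotic Jordan types of the pairs `(v, x)` with `x ^ 2 = 0`, where `v` is
in a given position, the rank of `x` is `2 * p` and the dimension is `4 * p + 2 * q`. -/
def Shape (p q : ℕ) (μ ν : YoungDiagram) : Position → Prop
  | .out => (HasCols μ (p + q) p ∧ HasCols ν 0 0) ∧ 0 < p
  | .ker => (HasCols μ (p + q) 0 ∧ HasCols ν p 0) ∧ 0 < q
  | .im => (HasCols μ p 0 ∧ HasCols ν (p + q) 0) ∧ 0 < p
  | .zero => HasCols μ 0 0 ∧ HasCols ν (p + q) p

/-- The sum μ + ν, which is the Jordan type of x on half of V, does not depend on the position of v.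
-/
theorem Shape.sumPart_eq {L : Position} (h : Shape p q μ ν L) (i : ℕ) :
    sumPart μ ν i = if i < p then 2 else if i < p + q then 1 else 0 := by
  unfold sumPart
  cases L with
  | out => rw [h.1.1.rowLen, h.1.2.rowLen]; split_ifs <;> omega
  | ker => rw [h.1.1.rowLen, h.1.2.rowLen]; split_ifs <;> omega
  | im => rw [h.1.1.rowLen, h.1.2.rowLen]; split_ifs <;> omega
  | zero => rw [h.1.rowLen, h.2.rowLen]; split_ifs <;> omega

theorem exists_shape (h : sumPart μ ν 0 ≤ 2) : ∃ L p q, Shape p q μ ν L := by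
  unfold sumPart at h
  have hμ := hasCols_of_rowLen_le (μ := μ) (by omega)
  have hν := hasCols_of_rowLen_le (μ := ν) (by omega)
  have hμ' := hμ.le
  have hν' := hν.le
  have e1 := lt_rowLen_iff μ 0 0
  have e2 := lt_rowLen_iff μ 0 1
  have e3 := lt_rowLen_iff ν 0 0
  have e4 := lt_rowLen_iff ν 0 1
  generalize μ.colLen 0 = a at *
  generalize μ.colLen 1 = b at *
  generalize ν.colLen 0 = a' at *
  generalize ν.colLen 1 = b' at *
  rcases Nat.eq_zero_or_pos b with rfl | hb
  · rcases Nat.eq_zero_or_pos a with rfl | ha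
    · obtain ⟨d, rfl⟩ := Nat.exists_eq_add_of_le hν'
      exact ⟨.zero, b', d, hμ, hν⟩
    · obtain rfl : b' = 0 := by omega
      rcases Nat.lt_or_ge a' a with h1 | h1
      · obtain ⟨d, rfl⟩ := Nat.exists_eq_add_of_lt h1
        exact ⟨.ker, a', d + 1, ⟨hμ, hν⟩, by omega⟩
      · obtain ⟨d, rfl⟩ := Nat.exists_eq_add_of_le h1
        exact ⟨.im, a, d, ⟨hμ, hν⟩, ha⟩
  · obtain ⟨d, rfl⟩ := Nat.exists_eq_add_of_le hμ'
    obtain rfl : a' = 0 := by omega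
    obtain rfl : b' = 0 := by omega
    exact ⟨.out, b, d, ⟨hμ, hν⟩, hb⟩

end Diagrams

/-! ### Normal bases of pairs with `x ^ 2 = 0` -/

section NormalBasis

open Module LinearMap.BilinForm

variable {V : Type*} [AddCommGroup V] [Module ℂ V] {ω : LinearMap.BilinForm ℂ V} {v : V}
  {x : End ℂ V} {μ ν : YoungDiagram} {p q : ℕ}

/-- The boxes of a diagram with `p` rows of length two and `q` rows of length one. -/
def boxOf (h : ∀ i, sumPart μ ν i = if i < p then 2 else if i < p + q then 1 else 0) :
    (Fin p ⊕ Fin p) ⊕ Fin q → Box μ ν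
  | Sum.inl (Sum.inl i) => ⟨(i, 0), by show 0 < sumPart μ ν i; rw [h, if_pos i.2]; norm_num⟩
  | Sum.inl (Sum.inr i) => ⟨(i, 1), by show 1 < sumPart μ ν i; rw [h, if_pos i.2]; norm_num⟩
  | Sum.inr j => ⟨(p + j, 0), by
      show 0 < sumPart μ ν (p + j)
      rw [h, if_neg (by omega), if_pos (by omega)]; norm_num⟩

variable (h : ∀ i, sumPart μ ν i = if i < p then 2 else if i < p + q then 1 else 0)

theorem boxOf_bijective : Function.Bijective (boxOf h) := by
  constructor
  · have hval : ∀ c d, boxOf h c = boxOf h d → (boxOf h c).1 = (boxOf h d).1 :=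
      fun c d hcd => congrArg Subtype.val hcd
    rintro ((i | i) | i) ((j | j) | j) hcd <;> have := hval _ _ hcd <;>
      simp only [boxOf, Prod.mk.injEq] at this <;> have hi := i.2 <;> have hj := j.2
    · exact congrArg _ (congrArg _ (Fin.ext this.1))
    · omega
    · omega
    · omega
    · exact congrArg _ (congrArg _ (Fin.ext this.1))
    · omega
    · omega
    · omega
    · exact congrArg _ (Fin.ext (by omega))
  · rintro ⟨⟨i, j⟩, hij⟩
    have hij' : j < sumPart μ ν i := hij
    rw [h] at hij'
    split_ifs at hij' with h1 h2
    · obtain rfl | rfl : j = 0 ∨ j = 1 := by omega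
      · exact ⟨Sum.inl (Sum.inl ⟨i, h1⟩), rfl⟩
      · exact ⟨Sum.inl (Sum.inr ⟨i, h1⟩), rfl⟩
    · obtain rfl : j = 0 := by omega
      refine ⟨Sum.inr ⟨i - p, by omega⟩, Subtype.ext (Prod.ext ?_ rfl)⟩
      show p + (i - p) = i
      omega
    · omega

/-- The boxes of a diagram with `p` rows of length two and `q` rows of length one. -/
noncomputable def boxEquiv : (Fin p ⊕ Fin p) ⊕ Fin q ≃ Box μ ν :=
  Equiv.ofBijective _ (boxOf_bijective h)

/-- The action of an endomorphism on a family of strings of length at most two. -/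
structure IsStrings (x : End ℂ V) (a b : (Fin p ⊕ Fin p) ⊕ Fin q → V) : Prop where
  left_zero : ∀ i, x (a (Sum.inl (Sum.inl i))) = 0
  left_one : ∀ i, x (a (Sum.inl (Sum.inr i))) = a (Sum.inl (Sum.inl i))
  left_short : ∀ j, x (a (Sum.inr j)) = 0
  right_zero : ∀ i, x (b (Sum.inl (Sum.inl i))) = b (Sum.inl (Sum.inr i))
  right_one : ∀ i, x (b (Sum.inl (Sum.inr i))) = 0
  right_short : ∀ j, x (b (Sum.inr j)) = 0

variable {b : Basis (Box μ ν ⊕ Box μ ν) ℂ V}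

theorem IsNormalBasis.isStrings (hb : IsNormalBasis ω v x μ ν b) :
    IsStrings x (fun c => b (Sum.inl (boxOf h c))) fun c => b (Sum.inr (boxOf h c)) where
  left_zero i := hb.left_zero i (boxOf h (Sum.inl (Sum.inl i))).2
  left_one i := hb.left_succ i 0 (boxOf h (Sum.inl (Sum.inr i))).2
  left_short j := hb.left_zero (p + j) (boxOf h (Sum.inr j)).2
  right_zero i := hb.right_succ i 0 (boxOf h (Sum.inl (Sum.inr i))).2
  right_one i := hb.right_last i 1 (boxOf h (Sum.inl (Sum.inr i))).2 (by rw [h, if_pos i.2])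
  right_short j := hb.right_last (p + j) 0 (boxOf h (Sum.inr j)).2 (by
    rw [h, if_neg (by omega), if_pos (by omega)])

theorem isNormalBasis_of_isStrings
    (h1 : ∀ c c', ω (b (Sum.inl (boxOf h c))) (b (Sum.inr (boxOf h c'))) = if c = c' then 1 else 0)
    (h2 : ∀ c c', ω (b (Sum.inl (boxOf h c))) (b (Sum.inl (boxOf h c'))) = 0)
    (h3 : ∀ c c', ω (b (Sum.inr (boxOf h c))) (b (Sum.inr (boxOf h c'))) = 0)
    (hv : v = ∑ i, b (Sum.inl (Box.last μ ν i)))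
    (hs : IsStrings x (fun c => b (Sum.inl (boxOf h c))) fun c => b (Sum.inr (boxOf h c))) :
    IsNormalBasis ω v x μ ν b where
  pairing_self c := by
    obtain ⟨c, rfl⟩ := (boxOf_bijective h).2 c
    rw [h1, if_pos rfl]
  pairing_ne c c' hc := by
    obtain ⟨c, rfl⟩ := (boxOf_bijective h).2 c
    obtain ⟨c', rfl⟩ := (boxOf_bijective h).2 c'
    rw [h1, if_neg (by rintro rfl; exact hc rfl)]
  pairing_left c c' := by
    obtain ⟨c, rfl⟩ := (boxOf_bijective h).2 c
    obtain ⟨c', rfl⟩ := (boxOf_bijective h).2 c'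
    exact h2 c c'
  pairing_right c c' := by
    obtain ⟨c, rfl⟩ := (boxOf_bijective h).2 c
    obtain ⟨c', rfl⟩ := (boxOf_bijective h).2 c'
    exact h3 c c'
  vec := hv
  left_zero i hi := by
    have hi' := hi
    rw [h] at hi'
    split_ifs at hi' with e1 e2
    · exact hs.left_zero ⟨i, e1⟩
    · obtain ⟨j, rfl⟩ := Nat.exists_eq_add_of_le (not_lt.1 e1)
      exact hs.left_short ⟨j, by omega⟩
    · omega
  left_succ i j hij := by
    have hi' := hij
    rw [h] at hi'
    split_ifs at hi' with e1 e2
    · obtain rfl : j = 0 := by omega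
      exact hs.left_one ⟨i, e1⟩
    · omega
    · omega
  right_succ i j hij := by
    have hi' := hij
    rw [h] at hi'
    split_ifs at hi' with e1 e2
    · obtain rfl : j = 0 := by omega
      exact hs.right_zero ⟨i, e1⟩
    · omega
    · omega
  right_last i j hij hj := by
    have hi' := hj
    rw [h] at hi'
    split_ifs at hi' with e1 e2
    · obtain rfl : j = 1 := by omega
      exact hs.right_one ⟨i, e1⟩
    · obtain ⟨l, rfl⟩ := Nat.exists_eq_add_of_le (not_lt.1 e1)
      obtain rfl : j = 0 := by omega
      exact hs.right_short ⟨l, by omega⟩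

/-- A row of length three would give a basis vector in the image of x². -/
theorem IsNormalBasis.sumPart_le (hb : IsNormalBasis ω v x μ ν b) (hx2 : ∀ u, x (x u) = 0) (i : ℕ) :
    sumPart μ ν i ≤ 2 := by
  by_contra! hi
  have h1 := hb.left_succ i 1 hi
  have h2 := hb.left_succ i 0 (by omega)
  have h3 := hx2 (b (Sum.inl ⟨(i, 1 + 1), hi⟩))
  rw [h1] at h3
  exact b.ne_zero _ (h2.symm.trans h3)

/-- This pairing detects that v is nonzero, outside the image or outside the kernel. -/
theorem IsNormalBasis.apply_last (hb : IsNormalBasis ω v x μ ν b) (i : Fin (μ.colLen 0)) :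
    ω v (b (Sum.inr (Box.last μ ν i))) = 1 := by
  rw [hb.vec, map_sum, LinearMap.sum_apply, Finset.sum_eq_single i, hb.pairing_self]
  · intro j _ hj
    refine hb.pairing_ne _ _ fun hc => hj (Fin.ext ?_)
    exact congrArg (fun c : Box μ ν => c.1.1) hc
  · simp

include h in
theorem IsNormalBasis.finrank (hb : IsNormalBasis ω v x μ ν b) :
    finrank ℂ V = 4 * p + 2 * q ∧ finrank ℂ (LinearMap.range x) = 2 * p := by
  have hs := hb.isStrings h
  constructor
  · have : Fintype (Box μ ν) := Fintype.ofEquiv _ (boxEquiv h)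
    rw [finrank_eq_card_basis b, Fintype.card_sum, Fintype.card_congr (boxEquiv h).symm]
    simp only [Fintype.card_sum, Fintype.card_fin]
    ring
  · let f : Fin p ⊕ Fin p → Box μ ν ⊕ Box μ ν := Sum.elim
      (fun i => Sum.inl (boxOf h (Sum.inl (Sum.inl i))))
      (fun i => Sum.inr (boxOf h (Sum.inl (Sum.inr i))))
    have hf : Function.Injective f := by
      have hinj := (boxOf_bijective h).1
      rintro (i | i) (j | j) hij
      · have := hinj (Sum.inl_injective hij)
        simpa using this
      · cases hij
      · cases hij
      · have := hinj (Sum.inr_injective hij)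
        simpa using this
    have hspan : LinearMap.range x = Submodule.span ℂ (Set.range (b ∘ f)) := by
      apply le_antisymm
      · rw [LinearMap.range_eq_map, ← b.span_eq, Submodule.map_span, Submodule.span_le]
        rintro _ ⟨_, ⟨(c | c), rfl⟩, rfl⟩
        · obtain ⟨(i | i) | j, rfl⟩ := (boxOf_bijective h).2 c
          · rw [hs.left_zero]
            exact Submodule.zero_mem _
          · rw [hs.left_one]
            exact Submodule.subset_span ⟨Sum.inl i, rfl⟩
          · rw [hs.left_short]
            exact Submodule.zero_mem _
        · obtain ⟨(i | i) | j, rfl⟩ := (boxOf_bijective h).2 c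
          · rw [hs.right_zero]
            exact Submodule.subset_span ⟨Sum.inr i, rfl⟩
          · rw [hs.right_one]
            exact Submodule.zero_mem _
          · rw [hs.right_short]
            exact Submodule.zero_mem _
      · rw [Submodule.span_le]
        rintro _ ⟨i | i, rfl⟩
        · exact ⟨_, hs.left_one i⟩
        · exact ⟨_, hs.right_zero i⟩
    rw [hspan, finrank_span_eq_card (b.linearIndependent.comp f hf), Fintype.card_sum,
      Fintype.card_fin, two_mul]

omit h in
theorem IsNormalBasis.holds {L : Position} (hb : IsNormalBasis ω v x μ ν b)
    (hx : ∀ u w, ω (x u) w = ω u (x w)) (hL : Shape p q μ ν L) : L.Holds x v := by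
  have h := hL.sumPart_eq
  have hs := hb.isStrings h
  cases L with
  | out =>
    obtain ⟨⟨hμ, hν⟩, hp⟩ := hL
    intro hxv
    have h1 := hb.apply_last ⟨0, by rw [hμ.zero]; omega⟩
    have h2 : Box.last μ ν ⟨0, by rw [hμ.zero]; omega⟩ = boxOf h (Sum.inl (Sum.inr ⟨0, hp⟩)) :=
      Subtype.ext (Prod.ext rfl (by
        show μ.rowLen 0 - 1 = 1
        rw [hμ.rowLen, if_pos hp]))
    have h3 := hs.right_zero ⟨0, hp⟩
    rw [h2, ← h3, ← hx, hxv, map_zero, LinearMap.zero_apply] at h1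
    exact zero_ne_one h1
  | ker =>
    obtain ⟨⟨hμ, hν⟩, hq⟩ := hL
    have h0 : ∀ i : Fin (μ.colLen 0), μ.rowLen i - 1 = 0 := fun i => by
      rw [hμ.rowLen, if_neg (by omega)]
      split_ifs <;> rfl
    constructor
    · rw [hb.vec, map_sum]
      refine Finset.sum_eq_zero fun i _ => ?_
      have h1 : Box.last μ ν i = ⟨(i, 0), (Nat.zero_le _).trans_lt (Box.last μ ν i).2⟩ :=
        Subtype.ext (Prod.ext rfl (h0 i))
      rw [h1]
      exact hb.left_zero _ _
    · rintro ⟨w, hw⟩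
      have h1 := hb.apply_last ⟨p, by rw [hμ.zero]; omega⟩
      have h2 : Box.last μ ν ⟨p, by rw [hμ.zero]; omega⟩ = boxOf h (Sum.inr ⟨0, hq⟩) :=
        Subtype.ext (Prod.ext rfl (h0 _))
      have h3 := hs.right_short ⟨0, hq⟩
      rw [h2, ← hw, hx, h3, map_zero] at h1
      exact zero_ne_one h1
  | im =>
    obtain ⟨⟨hμ, hν⟩, hp⟩ := hL
    constructor
    · rw [hb.vec]
      refine Submodule.sum_mem _ fun i _ => ?_
      have hi : i.1 < p := hμ.zero ▸ i.2
      have h1 : Box.last μ ν i = boxOf h (Sum.inl (Sum.inl ⟨i, hi⟩)) :=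
        Subtype.ext (Prod.ext rfl (by
          show μ.rowLen i - 1 = 0
          rw [hμ.rowLen, if_neg (by omega), if_pos hi]))
      rw [h1]
      exact ⟨_, hs.left_one _⟩
    · rintro rfl
      have h1 := hb.apply_last ⟨0, by rw [hμ.zero]; omega⟩
      rw [map_zero, LinearMap.zero_apply] at h1
      exact zero_ne_one h1
  | zero =>
    have : IsEmpty (Fin (μ.colLen 0)) := by rw [hL.1.zero]; infer_instance
    show v = 0
    rw [hb.vec, Fintype.sum_empty]

end NormalBasis

/-! ### The orbits with x² = 0 -/

section Orbit

open Module LinearMap.BilinForm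

theorem linearIndependent_of_pairing {V : Type*} [AddCommGroup V] [Module ℂ V]
    {ω : LinearMap.BilinForm ℂ V} {κ : Type*} [Fintype κ] [DecidableEq κ] {a b : κ → V}
    (hω : ω.IsAlt)
    (h1 : ∀ c c', ω (a c) (b c') = if c = c' then 1 else 0) (h2 : ∀ c c', ω (a c) (a c') = 0)
    (h3 : ∀ c c', ω (b c) (b c') = 0) : LinearIndependent ℂ (Sum.elim a b) := by
  have h4 : ∀ c c', ω (b c) (a c') = if c' = c then -1 else 0 := fun c c' => by
    rw [← hω.neg_eq, h1]
    split_ifs <;> simp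
  rw [Fintype.linearIndependent_iff]
  intro g hg
  rw [Fintype.sum_sum_type] at hg
  simp only [Sum.elim_inl, Sum.elim_inr] at hg
  rintro (i | i)
  · have := congrArg (fun w => ω w (b i)) hg
    simpa [h1, h3, LinearMap.add_apply, LinearMap.sum_apply] using this
  · have := congrArg (fun w => ω w (a i)) hg
    simpa [h2, h4, LinearMap.add_apply, LinearMap.sum_apply] using this

variable {V I Q : Type*} [AddCommGroup V] [Module ℂ V] [AddCommGroup I] [Module ℂ I]
  [AddCommGroup Q] [Module ℂ Q]
  {ω : LinearMap.BilinForm ℂ V} {x : End ℂ V} {β : LinearMap.BilinForm ℂ I}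
  {γ : LinearMap.BilinForm ℂ Q} {Φ : (I × Q × I) ≃ₗ[ℂ] V}
  {v : V} {μ ν : YoungDiagram} {p q : ℕ}

/-- The left half of the normal basis that corresponds to bases of `I` and `Q`. -/
def leftFam (Φ : (I × Q × I) ≃ₗ[ℂ] V) (e : Fin p → I) (g : Fin q → Q) :
    (Fin p ⊕ Fin p) ⊕ Fin q → V
  | Sum.inl (Sum.inl i) => Φ (e i, 0, 0)
  | Sum.inl (Sum.inr i) => Φ (0, 0, e i)
  | Sum.inr j => Φ (0, g j, 0)

/-- The right half of the normal basis that corresponds to bases of `I` and `Q`. -/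
def rightFam (Φ : (I × Q × I) ≃ₗ[ℂ] V) (f : Fin p → I) (h : Fin q → Q) :
    (Fin p ⊕ Fin p) ⊕ Fin q → V
  | Sum.inl (Sum.inl i) => Φ (0, 0, f i)
  | Sum.inl (Sum.inr i) => Φ (f i, 0, 0)
  | Sum.inr j => Φ (0, h j, 0)

variable [FiniteDimensional ℂ V]

theorem exists_normalBasis (hΦ : IsStandard ω x β γ Φ) (hω : ω.IsAlt)
    (hd : finrank ℂ V = 4 * p + 2 * q)
    (h : ∀ i, sumPart μ ν i = if i < p then 2 else if i < p + q then 1 else 0)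
    {e f : Fin p → I} (hef : IsSympFam β e f) {g k : Fin q → Q} (hgk : IsSympFam γ g k) :
    ∃ b : Basis (Box μ ν ⊕ Box μ ν) ℂ V, (∀ c, b (Sum.inl (boxOf h c)) = leftFam Φ e g c) ∧
      (v = ∑ i, b (Sum.inl (Box.last μ ν i)) → IsNormalBasis ω v x μ ν b) := by
  have h1 : ∀ c c', ω (leftFam Φ e g c) (rightFam Φ f k c') = if c = c' then 1 else 0 := by
    rintro ((i | i) | i) ((j | j) | j) <;>
      simp [leftFam, rightFam, hΦ.form, hef.pairing, hgk.pairing]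
  have h2 : ∀ c c', ω (leftFam Φ e g c) (leftFam Φ e g c') = 0 := by
    rintro ((i | i) | i) ((j | j) | j) <;> simp [leftFam, hΦ.form, hef.left, hgk.left]
  have h3 : ∀ c c', ω (rightFam Φ f k c) (rightFam Φ f k c') = 0 := by
    rintro ((i | i) | i) ((j | j) | j) <;> simp [rightFam, hΦ.form, hef.right, hgk.right]
  have hLI := linearIndependent_of_pairing hω h1 h2 h3
  let b₀ := basisOfLinearIndependentOfCardEqFinrank' _ hLI (by
    simp only [Fintype.card_sum, Fintype.card_fin, hd]
    ring)
  let b := b₀.reindex (Equiv.sumCongr (boxEquiv h) (boxEquiv h))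
  have hl : ∀ c, b (Sum.inl (boxOf h c)) = leftFam Φ e g c := fun c => by
    have : b (Sum.inl (boxEquiv h c)) = leftFam Φ e g c := by
      simp [b, b₀, Basis.reindex_apply]
    exact this
  have hr : ∀ c, b (Sum.inr (boxOf h c)) = rightFam Φ f k c := fun c => by
    have : b (Sum.inr (boxEquiv h c)) = rightFam Φ f k c := by
      simp [b, b₀, Basis.reindex_apply]
    exact this
  refine ⟨b, hl, fun hv => isNormalBasis_of_isStrings h (fun c c' => ?_) (fun c c' => ?_)
    (fun c c' => ?_) hv ?_⟩
  · rw [hl, hr, h1]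
  · rw [hl, hl, h2]
  · rw [hr, hr, h3]
  · simp only [hl, hr]
    constructor <;> intro i
    · exact (hΦ.apply _).trans (map_zero Φ)
    · exact hΦ.apply _
    · exact (hΦ.apply _).trans (map_zero Φ)
    · exact hΦ.apply _
    · exact (hΦ.apply _).trans (map_zero Φ)
    · exact (hΦ.apply _).trans (map_zero Φ)

theorem sum_fin_of_eq {M : Type*} [AddCommMonoid M] {n m : ℕ} (h : n = m) (f : Fin n → M) :
    ∑ i, f i = ∑ i : Fin m, f ⟨i, h ▸ i.2⟩ := by
  subst h
  rfl

/-- Symplectic bases of I and Q give a normal basis for x, and the standard coordinates of v can be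
prescribed within its position, so v is taken to be the sum that a normal basis demands. -/
theorem mem_exoticOrbit_of_holds (hω : ω.IsAlt) (hωn : ω.Nondegenerate)
    (hx : ∀ u w, ω (x u) w = ω u (x w)) (hx2 : ∀ u, x (x u) = 0) {L : Position}
    (hL : Shape p q μ ν L) (hd : finrank ℂ V = 4 * p + 2 * q)
    (hr : finrank ℂ (LinearMap.range x) = 2 * p) (hv : L.Holds x v) :
    (v, x) ∈ exoticOrbit ω μ ν := by
  refine ⟨⟨hx, 2, by ext u; exact hx2 u⟩, ?_⟩
  have hI : finrank ℂ (Fin (2 * p) → ℂ) = 2 * p := finrank_fin_fun ℂ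
  have hQ : finrank ℂ (Fin (2 * q) → ℂ) = 2 * q := finrank_fin_fun ℂ
  obtain ⟨β, hβ, hβn⟩ := exists_symplectic_form hI
  obtain ⟨γ, hγ, hγn⟩ := exists_symplectic_form hQ
  obtain ⟨e, f, hef⟩ := exists_sympFam_of_finrank hβ hβn hI
  obtain ⟨g, k, hgk⟩ := exists_sympFam_of_finrank hγ hγn hQ
  obtain ⟨Φ, hΦ⟩ := exists_isStandard hω hωn hx hx2 hβ hβn hγ hγn (by rw [hr, hI])
    (by rw [hd, hI, hQ]; ring)
  have h := hL.sumPart_eq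
  have hsum : ∀ {n : ℕ} {B : LinearMap.BilinForm ℂ (Fin (2 * n) → ℂ)} {a b : Fin n → _},
      IsSympFam B a b → 0 < n → ∑ i, a i ≠ 0 := fun {n B a b} hab hn h0 => by
    have := congrArg (fun w => B w (b ⟨0, hn⟩)) h0
    simp [LinearMap.sum_apply, hab.pairing] at this
  cases L with
  | out =>
    obtain ⟨⟨hμ, hν⟩, hp⟩ := hL
    -- The rows of length two end at the vectors (0, 0, eᵢ), those of length one at (0, gⱼ, 0).
    obtain ⟨Φ, hΦ, rfl⟩ := hΦ.exists_out hβ hβn hγ hv (hsum hef hp) (∑ j, g j)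
    obtain ⟨b, hb, hbn⟩ := exists_normalBasis hΦ hω hd h hef hgk
    refine ⟨b, hbn ?_⟩
    rw [sum_fin_of_eq hμ.zero, Fin.sum_univ_add]
    have h1 : ∀ i : Fin p, b (Sum.inl (Box.last μ ν ⟨(Fin.castAdd q i : Fin (p + q)), by
        rw [hμ.zero]; exact (Fin.castAdd q i).2⟩)) = Φ (0, 0, e i) := fun i => by
      rw [← show leftFam Φ e g (Sum.inl (Sum.inr i)) = Φ (0, 0, e i) from rfl, ← hb]
      refine congrArg (fun c => b (Sum.inl c)) (Subtype.ext (Prod.ext rfl ?_))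
      show μ.rowLen i - 1 = 1
      rw [hμ.rowLen, if_pos i.2]
    have h2 : ∀ j : Fin q, b (Sum.inl (Box.last μ ν ⟨(Fin.natAdd p j : Fin (p + q)), by
        rw [hμ.zero]; exact (Fin.natAdd p j).2⟩)) = Φ (0, g j, 0) := fun j => by
      rw [← show leftFam Φ e g (Sum.inr j) = Φ (0, g j, 0) from rfl, ← hb]
      refine congrArg (fun c => b (Sum.inl c)) (Subtype.ext (Prod.ext rfl ?_))
      show μ.rowLen (p + j) - 1 = 0
      rw [hμ.rowLen, if_neg (by omega), if_pos (by omega)]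
    simp only [h1, h2, ← map_sum, ← map_add]
    congr 1
    simp [Prod.ext_iff, Prod.fst_sum, Prod.snd_sum]
  | ker =>
    obtain ⟨⟨hμ, hν⟩, hq⟩ := hL
    obtain ⟨Φ, hΦ, rfl⟩ := hΦ.exists_ker hβ hγ hγn hv.1 hv.2 (∑ i, e i) (hsum hgk hq)
    obtain ⟨b, hb, hbn⟩ := exists_normalBasis hΦ hω hd h hef hgk
    refine ⟨b, hbn ?_⟩
    rw [sum_fin_of_eq hμ.zero, Fin.sum_univ_add]
    have h1 : ∀ i : Fin p, b (Sum.inl (Box.last μ ν ⟨(Fin.castAdd q i : Fin (p + q)), by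
        rw [hμ.zero]; exact (Fin.castAdd q i).2⟩)) = Φ (e i, 0, 0) := fun i => by
      rw [← show leftFam Φ e g (Sum.inl (Sum.inl i)) = Φ (e i, 0, 0) from rfl, ← hb]
      refine congrArg (fun c => b (Sum.inl c)) (Subtype.ext (Prod.ext rfl ?_))
      show μ.rowLen i - 1 = 0
      rw [hμ.rowLen, if_neg (by omega), if_pos (by omega)]
    have h2 : ∀ j : Fin q, b (Sum.inl (Box.last μ ν ⟨(Fin.natAdd p j : Fin (p + q)), by
        rw [hμ.zero]; exact (Fin.natAdd p j).2⟩)) = Φ (0, g j, 0) := fun j => by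
      rw [← show leftFam Φ e g (Sum.inr j) = Φ (0, g j, 0) from rfl, ← hb]
      refine congrArg (fun c => b (Sum.inl c)) (Subtype.ext (Prod.ext rfl ?_))
      show μ.rowLen (p + j) - 1 = 0
      rw [hμ.rowLen, if_neg (by omega), if_pos (by omega)]
    simp only [h1, h2, ← map_sum, ← map_add]
    congr 1
    simp [Prod.ext_iff, Prod.fst_sum, Prod.snd_sum]
  | im =>
    obtain ⟨⟨hμ, hν⟩, hp⟩ := hL
    obtain ⟨Φ, hΦ, rfl⟩ := hΦ.exists_im hβ hβn hv.1 hv.2 (hsum hef hp)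
    obtain ⟨b, hb, hbn⟩ := exists_normalBasis hΦ hω hd h hef hgk
    refine ⟨b, hbn ?_⟩
    rw [sum_fin_of_eq hμ.zero]
    have h1 : ∀ i : Fin p, b (Sum.inl (Box.last μ ν ⟨i, by rw [hμ.zero]; exact i.2⟩)) =
        Φ (e i, 0, 0) := fun i => by
      rw [← show leftFam Φ e g (Sum.inl (Sum.inl i)) = Φ (e i, 0, 0) from rfl, ← hb]
      refine congrArg (fun c => b (Sum.inl c)) (Subtype.ext (Prod.ext rfl ?_))
      show μ.rowLen i - 1 = 0
      rw [hμ.rowLen, if_neg (by omega), if_pos (by omega)]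
    simp only [h1, ← map_sum]
    congr 1
    simp [Prod.ext_iff, Prod.fst_sum, Prod.snd_sum]
  | zero =>
    obtain ⟨b, hb, hbn⟩ := exists_normalBasis hΦ hω hd h hef hgk
    refine ⟨b, hbn ?_⟩
    have : IsEmpty (Fin (μ.colLen 0)) := by rw [hL.1.zero]; infer_instance
    rw [Fintype.sum_empty]
    exact hv

/-- The exotic Jordan type of a pair `(v, x)` with `x ^ 2 = 0` is determined by the dimension, the
rank of `x` and the position of `v`. -/
theorem mem_exoticOrbit_iff (hω : ω.IsAlt) (hωn : ω.Nondegenerate)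
    (hx : ∀ u w, ω (x u) w = ω u (x w)) (hx2 : ∀ u, x (x u) = 0) {L : Position}
    (hL : Shape p q μ ν L) : (v, x) ∈ exoticOrbit ω μ ν ↔ finrank ℂ V = 4 * p + 2 * q ∧
      finrank ℂ (LinearMap.range x) = 2 * p ∧ L.Holds x v := by
  constructor
  · rintro ⟨-, b, hb⟩
    obtain ⟨h1, h2⟩ := hb.finrank hL.sumPart_eq
    exact ⟨h1, h2, hb.holds hx hL⟩
  · rintro ⟨h1, h2, h3⟩
    exact mem_exoticOrbit_of_holds hω hωn hx hx2 hL h1 h2 h3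

end Orbit

/-! ### The reduction of a pair -/

section Reduce

set_option linter.unusedSectionVars false

open Module LinearMap.BilinForm

variable {V : Type*} [AddCommGroup V] [Module ℂ V] [FiniteDimensional ℂ V]
  {ω : LinearMap.BilinForm ℂ V} {x : End ℂ V} {F : Submodule ℂ V}

theorem finrank_reduction (hωn : ω.Nondegenerate) (hF : F ≤ ω.orthogonal F) :
    finrank ℂ (Reduction ω F) + 2 * finrank ℂ F = finrank ℂ V := by
  have h1 : finrank ℂ (Reduction ω F) + _ = _ :=
    Submodule.finrank_quotient_add_finrank (F.submoduleOf (ω.orthogonal F))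
  have h2 : finrank ℂ (F.submoduleOf (ω.orthogonal F)) = finrank ℂ F :=
    (Submodule.submoduleOfEquivOfLe hF).finrank_eq
  have h3 := finrank_orthogonal hωn F
  have h4 := Submodule.finrank_le F
  rw [h2] at h1
  omega

theorem reducedForm_isAlt (hω : ω.IsAlt) : (reducedForm hω F).IsAlt := by
  intro a
  obtain ⟨a, rfl⟩ := Submodule.Quotient.mk_surjective _ a
  exact hω a.1

theorem reducedForm_nondegenerate (hω : ω.IsAlt) (hωn : ω.Nondegenerate) :
    (reducedForm hω F).Nondegenerate := by
  have h : ∀ a, (∀ b, reducedForm hω F b a = 0) → a = 0 := by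
    intro a ha
    obtain ⟨a, rfl⟩ := Submodule.Quotient.mk_surjective _ a
    rw [Submodule.Quotient.mk_eq_zero]
    show a.1 ∈ F
    exact (orthogonal_orthogonal hωn hω.isRefl F).le
      fun b hb => ha (Submodule.Quotient.mk ⟨b, hb⟩)
  exact ⟨fun a ha => h a fun b => (reducedForm_isAlt hω).isRefl _ _ (ha b), h⟩

variable (hx : ∀ u w, ω (x u) w = ω u (x w)) (hFx : F ≤ LinearMap.ker x)

include hx hFx in
theorem perpEnd_mem (u : ω.orthogonal F) : x u.1 ∈ ω.orthogonal F := (perpEnd hx F hFx u).2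

theorem reducedEnd_mk (u : ω.orthogonal F) : reducedEnd hx F hFx (Submodule.Quotient.mk u) =
    Submodule.Quotient.mk ⟨x u.1, perpEnd_mem hx hFx u⟩ := rfl

theorem reducedEnd_selfAdjoint (hω : ω.IsAlt) (a b : Reduction ω F) :
    reducedForm hω F (reducedEnd hx F hFx a) b = reducedForm hω F a (reducedEnd hx F hFx b) := by
  obtain ⟨a, rfl⟩ := Submodule.Quotient.mk_surjective _ a
  obtain ⟨b, rfl⟩ := Submodule.Quotient.mk_surjective _ b
  exact hx a.1 b.1

theorem reducedEnd_sq (hx2 : ∀ u, x (x u) = 0) (a : Reduction ω F) :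
    reducedEnd hx F hFx (reducedEnd hx F hFx a) = 0 := by
  obtain ⟨a, rfl⟩ := Submodule.Quotient.mk_surjective _ a
  rw [reducedEnd_mk, reducedEnd_mk, Submodule.Quotient.mk_eq_zero]
  show x (x a.1) ∈ F
  rw [hx2]
  exact F.zero_mem

variable {v : V} (hv : v ∈ ω.orthogonal F)

theorem reducedVec_eq_zero_iff : reducedVec F hv = 0 ↔ v ∈ F :=
  Submodule.Quotient.mk_eq_zero _

theorem reducedEnd_reducedVec_eq_zero_iff :
    reducedEnd hx F hFx (reducedVec F hv) = 0 ↔ x v ∈ F :=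
  Submodule.Quotient.mk_eq_zero _

theorem reducedVec_mem_range_iff : reducedVec F hv ∈ LinearMap.range (reducedEnd hx F hFx) ↔
    v ∈ F ⊔ (ω.orthogonal F).map x := by
  rw [Submodule.mem_sup]
  constructor
  · rintro ⟨a, ha⟩
    obtain ⟨a, rfl⟩ := Submodule.Quotient.mk_surjective _ a
    rw [reducedEnd_mk, eq_comm] at ha
    have h1 : v - x a.1 ∈ F := 
      (Submodule.Quotient.eq (F.submoduleOf (ω.orthogonal F)) (x := ⟨v, hv⟩)).1 ha
    exact ⟨_, h1, x a.1, ⟨a.1, a.2, rfl⟩, sub_add_cancel _ _⟩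
  · rintro ⟨f, hf, _, ⟨a, ha, rfl⟩, h⟩
    refine ⟨Submodule.Quotient.mk ⟨a, ha⟩, Eq.symm ?_⟩
    rw [reducedEnd_mk]
    refine (Submodule.Quotient.eq _).2 ?_
    show v - x a ∈ F
    rwa [← h, add_sub_cancel_right]

variable {I Q : Type*} [AddCommGroup I] [Module ℂ I] [AddCommGroup Q] [Module ℂ Q]
  [FiniteDimensional ℂ I] [FiniteDimensional ℂ Q]
  {β : LinearMap.BilinForm ℂ I} {γ : LinearMap.BilinForm ℂ Q} {Φ : (I × Q × I) ≃ₗ[ℂ] V}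

/-- The inclusion of the kernel. -/
def kerIncl (Φ : (I × Q × I) ≃ₗ[ℂ] V) : I × Q →ₗ[ℂ] V :=
  Φ.toLinearMap ∘ₗ LinearMap.prod (LinearMap.fst ℂ I Q)
    (LinearMap.prod (LinearMap.snd ℂ I Q) 0)

theorem kerIncl_apply (y : I × Q) : kerIncl Φ y = Φ (y.1, y.2, 0) := rfl

theorem kerIncl_injective : Function.Injective (kerIncl Φ) := fun a b hab => by
  have h : (a.1, a.2, (0 : I)) = (b.1, b.2, 0) := Φ.injective hab
  exact Prod.ext (congrArg (fun z : I × Q × I => z.1) h) (congrArg (fun z : I × Q × I => z.2.1) h)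

theorem mem_map_kerIncl {F₀ : Submodule ℂ (I × Q)} {a : I × Q × I} :
    Φ a ∈ F₀.map (kerIncl Φ) ↔ a.2.2 = 0 ∧ (a.1, a.2.1) ∈ F₀ := by
  constructor
  · rintro ⟨y, hy, h⟩
    have h := Φ.injective h
    subst h
    exact ⟨rfl, hy⟩
  · rintro ⟨h1, h2⟩
    refine ⟨_, h2, ?_⟩
    rw [kerIncl_apply, ← h1]

variable (h : IsStandard ω x β γ Φ)

include h

theorem IsStandard.ker_eq : LinearMap.ker x = LinearMap.range (kerIncl Φ) := by
  apply le_antisymm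
  · intro w hw
    obtain ⟨a, rfl⟩ := Φ.surjective w
    rw [LinearMap.mem_ker, h.apply, LinearEquiv.map_eq_zero_iff] at hw
    have : a.2.2 = 0 := congrArg Prod.fst hw
    exact ⟨(a.1, a.2.1), by rw [kerIncl_apply, ← this]⟩
  · rintro _ ⟨y, rfl⟩
    rw [LinearMap.mem_ker, kerIncl_apply, h.apply]
    exact map_zero Φ

theorem IsStandard.apply_apply (w : V) : x (x w) = 0 := by
  obtain ⟨a, rfl⟩ := Φ.surjective w
  rw [h.apply, h.apply]
  exact map_zero Φ

/-- The image under x sees only the last coordinate of a vector of F^⊥; orthogonality to F ∩ I says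
that this coordinate lies in E^⊥. -/
theorem IsStandard.map_perp (hω : ω.IsAlt) (hωn : ω.Nondegenerate)
    (hx : ∀ u w, ω (x u) w = ω u (x w)) (F₀ : Submodule ℂ (I × Q)) :
    (ω.orthogonal (F₀.map (kerIncl Φ))).map x =
      ((β.orthogonal (interLeft F₀)).map (LinearMap.inl ℂ I Q)).map (kerIncl Φ) := by
  apply le_antisymm
  · rintro _ ⟨w, hw, rfl⟩
    obtain ⟨a, rfl⟩ := Φ.surjective w
    refine ⟨(a.2.2, 0), ⟨_, fun e he => ?_, rfl⟩, by rw [h.apply, kerIncl_apply]⟩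
    have h1 : ω (kerIncl Φ (e, 0)) (Φ a) = 0 := hw _ ⟨_, he, rfl⟩
    rw [kerIncl_apply, h.form] at h1
    show β e a.2.2 = 0
    simpa using h1
  · rw [← orthogonal_orthogonal hωn hω.isRefl ((ω.orthogonal (F₀.map (kerIncl Φ))).map x)]
    rintro _ ⟨_, ⟨j, hj, rfl⟩, rfl⟩ w hw
    -- For the converse both sides are compared by their orthogonals: w is orthogonal to x(F^⊥)
    -- exactly if xw lies in F.
    have h1 : x w ∈ F₀.map (kerIncl Φ) := by
      rw [← orthogonal_orthogonal hωn hω.isRefl (F₀.map (kerIncl Φ))]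
      intro u hu
      show ω u (x w) = 0
      rw [← hx]
      exact hw _ ⟨u, hu, rfl⟩
    obtain ⟨a, rfl⟩ := Φ.surjective w
    rw [h.apply, mem_map_kerIncl] at h1
    have h2 : β a.2.2 j = 0 := hj _ h1.2
    show ω (Φ a) (kerIncl Φ (j, 0)) = 0
    rw [kerIncl_apply, h.form, h2, map_zero, map_zero]
    simp

theorem IsStandard.sup_map_perp (hω : ω.IsAlt) (hωn : ω.Nondegenerate)
    (hx : ∀ u w, ω (x u) w = ω u (x w)) (F₀ : Submodule ℂ (I × Q)) :
    F₀.map (kerIncl Φ) ⊔ (ω.orthogonal (F₀.map (kerIncl Φ))).map x =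
      (supPerp β F₀).map (kerIncl Φ) := by
  rw [h.map_perp hω hωn hx, supPerp, Submodule.map_sup]

/-- The image of the reduced endomorphism is E^⊥ / rad E, of dimension dim I - dim E - dim rad E. -/
theorem IsStandard.finrank_range_reducedEnd (hω : ω.IsAlt) (hωn : ω.Nondegenerate)
    (hβn : β.Nondegenerate) {F₀ : Submodule ℂ (I × Q)} (hF : F = F₀.map (kerIncl Φ)) :
    finrank ℂ (LinearMap.range (reducedEnd hx F hFx)) + (finrank ℂ (interLeft F₀) +
      finrank ℂ (interLeft F₀ ⊓ β.orthogonal (interLeft F₀) : Submodule ℂ I)) = finrank ℂ I := by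
  subst hF
  have hmem : ∀ j ∈ β.orthogonal (interLeft F₀), Φ (j, 0, 0) ∈
      (ω.orthogonal (F₀.map (kerIncl Φ))).map x := fun j hj => by
    rw [h.map_perp hω hωn hx]
    exact ⟨(j, 0), ⟨j, hj, rfl⟩, rfl⟩
  have hmem' : ∀ j ∈ β.orthogonal (interLeft F₀), Φ (j, 0, 0) ∈
      ω.orthogonal (F₀.map (kerIncl Φ)) := fun j hj => by
    obtain ⟨w, hw, hj⟩ := hmem j hj
    rw [← hj]
    exact perpEnd_mem hx hFx ⟨w, hw⟩
  let θ₀ : β.orthogonal (interLeft F₀) →ₗ[ℂ] ω.orthogonal (F₀.map (kerIncl Φ)) :=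
    LinearMap.codRestrict _ (Φ.toLinearMap ∘ₗ LinearMap.inl ℂ I (Q × I) ∘ₗ Submodule.subtype _)
      fun j => hmem' j.1 j.2
  let θ : β.orthogonal (interLeft F₀) →ₗ[ℂ] Reduction ω (F₀.map (kerIncl Φ)) :=
    Submodule.mkQ _ ∘ₗ θ₀
  have hrange : LinearMap.range θ = LinearMap.range (reducedEnd hx (F₀.map (kerIncl Φ)) hFx) := by
    apply le_antisymm
    · rintro _ ⟨j, rfl⟩
      obtain ⟨w, hw, hj⟩ := hmem j.1 j.2
      refine ⟨Submodule.Quotient.mk ⟨w, hw⟩, ?_⟩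
      rw [reducedEnd_mk]
      exact congrArg Submodule.Quotient.mk (Subtype.ext hj)
    · rintro _ ⟨a, rfl⟩
      obtain ⟨a, rfl⟩ := Submodule.Quotient.mk_surjective _ a
      have h1 : x a.1 ∈ (ω.orthogonal (F₀.map (kerIncl Φ))).map x := ⟨a.1, a.2, rfl⟩
      rw [h.map_perp hω hωn hx] at h1
      obtain ⟨_, ⟨j, hj, rfl⟩, hja⟩ := h1
      refine ⟨⟨j, hj⟩, ?_⟩
      rw [reducedEnd_mk]
      exact congrArg Submodule.Quotient.mk (Subtype.ext hja)
  have hker : LinearMap.ker θ = (interLeft F₀ ⊓ β.orthogonal (interLeft F₀)).submoduleOf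
      (β.orthogonal (interLeft F₀)) := by
    ext j
    rw [LinearMap.mem_ker]
    have h1 : θ j = 0 ↔ Φ (j.1, 0, 0) ∈ F₀.map (kerIncl Φ) := Submodule.Quotient.mk_eq_zero _
    rw [h1, mem_map_kerIncl]
    exact ⟨fun h2 => ⟨h2.2, j.2⟩, fun h2 => ⟨rfl, h2.1⟩⟩
  have h1 := θ.finrank_range_add_finrank_ker
  rw [hrange, hker, (Submodule.submoduleOfEquivOfLe inf_le_right).finrank_eq] at h1
  have h2 := finrank_orthogonal hβn (interLeft F₀)
  have h3 := Submodule.finrank_le (interLeft F₀)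
  omega

end Reduce

/-! ### The variety as a set of subspaces of I × Q -/

section Variety

set_option linter.unusedSectionVars false

open Module LinearMap.BilinForm

variable {V : Type*} [AddCommGroup V] [Module ℂ V] [FiniteDimensional ℂ V]
  {ω : LinearMap.BilinForm ℂ V} {x : End ℂ V}
  {I Q : Type*} [AddCommGroup I] [Module ℂ I] [AddCommGroup Q] [Module ℂ Q]
  [FiniteDimensional ℂ I] [FiniteDimensional ℂ Q]
  {β : LinearMap.BilinForm ℂ I} {γ : LinearMap.BilinForm ℂ Q} {Φ : (I × Q × I) ≃ₗ[ℂ] V}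

/-- The condition on a subspace that puts the image of a vector in a given position. -/
def Position.PairHolds (β : LinearMap.BilinForm ℂ I) (F : Submodule ℂ (I × Q)) (a : I × Q × I) :
    Position → Prop
  | out => (a.2.2, (0 : Q)) ∉ F
  | ker => (a.2.2, (0 : Q)) ∈ F ∧ ¬(a.2.2 = 0 ∧ (a.1, a.2.1) ∈ supPerp β F)
  | im => (a.2.2 = 0 ∧ (a.1, a.2.1) ∈ supPerp β F) ∧ ¬(a.2.2 = 0 ∧ (a.1, a.2.1) ∈ F)
  | zero => a.2.2 = 0 ∧ (a.1, a.2.1) ∈ F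

/-- The subspaces of the kernel that make up the variety. -/
def kerSet (β : LinearMap.BilinForm ℂ I) (γ : LinearMap.BilinForm ℂ Q) (k c : ℕ) (a : I × Q × I)
    (L : Position) : Set (Gr k (I × Q)) :=
  {F | F ∈ pairSet β γ k c (LinearMap.ker (prodForm β γ (a.2.2, a.2.1))) ∧ L.PairHolds β F.1 a}

theorem Position.reduced_holds_iff (h : IsStandard ω x β γ Φ) (hω : ω.IsAlt)
    (hωn : ω.Nondegenerate)
    (hx : ∀ u w, ω (x u) w = ω u (x w)) {F₀ : Submodule ℂ (I × Q)}
    (hFx : F₀.map (kerIncl Φ) ≤ LinearMap.ker x) {a : I × Q × I}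
    (hv : Φ a ∈ ω.orthogonal (F₀.map (kerIncl Φ))) (L : Position) :
    L.Holds (reducedEnd hx _ hFx) (reducedVec _ hv) ↔ L.PairHolds β F₀ a := by
  have h1 : reducedEnd hx _ hFx (reducedVec _ hv) = 0 ↔ (a.2.2, (0 : Q)) ∈ F₀ := by
    rw [reducedEnd_reducedVec_eq_zero_iff, h.apply, mem_map_kerIncl]
    exact ⟨fun h => h.2, fun h => ⟨rfl, h⟩⟩
  have h2 : reducedVec _ hv ∈ LinearMap.range (reducedEnd hx _ hFx) ↔
      a.2.2 = 0 ∧ (a.1, a.2.1) ∈ supPerp β F₀ := by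
    rw [reducedVec_mem_range_iff, h.sup_map_perp hω hωn hx, mem_map_kerIncl]
  have h3 : reducedVec _ hv = 0 ↔ a.2.2 = 0 ∧ (a.1, a.2.1) ∈ F₀ := by
    rw [reducedVec_eq_zero_iff, mem_map_kerIncl]
  cases L with
  | out => exact not_congr h1
  | ker => exact and_congr h1 (not_congr h2)
  | im => exact and_congr h2 (not_congr h3)
  | zero => exact h3

variable {k c p p' q' : ℕ} {μ' ν' : YoungDiagram} {L' : Position} {a : I × Q × I}

theorem map_mem_varietyB_iff (h : IsStandard ω x β γ Φ) (hω : ω.IsAlt) (hωn : ω.Nondegenerate)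
    (hx : ∀ u w, ω (x u) w = ω u (x w)) (hβn : β.Nondegenerate) (hL : Shape p' q' μ' ν' L')
    (hI : finrank ℂ I = 2 * (p' + c)) (hV : finrank ℂ V = 2 * k + 4 * p' + 2 * q')
    (F₀ : Gr k (I × Q)) :
    Gr.map (kerIncl Φ) kerIncl_injective F₀ ∈ varietyB hω hx (Φ a) k μ' ν' ↔
      F₀ ∈ kerSet β γ k c a L' := by
  have hform : ∀ y y' : I × Q, ω (kerIncl Φ y) (kerIncl Φ y') = γ y.2 y'.2 := fun y y' => by
    rw [kerIncl_apply, kerIncl_apply, h.form, map_zero, map_zero]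
    simp
  have hxF : F₀.1.map (kerIncl Φ) ≤ LinearMap.ker x := by
    rw [h.ker_eq]
    exact LinearMap.map_le_range
  have hiso : F₀.1.map (kerIncl Φ) ≤ ω.orthogonal (F₀.1.map (kerIncl Φ)) ↔
      ∀ a ∈ F₀.1, ∀ b ∈ F₀.1, γ a.2 b.2 = 0 := by
    constructor
    · intro hle y hy y' hy'
      rw [← hform]
      exact hle ⟨y', hy', rfl⟩ _ ⟨y, hy, rfl⟩
    · rintro hle _ ⟨y', hy', rfl⟩ _ ⟨y, hy, rfl⟩
      exact (hform y y').trans (hle y hy y' hy')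
  have hcyc : F₀.1.map (kerIncl Φ) ≤ ω.orthogonal (cyclicSpan x (Φ a)) ↔
      F₀.1 ≤ LinearMap.ker (prodForm β γ (a.2.2, a.2.1)) := by
    have hva : ∀ y : I × Q, ω (Φ a) (kerIncl Φ y) = prodForm β γ (a.2.2, a.2.1) y := fun y => by
      rw [kerIncl_apply, h.form, map_zero, zero_add, prodForm_apply]
    constructor
    · intro hle y hy
      rw [LinearMap.mem_ker, ← hva]
      exact hle ⟨y, hy, rfl⟩ _ (Submodule.subset_span ⟨0, rfl⟩)
    · rintro hle _ ⟨y, hy, rfl⟩ w hw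
      refine apply_eq_zero_of_mem_span (fun j => ?_) hw
      cases j with
      | zero => exact (hva y).trans (hle hy)
      | succ j =>
        -- The higher powers give no condition, since x moves to the other argument and kills F.
        have h1 : x (kerIncl Φ y) = 0 := hxF ⟨y, hy, rfl⟩
        rw [pow_succ', Module.End.mul_apply, hx, h1, map_zero]
  have hfr : finrank ℂ (F₀.1.map (kerIncl Φ)) = k := (Gr.map (kerIncl Φ) kerIncl_injective F₀).2
  constructor
  · rintro ⟨h1, h2, h3⟩
    have h4 := (mem_exoticOrbit_iff (reducedForm_isAlt hω) (reducedForm_nondegenerate hω hωn)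
      (reducedEnd_selfAdjoint hx _ hω) (reducedEnd_sq hx _ h.apply_apply) hL).1 h3
    have h5 := h.finrank_range_reducedEnd hx hxF hω hωn hβn rfl
    refine ⟨⟨⟨hiso.1 h1, ?_⟩, hcyc.1 (h2.trans inf_le_right)⟩, ?_⟩
    · have h6 : finrank ℂ (LinearMap.range (reducedEnd hx _ hxF)) = 2 * p' := h4.2.1
      omega
    · exact (Position.reduced_holds_iff h hω hωn hx hxF _ L').1 h4.2.2
  · rintro ⟨⟨⟨h1, h2⟩, h3⟩, h4⟩
    refine ⟨hiso.2 h1, le_inf hxF (hcyc.2 h3), ?_⟩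
    refine (mem_exoticOrbit_iff (reducedForm_isAlt hω) (reducedForm_nondegenerate hω hωn)
      (reducedEnd_selfAdjoint hx _ hω) (reducedEnd_sq hx _ h.apply_apply) hL).2 ⟨?_, ?_, ?_⟩
    · have h5 := finrank_reduction hωn (hiso.2 h1)
      rw [hfr] at h5
      have h6 : finrank ℂ (Reduction ω (F₀.1.map (kerIncl Φ))) = 4 * p' + 2 * q' := by omega
      exact h6
    · have h5 := h.finrank_range_reducedEnd hx hxF hω hωn hβn rfl
      have h6 : finrank ℂ (LinearMap.range (reducedEnd hx _ hxF)) = 2 * p' := by omega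
      exact h6
    · exact (Position.reduced_holds_iff h hω hωn hx hxF _ L').2 h4

theorem exists_grMap_eq (h : IsStandard ω x β γ Φ) {F : Gr k V} (hF : F.1 ≤ LinearMap.ker x) :
    ∃ F₀, Gr.map (kerIncl Φ) kerIncl_injective F₀ = F := by
  have hmap : (F.1.comap (kerIncl Φ)).map (kerIncl Φ) = F.1 :=
    Submodule.map_comap_eq_self (h.ker_eq ▸ hF)
  refine ⟨⟨F.1.comap (kerIncl Φ), ?_⟩, Subtype.ext hmap⟩
  rw [(Submodule.equivMapOfInjective _ (kerIncl_injective (Φ := Φ)) _).finrank_eq, hmap]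
  exact F.2

theorem varietyB_eq_image (h : IsStandard ω x β γ Φ) (hω : ω.IsAlt) (hωn : ω.Nondegenerate)
    (hx : ∀ u w, ω (x u) w = ω u (x w)) (hβn : β.Nondegenerate) (hL : Shape p' q' μ' ν' L')
    (hI : finrank ℂ I = 2 * (p' + c)) (hV : finrank ℂ V = 2 * k + 4 * p' + 2 * q') :
    varietyB hω hx (Φ a) k μ' ν' =
      Gr.map (kerIncl Φ) kerIncl_injective '' kerSet β γ k c a L' := by
  ext F
  constructor
  · intro hF
    obtain ⟨F₀, rfl⟩ := exists_grMap_eq h (hF.2.1.trans inf_le_left)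
    exact ⟨F₀, (map_mem_varietyB_iff h hω hωn hx hβn hL hI hV F₀).1 hF, rfl⟩
  · rintro ⟨F₀, hF₀, rfl⟩
    exact (map_mem_varietyB_iff h hω hωn hx hβn hL hI hV F₀).2 hF₀

theorem isIrreducible_image_grMap {U : Type*} [AddCommGroup U] [Module ℂ U] [FiniteDimensional ℂ U]
    {ι : U →ₗ[ℂ] V} (hι : Function.Injective ι) {X : Set (Gr k U)} (hX : IsIrreducible X) :
    IsIrreducible (Gr.map ι hι '' X) :=
  hX.image _ (isInducing_grMap ι hι).continuous.continuousOn

theorem topologicalKrullDim_image_grMap {U : Type*} [AddCommGroup U] [Module ℂ U]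
    [FiniteDimensional ℂ U] {ι : U →ₗ[ℂ] V} (hι : Function.Injective ι) (X : Set (Gr k U)) :
    topologicalKrullDim (Gr.map ι hι '' X) = topologicalKrullDim X := by
  have hinj : Function.Injective (Gr.map (k := k) ι hι) := fun F F' hF =>
    Subtype.ext (Submodule.map_injective_of_injective hι (congrArg Subtype.val hF))
  have hind := isInducing_grMap (k := k) ι hι
  let e : X ≃ Gr.map ι hι '' X := Equiv.Set.image _ X hinj
  have he : IsInducing e := by
    have h1 : IsInducing (Subtype.val ∘ e : X → Gr k V) := hind.comp IsInducing.subtypeVal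
    exact (IsInducing.subtypeVal.of_comp_iff).1 h1
  exact (IsHomeomorph.topologicalKrullDim_eq e
    (isHomeomorph_iff_exists_homeomorph.2 ⟨e.toHomeomorphOfIsInducing he, rfl⟩)).symm

end Variety

/-! ### Irreducibility and dimension in the nine cases -/

section VarietyDimension

open Module LinearMap.BilinForm

/-- The conditions on the numerical parameters under which the variety is nonempty. -/
def Admissible (ρ s z m p' : ℕ) : Position → Position → Prop
  | .zero, .zero => True
  | .im, .ker => 0 < ρ
  | .im, .im => 0 < p'
  | .im, .zero => 0 < ρ + s
  | .out, .out => 0 < p'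
  | .out, .ker => 0 < ρ
  | .ker, .ker => 0 < z ∨ 0 < ρ ∧ 0 < m
  | .ker, .im => 0 < m ∧ 0 < p'
  | .ker, .zero => 0 < m
  | _, _ => False

/-- The number of linear equations on the chart. -/
def equationCount (ρ s z m p' : ℕ) : Position → Position → ℕ
  | .im, .im => ρ
  | .im, .zero => 2 * p' + ρ
  | .out, .out => m + ρ + 2 * s
  | .out, .ker => 2 * s + 2 * p' + ρ + m
  | .ker, .ker => m
  | .ker, .im => 2 * z + m + ρ
  | .ker, .zero => 2 * z + m + ρ + 2 * p'
  | _, _ => 0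

/-- The dimension of the chart. -/
def chartDim (ρ s z m p' : ℕ) : ℕ :=
  (ρ + 1).choose 2 + ρ * (2 * s + 2 * p') + 2 * s * (2 * p') + (m + 1).choose 2 + m * (2 * z) +
    m * ρ + m * (2 * p')

theorem le_choose_two (n : ℕ) : n ≤ (n + 1).choose 2 := by
  rw [Nat.choose_succ_succ' n 1, Nat.choose_one_right]
  exact Nat.le_add_right _ _

variable {ρ s z m p' : ℕ} {L L' : Position}

/-- Ensures that the number of parameters minus the number of equations is a natural number. -/
theorem equationCount_le (h : Admissible ρ s z m p' L L') :
    equationCount ρ s z m p' L L' ≤ chartDim ρ s z m p' := by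
  have h1 := le_choose_two ρ
  have h2 := le_choose_two m
  unfold chartDim
  have hmul : ∀ a b : ℕ, 0 < a → b ≤ a * b := fun a b ha => Nat.le_mul_of_pos_left b ha
  cases L <;> cases L' <;> first | exact h.elim | skip
  · have h3 : 0 < p' := h
    have e1 := Nat.le_mul_of_pos_right ρ h3
    have e2 := Nat.le_mul_of_pos_right s h3
    have e3 := Nat.le_mul_of_pos_right m h3
    show m + ρ + 2 * s ≤ _
    nlinarith
  · have h3 : 0 < ρ := h
    have e1 := hmul ρ (2 * s + 2 * p') h3
    show 2 * s + 2 * p' + ρ + m ≤ _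
    omega
  · show m ≤ _
    omega
  · have e1 := hmul m (2 * z) h.1
    show 2 * z + m + ρ ≤ _
    omega
  · have e1 := hmul m (2 * z) h
    have e2 := hmul m (2 * p') h
    show 2 * z + m + ρ + 2 * p' ≤ _
    omega
  · exact Nat.zero_le _
  · show ρ ≤ _
    omega
  · have e1 := hmul (ρ + s) (2 * p') h
    show 2 * p' + ρ ≤ _
    nlinarith
  · exact Nat.zero_le _

section KerSet

variable {I Q : Type*} [AddCommGroup I] [Module ℂ I] [AddCommGroup Q] [Module ℂ Q]
  {β : LinearMap.BilinForm ℂ I} {γ : LinearMap.BilinForm ℂ Q} {k c : ℕ}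

theorem ker_prodForm_inl (u : I) :
    LinearMap.ker (prodForm β γ (u, 0)) = (LinearMap.ker (β u)).prod ⊤ := by
  ext y
  simp [prodForm_apply, Submodule.mem_prod]

theorem ker_prodForm_inr (v : Q) :
    LinearMap.ker (prodForm β γ (0, v)) = (⊤ : Submodule ℂ I).prod (LinearMap.ker (γ v)) := by
  ext y
  simp [prodForm_apply, Submodule.mem_prod]

theorem kerSet_zero : kerSet β γ k c 0 .zero = pairSet β γ k c ⊤ := by
  have h : LinearMap.ker (prodForm β γ (0, 0)) = ⊤ := by ext y; simp [prodForm_apply]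
  ext F
  show F ∈ pairSet β γ k c (LinearMap.ker (prodForm β γ (0, 0))) ∧ _ ↔ _
  rw [h]
  exact ⟨fun h => h.1, fun h => ⟨h, rfl, F.1.zero_mem⟩⟩

theorem kerSet_im (u : I) (L : Position) : kerSet β γ k c (u, 0, 0) L =
    {F | F ∈ pairSet β γ k c ⊤ ∧ L.PairHolds β F.1 (u, 0, 0)} := by
  have h : LinearMap.ker (prodForm β γ (0, 0)) = ⊤ := by ext y; simp [prodForm_apply]
  ext F
  show F ∈ pairSet β γ k c (LinearMap.ker (prodForm β γ (0, 0))) ∧ _ ↔ _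
  rw [h]
  rfl

theorem kerSet_im_ker (u : I) : kerSet β γ k c (u, 0, 0) .ker =
    {F | F ∈ pairSet β γ k c ⊤ ∧ (u, (0 : Q)) ∉ supPerp β F.1} := by
  rw [kerSet_im]
  ext F
  exact and_congr_right fun _ => ⟨fun h h' => h.2 ⟨rfl, h'⟩, fun h => ⟨F.1.zero_mem, fun h' => h h'.2⟩⟩

theorem kerSet_im_im (u : I) : kerSet β γ k c (u, 0, 0) .im =
    {F | F ∈ pairSet β γ k c ⊤ ∧ (u, (0 : Q)) ∈ supPerp β F.1 ∧ (u, (0 : Q)) ∉ F.1} := by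
  rw [kerSet_im]
  ext F
  exact and_congr_right fun _ => ⟨fun h => ⟨h.1.2, fun h' => h.2 ⟨rfl, h'⟩⟩,
    fun h => ⟨⟨rfl, h.1⟩, fun h' => h.2 h'.2⟩⟩

theorem kerSet_im_zero (u : I) : kerSet β γ k c (u, 0, 0) .zero =
    {F | F ∈ pairSet β γ k c ⊤ ∧ (u, (0 : Q)) ∈ F.1} := by
  rw [kerSet_im]
  ext F
  exact and_congr_right fun _ => ⟨fun h => h.2, fun h => ⟨rfl, h⟩⟩

theorem kerSet_out_out (u : I) : kerSet β γ k c (0, 0, u) .out =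
    {F | F ∈ pairSet β γ k c ((LinearMap.ker (β u)).prod ⊤) ∧ (u, (0 : Q)) ∉ F.1} := by
  rw [← ker_prodForm_inl]
  rfl

theorem kerSet_out_ker {u : I} (hu : u ≠ 0) : kerSet β γ k c (0, 0, u) .ker =
    {F | F ∈ pairSet β γ k c ((LinearMap.ker (β u)).prod ⊤) ∧ (u, (0 : Q)) ∈ F.1} := by
  rw [← ker_prodForm_inl]
  ext F
  exact and_congr_right fun _ => ⟨fun h => h.1, fun h => ⟨h, fun h' => hu h'.1⟩⟩

theorem kerSet_ker_ker (v : Q) : kerSet β γ k c (0, v, 0) .ker =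
    {F | F ∈ pairSet β γ k c ((⊤ : Submodule ℂ I).prod (LinearMap.ker (γ v))) ∧
      ((0 : I), v) ∉ supPerp β F.1} := by
  rw [← ker_prodForm_inr]
  ext F
  exact and_congr_right fun _ => ⟨fun h h' => h.2 ⟨rfl, h'⟩, fun h => ⟨F.1.zero_mem, fun h' => h h'.2⟩⟩

theorem kerSet_ker_im (v : Q) : kerSet β γ k c (0, v, 0) .im =
    {F | F ∈ pairSet β γ k c ((⊤ : Submodule ℂ I).prod (LinearMap.ker (γ v))) ∧
      ((0 : I), v) ∈ supPerp β F.1 ∧ (False ↔ ((0 : I), v) ∈ F.1)} := by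
  rw [← ker_prodForm_inr]
  ext F
  exact and_congr_right fun _ => ⟨fun h => ⟨h.1.2, False.elim, fun h' => h.2 ⟨rfl, h'⟩⟩,
    fun h => ⟨⟨rfl, h.1⟩, fun h' => h.2.2 h'.2⟩⟩

theorem kerSet_ker_zero (v : Q) : kerSet β γ k c (0, v, 0) .zero =
    {F | F ∈ pairSet β γ k c ((⊤ : Submodule ℂ I).prod (LinearMap.ker (γ v))) ∧
      ((0 : I), v) ∈ supPerp β F.1 ∧ (True ↔ ((0 : I), v) ∈ F.1)} := by
  rw [← ker_prodForm_inr]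
  ext F
  exact and_congr_right fun _ => ⟨fun h => ⟨Submodule.mem_sup_left h.2, fun _ => h.2,
    fun _ => trivial⟩, fun h => ⟨rfl, h.2.1 trivial⟩⟩

end KerSet

variable {V : Type*} [AddCommGroup V] [Module ℂ V] [FiniteDimensional ℂ V]
  {ω : LinearMap.BilinForm ℂ V} {x : End ℂ V} {v : V} {μ' ν' : YoungDiagram}

theorem exists_dim_varietyB (hω : ω.IsAlt) (hωn : ω.Nondegenerate)
    (hx : ∀ u w, ω (x u) w = ω u (x w)) (hx2 : ∀ u, x (x u) = 0)
    (hadm : Admissible ρ s z m p' L L') (hsz : s = 0 ∨ z = 0)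
    (hV : finrank ℂ V = 4 * (p' + ρ + s) + 2 * (m + z))
    (hr : finrank ℂ (LinearMap.range x) = 2 * (p' + ρ + s)) (hv : L.Holds x v)
    (hL' : Shape p' (ρ + z) μ' ν' L') :
    ∃ d : ℕ, d + equationCount ρ s z m p' L L' = chartDim ρ s z m p' ∧
      IsIrreducible (varietyB hω hx v (m + ρ + 2 * s) μ' ν') ∧
      topologicalKrullDim (varietyB hω hx v (m + ρ + 2 * s) μ' ν') = (d : WithBot ℕ∞) := by
  have hWf : finrank ℂ (Fin (2 * p') → ℂ) = 2 * p' := finrank_fin_fun ℂ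
  have hZf : finrank ℂ (Fin (2 * z) → ℂ) = 2 * z := finrank_fin_fun ℂ
  obtain ⟨ηH, hH, hHn⟩ := exists_symplectic_form (U := Fin (2 * s) → ℂ) (finrank_fin_fun ℂ)
  obtain ⟨ηW, hW, hWn⟩ := exists_symplectic_form hWf
  obtain ⟨ηZ, hZ, hZn⟩ := exists_symplectic_form hZf
  -- The model has σ = 2s, dim W = 2p' and dim Z = 2z, so that rank x = 2(p' + ρ + s) and dim Q =
  -- 2(m + z).
  have hM : ModelData ηH ηW ηZ (m + z) (m + ρ + 2 * s) (ρ + s) ρ m :=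
    ⟨hH, hHn, hW, hWn, hZ, hZn, by rw [hZf]; ring, by omega, by omega, by omega, by omega⟩
  have hP : finrank ℂ (Params ρ (2 * s) m (Fin (2 * p') → ℂ) (Fin (2 * z) → ℂ)) =
      chartDim ρ s z m p' := by rw [finrank_params, hWf, hZf]; rfl
  have hI : finrank ℂ (ModelI ρ (2 * s) (Fin (2 * p') → ℂ)) = 2 * (p' + (ρ + s)) := by
    have h1 : finrank ℂ (ModelI ρ (2 * s) (Fin (2 * p') → ℂ)) =
      2 * ρ + finrank ℂ ((Fin (2 * s) → ℂ) × (Fin (2 * p') → ℂ)) := finrank_hyp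
    rw [h1, finrank_prod, finrank_fin_fun, hWf]
    ring
  obtain ⟨Φ₀, hΦ₀⟩ := exists_isStandard hω hωn hx hx2 hM.altI hM.ndI hM.altQ hM.ndQ
    (by rw [hr, hI]; ring) (by rw [hV, hI, hM.finrankQ]; ring)
  obtain ⟨d, hd⟩ := Nat.exists_eq_add_of_le' (equationCount_le hadm)
  refine ⟨d, hd.symm, ?_⟩
  -- In each case Φ is chosen so that v gets the coordinates for which the chart computation was
  -- done.
  have hfin : ∀ Φ : (ModelI ρ (2 * s) (Fin (2 * p') → ℂ) × ModelQ m (Fin (2 * z) → ℂ) ×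
      ModelI ρ (2 * s) (Fin (2 * p') → ℂ)) ≃ₗ[ℂ] V,
      IsStandard ω x (modelFormI ηH ηW ρ) (modelFormQ ηZ m) Φ → ∀ a, Φ a = v →
      (IsIrreducible (kerSet (modelFormI ηH ηW ρ) (modelFormQ ηZ m) (m + ρ + 2 * s) (ρ + s) a L') ∧
        topologicalKrullDim (kerSet (modelFormI ηH ηW ρ) (modelFormQ ηZ m) (m + ρ + 2 * s)
          (ρ + s) a L') = (d : WithBot ℕ∞)) →
      IsIrreducible (varietyB hω hx v (m + ρ + 2 * s) μ' ν') ∧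
        topologicalKrullDim (varietyB hω hx v (m + ρ + 2 * s) μ' ν') = (d : WithBot ℕ∞) := by
    rintro Φ hΦ a rfl ⟨h1, h2⟩
    rw [varietyB_eq_image hΦ hω hωn hx hM.ndI hL' hI (by rw [hV]; ring)]
    exact ⟨isIrreducible_image_grMap _ h1, (topologicalKrullDim_image_grMap _ _).trans h2⟩
  have hw : 0 < p' → ∃ w : Fin (2 * p') → ℂ, w ≠ 0 := fun hp =>
    ⟨fun _ => 1, fun h0 => one_ne_zero (congrFun h0 ⟨0, by omega⟩)⟩
  cases L <;> cases L' <;> first | exact hadm.elim | skip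
  · obtain ⟨w, hw⟩ := hw hadm
    obtain ⟨u, hu, hX⟩ := hM.dim_perp_notMem hw (d := d) (by rw [hP, hd]; rfl)
    obtain ⟨Φ, hΦ, hΦv⟩ := hΦ₀.exists_out hM.altI hM.ndI hM.altQ hv hu 0
    exact hfin Φ hΦ _ hΦv (hX _ (kerSet_out_out u))
  · obtain ⟨u, hu, hX⟩ := hM.dim_perp_mem ⟨0, hadm⟩ (d := d) (by rw [hP, hd, hWf]; rfl)
    obtain ⟨Φ, hΦ, hΦv⟩ := hΦ₀.exists_out hM.altI hM.ndI hM.altQ hv hu 0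
    exact hfin Φ hΦ _ hΦv (hX _ (kerSet_out_ker hu))
  · obtain ⟨v', hv', hX⟩ : ∃ v' : ModelQ m (Fin (2 * z) → ℂ), v' ≠ 0 ∧
        ∀ X : Set (Gr (m + ρ + 2 * s) (ModelI ρ (2 * s) (Fin (2 * p') → ℂ) × ModelQ m (Fin (2 * z) → ℂ))),
        X = {F ∈ pairSet (modelFormI ηH ηW ρ) (modelFormQ ηZ m) (m + ρ + 2 * s) (ρ + s)
          ((⊤ : Submodule ℂ (ModelI ρ (2 * s) (Fin (2 * p') → ℂ))).prod
            (LinearMap.ker (modelFormQ ηZ m v'))) |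
          ((0 : ModelI ρ (2 * s) (Fin (2 * p') → ℂ)), v') ∉ supPerp (modelFormI ηH ηW ρ) F.1} →
        IsIrreducible X ∧ topologicalKrullDim X = d := by
      rcases Nat.eq_zero_or_pos z with hz | hz
      · have : Subsingleton (Fin (2 * z) → ℂ) :=
          ⟨fun a b => funext fun i => absurd i.2 (by omega)⟩
        have hadm : 0 < z ∨ 0 < ρ ∧ 0 < m := hadm
        exact hM.dim_inr_out_of_subsingleton ⟨0, by omega⟩ ⟨0, by omega⟩ (by rw [hP, hd]; rfl)
      · exact hM.dim_inr_out_of_ne (z := fun _ => 1)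
          (fun h0 => one_ne_zero (congrFun h0 ⟨0, by omega⟩)) (by rw [hP, hd]; rfl)
    obtain ⟨Φ, hΦ, hΦv⟩ := hΦ₀.exists_ker hM.altI hM.altQ hM.ndQ hv.1 hv.2 0 hv'
    exact hfin Φ hΦ _ hΦv (hX _ (kerSet_ker_ker v'))
  · obtain ⟨w, hw⟩ := hw hadm.2
    obtain ⟨v', hv', hX⟩ := hM.dim_inr_mid ⟨0, hadm.1⟩ hw (d := d) (by rw [hP, hd, hZf]; rfl)
    obtain ⟨Φ, hΦ, hΦv⟩ := hΦ₀.exists_ker hM.altI hM.altQ hM.ndQ hv.1 hv.2 0 hv'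
    exact hfin Φ hΦ _ hΦv (hX _ (kerSet_ker_im v'))
  · obtain ⟨v', hv', hX⟩ := hM.dim_inr_mem ⟨0, hadm⟩ (d := d) (by rw [hP, hd, hZf, hWf]; rfl)
    obtain ⟨Φ, hΦ, hΦv⟩ := hΦ₀.exists_ker hM.altI hM.altQ hM.ndQ hv.1 hv.2 0 hv'
    exact hfin Φ hΦ _ hΦv (hX _ (kerSet_ker_zero v'))
  · obtain ⟨u, hu, hX⟩ := hM.dim_inl_out ⟨0, hadm⟩ (d := d) (by rw [hP, hd]; rfl)
    obtain ⟨Φ, hΦ, hΦv⟩ := hΦ₀.exists_im hM.altI hM.ndI hv.1 hv.2 hu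
    exact hfin Φ hΦ _ hΦv (hX _ (kerSet_im_ker u))
  · obtain ⟨w, hw⟩ := hw hadm
    obtain ⟨u, hu, hX⟩ := hM.dim_inl_mid hw (d := d) (by rw [hP, hd]; rfl)
    obtain ⟨Φ, hΦ, hΦv⟩ := hΦ₀.exists_im hM.altI hM.ndI hv.1 hv.2 hu
    exact hfin Φ hΦ _ hΦv (hX _ (kerSet_im_im u))
  · obtain ⟨u, hu, hX⟩ : ∃ u : ModelI ρ (2 * s) (Fin (2 * p') → ℂ), u ≠ 0 ∧
        ∀ X : Set (Gr (m + ρ + 2 * s) (ModelI ρ (2 * s) (Fin (2 * p') → ℂ) × ModelQ m (Fin (2 * z) → ℂ))),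
        X = {F ∈ pairSet (modelFormI ηH ηW ρ) (modelFormQ ηZ m) (m + ρ + 2 * s) (ρ + s) ⊤ |
          (u, (0 : ModelQ m (Fin (2 * z) → ℂ))) ∈ F.1} →
        IsIrreducible X ∧ topologicalKrullDim X = d := by
      have hadm : 0 < ρ + s := hadm
      rcases Nat.eq_zero_or_pos s with hs | hs
      · exact hM.dim_inl_mem_of_eq_zero ⟨0, by omega⟩ (by omega) (by rw [hP, hd, hWf]; rfl)
      · exact hM.dim_inl_mem_of_pos ⟨0, by omega⟩ (by rw [hP, hd, hWf]; rfl)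
    obtain ⟨Φ, hΦ, hΦv⟩ := hΦ₀.exists_im hM.altI hM.ndI hv.1 hv.2 hu
    exact hfin Φ hΦ _ hΦv (hX _ (kerSet_im_zero u))
  · have h1 := hM.dim_zero (d := d) (by rw [hP, hd]; rfl)
    rw [← kerSet_zero] at h1
    exact hfin Φ₀ hΦ₀ 0 ((map_zero Φ₀).trans (Eq.symm hv)) h1

end VarietyDimension

/-! ### Numerical conditions -/

section Numerics

variable {μ ν μ' ν' : YoungDiagram} {a b a' b' p q p' q' k ρ s z m : ℕ} {L L' : Position}

theorem rowLen_le_of_le (h : μ' ≤ μ) (i : ℕ) : μ'.rowLen i ≤ μ.rowLen i := by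
  by_contra! hc
  have h1 : (i, μ.rowLen i) ∈ μ := h (YoungDiagram.mem_iff_lt_rowLen.2 hc)
  exact lt_irrefl _ (YoungDiagram.mem_iff_lt_rowLen.1 h1)

theorem HasCols.isVerticalStrip_iff (h : HasCols μ a b) (h' : HasCols μ' a' b') :
    IsVerticalStrip μ' μ ↔ a' ≤ a ∧ b' ≤ b ∧ b ≤ a' := by
  have hle := h.le
  have hle' := h'.le
  constructor
  · rintro ⟨h1, h2⟩
    have e1 := rowLen_le_of_le h1 a
    have e2 := rowLen_le_of_le h1 b
    have e3 := h2 a'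
    rw [h.rowLen, h'.rowLen] at e1 e2 e3
    split_ifs at e1 e2 e3 <;> omega
  · rintro ⟨h1, h2, h3⟩
    have key : ∀ i, μ'.rowLen i ≤ μ.rowLen i ∧ μ.rowLen i ≤ μ'.rowLen i + 1 := fun i => by
      rw [h.rowLen, h'.rowLen]
      split_ifs <;> omega
    refine ⟨?_, fun i => (key i).2⟩
    rintro ⟨i, j⟩ hij
    have hij : (i, j) ∈ μ' := hij
    rw [YoungDiagram.mem_iff_lt_rowLen] at hij
    exact YoungDiagram.mem_iff_lt_rowLen.2 (hij.trans_le (key i).1)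

theorem HasCols.card (h : HasCols μ a b) : μ.card = a + b := by
  have hc : μ.cells = Finset.range a ×ˢ {0} ∪ Finset.range b ×ˢ {1} := by
    ext ⟨i, j⟩
    rw [YoungDiagram.mem_cells, YoungDiagram.mem_iff_lt_rowLen, h.rowLen]
    simp only [Finset.mem_union, Finset.mem_product, Finset.mem_range, Finset.mem_singleton]
    have := h.le
    split_ifs <;> omega
  show μ.cells.card = _
  rw [hc, Finset.card_union_of_disjoint, Finset.card_product, Finset.card_product]
  · simp
  · rw [Finset.disjoint_left]
    rintro ⟨i, j⟩ h1 h2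
    simp only [Finset.mem_product, Finset.mem_singleton] at h1 h2
    omega

/-- The size of the second diagram. -/
def sndCard (p q : ℕ) : Position → ℕ
  | .out => 0
  | .ker => p
  | .im => p + q
  | .zero => 2 * p + q

theorem Shape.snd_card (h : Shape p q μ ν L) : ν.card = sndCard p q L := by
  cases L with
  | out => exact h.1.2.card
  | ker => exact h.1.2.card
  | im => exact h.1.2.card
  | zero => rw [h.2.card]; show p + q + p = 2 * p + q; ring

theorem Shape.card (h : Shape p q μ ν L) : μ.card + ν.card = 2 * p + q := by
  cases L with
  | out => rw [h.1.1.card, h.1.2.card]; ring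
  | ker => rw [h.1.1.card, h.1.2.card]; ring
  | im => rw [h.1.1.card, h.1.2.card]; ring
  | zero => rw [h.1.card, h.2.card]; ring

theorem Shape.max_colLen (h : Shape p q μ ν L) : max (μ.colLen 0) (ν.colLen 0) = p + q := by
  cases L with
  | out => rw [h.1.1.zero, h.1.2.zero]; omega
  | ker => rw [h.1.1.zero, h.1.2.zero]; omega
  | im => rw [h.1.1.zero, h.1.2.zero]; omega
  | zero => rw [h.1.zero, h.2.zero]; omega

theorem sum_range_cast (n : ℕ) : ∑ i ∈ Finset.range n, (i : ℚ) = n * (n - 1) / 2 := by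
  induction n with
  | zero => simp
  | succ n ih => rw [Finset.sum_range_succ, ih]; push_cast; ring

theorem Shape.two_mul_sumN (h : Shape p q μ ν L) :
    2 * (sumN μ ν : ℚ) = p * (p - 1) + (p + q) * (p + q - 1) := by
  have h1 : (sumN μ ν : ℚ) = ∑ i ∈ Finset.range (p + q), ((i : ℚ) + if i < p then (i : ℚ) else 0) := by
    rw [sumN, h.max_colLen, Nat.cast_sum]
    refine Finset.sum_congr rfl fun i hi => ?_
    rw [Finset.mem_range] at hi
    rw [h.sumPart_eq]
    split_ifs <;> push_cast <;> ring
  have h2 : (Finset.range (p + q)).filter (· < p) = Finset.range p := by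
    ext i
    simp only [Finset.mem_filter, Finset.mem_range]
    omega
  rw [h1, Finset.sum_add_distrib, ← Finset.sum_filter, h2, sum_range_cast, sum_range_cast]
  push_cast
  ring

/-- The difference of the expected and the actual dimension. -/
def defect (s z p' : ℕ) : Position → Position → ℕ
  | .zero, .zero => s
  | .im, .ker => z
  | .im, .zero => p'
  | .out, .out => s
  | .out, .ker => p' + s
  | .ker, .im => z
  | .ker, .zero => p' + z
  | _, _ => 0

/-- A polynomial identity in each of the nine cases; it uses sz = 0. -/
theorem chartDim_sub (hadm : Admissible ρ s z m p' L L') (hsz : s = 0 ∨ z = 0)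
    (h : Shape (p' + ρ + s) (m + z) μ ν L) (h' : Shape p' (ρ + z) μ' ν' L') (α' : List ℕ) {d : ℕ}
    (hd : d + equationCount ρ s z m p' L L' = chartDim ρ s z m p') :
    (d : ℚ) + defect s z p' L L' =
      dimNumber ((m + ρ + 2 * s) :: α') μ ν - dimNumber α' μ' ν' := by
  have h1 : (d : ℚ) + equationCount ρ s z m p' L L' = chartDim ρ s z m p' := by exact_mod_cast hd
  have h2 : (chartDim ρ s z m p' : ℚ) = ρ * (ρ + 1) / 2 + ρ * (2 * s + 2 * p') + 2 * s * (2 * p') +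
      m * (m + 1) / 2 + m * (2 * z) + m * ρ + m * (2 * p') := by
    simp only [chartDim, Nat.cast_add, Nat.cast_mul, Nat.cast_choose_two]
    push_cast
    ring
  simp only [dimNumber, h.two_mul_sumN, h'.two_mul_sumN, h.snd_card, h'.snd_card, List.map_cons,
    List.sum_cons]
  rw [eq_sub_of_add_eq h1, h2]
  cases L <;> cases L' <;> first | exact hadm.elim | skip
  all_goals
    simp only [equationCount, defect, sndCard]
    rcases hsz with rfl | rfl <;> push_cast <;> ring

theorem isVerticalStrip_iff (hadm : Admissible ρ s z m p' L L') (hsz : s = 0 ∨ z = 0)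
    (h : Shape (p' + ρ + s) (m + z) μ ν L) (h' : Shape p' (ρ + z) μ' ν' L') :
    defect s z p' L L' = 0 ↔ IsVerticalStrip μ' μ ∧ IsVerticalStrip ν' ν := by
  cases L <;> cases L' <;> first | exact hadm.elim | skip
  · rw [h.1.1.isVerticalStrip_iff h'.1.1, h.1.2.isVerticalStrip_iff h'.1.2]
    simp only [defect]; omega
  · rw [h.1.1.isVerticalStrip_iff h'.1.1, h.1.2.isVerticalStrip_iff h'.1.2]
    simp only [defect]; omega
  · rw [h.1.1.isVerticalStrip_iff h'.1.1, h.1.2.isVerticalStrip_iff h'.1.2]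
    change 0 = 0 ↔ _; omega
  · rw [h.1.1.isVerticalStrip_iff h'.1.1, h.1.2.isVerticalStrip_iff h'.1.2]
    simp only [defect]; omega
  · rw [h.1.1.isVerticalStrip_iff h'.1, h.1.2.isVerticalStrip_iff h'.2]
    simp only [defect]; omega
  · rw [h.1.1.isVerticalStrip_iff h'.1.1, h.1.2.isVerticalStrip_iff h'.1.2]
    simp only [defect]; omega
  · rw [h.1.1.isVerticalStrip_iff h'.1.1, h.1.2.isVerticalStrip_iff h'.1.2]
    change 0 = 0 ↔ _; omega
  · rw [h.1.1.isVerticalStrip_iff h'.1, h.1.2.isVerticalStrip_iff h'.2]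
    simp only [defect]; omega
  · rw [h.1.isVerticalStrip_iff h'.1, h.2.isVerticalStrip_iff h'.2]
    simp only [defect]; omega

/-- The comparison of p - p' with q' decides the alternative: either the generic E is isotropic (s =
0) or the generic image in Q is Lagrangian (z = 0). -/
theorem exists_parameters (h1 : p' ≤ p) (h2 : p' + q' ≤ p + q) (h3 : k + 2 * p' + q' = 2 * p + q) :
    ∃ ρ s z m, p = p' + ρ + s ∧ q = m + z ∧ q' = ρ + z ∧ k = m + ρ + 2 * s ∧ (s = 0 ∨ z = 0) := by
  rcases Nat.le_total (p - p') q' with h | h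
  · exact ⟨p - p', 0, q' - (p - p'), q - (q' - (p - p')), by omega, by omega, by omega, by omega,
      Or.inl rfl⟩
  · exact ⟨q', p - p' - q', 0, q, by omega, by omega, by omega, by omega, Or.inr rfl⟩

theorem le_of_isVerticalStrip (h : Shape p q μ ν L) (h' : Shape p' q' μ' ν' L')
    (h1 : IsVerticalStrip μ' μ) (h2 : IsVerticalStrip ν' ν) : p' ≤ p ∧ p' + q' ≤ p + q := by
  have key : ∀ i, sumPart μ' ν' i ≤ sumPart μ ν i := fun i =>
    Nat.add_le_add (rowLen_le_of_le h1.1 i) (rowLen_le_of_le h2.1 i)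
  have e1 := key p
  have e2 := key (p + q)
  rw [h.sumPart_eq, h'.sumPart_eq] at e1 e2
  split_ifs at e1 e2 <;> omega

theorem admissible_of_isVerticalStrip (hsz : s = 0 ∨ z = 0)
    (h : Shape (p' + ρ + s) (m + z) μ ν L) (h' : Shape p' (ρ + z) μ' ν' L')
    (h1 : IsVerticalStrip μ' μ) (h2 : IsVerticalStrip ν' ν) : Admissible ρ s z m p' L L' := by
  cases L <;> cases L' <;> unfold Admissible <;> simp only [Shape] at h h'
  all_goals
    first
    | rw [h.1.1.isVerticalStrip_iff h'.1.1] at h1; rw [h.1.2.isVerticalStrip_iff h'.1.2] at h2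
    | rw [h.1.1.isVerticalStrip_iff h'.1] at h1; rw [h.1.2.isVerticalStrip_iff h'.2] at h2
    | rw [h.1.isVerticalStrip_iff h'.1.1] at h1; rw [h.2.isVerticalStrip_iff h'.1.2] at h2
    | rw [h.1.isVerticalStrip_iff h'.1] at h1; rw [h.2.isVerticalStrip_iff h'.2] at h2
  all_goals
    first
    | trivial
    | (have e1 := h.2; have e2 := h'.2; omega)

end Numerics

/-! ### Numerical consequences of the existence of a member -/

section Necessity

open Module LinearMap.BilinForm

variable {I Q : Type*} [AddCommGroup I] [Module ℂ I] [AddCommGroup Q] [Module ℂ Q]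
  {β : LinearMap.BilinForm ℂ I} {γ : LinearMap.BilinForm ℂ Q} {a : I × Q × I}

/-- The condition on the coordinates of a vector in a given position. -/
def Position.Coords (a : I × Q × I) : Position → Prop
  | out => a.2.2 ≠ 0
  | ker => a.2.2 = 0 ∧ a.2.1 ≠ 0
  | im => a.2.2 = 0 ∧ a.2.1 = 0 ∧ a.1 ≠ 0
  | zero => a = 0

theorem IsStandard.coords_of_holds {V : Type*} [AddCommGroup V] [Module ℂ V]
    {ω : LinearMap.BilinForm ℂ V} {x : End ℂ V} {Φ : (I × Q × I) ≃ₗ[ℂ] V}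
    (h : IsStandard ω x β γ Φ) {L : Position} (hL : L.Holds x (Φ a)) : L.Coords a := by
  obtain ⟨i, q, j⟩ := a
  have hx0 : x (Φ (i, q, j)) = 0 ↔ j = 0 := by
    rw [h.apply, LinearEquiv.map_eq_zero_iff]
    simp [Prod.ext_iff]
  cases L with
  | out => exact fun hj => hL (hx0.2 hj)
  | ker =>
    refine ⟨hx0.1 hL.1, fun hq => hL.2 ⟨Φ (0, 0, i), ?_⟩⟩
    have hj : j = 0 := hx0.1 hL.1
    have hq : q = 0 := hq
    rw [h.apply, hj, hq]
  | im =>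
    obtain ⟨⟨w, hw⟩, hne⟩ := hL
    obtain ⟨b, rfl⟩ := Φ.surjective w
    rw [h.apply] at hw
    have h1 := Φ.injective hw
    simp only [Prod.mk.injEq] at h1
    obtain ⟨h1, rfl, rfl⟩ := h1
    refine ⟨rfl, rfl, fun hi => hne ?_⟩
    have hi : i = 0 := hi
    rw [hi]
    exact map_zero Φ
  | zero => exact (LinearEquiv.map_eq_zero_iff Φ).1 hL

variable [FiniteDimensional ℂ I] [FiniteDimensional ℂ Q] {μ ν μ' ν' : YoungDiagram}
  {ρ s z m p' : ℕ} {L L' : Position}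

/-- The member need not be generic, but ρ and m bound its radical and its image in Q from above. So
a nonzero vector in either of these makes the corresponding generic number positive. -/
theorem admissible_of_mem_kerSet (hβ : β.IsAlt) (hβn : β.Nondegenerate) (hγn : γ.Nondegenerate)
    (hq : finrank ℂ Q = 2 * (m + z)) (hsz : s = 0 ∨ z = 0) (hL : Shape (p' + ρ + s) (m + z) μ ν L)
    (hL' : Shape p' (ρ + z) μ' ν' L') (ha : L.Coords a) {F : Gr (m + ρ + 2 * s) (I × Q)}
    (hF : F ∈ kerSet β γ (m + ρ + 2 * s) (ρ + s) a L') : Admissible ρ s z m p' L L' := by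
  obtain ⟨⟨hF1, hF2⟩, hF3⟩ := hF
  have hN : PairNumbers (m + z) (m + ρ + 2 * s) (ρ + s) ρ (2 * s) m :=
    ⟨by omega, by omega, by omega, by omega⟩
  obtain ⟨-, hm, hρ⟩ := hF1.le_finrank hγn hq hN
  have hb := hF1.bounds hγn hq
  have hρ0 : ∀ u ∈ interLeft F.1 ⊓ β.orthogonal (interLeft F.1), u ≠ 0 → 0 < ρ := fun u hu hne =>
    (finrank_pos_iff_exists_ne_zero.2 ⟨⟨u, hu⟩, fun h => hne (congrArg Subtype.val h)⟩).trans_le hρ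
  have hm0 : ∀ y ∈ F.1, y.2 ≠ 0 → 0 < m := fun y hy hne =>
    (finrank_pos_iff_exists_ne_zero.2 ⟨⟨y.2, ⟨y, hy, rfl⟩⟩,
      fun h => hne (congrArg Subtype.val h)⟩).trans_le hm
  have hms : (a.1, a.2.1) ∈ supPerp β F.1 → a.2.1 ≠ 0 → 0 < m := fun h hne => by
    obtain ⟨i, -, hi⟩ := mem_supPerp_iff.1 h
    exact hm0 _ hi (by simpa using hne)
  cases L with
  | out =>
    have ha : a.2.2 ≠ 0 := ha
    cases L' with
    | out => exact hL'.2
    | ker =>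
      refine hρ0 a.2.2 ⟨hF3.1, fun u hu => ?_⟩ ha
      have h1 : prodForm β γ (a.2.2, a.2.1) (u, 0) = 0 := hF2 hu
      rw [prodForm_apply, map_zero, add_zero] at h1
      exact (hβ.isRefl _ _ h1)
    | im => exact ha hF3.1.1
    | zero => exact ha hF3.1
  | ker =>
    obtain ⟨ha1, ha2⟩ := ha
    cases L' with
    | out => exact hF3 (ha1 ▸ F.1.zero_mem)
    | ker =>
      have h1 := hL.2
      have h2 := hL'.2
      show 0 < z ∨ 0 < ρ ∧ 0 < m
      omega
    | im => exact ⟨hms hF3.1.2 ha2, hL'.2⟩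
    | zero => exact hm0 _ hF3.2 ha2
  | im =>
    obtain ⟨ha1, ha2, ha3⟩ := ha
    cases L' with
    | out => exact hF3 (ha1 ▸ F.1.zero_mem)
    | ker =>
      show 0 < ρ
      by_contra hcon
      refine hF3.2 ⟨ha1, ?_⟩
      have h1 : interLeft F.1 ⊓ β.orthogonal (interLeft F.1) = ⊥ :=
        Submodule.finrank_eq_zero.1 (by omega)
      rw [ha2, inl_mem_supPerp_iff, ← orthogonal_inf_orthogonal hβ hβn, h1]
      intro w hw
      rw [(Submodule.mem_bot ℂ).1 hw]
      exact LinearMap.congr_fun (map_zero β) a.1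
    | im => exact hL'.2
    | zero =>
      have h1 : a.1 ∈ interLeft F.1 := by
        have := hF3.2
        rwa [ha2] at this
      have h2 : 0 < finrank ℂ (interLeft F.1) :=
        finrank_pos_iff_exists_ne_zero.2 ⟨⟨a.1, h1⟩, fun h => ha3 (congrArg Subtype.val h)⟩
      show 0 < ρ + s
      omega
  | zero =>
    have ha : a = 0 := ha
    subst ha
    cases L' with
    | out => exact hF3 F.1.zero_mem
    | ker => exact hF3.2 ⟨rfl, Submodule.zero_mem _⟩
    | im => exact hF3.2 ⟨rfl, F.1.zero_mem⟩
    | zero => trivial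

variable {V : Type*} [AddCommGroup V] [Module ℂ V] [FiniteDimensional ℂ V]
  {ω : LinearMap.BilinForm ℂ V} {x : End ℂ V} {v : V} {p q q' k : ℕ}

theorem exists_parameters_of_mem (hω : ω.IsAlt) (hωn : ω.Nondegenerate)
    (hx : ∀ u w, ω (x u) w = ω u (x w)) (hx2 : ∀ u, x (x u) = 0)
    (hV : finrank ℂ V = 4 * p + 2 * q) (hr : finrank ℂ (LinearMap.range x) = 2 * p)
    (hv : L.Holds x v) (hk : k + 2 * p' + q' = 2 * p + q) (hL : Shape p q μ ν L)
    (hL' : Shape p' q' μ' ν' L') {F : Gr k V} (hF : F ∈ varietyB hω hx v k μ' ν') :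
    ∃ ρ s z m, p = p' + ρ + s ∧ q = m + z ∧ q' = ρ + z ∧ k = m + ρ + 2 * s ∧ (s = 0 ∨ z = 0) ∧
      Admissible ρ s z m p' L L' := by
  have hI : finrank ℂ (Fin (2 * p) → ℂ) = 2 * p := finrank_fin_fun ℂ
  have hQ : finrank ℂ (Fin (2 * q) → ℂ) = 2 * q := finrank_fin_fun ℂ
  obtain ⟨β, hβ, hβn⟩ := exists_symplectic_form hI
  obtain ⟨γ, hγ, hγn⟩ := exists_symplectic_form hQ
  obtain ⟨Φ, hΦ⟩ := exists_isStandard hω hωn hx hx2 hβ hβn hγ hγn (by rw [hr, hI])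
    (by rw [hV, hI, hQ]; ring)
  obtain ⟨a, rfl⟩ := Φ.surjective v
  have hFx := hF.2.1.trans inf_le_left
  obtain ⟨F₀, rfl⟩ := exists_grMap_eq hΦ hFx
  have h1 := ((mem_exoticOrbit_iff (reducedForm_isAlt hω) (reducedForm_nondegenerate hω hωn)
    (reducedEnd_selfAdjoint hx hFx hω) (reducedEnd_sq hx hFx hx2) hL').1 hF.2.2).2.1
  have h2 := hΦ.finrank_range_reducedEnd hx hFx hω hωn hβn rfl
  rw [h1, hI] at h2
  obtain ⟨c, rfl⟩ := Nat.exists_eq_add_of_le (show p' ≤ p by omega)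
  have h3 := (map_mem_varietyB_iff hΦ hω hωn hx hβn hL' hI (by omega) F₀).1 hF
  have h4 := h3.1.1.bounds hγn hQ
  rw [F₀.2] at h4
  obtain ⟨ρ, s, z, m, e1, rfl, rfl, rfl, hsz⟩ := exists_parameters (Nat.le_add_right p' c)
    (show p' + q' ≤ p' + c + q by omega) hk
  obtain rfl : c = ρ + s := by omega
  refine ⟨ρ, s, z, m, e1, rfl, rfl, rfl, hsz, ?_⟩
  rw [e1] at hL
  exact admissible_of_mem_kerSet hβ hβn hγn hQ hsz hL hL' (hΦ.coords_of_holds hv) h3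

end Necessity
end Exotic

namespace Exotic

/-! ### Assembly -/

section Main

open Module

variable {V : Type*} [AddCommGroup V] [Module ℂ V] [FiniteDimensional ℂ V]
  {ω : LinearMap.BilinForm ℂ V} {x : End ℂ V} {v : V} {μ ν μ' ν' : YoungDiagram} {k : ℕ}

theorem sumPart_le_of_mem_exoticOrbit {W : Type*} [AddCommGroup W] [Module ℂ W]
    {ω : LinearMap.BilinForm ℂ W} {x : End ℂ W} {v : W}
    (h : (v, x) ∈ exoticOrbit ω μ ν) (hx2 : ∀ u, x (x u) = 0) (i : ℕ) : sumPart μ ν i ≤ 2 := by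
  obtain ⟨-, b, hb⟩ := h
  exact hb.sumPart_le hx2 i

/-- A member and a pair of vertical strips each yield admissible numbers, and for these the chart
gives both nonemptiness and the dimension. The natural number e is the `defect`. -/
theorem exists_dim_defect (hω : ω.IsAlt) (hωn : ω.Nondegenerate)
    (hvx : (v, x) ∈ exoticOrbit ω μ ν) (hx2 : ∀ u, x (x u) = 0)
    (hcard : k + (μ'.card + ν'.card) = μ.card + ν.card)
    (hne : (varietyB hω hvx.1.1 v k μ' ν').Nonempty ∨ IsVerticalStrip μ' μ ∧ IsVerticalStrip ν' ν)
    (α' : List ℕ) :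
    ∃ d e : ℕ, IsIrreducible (varietyB hω hvx.1.1 v k μ' ν') ∧
      topologicalKrullDim (varietyB hω hvx.1.1 v k μ' ν') = (d : WithBot ℕ∞) ∧
      (d : ℚ) + e = dimNumber (k :: α') μ ν - dimNumber α' μ' ν' ∧
      (e = 0 ↔ IsVerticalStrip μ' μ ∧ IsVerticalStrip ν' ν) := by
  have hx := hvx.1.1
  have hs := sumPart_le_of_mem_exoticOrbit hvx hx2 0
  obtain ⟨L, p, q, hL⟩ := exists_shape hs
  obtain ⟨hV, hr, hv⟩ := (mem_exoticOrbit_iff hω hωn hx hx2 hL).1 hvx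
  have hs' : sumPart μ' ν' 0 ≤ 2 := by
    rcases hne with ⟨F, hF⟩ | ⟨h1, h2⟩
    · exact sumPart_le_of_mem_exoticOrbit hF.2.2 (reducedEnd_sq hx _ hx2) 0
    · exact (Nat.add_le_add (rowLen_le_of_le h1.1 0) (rowLen_le_of_le h2.1 0)).trans hs
  obtain ⟨L', p', q', hL'⟩ := exists_shape hs'
  have hk : k + 2 * p' + q' = 2 * p + q := by
    have h1 := hL.card
    have h2 := hL'.card
    omega
  obtain ⟨ρ, s, z, m, rfl, rfl, rfl, rfl, hsz, hadm⟩ : ∃ ρ s z m, p = p' + ρ + s ∧ q = m + z ∧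
      q' = ρ + z ∧ k = m + ρ + 2 * s ∧ (s = 0 ∨ z = 0) ∧ Admissible ρ s z m p' L L' := by
    rcases hne with ⟨F, hF⟩ | ⟨h1, h2⟩
    · exact exists_parameters_of_mem hω hωn hx hx2 hV hr hv hk hL hL' hF
    · obtain ⟨e1, e2⟩ := le_of_isVerticalStrip hL hL' h1 h2
      obtain ⟨ρ, s, z, m, rfl, rfl, rfl, rfl, hsz⟩ := exists_parameters e1 e2 hk
      exact ⟨ρ, s, z, m, rfl, rfl, rfl, rfl, hsz, admissible_of_isVerticalStrip hsz hL hL' h1 h2⟩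
  obtain ⟨d, hd, hirr, hdim⟩ := exists_dim_varietyB hω hωn hx hx2 hadm hsz hV hr hv hL'
  exact ⟨d, defect s z p' L L', hirr, hdim, chartDim_sub hadm hsz hL hL' α' hd,
    isVerticalStrip_iff hadm hsz hL hL'⟩

end Main
end Exotic

theorem mainTheorem2
    {V : Type*} [AddCommGroup V] [Module ℂ V] [FiniteDimensional ℂ V]
    (n : ℕ) (hn : Module.finrank ℂ V = 2 * n)
    (ω : LinearMap.BilinForm ℂ V) (hω : ω.IsAlt) (hnd : ω.Nondegenerate)
    (k : ℕ) (α' : List ℕ) (hα : Exotic.IsComposition (k :: α') n)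
    (μ ν : YoungDiagram) (hμν : Exotic.IsBipartition μ ν n)
    (μ' ν' : YoungDiagram) (hμν' : Exotic.IsBipartition μ' ν' (n - k))
    (v : V) (x : Module.End ℂ V) (hvx : (v, x) ∈ Exotic.exoticOrbit ω μ ν)
    (hx2 : x ^ 2 = 0) :
    ((Exotic.varietyB hω hvx.1.1 v k μ' ν').Nonempty →
      IsIrreducible (Exotic.varietyB hω hvx.1.1 v k μ' ν') ∧
      ∃ d : ℕ, topologicalKrullDim (Exotic.varietyB hω hvx.1.1 v k μ' ν') = (d : WithBot ℕ∞) ∧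
        (d : ℚ) ≤ Exotic.dimNumber (k :: α') μ ν - Exotic.dimNumber α' μ' ν') ∧
    ((∃ d : ℕ, topologicalKrullDim (Exotic.varietyB hω hvx.1.1 v k μ' ν') = (d : WithBot ℕ∞) ∧
        (d : ℚ) = Exotic.dimNumber (k :: α') μ ν - Exotic.dimNumber α' μ' ν') ↔
      Exotic.IsVerticalStrip μ' μ ∧ Exotic.IsVerticalStrip ν' ν) := by
  have hx2' : ∀ u, x (x u) = 0 := fun u => by
    have h := LinearMap.congr_fun hx2 u
    rwa [pow_two] at h
  have hcard : k + (μ'.card + ν'.card) = μ.card + ν.card := by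
    have h1 : k + α'.sum = n := hα.2
    have h2 : μ.card + ν.card = n := hμν
    have h3 : μ'.card + ν'.card = n - k := hμν'
    omega
  have key := fun hne => Exotic.exists_dim_defect hω hnd hvx hx2' hcard hne α'
  constructor
  · intro hne
    obtain ⟨d, e, hirr, hdim, hde, -⟩ := key (Or.inl hne)
    exact ⟨hirr, d, hdim, by rw [← hde]; exact le_add_of_nonneg_right (Nat.cast_nonneg e)⟩
  · constructor
    · rintro ⟨d, hdim, hd⟩
      have hne : (Exotic.varietyB hω hvx.1.1 v k μ' ν').Nonempty := by
        rw [Set.nonempty_iff_ne_empty]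
        intro h0
        -- The empty set has dimension ⊥, so a natural number as dimension includes nonemptiness.
        rw [h0, Exotic.topologicalKrullDim_empty] at hdim
        exact absurd hdim.symm (by simp)
      obtain ⟨d', e, -, hdim', hde, hiff⟩ := key (Or.inl hne)
      have h1 : d' = d := by exact_mod_cast hdim'.symm.trans hdim
      rw [h1, hd] at hde
      refine hiff.1 ?_
      have h2 : (e : ℚ) = 0 := by linarith
      exact_mod_cast h2
    · intro hstrip
      obtain ⟨d, e, -, hdim, hde, hiff⟩ := key (Or.inr hstrip)
      refine ⟨d, hdim, ?_⟩
      rw [← hde, hiff.2 hstrip, Nat.cast_zero, add_zero]
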